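/- **Conventions.** "Multicategory" means symmetric multicategory enriched in $\mathcal{C}at$ (small categories): it has a category $\mathbf{M}(a_1,\dots,a_k;b)$ of $k$-ary morphisms and $k$-ary cells for every $k\ge 0$, composition functors, identities and actions of the symmetric groups, subject to the associativity, unit and equivariance axioms. "Multifunctor" means symmetric multifunctor enriched in $\mathcal{C}at$. **$\mathbf{SMC}$.** The objects are small symmetric monoidal categories $(\mathcal{C},\oplus,e)$ whose unit $e$ is strict (both unitors are identities); the associator $\alpha$ and the symmetry $\gamma$ are arbitrary. A $k$-ary morphism $(\mathcal{C}_1,\dots,\mathcal{C}_k)\to\mathcal{D}$ is a $k$-linear functor: a functor $F\colon\mathcal{C}_1\times\dots\times\mathcal{C}_k\to\mathcal{D}$ with natural isomorphisms $\delta_i\colon F(c_i)\oplus F(c_i')\to F(c_i\oplus c_i')$, $1\le i\le k$ (the other variables are fixed and suppressed), such that $F(c_1,\dots,c_k)=e$ if some $c_i=e$; $F(f_1,\dots,f_k)=\mathrm{id}_e$ if some $f_i=\mathrm{id}_e$; $\delta_i=\mathrm{id}$ if $c_i$, $c_i'$ or some $c_j$, $j\ne i$, is $e$; $F(\alpha)\circ\delta_i\circ(\delta_i\oplus\mathrm{id})=\delta_i\circ(\mathrm{id}\oplus\delta_i)\circ\alpha$;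 $F(\gamma)\circ\delta_i=\delta_i\circ\gamma$; and $\delta_j\circ(\delta_i\oplus\delta_i)=\delta_i\circ(\delta_j\oplus\delta_j)\circ\mu$ for $i\ne j$, where $\mu\colon(a\oplus b)\oplus(c\oplus d)\to(a\oplus c)\oplus(b\oplus d)$ is the composite of associators and of the symmetry in the two middle summands. A $k$-ary cell is a natural transformation $\phi$ which commutes with all the $\delta_i$ and satisfies $\phi_{(c_1,\dots,c_k)}=\mathrm{id}_e$ if some $c_i=e$. The composite of $k$-linear functors is the composite of functors with the distributivity $\delta_{(i,j)}=G(\delta^{F_i}_j)\circ\delta^G_i$, and the symmetric groups permute the variables. **$\mathcal{E}_*\text{-}\mathcal{C}at$.** Let $\mathcal{E}$ be the category whose objects are the tuples $\langle\mathbf{m}\rangle=([m_1],\dots,[m_r])$, $r\ge0$, of objects of $\Delta^{op}$, and whose morphisms $\langle\mathbf{m}\rangle\to\langle\mathbf{m}'\rangle=([m'_1],\dots,[m'_s])$ are pairs of an injection $q\colon\{1,\dots,r\}\to\{1,\dots,s\}$ and a morphism $q_*\langle\mathbf{m}\rangle\to\langle\mathbf{m}'\rangle$ of $(\Delta^{op})^s$,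 where $q_*\langle\mathbf{m}\rangle$ has the entry $[m_i]$ at the place $q(i)$ and $[1]$ at the places outside the image of $q$. Let $\odot$ be the concatenation of tuples. An $\mathcal{E}_*$-category is a functor $X$ from $\mathcal{E}$ to small based categories such that $X([m_1],\dots,[m_r])$ is the category with one object and one morphism if some $m_i=0$. A $k$-ary morphism $(X_1,\dots,X_k)\to Y$ is a family of functors $X_1\langle\mathbf{m}_1\rangle\times\dots\times X_k\langle\mathbf{m}_k\rangle\to Y(\langle\mathbf{m}_1\rangle\odot\dots\odot\langle\mathbf{m}_k\rangle)$, natural in $\mathcal{E}^k$, which factor through the smash product of based categories (a tuple in which some object is the base object goes to the base object, and a tuple of morphisms in which some morphism is the identity of the base object goes to an identity). A $k$-ary cell is a modification whose component at $(x_1,\dots,x_k)$ is an identity if some $x_i$ is the base object. **$\mathbf{Spec}(s\mathcal{C}at)$.** Let $S^1=\Delta[1]/\partial\Delta[1]$, with $S^1_q=\{0,\dots,q\}$ based at $0$. The objects are symmetric spectra in simplicial based categories: sequences $T(n)$, $n\ge 0$, with $\Sigma_n$-actions and structure maps $T(n)\wedge S^1\to T(n+1)$ whose iterates $T(n)\wedge(S^1)^{\wedge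 m}\to T(n+m)$ are $\Sigma_n\times\Sigma_m$-equivariant. A $k$-ary morphism $(T_1,\dots,T_k)\to U$ is a $k$-linear map: $\Sigma_{p_1}\times\dots\times\Sigma_{p_k}$-equivariant maps $T_1(p_1)\wedge\dots\wedge T_k(p_k)\to U(p_1+\dots+p_k)$ of simplicial based categories which are compatible with the structure maps in all variables. A $k$-ary cell is a family of based natural transformations which is compatible with the simplicial structure, the actions and the structure maps. **The construction of Elmendorf and Mandell.** Let $\mathcal{C}$ be an object of $\mathbf{SMC}$ and let $M_1,\dots,M_n$ be finite based sets. The objects of the based category $\overline{\mathcal{C}}(M_1,\dots,M_n)$ are systems $\{C_{\langle S\rangle},\rho_{\langle S\rangle,i,T,U}\}$, where $\langle S\rangle=(S_1,\dots,S_n)$ runs through the tuples of subsets $S_i\subset M_i$ which do not contain the base point, $i$ through $1,\dots,n$, and $(T,U)$ through the pairs of disjoint sets with union $S_i$; here $C_{\langle S\rangle}$ is an object of $\mathcal{C}$ and $$\rho_{\langle S\rangle,i,T,U}\colon C_{\langle S\lceil_iT\rangle}\oplus C_{\langle S\lceil_iU\rangle}\to C_{\langle S\rangle}$$ is an isomorphism,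 where $\langle S\lceil_iT\rangle$ is $\langle S\rangle$ with $S_i$ replaced by $T$. It is required that (1) $C_{\langle S\rangle}=e$ if some $S_k$ is empty; (2) $\rho_{\langle S\rangle,i,T,U}=\mathrm{id}$ if some $S_k$, $T$ or $U$ is empty; (3) $\rho_{\langle S\rangle,i,T,U}=\rho_{\langle S\rangle,i,U,T}\circ\gamma$; (4) if $S_i$ is the disjoint union of $T,U,V$, then $\rho_{\langle S\rangle,i,T\cup U,V}\circ(\rho_{\langle S\lceil_iT\cup U\rangle,i,T,U}\oplus\mathrm{id})=\rho_{\langle S\rangle,i,T,U\cup V}\circ(\mathrm{id}\oplus\rho_{\langle S\lceil_iU\cup V\rangle,i,U,V})\circ\alpha$; (5) if $i\ne j$, $S_i=T\sqcup U$ and $S_j=V\sqcup W$, then $\rho_{\langle S\rangle,j,V,W}\circ(\rho_{\langle S\lceil_jV\rangle,i,T,U}\oplus\rho_{\langle S\lceil_jW\rangle,i,T,U})=\rho_{\langle S\rangle,i,T,U}\circ(\rho_{\langle S\lceil_iT\rangle,j,V,W}\oplus\rho_{\langle S\lceil_iU\rangle,j,V,W})\circ\mu$. Morphisms are families $f_{\langle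 S\rangle}\colon C_{\langle S\rangle}\to C'_{\langle S\rangle}$ which commute with the $\rho$'s, and are identities if some $S_k$ is empty. The base object is the system with all $C_{\langle S\rangle}=e$. The $\mathcal{E}_*$-category $\overline{\mathcal{C}}$ has the value $\overline{\mathcal{C}}([m_1],\dots,[m_r])=\overline{\mathcal{C}}(S^1_{m_1},\dots,S^1_{m_r})$. Morphisms of $(\Delta^{op})^r$ act by taking preimages of the sets $S_k$ under the induced maps of based sets, permutations act by permuting the sets, and the inclusion $([m_1],\dots,[m_r])\to([m_1],\dots,[m_r],[1])$ acts by the extension $D_{\langle S_1,\dots,S_r,\{1\}\rangle}=C_{\langle S_1,\dots,S_r\rangle}$, $D_{\langle S_1,\dots,S_r,\emptyset\rangle}=e$, where $\rho_{\langle S\rangle,i,T,U}$ for $i\le r$ and $S_{r+1}=\{1\}$ is the one of the given system, and all other $\rho$ are identities. **The functor $I$ on objects.** For an $\mathcal{E}_*$-category $X$, the symmetric spectrum $IX$ has as its level $n$ the simplicial based category $[q]\mapsto X([q],\dots,[q])$ ($n$ entries) with the permutation action; its structure map on the summand of $j\in\{1,\dots,q\}\subset S^1_q$ is induced by the morphism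 $([q],\dots,[q])\to([q],\dots,[q],[q])$ of $\mathcal{E}$ given by the inclusion of $\{1,\dots,n\}$ into $\{1,\dots,n+1\}$, by identities, and by the map $[q]\to[1]$ of $\Delta$ with $0,\dots,j-1\mapsto0$ and $j,\dots,q\mapsto1$. **Theorem.** $\mathbf{SMC}$, $\mathcal{E}_*\text{-}\mathcal{C}at$ and $\mathbf{Spec}(s\mathcal{C}at)$ are symmetric multicategories enriched in $\mathcal{C}at$, and: 1. The assignment $\mathcal{C}\mapsto\overline{\mathcal{C}}$ extends to an enriched symmetric multifunctor $J\colon\mathbf{SMC}\to\mathcal{E}_*\text{-}\mathcal{C}at$. It sends a $k$-linear functor $F$ to the $k$-ary morphism that takes systems $\{C^i,\rho^i\}$, $i=1,\dots,k$, to the system with the objects $F(C^1_{\langle S_1\rangle},\dots,C^k_{\langle S_k\rangle})$, where $\langle S_i\rangle$ is the $i$-th block of $\langle S\rangle=\langle S_1\rangle\odot\dots\odot\langle S_k\rangle$, and with the isomorphisms $F(\mathrm{id},\dots,\rho^i,\dots,\mathrm{id})\circ\delta_i$ at the places of the $i$-th block, and takes morphisms $f^i$ of systems to $F(f^1_{\langle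 S_1\rangle},\dots,f^k_{\langle S_k\rangle})$; and it sends a $k$-linear transformation $\phi$ to the cell with the components $\phi_{(C^1_{\langle S_1\rangle},\dots,C^k_{\langle S_k\rangle})}$. 2. The assignment $X\mapsto IX$ extends to an enriched symmetric multifunctor $I\colon\mathcal{E}_*\text{-}\mathcal{C}at\to\mathbf{Spec}(s\mathcal{C}at)$ which sends a $k$-ary morphism or cell to its components at the tuples $([q],\dots,[q])$ of lengths $p_1,\dots,p_k$. 3. Hence $\mathbb{K}_{SMC}=I\circ J\colon\mathbf{SMC}\to\mathbf{Spec}(s\mathcal{C}at)$ is an enriched symmetric multifunctor. On objects it is the $K$-theory construction: for $n>0$, the level $n$ of $\mathbb{K}_{SMC}(\mathcal{C})$ is the diagonal of $\overline{\mathcal{C}}(S^1,\dots,S^1)$ ($n$ entries), and the level $0$ is isomorphic, by the extension functor $\overline{\mathcal{C}}(\,)\to\overline{\mathcal{C}}(\{0,1\})$, to the constant simplicial based category with value $\overline{\mathcal{C}}(S^0)$, $S^0=\{0,1\}$. -/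

import Mathlib

open CategoryTheory MonoidalCategory Opposite

universe u v w u' v' w' u'' v'' w''

namespace EM

/-- `f` is an identity morphism (its source and target are equal and `f` is the identity). -/
def IsId {C : Type*} [Category C] {X Y : C} (f : X ⟶ Y) : Prop :=
  ∃ h : X = Y, f = eqToHom h

/-! ### Concatenation of tuples and the associated reindexings

`finSigmaFinEquiv` identifies a pair `(i, j)`, the `j`-th place of the `i`-th block, with the place
`p 0 + ⋯ + p (i - 1) + j` of the concatenated tuple. -/

/-- The place of the concatenated tuple which is the `j`-th place of the `i`-th block. -/
def place {k : ℕ} {p : Fin k → ℕ} (i : Fin k) (j : Fin (p i)) : Fin (∑ i, p i) :=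
  finSigmaFinEquiv ⟨i, j⟩

/-- The block sum of bijections. -/
def blockSum {k : ℕ} {p p' : Fin k → ℕ} (e : ∀ i, Fin (p i) ≃ Fin (p' i)) :
    Fin (∑ i, p i) ≃ Fin (∑ i, p' i) :=
  finSigmaFinEquiv.symm.trans ((Equiv.sigmaCongrRight e).trans finSigmaFinEquiv)

/-- The bijection that permutes blocks: block `i` goes to block `e i`. -/
def blockPerm {k l : ℕ} (e : Fin k ≃ Fin l) (p : Fin l → ℕ) :
    Fin (∑ i, p (e i)) ≃ Fin (∑ i, p i) :=
  finSigmaFinEquiv.symm.trans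
    ((Equiv.sigmaCongrLeft (β := fun i => Fin (p i)) e).trans finSigmaFinEquiv)

/-- The order preserving identification of a concatenation of concatenations with the
concatenation of the whole family. -/
def blockAssoc {n : ℕ} (k : Fin n → ℕ) (l : Fin (∑ i, k i) → ℕ) :
    Fin (∑ i, ∑ j, l (place i j)) ≃ Fin (∑ s, l s) :=
  finSigmaFinEquiv.symm.trans
    (((Equiv.sigmaCongrRight fun _ => finSigmaFinEquiv.symm).trans
      ((Equiv.sigmaAssoc fun i j => Fin (l (place i j))).symm.trans
        (Equiv.sigmaCongrLeft (β := fun s => Fin (l s)) finSigmaFinEquiv))).trans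
      finSigmaFinEquiv)

/-- The sum of two bijections acting on the first and on the last places. -/
def sumPerm {n n' m m' : ℕ} (e : Fin n ≃ Fin n') (f : Fin m ≃ Fin m') :
    Fin (n + m) ≃ Fin (n' + m') :=
  finSumFinEquiv.symm.trans ((Equiv.sumCongr e f).trans finSumFinEquiv)

/-- The shuffle that moves `m i` places to the end of the `i`-th block:
`(p₁, …, p_k, m₁, …, m_k) ↦ (p₁, m₁, …, p_k, m_k)`. -/
def shuffle {k : ℕ} (p m : Fin k → ℕ) :
    Fin ((∑ i, p i) + ∑ i, m i) ≃ Fin (∑ i, (p i + m i)) :=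
  finSumFinEquiv.symm.trans
    (((Equiv.sumCongr finSigmaFinEquiv.symm finSigmaFinEquiv.symm).trans
      (Equiv.sigmaSumDistrib (fun i => Fin (p i)) (fun i => Fin (m i))).symm).trans
        ((Equiv.sigmaCongrRight fun _ => finSumFinEquiv).trans finSigmaFinEquiv))

/-! ### Symmetric multicategories enriched in categories -/

/-- The data of a symmetric multicategory enriched in `Cat`. The tuple of inputs of a composite is
given after concatenation: its `i`-th block is `fun j => a (place i j)`. The symmetric group action
is given as the left action `σ_* : M(a_{σ 1}, …, a_{σ k}; b) ⟶ M(a_1, …, a_k; b)`, which is the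
inverse of the right action `σ^*`. It is indexed by bijections `Fin k ≃ Fin l` (so that `k = l`),
which avoids transports along equalities of natural numbers. -/
structure CatMultiData where
  Obj : Type u
  Hom : ∀ {k : ℕ}, (Fin k → Obj) → Obj → Type v
  [cat : ∀ {k : ℕ} (a : Fin k → Obj) (b : Obj), Category.{w} (Hom a b)]
  one : ∀ a : Obj, Hom (fun _ : Fin 1 => a) a
  comp : ∀ {n : ℕ} {k : Fin n → ℕ} (a : Fin (∑ i, k i) → Obj) (b : Fin n → Obj) (c : Obj),
    (Hom b c × ∀ i, Hom (fun j => a (place i j)) (b i)) ⥤ Hom a c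
  act : ∀ {k l : ℕ} (e : Fin k ≃ Fin l) (a : Fin l → Obj) (b : Obj),
    Hom (fun i => a (e i)) b ⥤ Hom a b

attribute [instance] CatMultiData.cat

/-- The axioms of a symmetric multicategory enriched in `Cat`: unit laws, associativity,
functoriality of the symmetric group actions and the two equivariance laws for composition, each
for `k`-ary morphisms and for `k`-ary cells. Tuples that agree only up to a (unique, order
preserving) identification of their index sets are compared by heterogeneous equality. -/
structure CatMultiData.IsSymmetricMulticategory (M : CatMultiData.{u, v, w}) : Prop where
  one_comp : ∀ {k : Fin 1 → ℕ} (a : Fin (∑ i, k i) → M.Obj) (c : M.Obj)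
    (f : ∀ i : Fin 1, M.Hom (fun j => a (place i j)) c),
    HEq ((M.comp a (fun _ => c) c).obj (M.one c, f)) (f 0)
  one_comp_map : ∀ {k : Fin 1 → ℕ} (a : Fin (∑ i, k i) → M.Obj) (c : M.Obj)
    (f f' : ∀ i : Fin 1, M.Hom (fun j => a (place i j)) c) (φ : f ⟶ f'),
    HEq ((M.comp a (fun _ => c) c).map ((𝟙 (M.one c), φ) : (M.one c, f) ⟶ (M.one c, f'))) (φ 0)
  comp_one : ∀ {n : ℕ} (b : Fin n → M.Obj) (c : M.Obj) (a : Fin (∑ _i : Fin n, 1) → M.Obj)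
    (g : ∀ i : Fin n, M.Hom (fun j : Fin 1 => a (place (p := fun _ => 1) i j)) (b i))
    (_ : ∀ i j, a (place (p := fun _ => 1) i j) = b i) (_ : ∀ i, HEq (g i) (M.one (b i)))
    (f : M.Hom b c),
    HEq ((M.comp (k := fun _ => 1) a b c).obj (f, g)) f
  comp_one_map : ∀ {n : ℕ} (b : Fin n → M.Obj) (c : M.Obj) (a : Fin (∑ _i : Fin n, 1) → M.Obj)
    (g : ∀ i : Fin n, M.Hom (fun j : Fin 1 => a (place (p := fun _ => 1) i j)) (b i))
    (_ : ∀ i j, a (place (p := fun _ => 1) i j) = b i) (_ : ∀ i, HEq (g i) (M.one (b i)))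
    (f f' : M.Hom b c) (φ : f ⟶ f'),
    HEq ((M.comp (k := fun _ => 1) a b c).map ((φ, 𝟙 g) : (f, g) ⟶ (f', g))) φ
  assoc : ∀ {n : ℕ} {k : Fin n → ℕ} {l : Fin (∑ i, k i) → ℕ} (a : Fin (∑ s, l s) → M.Obj)
    (b : Fin (∑ i, k i) → M.Obj) (c : Fin n → M.Obj) (d : M.Obj) (h : M.Hom c d)
    (g : ∀ i, M.Hom (fun j => b (place i j)) (c i))
    (f : ∀ s, M.Hom (fun t => a (place s t)) (b s))
    (f' : ∀ i j, M.Hom (fun t => a (blockAssoc k l (place i (place j t)))) (b (place i j)))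
    (_ : ∀ i j, HEq (f' i j) (f (place i j))),
    HEq ((M.comp a b d).obj ((M.comp b c d).obj (h, g), f))
      ((M.comp (fun t => a (blockAssoc k l t)) c d).obj
        (h, fun i => (M.comp (fun t => a (blockAssoc k l (place i t)))
          (fun j => b (place i j)) (c i)).obj (g i, f' i)))
  assoc_map : ∀ {n : ℕ} {k : Fin n → ℕ} {l : Fin (∑ i, k i) → ℕ} (a : Fin (∑ s, l s) → M.Obj)
    (b : Fin (∑ i, k i) → M.Obj) (c : Fin n → M.Obj) (d : M.Obj) (h h₁ : M.Hom c d)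
    (g g₁ : ∀ i, M.Hom (fun j => b (place i j)) (c i))
    (f f₁ : ∀ s, M.Hom (fun t => a (place s t)) (b s))
    (f' f₁' : ∀ i j, M.Hom (fun t => a (blockAssoc k l (place i (place j t)))) (b (place i j)))
    (_ : ∀ i j, HEq (f' i j) (f (place i j))) (_ : ∀ i j, HEq (f₁' i j) (f₁ (place i j)))
    (χ : h ⟶ h₁) (ψ : g ⟶ g₁) (φ : f ⟶ f₁) (φ' : ∀ i j, f' i j ⟶ f₁' i j)
    (_ : ∀ i j, HEq (φ' i j) (φ (place i j))),
    HEq ((M.comp a b d).map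
        (((M.comp b c d).map ((χ, ψ) : (h, g) ⟶ (h₁, g₁)), φ) :
          ((M.comp b c d).obj (h, g), f) ⟶ ((M.comp b c d).obj (h₁, g₁), f₁)))
      ((M.comp (fun t => a (blockAssoc k l t)) c d).map
        ((χ, fun i => (M.comp (fun t => a (blockAssoc k l (place i t)))
            (fun j => b (place i j)) (c i)).map ((ψ i, φ' i) : (g i, f' i) ⟶ (g₁ i, f₁' i))) :
          (h, fun i => (M.comp (fun t => a (blockAssoc k l (place i t)))
            (fun j => b (place i j)) (c i)).obj (g i, f' i)) ⟶
          (h₁, fun i => (M.comp (fun t => a (blockAssoc k l (place i t)))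
            (fun j => b (place i j)) (c i)).obj (g₁ i, f₁' i))))
  act_refl : ∀ {k : ℕ} (a : Fin k → M.Obj) (b : M.Obj), M.act (Equiv.refl (Fin k)) a b = 𝟭 _
  act_trans : ∀ {k l m : ℕ} (e : Fin k ≃ Fin l) (e' : Fin l ≃ Fin m) (a : Fin m → M.Obj)
    (b : M.Obj), M.act (e.trans e') a b = M.act e (fun i => a (e' i)) b ⋙ M.act e' a b
  act_comp : ∀ {n n' : ℕ} (e : Fin n ≃ Fin n') {k : Fin n' → ℕ} (a : Fin (∑ i, k i) → M.Obj)
    (b : Fin n' → M.Obj) (c : M.Obj) (f : M.Hom (fun i => b (e i)) c)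
    (g : ∀ i, M.Hom (fun j => a (place i j)) (b i))
    (g' : ∀ i, M.Hom (fun j => a (blockPerm e k (place i j))) (b (e i)))
    (_ : ∀ i, HEq (g' i) (g (e i))),
    (M.comp a b c).obj ((M.act e b c).obj f, g) =
      (M.act (blockPerm e k) a c).obj
        ((M.comp (fun s => a (blockPerm e k s)) (fun i => b (e i)) c).obj (f, g'))
  act_comp_map : ∀ {n n' : ℕ} (e : Fin n ≃ Fin n') {k : Fin n' → ℕ} (a : Fin (∑ i, k i) → M.Obj)
    (b : Fin n' → M.Obj) (c : M.Obj) (f f₁ : M.Hom (fun i => b (e i)) c)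
    (g g₁ : ∀ i, M.Hom (fun j => a (place i j)) (b i))
    (g' g₁' : ∀ i, M.Hom (fun j => a (blockPerm e k (place i j))) (b (e i)))
    (_ : ∀ i, HEq (g' i) (g (e i))) (_ : ∀ i, HEq (g₁' i) (g₁ (e i)))
    (φ : f ⟶ f₁) (ψ : g ⟶ g₁) (ψ' : g' ⟶ g₁') (_ : ∀ i, HEq (ψ' i) (ψ (e i))),
    HEq ((M.comp a b c).map (((M.act e b c).map φ, ψ) :
        ((M.act e b c).obj f, g) ⟶ ((M.act e b c).obj f₁, g₁)))
      ((M.act (blockPerm e k) a c).map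
        ((M.comp (fun s => a (blockPerm e k s)) (fun i => b (e i)) c).map
          ((φ, ψ') : (f, g') ⟶ (f₁, g₁'))))
  comp_act : ∀ {n : ℕ} {k k' : Fin n → ℕ} (e : ∀ i, Fin (k i) ≃ Fin (k' i))
    (a : Fin (∑ i, k' i) → M.Obj) (b : Fin n → M.Obj) (c : M.Obj) (f : M.Hom b c)
    (g : ∀ i, M.Hom (fun j => a (place i (e i j))) (b i))
    (g' : ∀ i, M.Hom (fun j => a (blockSum e (place i j))) (b i))
    (_ : ∀ i, HEq (g' i) (g i)),
    (M.comp a b c).obj (f, fun i => (M.act (e i) (fun j => a (place i j)) (b i)).obj (g i)) =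
      (M.act (blockSum e) a c).obj ((M.comp (fun s => a (blockSum e s)) b c).obj (f, g'))
  comp_act_map : ∀ {n : ℕ} {k k' : Fin n → ℕ} (e : ∀ i, Fin (k i) ≃ Fin (k' i))
    (a : Fin (∑ i, k' i) → M.Obj) (b : Fin n → M.Obj) (c : M.Obj) (f f₁ : M.Hom b c)
    (g g₁ : ∀ i, M.Hom (fun j => a (place i (e i j))) (b i))
    (g' g₁' : ∀ i, M.Hom (fun j => a (blockSum e (place i j))) (b i))
    (_ : ∀ i, HEq (g' i) (g i)) (_ : ∀ i, HEq (g₁' i) (g₁ i))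
    (φ : f ⟶ f₁) (ψ : g ⟶ g₁) (ψ' : g' ⟶ g₁') (_ : ∀ i, HEq (ψ' i) (ψ i)),
    HEq ((M.comp a b c).map
        ((φ, fun i => (M.act (e i) (fun j => a (place i j)) (b i)).map (ψ i)) :
          (f, fun i => (M.act (e i) (fun j => a (place i j)) (b i)).obj (g i)) ⟶
          (f₁, fun i => (M.act (e i) (fun j => a (place i j)) (b i)).obj (g₁ i))))
      ((M.act (blockSum e) a c).map
        ((M.comp (fun s => a (blockSum e s)) b c).map ((φ, ψ') : (f, g') ⟶ (f₁, g₁'))))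

/-- A symmetric multifunctor enriched in `Cat` with the object function `φ`. -/
structure EnrichedMultifunctor (M : CatMultiData.{u, v, w}) (N : CatMultiData.{u', v', w'})
    (φ : M.Obj → N.Obj) where
  map : ∀ {k : ℕ} (a : Fin k → M.Obj) (b : M.Obj), M.Hom a b ⥤ N.Hom (fun i => φ (a i)) (φ b)
  map_one : ∀ a : M.Obj, (map (fun _ => a) a).obj (M.one a) = N.one (φ a)
  map_comp : ∀ {n : ℕ} {k : Fin n → ℕ} (a : Fin (∑ i, k i) → M.Obj) (b : Fin n → M.Obj)
    (c : M.Obj),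
    M.comp a b c ⋙ map a c =
      (map b c).prod (Functor.pi fun i => map (fun j => a (place i j)) (b i)) ⋙
        N.comp (fun s => φ (a s)) (fun i => φ (b i)) (φ c)
  map_act : ∀ {k l : ℕ} (e : Fin k ≃ Fin l) (a : Fin l → M.Obj) (b : M.Obj),
    M.act e a b ⋙ map a b = map (fun i => a (e i)) b ⋙ N.act e (fun i => φ (a i)) (φ b)

/-- The composite of two enriched symmetric multifunctors. -/
def EnrichedMultifunctor.trans {M : CatMultiData.{u, v, w}} {N : CatMultiData.{u', v', w'}}
    {P : CatMultiData.{u'', v'', w''}} {φ : M.Obj → N.Obj} {ψ : N.Obj → P.Obj}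
    (F : EnrichedMultifunctor M N φ) (G : EnrichedMultifunctor N P ψ) :
    EnrichedMultifunctor M P (fun a => ψ (φ a)) where
  map a b := F.map a b ⋙ G.map (fun i => φ (a i)) (φ b)
  map_one a := by
    simp only [Functor.comp_obj, F.map_one]
    exact G.map_one _
  map_comp a b c := by
    rw [← Functor.assoc, F.map_comp, Functor.assoc, G.map_comp]
    rfl
  map_act e a b := by
    rw [← Functor.assoc, F.map_act, Functor.assoc, G.map_act]
    rfl

/-! ### Strictly unital symmetric monoidal categories and multilinear functors -/

/-- A symmetric monoidal category has a strict unit if the unitors are identity morphisms. By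
naturality of the unitors, the functors `e ⊗ -` and `- ⊗ e` are then the identity functor. -/
class StrictUnit (C : Type*) [Category C] [MonoidalCategory C] : Prop where
  left : ∀ X : C, IsId (λ_ X).hom
  right : ∀ X : C, IsId (ρ_ X).hom

/-- Small symmetric monoidal categories with a strict unit. -/
structure SMCat : Type (u + 1) where
  carrier : Type u
  [cat : SmallCategory carrier]
  [mon : MonoidalCategory carrier]
  [symm : SymmetricCategory carrier]
  [strict : StrictUnit carrier]

instance : CoeSort SMCat.{u} (Type u) := ⟨SMCat.carrier⟩
attribute [instance] SMCat.cat SMCat.mon SMCat.symm SMCat.strict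

section Linear

variable {ι : Type} {C : ι → SMCat.{u}}

/-- The tuple `z` is `(c₁, …, cᵢ ⊗ cᵢ', …, c_k)`, where `x = (c₁, …, cᵢ, …, c_k)` and
`y = (c₁, …, cᵢ', …, c_k)`. -/
structure AddAt (i : ι) (x y z : ∀ j, C j) : Prop where
  at_eq : z i = x i ⊗ y i
  left : ∀ j, j ≠ i → x j = z j
  right : ∀ j, j ≠ i → y j = z j

/-- The corresponding relation for morphisms of tuples. -/
structure AddAtHom (i : ι) {x y z x' y' z' : ∀ j, C j} (f : x ⟶ x') (g : y ⟶ y') (h : z ⟶ z') :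
    Prop where
  at_eq : HEq (h i) (f i ⊗ₘ g i)
  left : ∀ j, j ≠ i → HEq (f j) (h j)
  right : ∀ j, j ≠ i → HEq (g j) (h j)

/-- The morphism of tuples `m` is `f` in the variable `i` and the identity in all others. -/
structure OnlyAt (i : ι) {x y : ∀ j, C j} (m : x ⟶ y) {a b : C i} (f : a ⟶ b) : Prop where
  at_eq : HEq (m i) f
  others : ∀ j, j ≠ i → IsId (m j)

/-- A multilinear functor: the functor `F` with the distributivity isomorphisms
`δᵢ : F(c₁, …, cᵢ, …, c_k) ⊗ F(c₁, …, cᵢ', …, c_k) ≅ F(c₁, …, cᵢ ⊗ cᵢ', …, c_k)`. In the compatibility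
of `δᵢ` and `δⱼ`, `tensorμ a b c d : (a ⊗ b) ⊗ (c ⊗ d) ⟶ (a ⊗ c) ⊗ (b ⊗ d)` is the composite of
associators and of the symmetry in the two middle factors. -/
structure LinFun (C : ι → SMCat.{u}) (D : SMCat.{u}) where
  F : (∀ i, C i) ⥤ D
  δ : ∀ (i : ι) {x y z : ∀ j, C j}, AddAt i x y z → (F.obj x ⊗ F.obj y ≅ F.obj z)
  natural : ∀ (i : ι) {x y z x' y' z' : ∀ j, C j} (h : AddAt i x y z) (h' : AddAt i x' y' z')
    (f : x ⟶ x') (g : y ⟶ y') (k : z ⟶ z'), AddAtHom i f g k →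
    (F.map f ⊗ₘ F.map g) ≫ (δ i h').hom = (δ i h).hom ≫ F.map k
  unit_obj : ∀ (x : ∀ j, C j) (i : ι), x i = 𝟙_ (C i) → F.obj x = 𝟙_ D
  unit_map : ∀ {x y : ∀ j, C j} (f : x ⟶ y) (i : ι), HEq (f i) (𝟙 (𝟙_ (C i))) →
    x i = 𝟙_ (C i) → y i = 𝟙_ (C i) → HEq (F.map f) (𝟙 (𝟙_ D))
  unit_δ : ∀ (i : ι) {x y z : ∀ j, C j} (h : AddAt i x y z),
    (x i = 𝟙_ (C i) ∨ y i = 𝟙_ (C i) ∨ ∃ j, j ≠ i ∧ z j = 𝟙_ (C j)) → IsId (δ i h).hom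
  δ_assoc : ∀ (i : ι) {x y z xy yz l r : ∀ j, C j} (h₁ : AddAt i x y xy) (h₂ : AddAt i xy z l)
    (h₃ : AddAt i y z yz) (h₄ : AddAt i x yz r) (m : l ⟶ r),
    OnlyAt i m (α_ (x i) (y i) (z i)).hom →
    ((δ i h₁).hom ▷ F.obj z) ≫ (δ i h₂).hom ≫ F.map m =
      (α_ (F.obj x) (F.obj y) (F.obj z)).hom ≫ (F.obj x ◁ (δ i h₃).hom) ≫ (δ i h₄).hom
  δ_symm : ∀ (i : ι) {x y z w : ∀ j, C j} (h₁ : AddAt i x y z) (h₂ : AddAt i y x w) (m : z ⟶ w),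
    OnlyAt i m (β_ (x i) (y i)).hom →
    (δ i h₁).hom ≫ F.map m = (β_ (F.obj x) (F.obj y)).hom ≫ (δ i h₂).hom
  δ_comm : ∀ (i j : ι), i ≠ j → ∀ {tv uv tw uw sv sw ts us s : ∀ j, C j}
    (h₁ : AddAt i tv uv sv) (h₂ : AddAt i tw uw sw) (h₃ : AddAt j sv sw s)
    (h₄ : AddAt j tv tw ts) (h₅ : AddAt j uv uw us) (h₆ : AddAt i ts us s),
    ((δ i h₁).hom ⊗ₘ (δ i h₂).hom) ≫ (δ j h₃).hom =
      tensorμ (F.obj tv) (F.obj uv) (F.obj tw) (F.obj uw) ≫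
        ((δ j h₄).hom ⊗ₘ (δ j h₅).hom) ≫ (δ i h₆).hom

/-- Multilinear natural transformations. -/
@[ext]
structure LinFun.Hom {D : SMCat.{u}} (F G : LinFun C D) where
  app : F.F ⟶ G.F
  comm : ∀ (i : ι) {x y z : ∀ j, C j} (h : AddAt i x y z),
    (F.δ i h).hom ≫ app.app z = (app.app x ⊗ₘ app.app y) ≫ (G.δ i h).hom
  unit : ∀ (x : ∀ j, C j) (i : ι), x i = 𝟙_ (C i) → IsId (app.app x)

theorem IsId.id {C : Type*} [Category C] (X : C) : IsId (𝟙 X) := ⟨rfl, rfl⟩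

theorem IsId.comp {C : Type*} [Category C] {X Y Z : C} {f : X ⟶ Y} {g : Y ⟶ Z} (hf : IsId f)
    (hg : IsId g) : IsId (f ≫ g) := by
  obtain ⟨rfl, rfl⟩ := hf
  obtain ⟨rfl, rfl⟩ := hg
  exact ⟨rfl, by simp⟩

instance {D : SMCat.{u}} : Category (LinFun C D) where
  Hom F G := LinFun.Hom F G
  id F := ⟨𝟙 _, by intros; simp, fun x _ _ => IsId.id (F.F.obj x)⟩
  comp f g := ⟨f.app ≫ g.app, by
    intro i x y z h
    rw [NatTrans.comp_app, ← Category.assoc, f.comm, Category.assoc, g.comm, NatTrans.comp_app,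
      NatTrans.comp_app, ← tensorHom_comp_tensorHom, Category.assoc], fun x i h => (f.unit x i h).comp (g.unit x i h)⟩
  id_comp f := LinFun.Hom.ext (Category.id_comp _)
  comp_id f := LinFun.Hom.ext (Category.comp_id _)
  assoc f g h := LinFun.Hom.ext (Category.assoc _ _ _)

end Linear

section LinearLemmas

variable {ι : Type} {C : ι → SMCat.{u}}

theorem isId_of_heq {C : Type*} [Category C] {X Y Z : C} {f : X ⟶ Y} (h : X = Z) (h' : Y = Z)
    (H : HEq f (𝟙 Z)) : IsId f := by
  subst h; subst h'; exact ⟨rfl, eq_of_heq H⟩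

theorem IsId.heq {C : Type*} [Category C] {X Y Z : C} {f : X ⟶ Y} (h : X = Z) (H : IsId f) :
    HEq f (𝟙 Z) := by
  obtain ⟨rfl, rfl⟩ := H; subst h; rfl

theorem IsId.heq' {C : Type*} [Category C] {X Y X' Y' : C} {f : X ⟶ Y} {g : X' ⟶ Y'} (h : X = X')
    (H : IsId f) (H' : IsId g) : HEq f g := by
  obtain ⟨rfl, rfl⟩ := H; obtain ⟨rfl, rfl⟩ := H'; subst h; rfl

theorem IsId.comp_heq {C : Type*} [Category C] {X Y Z : C} {f : X ⟶ Y} (H : IsId f) (g : Y ⟶ Z) :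
    HEq (f ≫ g) g := by
  obtain ⟨rfl, rfl⟩ := H; simp

theorem IsId.heq_comp {C : Type*} [Category C] {X Y Z : C} {f : Y ⟶ Z} (H : IsId f) (g : X ⟶ Y) :
    HEq (g ≫ f) g := by
  obtain ⟨rfl, rfl⟩ := H; simp

theorem IsId.map {C D : Type*} [Category C] [Category D] (F : C ⥤ D) {X Y : C} {f : X ⟶ Y}
    (H : IsId f) : IsId (F.map f) := by
  obtain ⟨rfl, rfl⟩ := H; simpa using IsId.id _

theorem isId_pi {x y : ∀ j, C j} {f : x ⟶ y} (H : ∀ j, IsId (f j)) : IsId f := by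
  obtain rfl : x = y := funext fun j => (H j).1
  exact ⟨rfl, funext fun j => by obtain ⟨_, h⟩ := H j; simpa using h⟩

theorem IsId.pi {x y : ∀ j, C j} {f : x ⟶ y} (H : IsId f) (j : ι) : IsId (f j) := by
  obtain ⟨rfl, rfl⟩ := H; exact ⟨rfl, rfl⟩

theorem pi_hom_heq {x y x' y' : ∀ j, C j} {f : x ⟶ y} {g : x' ⟶ y'} (hx : x = x') (hy : y = y')
    (H : ∀ j, HEq (f j) (g j)) : HEq f g := by
  subst hx; subst hy; exact heq_of_eq (funext fun j => eq_of_heq (H j))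

theorem heq_pi {x y x' y' : ∀ j, C j} {f : x ⟶ y} {g : x' ⟶ y'} (hx : x = x') (hy : y = y')
    (H : HEq f g) (j : ι) : HEq (f j) (g j) := by
  subst hx; subst hy; cases H; rfl

theorem map_heq {C D : Type*} [Category C] [Category D] (F : C ⥤ D) {X Y X' Y' : C} {f : X ⟶ Y}
    {g : X' ⟶ Y'} (hx : X = X') (hy : Y = Y') (H : HEq f g) : HEq (F.map f) (F.map g) := by
  subst hx; subst hy; cases H; rfl

theorem tensorHom_heq {C : Type*} [Category C] [MonoidalCategory C] {X Y X' Y' Z W Z' W' : C}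
    {f : X ⟶ Y} {g : X' ⟶ Y'} {f' : Z ⟶ W} {g' : Z' ⟶ W'} (hx : X = X') (hy : Y = Y')
    (hz : Z = Z') (hw : W = W') (H : HEq f g) (H' : HEq f' g') : HEq (f ⊗ₘ f') (g ⊗ₘ g') := by
  subst hx; subst hy; subst hz; subst hw; cases H; cases H'; rfl

theorem exists_heq {C : Type*} [Category C] {X Y X' Y' : C} (f : X ⟶ Y) (hx : X = X')
    (hy : Y = Y') : ∃ g : X' ⟶ Y', HEq g f := by
  subst hx; subst hy; exact ⟨f, HEq.rfl⟩

open Classical in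
/-- An isomorphism of tuples which is `f` in the variable `i` and the identity in all others. -/
noncomputable def onlyIso (i : ι) {x y : ∀ j, C j} (h : ∀ j, j ≠ i → x j = y j) (f : x i ≅ y i) :
    x ≅ y :=
  Pi.isoMk fun j => if e : j = i then e ▸ f else eqToIso (h j e)

theorem onlyIso_onlyAt (i : ι) {x y : ∀ j, C j} (h : ∀ j, j ≠ i → x j = y j) (f : x i ≅ y i) :
    OnlyAt i (onlyIso i h f).hom f.hom := by
  constructor
  · simp [onlyIso]
  · intro j hj
    refine ⟨h j hj, ?_⟩
    simp [onlyIso, hj]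

open Classical in
theorem exists_pi {x y : ∀ j, C j} (H : ∀ j, (x j ⟶ y j) → Prop) (h : ∀ j, ∃ f, H j f) :
    ∃ m : x ⟶ y, ∀ j, H j (m j) :=
  ⟨fun j => (h j).choose, fun j => (h j).choose_spec⟩

theorem exists_onlyAt (i : ι) {x y : ∀ j, C j} (h : ∀ j, j ≠ i → x j = y j) {a b : C i}
    (f : a ⟶ b) (ha : x i = a) (hb : y i = b) : ∃ m : x ⟶ y, OnlyAt i m f := by
  obtain ⟨m, hm⟩ := exists_pi (x := x) (y := y)
    (fun j g => (∀ e : j = i, HEq g f) ∧ (j ≠ i → IsId g)) (by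
      intro j
      by_cases e : j = i
      · subst e; subst ha; subst hb
        exact ⟨f, fun _ => HEq.rfl, fun h => absurd rfl h⟩
      · exact ⟨eqToHom (h j e), fun e' => absurd e' e, fun _ => ⟨_, rfl⟩⟩)
  exact ⟨m, (hm i).1 rfl, fun j hj => (hm j).2 hj⟩

theorem OnlyAt.comp {i : ι} {x y z : ∀ j, C j} {m : x ⟶ y} {m' : y ⟶ z} {a b c : C i} {f : a ⟶ b}
    {g : b ⟶ c} (ha : x i = a) (hb : y i = b) (hc : z i = c) (h : OnlyAt i m f)
    (h' : OnlyAt i m' g) : OnlyAt i (m ≫ m') (f ≫ g) :=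
  ⟨CategoryTheory.heq_comp ha hb hc h.at_eq h'.at_eq,
    fun j hj => (h.others j hj).comp (h'.others j hj)⟩

theorem OnlyAt.unique {i : ι} {x y : ∀ j, C j} {m m' : x ⟶ y} {a b : C i} {f : a ⟶ b}
    (h : OnlyAt i m f) (h' : OnlyAt i m' f) : m = m' := by
  funext j
  by_cases e : j = i
  · subst e; exact eq_of_heq (h.at_eq.trans h'.at_eq.symm)
  · obtain ⟨_, h₁⟩ := h.others j e
    obtain ⟨_, h₂⟩ := h'.others j e
    rw [h₁, h₂]

theorem AddAt.exists (i : ι) {x y z : ∀ j, C j} (hx : ∀ j, j ≠ i → x j = z j)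
    (hy : ∀ j, j ≠ i → y j = z j) : ∃ w, AddAt i x y w ∧ ∀ j, j ≠ i → w j = z j := by
  classical
  refine ⟨Function.update z i (x i ⊗ y i), ⟨by simp, ?_, ?_⟩, ?_⟩ <;> intro j hj <;> simp [hj]
  exacts [hx j hj, hy j hj]

variable {D : SMCat.{u}} (F : LinFun C D)

namespace LinFun

theorem nat' (i : ι) {x y w z x' y' w' z' : ∀ j, C j} (h : AddAt i x y w) (h' : AddAt i x' y' w')
    (m : w ⟶ z) (m' : w' ⟶ z') (u : x i ⊗ y i ⟶ z i) (u' : x' i ⊗ y' i ⟶ z' i)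
    (hm : OnlyAt i m u) (hm' : OnlyAt i m' u') (f : x ⟶ x') (g : y ⟶ y') (k : z ⟶ z')
    (H : (f i ⊗ₘ g i) ≫ u' = u ≫ k i) (hf : ∀ j, j ≠ i → HEq (f j) (k j))
    (hg : ∀ j, j ≠ i → HEq (g j) (k j)) :
    (F.F.map f ⊗ₘ F.F.map g) ≫ (F.δ i h').hom ≫ F.F.map m' =
      (F.δ i h).hom ≫ F.F.map m ≫ F.F.map k := by
  obtain ⟨t, ht⟩ := exists_pi (x := w) (y := w')
    (fun j t => (∀ e : j = i, HEq t (f j ⊗ₘ g j)) ∧ (j ≠ i → HEq t (k j))) (by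
      intro j
      by_cases e : j = i
      · subst e
        obtain ⟨t, ht⟩ := exists_heq (f j ⊗ₘ g j) h.at_eq.symm h'.at_eq.symm
        exact ⟨t, fun _ => ht, fun h => absurd rfl h⟩
      · obtain ⟨t, ht⟩ := exists_heq (k j) (hm.others j e).1.symm (hm'.others j e).1.symm
        exact ⟨t, fun e' => absurd e' e, fun _ => ht⟩)
  have hA : AddAtHom i f g t := ⟨(ht i).1 rfl, fun j hj => (hf j hj).trans ((ht j).2 hj).symm,
    fun j hj => (hg j hj).trans ((ht j).2 hj).symm⟩
  rw [← Category.assoc, F.natural i h h' f g t hA, Category.assoc, ← F.F.map_comp,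
    ← F.F.map_comp]
  congr 2
  funext j
  by_cases e : j = i
  · subst e
    apply eq_of_heq
    refine (CategoryTheory.heq_comp h.at_eq h'.at_eq rfl ((ht j).1 rfl) hm'.at_eq).trans ?_
    rw [H]
    exact (CategoryTheory.heq_comp h.at_eq rfl rfl hm.at_eq HEq.rfl).symm
  · apply eq_of_heq
    refine ((hm'.others j e).heq_comp (t j)).trans (((ht j).2 e).trans ?_)
    exact ((hm.others j e).comp_heq (k j)).symm

/-- The special case of `nat'` in which all three morphisms only change the variable `i`. -/
theorem assoc' (i : ι) {x y z xy p pz r yz q xq r' : ∀ j, C j} (h₁ : AddAt i x y xy)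
    (h₂ : AddAt i p z pz) (h₃ : AddAt i y z yz) (h₄ : AddAt i x q xq)
    (m₁ : xy ⟶ p) (m₂ : pz ⟶ r) (m₃ : yz ⟶ q) (m₄ : xq ⟶ r') (k : r ⟶ r')
    (u₁ : x i ⊗ y i ⟶ p i) (u₂ : p i ⊗ z i ⟶ r i) (u₃ : y i ⊗ z i ⟶ q i) (u₄ : x i ⊗ q i ⟶ r' i)
    (hm₁ : OnlyAt i m₁ u₁) (hm₂ : OnlyAt i m₂ u₂) (hm₃ : OnlyAt i m₃ u₃) (hm₄ : OnlyAt i m₄ u₄)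
    (hk : ∀ j, j ≠ i → IsId (k j))
    (H : (u₁ ▷ z i) ≫ u₂ ≫ k i = (α_ (x i) (y i) (z i)).hom ≫ (x i ◁ u₃) ≫ u₄) :
    (((F.δ i h₁).hom ≫ F.F.map m₁) ▷ F.F.obj z) ≫ ((F.δ i h₂).hom ≫ F.F.map m₂) ≫ F.F.map k =
      (α_ _ _ _).hom ≫ (F.F.obj x ◁ ((F.δ i h₃).hom ≫ F.F.map m₃)) ≫
        ((F.δ i h₄).hom ≫ F.F.map m₄) := by
  have ezr : ∀ j, j ≠ i → z j = r' j := fun j hj =>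
    (h₂.right j hj).trans (((hm₂.others j hj).1).trans (hk j hj).1)
  have exr : ∀ j, j ≠ i → x j = r' j := fun j hj => (h₄.left j hj).trans (hm₄.others j hj).1
  have eyr : ∀ j, j ≠ i → y j = r' j := fun j hj =>
    ((h₁.right j hj).trans (h₁.left j hj).symm).trans (exr j hj)
  have exyr : ∀ j, j ≠ i → xy j = r' j := fun j hj => (h₁.left j hj).symm.trans (exr j hj)
  have eyzr : ∀ j, j ≠ i → yz j = r' j := fun j hj => (h₃.left j hj).symm.trans (eyr j hj)
  obtain ⟨l, hl, elr⟩ := AddAt.exists i exyr ezr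
  obtain ⟨rr, hrr, errr⟩ := AddAt.exists i exr eyzr
  obtain ⟨a, ha⟩ := exists_onlyAt i (x := l) (y := rr)
    (fun j hj => (elr j hj).trans (errr j hj).symm) (α_ (x i) (y i) (z i)).hom
    (by rw [hl.at_eq, h₁.at_eq]) (by rw [hrr.at_eq, h₃.at_eq])
  obtain ⟨b, hb⟩ := exists_onlyAt i (x := l) (y := r)
    (fun j hj => (elr j hj).trans (hk j hj).1.symm) ((u₁ ▷ z i) ≫ u₂)
    (by rw [hl.at_eq, h₁.at_eq]) rfl
  obtain ⟨c, hc⟩ := exists_onlyAt i (x := rr) (y := r') errr ((x i ◁ u₃) ≫ u₄)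
    (by rw [hrr.at_eq, h₃.at_eq]) rfl
  obtain ⟨b', hb'⟩ := exists_heq ((u₁ ▷ z i) ≫ u₂) (by rw [h₁.at_eq] : _ = xy i ⊗ z i) rfl
  obtain ⟨c', hc'⟩ := exists_heq ((x i ◁ u₃) ≫ u₄) (by rw [h₃.at_eq] : _ = x i ⊗ yz i) rfl
  have e₁ : (F.F.map m₁ ⊗ₘ F.F.map (𝟙 z)) ≫ (F.δ i h₂).hom ≫ F.F.map m₂ =
      (F.δ i hl).hom ≫ F.F.map b ≫ F.F.map (𝟙 r) := by
    refine F.nat' i hl h₂ b m₂ b' u₂ ⟨hb.at_eq.trans hb'.symm, hb.others⟩ hm₂ m₁ (𝟙 z) (𝟙 r) ?_ ?_ ?_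
    · apply eq_of_heq
      refine HEq.trans ?_ (hb'.symm.trans (heq_of_eq (Category.comp_id b').symm))
      refine CategoryTheory.heq_comp (by rw [h₁.at_eq]) rfl rfl ?_ HEq.rfl
      rw [← tensorHom_id]
      exact tensorHom_heq h₁.at_eq rfl rfl rfl hm₁.at_eq HEq.rfl
    · intro j hj
      exact (hm₁.others j hj).heq' ((exyr j hj).trans (hk j hj).1.symm) (IsId.id _)
    · intro j hj
      exact (IsId.id _).heq' ((ezr j hj).trans (hk j hj).1.symm) (IsId.id _)
  have e₂ : (F.F.map (𝟙 x) ⊗ₘ F.F.map m₃) ≫ (F.δ i h₄).hom ≫ F.F.map m₄ =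
      (F.δ i hrr).hom ≫ F.F.map c ≫ F.F.map (𝟙 r') := by
    refine F.nat' i hrr h₄ c m₄ c' u₄ ⟨hc.at_eq.trans hc'.symm, hc.others⟩ hm₄ (𝟙 x) m₃ (𝟙 r')
      ?_ ?_ ?_
    · apply eq_of_heq
      refine HEq.trans ?_ (hc'.symm.trans (heq_of_eq (Category.comp_id c').symm))
      refine CategoryTheory.heq_comp (by rw [h₃.at_eq]) rfl rfl ?_ HEq.rfl
      rw [← id_tensorHom]
      exact tensorHom_heq rfl rfl h₃.at_eq rfl HEq.rfl hm₃.at_eq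
    · intro j hj
      exact (IsId.id _).heq' (exr j hj) (IsId.id _)
    · intro j hj
      exact (hm₃.others j hj).heq' (eyzr j hj) (IsId.id _)
  have e₃ : b ≫ k = a ≫ c := by
    have hb₁ : OnlyAt i (b ≫ k) (((u₁ ▷ z i) ≫ u₂) ≫ k i) :=
      OnlyAt.comp (by rw [hl.at_eq, h₁.at_eq]) rfl rfl hb ⟨HEq.rfl, hk⟩
    have hb₂ : OnlyAt i (a ≫ c) ((α_ (x i) (y i) (z i)).hom ≫ (x i ◁ u₃) ≫ u₄) :=
      OnlyAt.comp (by rw [hl.at_eq, h₁.at_eq]) (by rw [hrr.at_eq, h₃.at_eq]) rfl ha hc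
    rw [Category.assoc, H] at hb₁
    exact hb₁.unique hb₂
  simp only [F.F.map_id, tensorHom_id, id_tensorHom, Category.comp_id] at e₁ e₂
  rw [comp_whiskerRight, Category.assoc, ← Category.assoc (F.F.map m₁ ▷ _), e₁,
    whiskerLeft_comp, Category.assoc, Category.assoc, e₂, ← F.F.map_comp, e₃, F.F.map_comp]
  have := F.δ_assoc i h₁ hl h₃ hrr a ha
  simp only [← Category.assoc] at this ⊢
  rw [this]

theorem symm' (i : ι) {x y w z w' z' : ∀ j, C j} (h : AddAt i x y w) (h' : AddAt i y x w')
    (m : w ⟶ z) (m' : w' ⟶ z') (k : z ⟶ z') (u : x i ⊗ y i ⟶ z i) (u' : y i ⊗ x i ⟶ z' i)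
    (hm : OnlyAt i m u) (hm' : OnlyAt i m' u') (hk : ∀ j, j ≠ i → IsId (k j))
    (H : u ≫ k i = (β_ (x i) (y i)).hom ≫ u') :
    ((F.δ i h).hom ≫ F.F.map m) ≫ F.F.map k =
      (β_ _ _).hom ≫ ((F.δ i h').hom ≫ F.F.map m') := by
  obtain ⟨a, ha⟩ := exists_onlyAt i (x := w) (y := w')
    (fun j hj => (h.left j hj).symm.trans (h'.right j hj)) (β_ (x i) (y i)).hom h.at_eq h'.at_eq
  have e : m ≫ k = a ≫ m' := by
    have h₁ : OnlyAt i (m ≫ k) (u ≫ k i) := OnlyAt.comp h.at_eq rfl rfl hm ⟨HEq.rfl, hk⟩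
    have h₂ : OnlyAt i (a ≫ m') ((β_ (x i) (y i)).hom ≫ u') :=
      OnlyAt.comp h.at_eq h'.at_eq rfl ha hm'
    rw [H] at h₁
    exact h₁.unique h₂
  rw [Category.assoc, ← F.F.map_comp, e, F.F.map_comp, ← Category.assoc, F.δ_symm i h h' a ha,
    Category.assoc]

end LinFun

theorem IsId.eq {C : Type*} [Category C] {X Y : C} {f g : X ⟶ Y} (h : IsId f) (h' : IsId g) :
    f = g := by
  obtain ⟨rfl, rfl⟩ := h; obtain ⟨_, rfl⟩ := h'; rfl

theorem IsId.tensor {C : Type*} [Category C] [MonoidalCategory C] {X Y X' Y' : C} {f : X ⟶ Y}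
    {g : X' ⟶ Y'} (h : IsId f) (h' : IsId g) : IsId (f ⊗ₘ g) := by
  obtain ⟨rfl, rfl⟩ := h; obtain ⟨rfl, rfl⟩ := h'
  simpa using IsId.id _

theorem exists_sliceMap [DecidableEq ι] (i : ι) (b : ∀ j, C j) {a a' : C i} (f : a ⟶ a') :
    ∃ m : Function.update b i a ⟶ Function.update b i a', OnlyAt i m f :=
  exists_onlyAt i (fun j hj => by simp [hj]) f (by simp) (by simp)

open Classical in
/-- The functor `c ↦ (b₁, …, c, …, b_k)` that varies the variable `i` only. -/
noncomputable def sliceFunctor (i : ι) (b : ∀ j, C j) : C i ⥤ ∀ j, C j where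
  obj a := Function.update b i a
  map f := (exists_sliceMap i b f).choose
  map_id a := by
    refine (exists_sliceMap i b (𝟙 a)).choose_spec.unique ⟨?_, fun j _ => ⟨rfl, rfl⟩⟩
    exact IsId.heq' (by simp) ⟨rfl, rfl⟩ (IsId.id a)
  map_comp {a a' a''} f g := by
    refine (exists_sliceMap i b (f ≫ g)).choose_spec.unique ?_
    exact OnlyAt.comp (by simp) (by simp) (by simp) (exists_sliceMap i b f).choose_spec
      (exists_sliceMap i b g).choose_spec

theorem sliceFunctor_onlyAt (i : ι) (b : ∀ j, C j) {a a' : C i} (f : a ⟶ a') :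
    OnlyAt i ((sliceFunctor i b).map f) f := by
  classical exact (exists_sliceMap i b f).choose_spec

theorem sliceFunctor_self (i : ι) (b : ∀ j, C j) (a : C i) : (sliceFunctor i b).obj a i = a := by
  simp [sliceFunctor]

theorem sliceFunctor_other (i : ι) (b : ∀ j, C j) (a : C i) (j : ι) (h : j ≠ i) :
    (sliceFunctor i b).obj a j = b j := by
  simp [sliceFunctor, h]

theorem sliceFunctor_eq (i : ι) (b x : ∀ j, C j) (h : ∀ j, j ≠ i → x j = b j) :
    (sliceFunctor i b).obj (x i) = x := by
  funext j
  by_cases e : j = i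
  · subst e; exact sliceFunctor_self j b _
  · rw [sliceFunctor_other i b _ j e, h j e]

theorem sliceFunctor_addAt (i : ι) (b : ∀ j, C j) (a a' : C i) :
    AddAt i ((sliceFunctor i b).obj a) ((sliceFunctor i b).obj a')
      ((sliceFunctor i b).obj (a ⊗ a')) :=
  ⟨by simp [sliceFunctor], fun j hj => by simp [sliceFunctor, hj],
    fun j hj => by simp [sliceFunctor, hj]⟩

namespace LinFun

/-- The lax monoidal structure of a multilinear functor in one of its variables. -/
@[reducible]
noncomputable def sliceMonoidal (i : ι) (b : ∀ j, C j) :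
    (sliceFunctor i b ⋙ F.F).LaxMonoidal where
  ε := eqToHom (F.unit_obj _ i (sliceFunctor_self i b _)).symm
  μ a a' := (F.δ i (sliceFunctor_addAt i b a a')).hom
  μ_natural_left {a a'} f c := by
    rw [← tensorHom_id, ← (sliceFunctor i b ⋙ F.F).map_id]
    refine F.natural i _ _ _ _ _ ⟨?_, ?_, ?_⟩
    · refine (sliceFunctor_onlyAt i b _).at_eq.trans ?_
      rw [← tensorHom_id]
      exact tensorHom_heq (sliceFunctor_self i b _).symm (sliceFunctor_self i b _).symm
        (sliceFunctor_self i b _).symm (sliceFunctor_self i b _).symm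
        (sliceFunctor_onlyAt i b f).at_eq.symm (sliceFunctor_onlyAt i b (𝟙 c)).at_eq.symm
    · intro j hj
      exact ((sliceFunctor_onlyAt i b _).others j hj).heq'
        (by rw [sliceFunctor_other i b _ j hj, sliceFunctor_other i b _ j hj])
        ((sliceFunctor_onlyAt i b _).others j hj)
    · intro j hj
      exact ((sliceFunctor_onlyAt i b _).others j hj).heq'
        (by rw [sliceFunctor_other i b _ j hj, sliceFunctor_other i b _ j hj])
        ((sliceFunctor_onlyAt i b _).others j hj)
  μ_natural_right {a a'} c f := by
    rw [← id_tensorHom, ← (sliceFunctor i b ⋙ F.F).map_id]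
    refine F.natural i _ _ _ _ _ ⟨?_, ?_, ?_⟩
    · refine (sliceFunctor_onlyAt i b _).at_eq.trans ?_
      rw [← id_tensorHom]
      exact tensorHom_heq (sliceFunctor_self i b _).symm (sliceFunctor_self i b _).symm
        (sliceFunctor_self i b _).symm (sliceFunctor_self i b _).symm
        (sliceFunctor_onlyAt i b (𝟙 c)).at_eq.symm (sliceFunctor_onlyAt i b f).at_eq.symm
    · intro j hj
      exact ((sliceFunctor_onlyAt i b _).others j hj).heq'
        (by rw [sliceFunctor_other i b _ j hj, sliceFunctor_other i b _ j hj])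
        ((sliceFunctor_onlyAt i b _).others j hj)
    · intro j hj
      exact ((sliceFunctor_onlyAt i b _).others j hj).heq'
        (by rw [sliceFunctor_other i b _ j hj, sliceFunctor_other i b _ j hj])
        ((sliceFunctor_onlyAt i b _).others j hj)
  associativity a a' a'' := by
    refine F.δ_assoc i _ _ _ _ _ ⟨?_, (sliceFunctor_onlyAt i b _).others⟩
    refine (sliceFunctor_onlyAt i b _).at_eq.trans ?_
    rw [sliceFunctor_self, sliceFunctor_self, sliceFunctor_self]
  left_unitality a := by
    refine (StrictUnit.left _).eq (IsId.comp ?_ (IsId.comp ?_ ?_))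
    · rw [← tensorHom_id]
      exact IsId.tensor ⟨_, rfl⟩ (IsId.id _)
    · exact F.unit_δ i _ (Or.inl (sliceFunctor_self i b _))
    · exact IsId.map _ (StrictUnit.left _)
  right_unitality a := by
    refine (StrictUnit.right _).eq (IsId.comp ?_ (IsId.comp ?_ ?_))
    · rw [← id_tensorHom]
      exact IsId.tensor (IsId.id _) ⟨_, rfl⟩
    · exact F.unit_δ i _ (Or.inr (Or.inl (sliceFunctor_self i b _)))
    · exact IsId.map _ (StrictUnit.right _)

theorem slice_tensorμ (i : ι) (b : ∀ j, C j) (a₁ a₂ a₃ a₄ : C i) :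
    tensorμ _ _ _ _ ≫ ((F.δ i (sliceFunctor_addAt i b a₁ a₃)).hom ⊗ₘ
        (F.δ i (sliceFunctor_addAt i b a₂ a₄)).hom) ≫ (F.δ i (sliceFunctor_addAt i b _ _)).hom =
      ((F.δ i (sliceFunctor_addAt i b a₁ a₂)).hom ⊗ₘ
        (F.δ i (sliceFunctor_addAt i b a₃ a₄)).hom) ≫ (F.δ i (sliceFunctor_addAt i b _ _)).hom ≫
        F.F.map ((sliceFunctor i b).map (tensorμ a₁ a₂ a₃ a₄)) := by
  let := F.sliceMonoidal i b
  let : (sliceFunctor i b ⋙ F.F).LaxBraided :=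
    { braided := fun a a' => F.δ_symm i _ _ _ (by
        refine ⟨?_, (sliceFunctor_onlyAt i b _).others⟩
        refine (sliceFunctor_onlyAt i b _).at_eq.trans ?_
        rw [sliceFunctor_self, sliceFunctor_self]) }
  exact tensorμ_comp_μ_tensorHom_μ_comp_μ (sliceFunctor i b ⋙ F.F) a₁ a₂ a₃ a₄

end LinFun

theorem sliceFunctor_addAt_eq (i : ι) (b : ∀ j, C j) {a a' : C i} {w : ∀ j, C j}
    (h : AddAt i ((sliceFunctor i b).obj a) ((sliceFunctor i b).obj a') w)
    (hw : ∀ j, j ≠ i → w j = b j) : w = (sliceFunctor i b).obj (a ⊗ a') := by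
  have := h.at_eq
  rw [sliceFunctor_self, sliceFunctor_self] at this
  rw [← this, sliceFunctor_eq i b w hw]

namespace LinFun

theorem interchange_aux (i : ι) {tv uv tw uw sv sw ts us s s' : ∀ j, C j}
    (h₁ : AddAt i tv uv sv) (h₂ : AddAt i tw uw sw) (h₃ : AddAt i sv sw s)
    (h₄ : AddAt i tv tw ts) (h₅ : AddAt i uv uw us) (h₆ : AddAt i ts us s')
    (m : s ⟶ s') (hm : OnlyAt i m (tensorμ (tv i) (uv i) (tw i) (uw i))) :
    ((F.δ i h₁).hom ⊗ₘ (F.δ i h₂).hom) ≫ (F.δ i h₃).hom ≫ F.F.map m =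
      tensorμ _ _ _ _ ≫ ((F.δ i h₄).hom ⊗ₘ (F.δ i h₅).hom) ≫ (F.δ i h₆).hom := by
  obtain ⟨b, hb⟩ : ∃ b, b = s := ⟨_, rfl⟩
  have es : ∀ j, j ≠ i → s j = b j := fun j hj => by rw [hb]
  have esv : ∀ j, j ≠ i → sv j = b j := fun j hj => (h₃.left j hj).trans (es j hj)
  have esw : ∀ j, j ≠ i → sw j = b j := fun j hj => (h₃.right j hj).trans (es j hj)
  have etv : ∀ j, j ≠ i → tv j = b j := fun j hj => (h₁.left j hj).trans (esv j hj)
  have euv : ∀ j, j ≠ i → uv j = b j := fun j hj => (h₁.right j hj).trans (esv j hj)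
  have etw : ∀ j, j ≠ i → tw j = b j := fun j hj => (h₂.left j hj).trans (esw j hj)
  have euw : ∀ j, j ≠ i → uw j = b j := fun j hj => (h₂.right j hj).trans (esw j hj)
  have ets : ∀ j, j ≠ i → ts j = b j := fun j hj => (h₄.left j hj).symm.trans (etv j hj)
  have eus : ∀ j, j ≠ i → us j = b j := fun j hj => (h₅.left j hj).symm.trans (euv j hj)
  have es' : ∀ j, j ≠ i → s' j = b j := fun j hj => (h₆.left j hj).symm.trans (ets j hj)
  clear hb
  obtain ⟨a₁, rfl⟩ : ∃ a, tv = (sliceFunctor i b).obj a := ⟨tv i, (sliceFunctor_eq i b tv etv).symm⟩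
  obtain ⟨a₂, rfl⟩ : ∃ a, uv = (sliceFunctor i b).obj a := ⟨uv i, (sliceFunctor_eq i b uv euv).symm⟩
  obtain ⟨a₃, rfl⟩ : ∃ a, tw = (sliceFunctor i b).obj a := ⟨tw i, (sliceFunctor_eq i b tw etw).symm⟩
  obtain ⟨a₄, rfl⟩ : ∃ a, uw = (sliceFunctor i b).obj a := ⟨uw i, (sliceFunctor_eq i b uw euw).symm⟩
  obtain rfl := sliceFunctor_addAt_eq i b h₁ esv
  obtain rfl := sliceFunctor_addAt_eq i b h₂ esw
  obtain rfl := sliceFunctor_addAt_eq i b h₃ es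
  obtain rfl := sliceFunctor_addAt_eq i b h₄ ets
  obtain rfl := sliceFunctor_addAt_eq i b h₅ eus
  obtain rfl := sliceFunctor_addAt_eq i b h₆ es'
  have := F.slice_tensorμ i b a₁ a₂ a₃ a₄
  have hs : OnlyAt i ((sliceFunctor i b).map (tensorμ a₁ a₂ a₃ a₄)) (tensorμ
      ((sliceFunctor i b).obj a₁ i) ((sliceFunctor i b).obj a₂ i) ((sliceFunctor i b).obj a₃ i)
      ((sliceFunctor i b).obj a₄ i)) :=
    ⟨(sliceFunctor_onlyAt i b _).at_eq.trans (by
      rw [sliceFunctor_self, sliceFunctor_self, sliceFunctor_self, sliceFunctor_self]),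
      (sliceFunctor_onlyAt i b _).others⟩
  rw [hm.unique hs]
  exact this.symm

/-- Merging three sums into one. The sums are taken in the variables `i`, `i` and `j`. -/
theorem merge (i j : ι) {x y p₀ p x' y' q₀ q s₀ s s₁ : ∀ j, C j} (h₁ : AddAt i x y p₀)
    (h₂ : AddAt i x' y' q₀) (h₃ : AddAt j p q s₀) (m₁ : p₀ ⟶ p) (m₂ : q₀ ⟶ q) (m₃ : s₀ ⟶ s)
    (u₃ : p j ⊗ q j ⟶ s j) (hm₃ : OnlyAt j m₃ u₃) (h : AddAt j p₀ q₀ s₁) (m : s₁ ⟶ s)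
    (hm : HEq (m j) ((m₁ j ⊗ₘ m₂ j) ≫ u₃))
    (hl : ∀ l, l ≠ j → HEq (m₁ l) (m l)) (hr : ∀ l, l ≠ j → HEq (m₂ l) (m l)) :
    (((F.δ i h₁).hom ≫ F.F.map m₁) ⊗ₘ ((F.δ i h₂).hom ≫ F.F.map m₂)) ≫
      (F.δ j h₃).hom ≫ F.F.map m₃ =
      ((F.δ i h₁).hom ⊗ₘ (F.δ i h₂).hom) ≫ (F.δ j h).hom ≫ F.F.map m := by
  rw [← tensorHom_comp_tensorHom, Category.assoc]
  congr 1
  have hA : ∃ t : s₁ ⟶ s₀, AddAtHom j m₁ m₂ t := by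
    obtain ⟨t, ht⟩ := exists_pi (x := s₁) (y := s₀)
      (fun l t => (∀ e : l = j, HEq t (m₁ l ⊗ₘ m₂ l)) ∧ (l ≠ j → HEq t (m l))) (by
        intro l
        by_cases e : l = j
        · subst e
          obtain ⟨t, ht⟩ := exists_heq (m₁ l ⊗ₘ m₂ l) h.at_eq.symm h₃.at_eq.symm
          exact ⟨t, fun _ => ht, fun h => absurd rfl h⟩
        · obtain ⟨t, ht⟩ := exists_heq (m l) rfl (hm₃.others l e).1.symm
          exact ⟨t, fun e' => absurd e' e, fun _ => ht⟩)
    exact ⟨t, (ht j).1 rfl, fun l e => (hl l e).trans ((ht l).2 e).symm,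
      fun l e => (hr l e).trans ((ht l).2 e).symm⟩
  obtain ⟨t, ht⟩ := hA
  rw [← Category.assoc, F.natural j h h₃ m₁ m₂ t ht, Category.assoc, ← F.F.map_comp]
  congr 2
  funext l
  by_cases e : l = j
  · subst e
    exact eq_of_heq ((CategoryTheory.heq_comp h.at_eq h₃.at_eq rfl ht.at_eq hm₃.at_eq).trans hm.symm)
  · exact eq_of_heq (((hm₃.others l e).heq_comp (t l)).trans
      ((ht.left l e).symm.trans (hl l e)))

theorem interchange (i : ι)
    {tv uv tw uw sv₀ sv sw₀ sw ts₀ ts us₀ us s₁ s₂ s : ∀ j, C j}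
    (h₁ : AddAt i tv uv sv₀) (h₂ : AddAt i tw uw sw₀) (h₃ : AddAt i sv sw s₁)
    (h₄ : AddAt i tv tw ts₀) (h₅ : AddAt i uv uw us₀) (h₆ : AddAt i ts us s₂)
    (m₁ : sv₀ ⟶ sv) (m₂ : sw₀ ⟶ sw) (m₃ : s₁ ⟶ s) (m₄ : ts₀ ⟶ ts) (m₅ : us₀ ⟶ us) (m₆ : s₂ ⟶ s)
    {u₁ : tv i ⊗ uv i ⟶ sv i} {u₂ : tw i ⊗ uw i ⟶ sw i} {u₃ : sv i ⊗ sw i ⟶ s i}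
    {u₄ : tv i ⊗ tw i ⟶ ts i} {u₅ : uv i ⊗ uw i ⟶ us i} {u₆ : ts i ⊗ us i ⟶ s i}
    (hm₁ : OnlyAt i m₁ u₁) (hm₂ : OnlyAt i m₂ u₂) (hm₃ : OnlyAt i m₃ u₃)
    (hm₄ : OnlyAt i m₄ u₄) (hm₅ : OnlyAt i m₅ u₅) (hm₆ : OnlyAt i m₆ u₆)
    (H : (u₁ ⊗ₘ u₂) ≫ u₃ = tensorμ _ _ _ _ ≫ (u₄ ⊗ₘ u₅) ≫ u₆) :
    (((F.δ i h₁).hom ≫ F.F.map m₁) ⊗ₘ ((F.δ i h₂).hom ≫ F.F.map m₂)) ≫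
        (F.δ i h₃).hom ≫ F.F.map m₃ =
      tensorμ _ _ _ _ ≫ (((F.δ i h₄).hom ≫ F.F.map m₄) ⊗ₘ ((F.δ i h₅).hom ≫ F.F.map m₅)) ≫
        (F.δ i h₆).hom ≫ F.F.map m₆ := by
  have esv : ∀ j, j ≠ i → sv₀ j = s j := fun j hj =>
    (hm₁.others j hj).1.trans ((h₃.left j hj).trans (hm₃.others j hj).1)
  have esw : ∀ j, j ≠ i → sw₀ j = s j := fun j hj =>
    (hm₂.others j hj).1.trans ((h₃.right j hj).trans (hm₃.others j hj).1)
  have ets : ∀ j, j ≠ i → ts₀ j = s j := fun j hj =>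
    (hm₄.others j hj).1.trans ((h₆.left j hj).trans (hm₆.others j hj).1)
  have eus : ∀ j, j ≠ i → us₀ j = s j := fun j hj =>
    (hm₅.others j hj).1.trans ((h₆.right j hj).trans (hm₆.others j hj).1)
  obtain ⟨a, ha, ea⟩ := AddAt.exists i esv esw
  obtain ⟨b, hb, eb⟩ := AddAt.exists i ets eus
  have hai : a i = (tv i ⊗ uv i) ⊗ (tw i ⊗ uw i) := by rw [ha.at_eq, h₁.at_eq, h₂.at_eq]
  have hbi : b i = (tv i ⊗ tw i) ⊗ (uv i ⊗ uw i) := by rw [hb.at_eq, h₄.at_eq, h₅.at_eq]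
  obtain ⟨c, hc⟩ := exists_onlyAt i (x := a) (y := s) ea ((u₁ ⊗ₘ u₂) ≫ u₃) hai rfl
  obtain ⟨d, hd⟩ := exists_onlyAt i (x := b) (y := s) eb ((u₄ ⊗ₘ u₅) ≫ u₆) hbi rfl
  obtain ⟨t, ht⟩ := exists_onlyAt i (x := a) (y := b) (fun j hj => (ea j hj).trans (eb j hj).symm)
    (tensorμ (tv i) (uv i) (tw i) (uw i)) hai hbi
  have e : c = t ≫ d := by
    have := OnlyAt.comp hai hbi rfl ht hd
    rw [← H] at this
    exact hc.unique this
  rw [F.merge i i h₁ h₂ h₃ m₁ m₂ m₃ u₃ hm₃ ha c, F.merge i i h₄ h₅ h₆ m₄ m₅ m₆ u₆ hm₆ hb d, e,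
    F.F.map_comp]
  · have := F.interchange_aux i h₁ h₂ ha h₄ h₅ hb t ht
    simp only [← Category.assoc] at this ⊢
    rw [this]
  · refine hd.at_eq.trans (CategoryTheory.heq_comp (by rw [h₄.at_eq, h₅.at_eq]) rfl rfl
      (tensorHom_heq h₄.at_eq.symm rfl h₅.at_eq.symm rfl hm₄.at_eq.symm hm₅.at_eq.symm) HEq.rfl)
  · exact fun l hl => (hm₄.others l hl).heq' ((ets l hl).trans (eb l hl).symm) (hd.others l hl)
  · exact fun l hl => (hm₅.others l hl).heq' ((eus l hl).trans (eb l hl).symm) (hd.others l hl)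
  · refine hc.at_eq.trans (CategoryTheory.heq_comp (by rw [h₁.at_eq, h₂.at_eq]) rfl rfl
      (tensorHom_heq h₁.at_eq.symm rfl h₂.at_eq.symm rfl hm₁.at_eq.symm hm₂.at_eq.symm) HEq.rfl)
  · exact fun l hl => (hm₁.others l hl).heq' ((esv l hl).trans (ea l hl).symm) (hc.others l hl)
  · exact fun l hl => (hm₂.others l hl).heq' ((esw l hl).trans (ea l hl).symm) (hc.others l hl)

theorem comm' (i j : ι) (hij : i ≠ j)
    {tv uv tw uw sv₀ sv sw₀ sw ts₀ ts us₀ us s₁ s₂ s : ∀ j, C j}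
    (h₁ : AddAt i tv uv sv₀) (h₂ : AddAt i tw uw sw₀) (h₃ : AddAt j sv sw s₁)
    (h₄ : AddAt j tv tw ts₀) (h₅ : AddAt j uv uw us₀) (h₆ : AddAt i ts us s₂)
    (m₁ : sv₀ ⟶ sv) (m₂ : sw₀ ⟶ sw) (m₃ : s₁ ⟶ s) (m₄ : ts₀ ⟶ ts) (m₅ : us₀ ⟶ us) (m₆ : s₂ ⟶ s)
    {u₁ : tv i ⊗ uv i ⟶ sv i} {u₂ : tw i ⊗ uw i ⟶ sw i} {u₃ : sv j ⊗ sw j ⟶ s j}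
    {u₄ : tv j ⊗ tw j ⟶ ts j} {u₅ : uv j ⊗ uw j ⟶ us j} {u₆ : ts i ⊗ us i ⟶ s i}
    (hm₁ : OnlyAt i m₁ u₁) (hm₂ : OnlyAt i m₂ u₂) (hm₃ : OnlyAt j m₃ u₃)
    (hm₄ : OnlyAt j m₄ u₄) (hm₅ : OnlyAt j m₅ u₅) (hm₆ : OnlyAt i m₆ u₆)
    (H₁₂ : HEq u₁ u₂) (H₁₆ : HEq u₁ u₆) (H₄₅ : HEq u₄ u₅) (H₄₃ : HEq u₄ u₃)
    (e₁ : tv i = tw i) (e₂ : uv i = uw i) (e₃ : sv i = sw i)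
    (e₄ : tv j = uv j) (e₅ : tw j = uw j) (e₆ : ts j = us j) :
    (((F.δ i h₁).hom ≫ F.F.map m₁) ⊗ₘ ((F.δ i h₂).hom ≫ F.F.map m₂)) ≫
        (F.δ j h₃).hom ≫ F.F.map m₃ =
      tensorμ _ _ _ _ ≫ (((F.δ j h₄).hom ≫ F.F.map m₄) ⊗ₘ ((F.δ j h₅).hom ≫ F.F.map m₅)) ≫
        (F.δ i h₆).hom ≫ F.F.map m₆ := by
  have hji : j ≠ i := hij.symm
  have etsi : ts i = tv i := (hm₄.others i hij).1.symm.trans (h₄.left i hij).symm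
  have eusi : us i = uv i := (hm₅.others i hij).1.symm.trans (h₅.left i hij).symm
  have esvj : sv j = tv j := (hm₁.others j hji).1.symm.trans (h₁.left j hji).symm
  have eswj : sw j = tw j := (hm₂.others j hji).1.symm.trans (h₂.left j hji).symm
  have esvi : sv i = s i := (h₃.left i hij).trans (hm₃.others i hij).1
  have etsj : ts j = s j := (h₆.left j hji).trans (hm₆.others j hji).1
  have hi : sv₀ i = sw₀ i := by rw [h₁.at_eq, h₂.at_eq, e₁, e₂]
  obtain ⟨a, ha, ea⟩ := AddAt.exists j (x := sv₀) (y := sw₀) (z := sv₀) (fun _ _ => rfl)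
    (fun l hl => by
      by_cases hli : l = i
      · subst hli; exact hi.symm
      · exact (hm₂.others l hli).1.trans ((h₃.right l hl).trans
          ((h₃.left l hl).symm.trans (hm₁.others l hli).1.symm)))
  have haj : a j = tv j ⊗ tw j := by
    rw [ha.at_eq, ← h₁.left j hji, ← h₂.left j hji]
  have hai : a i = tv i ⊗ uv i := by rw [ea i hij, h₁.at_eq]
  have hb : AddAt i ts₀ us₀ a := by
    refine ⟨?_, ?_, ?_⟩
    · rw [hai, h₄.left i hij, h₅.left i hij]
    · intro l hl
      by_cases hlj : l = j
      · subst hlj; rw [h₄.at_eq, haj]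
      · rw [← h₄.left l hlj, h₁.left l hl, ea l hlj]
    · intro l hl
      by_cases hlj : l = j
      · subst hlj; rw [h₅.at_eq, haj, e₄, e₅]
      · rw [← h₅.left l hlj, h₁.right l hl, ea l hlj]
  obtain ⟨c, hc⟩ := exists_pi (x := a) (y := s)
    (fun l t => (∀ e : l = i, HEq t (m₁ l)) ∧ (∀ e : l = j, HEq t (m₄ l)) ∧
      (l ≠ i → l ≠ j → IsId t)) (by
      intro l
      by_cases hi : l = i
      · subst hi
        obtain ⟨t, ht⟩ := exists_heq (m₁ l) (ea l hij).symm esvi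
        exact ⟨t, fun _ => ht, fun e => absurd e hij, fun e => absurd rfl e⟩
      · by_cases hj : l = j
        · subst hj
          obtain ⟨t, ht⟩ := exists_heq (m₄ l) (h₄.at_eq.trans haj.symm) etsj
          exact ⟨t, fun e => absurd e hji, fun _ => ht, fun _ e => absurd rfl e⟩
        · exact ⟨eqToHom ((ea l hj).trans ((hm₁.others l hi).1.trans ((h₃.left l hj).trans
            (hm₃.others l hj).1))), fun e => absurd e hi, fun e => absurd e hj, fun _ _ => ⟨_, rfl⟩⟩)
  have hci : HEq (c i) (m₁ i) := (hc i).1 rfl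
  have hcj : HEq (c j) (m₄ j) := (hc j).2.1 rfl
  rw [F.merge i j h₁ h₂ h₃ m₁ m₂ m₃ u₃ hm₃ ha c, F.merge j i h₄ h₅ h₆ m₄ m₅ m₆ u₆ hm₆ hb c]
  · have := F.δ_comm i j hij h₁ h₂ ha h₄ h₅ hb
    simp only [← Category.assoc] at this ⊢
    rw [this]
  · refine hci.trans (hm₁.at_eq.trans (H₁₆.trans ?_))
    exact (((hm₄.others i hij).tensor (hm₅.others i hij)).comp_heq u₆).symm
  · intro l hl
    by_cases hlj : l = j
    · subst hlj; exact hcj.symm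
    · exact (hm₄.others l hlj).heq' (hb.left l hl) ((hc l).2.2 hl hlj)
  · intro l hl
    by_cases hlj : l = j
    · subst hlj
      exact (hm₅.at_eq.trans (H₄₅.symm.trans hm₄.at_eq.symm)).trans hcj.symm
    · exact (hm₅.others l hlj).heq' (hb.right l hl) ((hc l).2.2 hl hlj)
  · refine hcj.trans (hm₄.at_eq.trans (H₄₃.trans ?_))
    exact (((hm₁.others j hji).tensor (hm₂.others j hji)).comp_heq u₃).symm
  · intro l hl
    by_cases hli : l = i
    · subst hli; exact hci.symm
    · exact (hm₁.others l hli).heq' (ha.left l hl) ((hc l).2.2 hli hl)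
  · intro l hl
    by_cases hli : l = i
    · subst hli
      exact (hm₂.at_eq.trans (H₁₂.symm.trans hm₁.at_eq.symm)).trans hci.symm
    · exact (hm₂.others l hli).heq' (ha.right l hl) ((hc l).2.2 hli hl)

end LinFun

/-! ### Composition of multilinear functors -/

section Comp

variable {κ : ι → Type} {τ : Type} (e : (Σ i, κ i) ≃ τ) {A : τ → SMCat.{u}}

/-- The `i`-th block of a tuple. -/
def block (A : τ → SMCat.{u}) (i : ι) : (∀ t, A t) ⥤ ∀ j : κ i, A (e ⟨i, j⟩) where
  obj x j := x (e ⟨i, j⟩)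
  map f j := f (e ⟨i, j⟩)

theorem e_ne {i : ι} {j : κ i} {i' : ι} (j' : κ i') (h : i' ≠ i) : e ⟨i', j'⟩ ≠ e ⟨i, j⟩ :=
  fun h' => h (congrArg Sigma.fst (e.injective h'))

theorem e_ne' {i : ι} {j j' : κ i} (h : j' ≠ j) : e ⟨i, j'⟩ ≠ e ⟨i, j⟩ := by
  intro h'
  have := e.injective h'
  simp only [Sigma.mk.injEq, heq_eq_eq, true_and] at this
  exact h this

variable {e}

theorem AddAt.block {i : ι} {j : κ i} {x y z : ∀ t, A t} (h : AddAt (e ⟨i, j⟩) x y z) :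
    AddAt j ((block e A i).obj x) ((block e A i).obj y) ((block e A i).obj z) :=
  ⟨h.at_eq, fun _ hj => h.left _ (e_ne' e hj), fun _ hj => h.right _ (e_ne' e hj)⟩

theorem AddAt.block_left {i : ι} {j : κ i} {x y z : ∀ t, A t} (h : AddAt (e ⟨i, j⟩) x y z)
    {i' : ι} (hi : i' ≠ i) : (EM.block e A i').obj x = (EM.block e A i').obj z :=
  funext fun j' => h.left _ (e_ne e j' hi)

theorem AddAt.block_right {i : ι} {j : κ i} {x y z : ∀ t, A t} (h : AddAt (e ⟨i, j⟩) x y z)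
    {i' : ι} (hi : i' ≠ i) : (EM.block e A i').obj y = (EM.block e A i').obj z :=
  funext fun j' => h.right _ (e_ne e j' hi)

theorem OnlyAt.block {i : ι} {j : κ i} {x y : ∀ t, A t} {m : x ⟶ y} {a b : A (e ⟨i, j⟩)}
    {f : a ⟶ b} (h : OnlyAt (e ⟨i, j⟩) m f) :
    OnlyAt (C := fun j => A (e ⟨i, j⟩)) j ((EM.block e A i).map m) f :=
  ⟨h.at_eq, fun _ hj => h.others _ (e_ne' e hj)⟩

theorem OnlyAt.block_ne {i : ι} {j : κ i} {x y : ∀ t, A t} {m : x ⟶ y} {a b : A (e ⟨i, j⟩)}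
    {f : a ⟶ b} (h : OnlyAt (e ⟨i, j⟩) m f) {i' : ι} (hi : i' ≠ i) :
    IsId ((EM.block e A i').map m) :=
  isId_pi fun j' => h.others _ (e_ne e j' hi)

variable {B : ι → SMCat.{u}} {D : SMCat.{u}} (G : LinFun B D)
  (F : ∀ i, LinFun (fun j : κ i => A (e ⟨i, j⟩)) (B i))

/-- The product of the functors `Fᵢ`. -/
def innerFunctor : (∀ t, A t) ⥤ ∀ i, B i := Functor.pi' fun i => block e A i ⋙ (F i).F

open Classical in
/-- The intermediate tuple `(F₁, …, Fᵢ(x) ⊗ Fᵢ(y), …, F_n)`. -/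
noncomputable def midTuple (x y z : ∀ t, A t) (i : ι) : ∀ i, B i :=
  Function.update ((innerFunctor F).obj z) i ((innerFunctor F).obj x i ⊗ (innerFunctor F).obj y i)

theorem midTuple_addAt {i : ι} {j : κ i} {x y z : ∀ t, A t} (h : AddAt (e ⟨i, j⟩) x y z) :
    AddAt i ((innerFunctor F).obj x) ((innerFunctor F).obj y) (midTuple F x y z i) := by
  refine ⟨by simp [midTuple], ?_, ?_⟩
  · intro i' hi
    simp only [midTuple, ne_eq, hi, not_false_eq_true, Function.update_of_ne]
    exact congrArg (F i').F.obj (h.block_left hi)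
  · intro i' hi
    simp only [midTuple, ne_eq, hi, not_false_eq_true, Function.update_of_ne]
    exact congrArg (F i').F.obj (h.block_right hi)

/-- The isomorphism `(F₁, …, Fᵢ(x) ⊗ Fᵢ(y), …, F_n) ≅ (F₁, …, Fᵢ(z), …, F_n)` given by `δⱼ` of `Fᵢ`. -/
noncomputable def midIso {i : ι} {j : κ i} {x y z : ∀ t, A t} (h : AddAt (e ⟨i, j⟩) x y z) :
    midTuple F x y z i ≅ (innerFunctor F).obj z :=
  onlyIso i (fun i' hi => by simp [midTuple, hi])
    (eqToIso (midTuple_addAt F h).at_eq ≪≫ (F i).δ j h.block)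

theorem midIso_onlyAt {i : ι} {j : κ i} {x y z : ∀ t, A t} (h : AddAt (e ⟨i, j⟩) x y z) :
    OnlyAt i (midIso F h).hom ((F i).δ j h.block).hom := by
  have := onlyIso_onlyAt i (x := midTuple F x y z i) (y := (innerFunctor F).obj z)
    (fun i' hi => by simp [midTuple, hi])
    (eqToIso (midTuple_addAt F h).at_eq ≪≫ (F i).δ j h.block)
  refine ⟨this.at_eq.trans ?_, this.others⟩
  exact eqToHom_comp_heq ((F i).δ j h.block).hom (midTuple_addAt F h).at_eq

/-- The distributivity isomorphism of the composite at the `j`-th place of the `i`-th block. -/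
noncomputable def compδ {p : Σ i, κ i} {x y z : ∀ t, A t} (h : AddAt (e p) x y z) :
    G.F.obj ((innerFunctor F).obj x) ⊗ G.F.obj ((innerFunctor F).obj y) ≅
      G.F.obj ((innerFunctor F).obj z) :=
  G.δ p.1 (midTuple_addAt F (j := p.2) h) ≪≫ G.F.mapIso (midIso F (j := p.2) h)

/-- The distributivity isomorphisms of the composite. -/
noncomputable def compδ' (t : τ) {x y z : ∀ t, A t} (h : AddAt t x y z) :
    G.F.obj ((innerFunctor F).obj x) ⊗ G.F.obj ((innerFunctor F).obj y) ≅
      G.F.obj ((innerFunctor F).obj z) :=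
  compδ G F (p := e.symm t) (by rwa [e.apply_symm_apply])

theorem compδ'_eq {i : ι} {j : κ i} {x y z : ∀ t, A t} (h : AddAt (e ⟨i, j⟩) x y z) :
    (compδ' G F _ h).hom =
      (G.δ i (midTuple_addAt F h)).hom ≫ G.F.map (midIso F h).hom := by
  have key : ∀ (p q : Σ i, κ i) (hq : AddAt (e q) x y z) (hp : AddAt (e p) x y z), p = q →
      compδ G F hp = compδ G F hq := by
    rintro p _ hq hp rfl; rfl
  exact congrArg Iso.hom (key _ ⟨i, j⟩ h _ (e.symm_apply_apply _))

variable (e) in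
theorem exists_place (t : τ) : ∃ i j, t = e ⟨i, j⟩ :=
  ⟨(e.symm t).1, (e.symm t).2, (e.apply_symm_apply t).symm⟩

/-- The composite `G ∘ (F₁ × ⋯ × F_n)`, where `δ` at the `j`-th place of the `i`-th block is
`G(δⱼ) ∘ δᵢ`. -/
noncomputable def LinFun.comp : LinFun A D where
  F := innerFunctor F ⋙ G.F
  δ t _ _ _ h := compδ' G F t h
  natural t x y z x' y' z' h h' f g k H := by
    obtain ⟨i, j, rfl⟩ := exists_place e t
    rw [compδ'_eq, compδ'_eq, Category.assoc]
    refine G.nat' i _ _ _ _ _ _ (midIso_onlyAt F h) (midIso_onlyAt F h') _ _ _ ?_ ?_ ?_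
    · exact (F i).natural j h.block h'.block _ _ _
        ⟨H.at_eq, fun _ hj => H.left _ (e_ne' e hj), fun _ hj => H.right _ (e_ne' e hj)⟩
    · intro i' hi
      exact map_heq (F i').F (h.block_left hi) (h'.block_left hi)
        (pi_hom_heq (h.block_left hi) (h'.block_left hi) fun j' => H.left _ (e_ne e j' hi))
    · intro i' hi
      exact map_heq (F i').F (h.block_right hi) (h'.block_right hi)
        (pi_hom_heq (h.block_right hi) (h'.block_right hi) fun j' => H.right _ (e_ne e j' hi))
  unit_obj x t h := by
    obtain ⟨i, j, rfl⟩ := exists_place e t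
    exact G.unit_obj _ i ((F i).unit_obj _ j h)
  unit_map f t h hx hy := by
    obtain ⟨i, j, rfl⟩ := exists_place e t
    exact G.unit_map _ i ((F i).unit_map _ j h hx hy) ((F i).unit_obj _ j hx)
      ((F i).unit_obj _ j hy)
  unit_δ t x y z h H := by
    obtain ⟨i, j, rfl⟩ := exists_place e t
    rw [compδ'_eq]
    have h₁ : IsId (G.δ i (midTuple_addAt F h)).hom ∧ IsId (G.F.map (midIso F h).hom) := by
      have hO := midIso_onlyAt F h
      have aux : IsId ((F i).δ j h.block).hom → IsId (G.F.map (midIso F h).hom) := by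
        intro hd
        refine IsId.map _ (isId_pi fun i' => ?_)
        by_cases hi : i' = i
        · subst hi
          exact isId_of_heq ((midTuple_addAt F h).at_eq.trans hd.1) rfl
            (hO.at_eq.trans (hd.heq hd.1))
        · exact hO.others i' hi
      rcases H with H | H | ⟨t, ht, H⟩
      · exact ⟨G.unit_δ i _ (Or.inl ((F i).unit_obj _ j H)),
          aux ((F i).unit_δ j _ (Or.inl H))⟩
      · exact ⟨G.unit_δ i _ (Or.inr (Or.inl ((F i).unit_obj _ j H))),
          aux ((F i).unit_δ j _ (Or.inr (Or.inl H)))⟩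
      · obtain ⟨i', j', rfl⟩ := exists_place e t
        by_cases hi : i' = i
        · subst hi
          have hj : j' ≠ j := fun h => ht (by rw [h])
          refine ⟨G.unit_δ i' _ (Or.inl ((F i').unit_obj _ j' ?_)),
            aux ((F i').unit_δ j _ (Or.inr (Or.inr ⟨j', hj, H⟩)))⟩
          exact (h.left _ ht).trans H
        · refine ⟨G.unit_δ i _ (Or.inr (Or.inr ⟨i', hi, ?_⟩)), ?_⟩
          · rw [(hO.others i' hi).1]
            exact (F i').unit_obj _ j' H
          · have hz := (F i').unit_obj ((block e A i').obj z) j' H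
            have hz' : (innerFunctor F).obj z i' = 𝟙_ (B i') := hz
            have hm := (hO.others i' hi)
            exact isId_of_heq (G.unit_obj _ i' (hm.1.trans hz')) (G.unit_obj _ i' hz')
              (G.unit_map _ i' (hm.heq (hm.1.trans hz')) (hm.1.trans hz') hz')
    exact h₁.1.comp h₁.2
  δ_assoc t x y z xy yz l r h₁ h₂ h₃ h₄ m hm := by
    obtain ⟨i, j, rfl⟩ := exists_place e t
    rw [compδ'_eq, compδ'_eq, compδ'_eq, compδ'_eq, ← Category.assoc (Z := _)]
    refine (Category.assoc _ _ _).trans (G.assoc' i _ _ _ _ _ _ _ _ ((innerFunctor F).map m) _ _ _ _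
      (midIso_onlyAt F h₁) (midIso_onlyAt F h₂) (midIso_onlyAt F h₃) (midIso_onlyAt F h₄) ?_ ?_)
    · intro i' hi
      exact (hm.block_ne hi).map _
    · exact (F i).δ_assoc j h₁.block h₂.block h₃.block h₄.block _ hm.block
  δ_symm t x y z w h₁ h₂ m hm := by
    obtain ⟨i, j, rfl⟩ := exists_place e t
    rw [compδ'_eq, compδ'_eq]
    refine G.symm' i _ _ _ _ ((innerFunctor F).map m) _ _ (midIso_onlyAt F h₁)
      (midIso_onlyAt F h₂) ?_ ?_
    · intro i' hi
      exact (hm.block_ne hi).map _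
    · exact (F i).δ_symm j h₁.block h₂.block _ hm.block
  δ_comm t t' htt tv uv tw uw sv sw ts us s h₁ h₂ h₃ h₄ h₅ h₆ := by
    obtain ⟨i, j, rfl⟩ := exists_place e t
    obtain ⟨i', j', rfl⟩ := exists_place e t'
    rw [compδ'_eq, compδ'_eq, compδ'_eq, compδ'_eq, compδ'_eq, compδ'_eq]
    by_cases hi : i = i'
    · subst hi
      have hj : j ≠ j' := fun h => htt (by rw [h])
      exact G.interchange i _ _ _ _ _ _ _ _ _ _ _ _ (midIso_onlyAt F h₁) (midIso_onlyAt F h₂)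
        (midIso_onlyAt F h₃) (midIso_onlyAt F h₄) (midIso_onlyAt F h₅) (midIso_onlyAt F h₆)
        ((F i).δ_comm j j' hj h₁.block h₂.block h₃.block h₄.block h₅.block h₆.block)
    · have hi' : i' ≠ i := fun h => hi h.symm
      have key : ∀ {i : ι} {j : κ i} {x y z x' y' z' : ∀ t, A t} (h : AddAt (e ⟨i, j⟩) x y z)
          (h' : AddAt (e ⟨i, j⟩) x' y' z'), (block e A i).obj x = (block e A i).obj x' →
          (block e A i).obj y = (block e A i).obj y' → (block e A i).obj z = (block e A i).obj z' →
          HEq ((F i).δ j h.block).hom ((F i).δ j h'.block).hom := by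
        intro i j x y z x' y' z' h h' hx hy hz
        have : ∀ {X Y Z X' Y' Z' : ∀ j, A (e ⟨i, j⟩)} (H : AddAt j X Y Z) (H' : AddAt j X' Y' Z'),
            X = X' → Y = Y' → Z = Z' → HEq ((F i).δ j H).hom ((F i).δ j H').hom := by
          rintro X Y Z _ _ _ H H' rfl rfl rfl; rfl
        exact this _ _ hx hy hz
      have a₁ := h₄.block_left hi
      have a₂ := h₄.block_right hi
      have a₃ := h₅.block_left hi
      have a₄ := h₅.block_right hi
      have a₅ := h₃.block_left hi
      have a₆ := h₃.block_right hi
      have b₁ := h₁.block_left hi'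
      have b₂ := h₁.block_right hi'
      have b₃ := h₂.block_left hi'
      have b₄ := h₂.block_right hi'
      have b₅ := h₆.block_left hi'
      have b₆ := h₆.block_right hi'
      exact G.comm' i i' hi _ _ _ _ _ _ _ _ _ _ _ _ (midIso_onlyAt F h₁) (midIso_onlyAt F h₂)
        (midIso_onlyAt F h₃) (midIso_onlyAt F h₄) (midIso_onlyAt F h₅) (midIso_onlyAt F h₆)
        (key h₁ h₂ (a₁.trans a₂.symm) (a₃.trans a₄.symm) (a₅.trans a₆.symm))
        (key h₁ h₆ a₁ a₃ a₅) (key h₄ h₅ (b₁.trans b₂.symm) (b₃.trans b₄.symm) (b₅.trans b₆.symm))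
        (key h₄ h₃ b₁ b₃ b₅)
        (congrArg (F i).F.obj (a₁.trans a₂.symm)) (congrArg (F i).F.obj (a₃.trans a₄.symm))
        (congrArg (F i).F.obj (a₅.trans a₆.symm)) (congrArg (F i').F.obj (b₁.trans b₂.symm))
        (congrArg (F i').F.obj (b₃.trans b₄.symm)) (congrArg (F i').F.obj (b₅.trans b₆.symm))



/-- The product of natural transformations `Fᵢ ⟶ Fᵢ'`. -/
def innerMap {F F' : ∀ i, LinFun (fun j : κ i => A (e ⟨i, j⟩)) (B i)} (ψ : F ⟶ F') :
    innerFunctor F ⟶ innerFunctor F' where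
  app x := (fun i => (ψ i).app.app ((block e A i).obj x) :
    ∀ i, (innerFunctor F).obj x i ⟶ (innerFunctor F').obj x i)
  naturality _ _ f := funext fun i => (ψ i).app.naturality ((block e A i).map f)

theorem innerMap_heq {F F' : ∀ i, LinFun (fun j : κ i => A (e ⟨i, j⟩)) (B i)} (ψ : F ⟶ F')
    {x z : ∀ t, A t} (i : ι) (h : (block e A i).obj x = (block e A i).obj z) :
    HEq ((innerMap ψ).app x i) ((innerMap ψ).app z i) := by
  have key : ∀ X Z : ∀ j, A (e ⟨i, j⟩), X = Z → HEq ((ψ i).app.app X) ((ψ i).app.app Z) := by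
    rintro X _ rfl; rfl
  exact key _ _ h

/-- The horizontal composite of multilinear natural transformations. -/
noncomputable def LinFun.compMap {G G' : LinFun B D}
    {F F' : ∀ i, LinFun (fun j : κ i => A (e ⟨i, j⟩)) (B i)} (φ : G ⟶ G') (ψ : F ⟶ F') :
    LinFun.comp G F ⟶ LinFun.comp G' F' where
  app := innerMap ψ ◫ φ.app
  comm t x y z h := by
    obtain ⟨i, j, rfl⟩ := exists_place e t
    change (compδ' G F _ h).hom ≫ _ = _ ≫ (compδ' G' F' _ h).hom
    rw [compδ'_eq, compδ'_eq]
    have h₁ := G.nat' i (midTuple_addAt F h) (midTuple_addAt F' h) (midIso F h).hom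
      (midIso F' h).hom _ _ (midIso_onlyAt F h) (midIso_onlyAt F' h)
      ((innerMap ψ).app x) ((innerMap ψ).app y) ((innerMap ψ).app z) ((ψ i).comm j h.block).symm
      (fun i' hi => innerMap_heq ψ i' (h.block_left hi))
      (fun i' hi => innerMap_heq ψ i' (h.block_right hi))
    have h₂ := φ.comm i (midTuple_addAt F' h)
    have h₃ : ∀ x, (innerMap ψ ◫ φ.app).app x =
        G.F.map ((innerMap ψ).app x) ≫ φ.app.app ((innerFunctor F').obj x) := fun x => by
      rw [NatTrans.hcomp_app, φ.app.naturality]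
    have key : ((G.δ i (midTuple_addAt F h)).hom ≫ G.F.map (midIso F h).hom) ≫
        (G.F.map ((innerMap ψ).app z) ≫ φ.app.app ((innerFunctor F').obj z)) =
        ((G.F.map ((innerMap ψ).app x) ≫ φ.app.app ((innerFunctor F').obj x)) ⊗ₘ
          (G.F.map ((innerMap ψ).app y) ≫ φ.app.app ((innerFunctor F').obj y))) ≫
        ((G'.δ i (midTuple_addAt F' h)).hom ≫ G'.F.map (midIso F' h).hom) := by
      have e₁ := congrArg (· ≫ φ.app.app ((innerFunctor F').obj z)) h₁
      have e₂ := congrArg (· ≫ G'.F.map (midIso F' h).hom) h₂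
      simp only [Category.assoc] at e₁ e₂
      rw [← tensorHom_comp_tensorHom, Category.assoc, Category.assoc, ← e₂, ← e₁,
        ← φ.app.naturality]
    rw [h₃, h₃, h₃]
    exact key
  unit x t h := by
    obtain ⟨i, j, rfl⟩ := exists_place e t
    have h₁ : (innerFunctor F).obj x i = 𝟙_ (B i) := (F i).unit_obj _ j h
    have h₂ : (innerFunctor F').obj x i = 𝟙_ (B i) := (F' i).unit_obj _ j h
    have h₃ : IsId ((innerMap ψ).app x i) := (ψ i).unit ((block e A i).obj x) j h
    rw [NatTrans.hcomp_app]
    exact (φ.unit _ i h₁).comp (isId_of_heq (G'.unit_obj _ i h₁) (G'.unit_obj _ i h₂)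
      (G'.unit_map _ i (h₃.heq h₁) h₁ h₂))

/-- Composition of multilinear functors, as a functor. -/
noncomputable def LinFun.compFunctor :
    (LinFun B D × ∀ i, LinFun (fun j : κ i => A (e ⟨i, j⟩)) (B i)) ⥤ LinFun A D where
  obj p := LinFun.comp p.1 p.2
  map f := LinFun.compMap f.1 f.2
  map_id p := LinFun.Hom.ext (by
    apply NatTrans.ext
    funext x
    change (𝟙 p.1 : p.1 ⟶ p.1).app.app _ ≫ p.1.F.map (𝟙 _) = 𝟙 _
    rw [p.1.F.map_id, Category.comp_id]
    rfl)
  map_comp f g := LinFun.Hom.ext (NatTrans.exchange (innerMap f.2) (innerMap g.2) f.1.app g.1.app)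

end Comp

/-! ### Permutation of the variables -/

section Act

variable {κ : Type} (e : κ ≃ ι) {A : ι → SMCat.{u}} {D : SMCat.{u}}

/-- The functor that permutes the variables. -/
def reindex (A : ι → SMCat.{u}) : (∀ i, A i) ⥤ ∀ j, A (e j) where
  obj x j := x (e j)
  map f j := f (e j)

theorem AddAt.reindex {j : κ} {x y z : ∀ i, A i} (h : AddAt (e j) x y z) :
    AddAt j ((EM.reindex e A).obj x) ((EM.reindex e A).obj y) ((EM.reindex e A).obj z) :=
  ⟨h.at_eq, fun _ hj => h.left _ (e.injective.ne hj), fun _ hj => h.right _ (e.injective.ne hj)⟩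

theorem AddAt.reindex' {i : ι} {x y z : ∀ i, A i} (h : AddAt i x y z) :
    AddAt (e.symm i) ((EM.reindex e A).obj x) ((EM.reindex e A).obj y)
      ((EM.reindex e A).obj z) :=
  AddAt.reindex e (by rwa [e.apply_symm_apply])

theorem OnlyAt.reindex {j : κ} {x y : ∀ i, A i} {m : x ⟶ y} {a b : A (e j)} {f : a ⟶ b}
    (h : OnlyAt (e j) m f) :
    OnlyAt (C := fun j => A (e j)) j ((EM.reindex e A).map m) f :=
  ⟨h.at_eq, fun _ hj => h.others _ (e.injective.ne hj)⟩

theorem LinFun.δ_reindex_eq (F : LinFun (fun j => A (e j)) D) {j : κ} {x y z : ∀ i, A i}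
    (h : AddAt (e j) x y z) :
    F.δ (e.symm (e j)) (h.reindex' e) = F.δ j (h.reindex e) := by
  have key : ∀ (p q : κ) (hp : AddAt (C := fun j => A (e j)) p ((EM.reindex e A).obj x)
      ((EM.reindex e A).obj y) ((EM.reindex e A).obj z))
      (hq : AddAt (C := fun j => A (e j)) q ((EM.reindex e A).obj x)
      ((EM.reindex e A).obj y) ((EM.reindex e A).obj z)), p = q → F.δ p hp = F.δ q hq := by
    rintro p _ hp hq rfl; rfl
  exact key _ _ _ _ (e.symm_apply_apply j)

/-- Permutation of the variables of a multilinear functor. -/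
def LinFun.act (F : LinFun (fun j => A (e j)) D) : LinFun A D where
  F := reindex e A ⋙ F.F
  δ i _ _ _ h := F.δ (e.symm i) (h.reindex' e)
  natural i x y z x' y' z' h h' f g k H := by
    obtain ⟨j, rfl⟩ := e.surjective i
    rw [F.δ_reindex_eq e h, F.δ_reindex_eq e h']
    exact F.natural j _ _ _ _ _ ⟨H.at_eq, fun _ hj => H.left _ (e.injective.ne hj),
      fun _ hj => H.right _ (e.injective.ne hj)⟩
  unit_obj x i h := by
    obtain ⟨j, rfl⟩ := e.surjective i
    exact F.unit_obj _ j h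
  unit_map f i h hx hy := by
    obtain ⟨j, rfl⟩ := e.surjective i
    exact F.unit_map _ j h hx hy
  unit_δ i x y z h H := by
    obtain ⟨j, rfl⟩ := e.surjective i
    rw [F.δ_reindex_eq e h]
    refine F.unit_δ j _ (H.imp id (Or.imp id ?_))
    rintro ⟨i', hi, H⟩
    obtain ⟨j', rfl⟩ := e.surjective i'
    exact ⟨j', fun h => hi (by rw [h]), H⟩
  δ_assoc i x y z xy yz l r h₁ h₂ h₃ h₄ m hm := by
    obtain ⟨j, rfl⟩ := e.surjective i
    rw [F.δ_reindex_eq e h₁, F.δ_reindex_eq e h₂, F.δ_reindex_eq e h₃, F.δ_reindex_eq e h₄]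
    exact F.δ_assoc j _ _ _ _ _ (hm.reindex e)
  δ_symm i x y z w h₁ h₂ m hm := by
    obtain ⟨j, rfl⟩ := e.surjective i
    rw [F.δ_reindex_eq e h₁, F.δ_reindex_eq e h₂]
    exact F.δ_symm j _ _ _ (hm.reindex e)
  δ_comm i i' hi tv uv tw uw sv sw ts us s h₁ h₂ h₃ h₄ h₅ h₆ := by
    obtain ⟨j, rfl⟩ := e.surjective i
    obtain ⟨j', rfl⟩ := e.surjective i'
    rw [F.δ_reindex_eq e h₁, F.δ_reindex_eq e h₂, F.δ_reindex_eq e h₃, F.δ_reindex_eq e h₄,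
      F.δ_reindex_eq e h₅, F.δ_reindex_eq e h₆]
    exact F.δ_comm j j' (fun h => hi (by rw [h])) _ _ _ _ _ _

/-- Permutation of the variables, as a functor. -/
def LinFun.actFunctor : LinFun (fun j => A (e j)) D ⥤ LinFun A D where
  obj F := LinFun.act e F
  map {F G} φ :=
    { app := Functor.whiskerLeft (reindex e A) φ.app
      comm := fun i _ _ _ h => φ.comm (e.symm i) (h.reindex' e)
      unit := fun x i h => by
        obtain ⟨j, rfl⟩ := e.surjective i
        exact φ.unit _ j h }

end Act

/-- The identity functor as a `1`-linear functor. -/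
def LinFun.one (A : SMCat.{u}) : LinFun (fun _ : Fin 1 => A) A where
  F := Pi.eval _ 0
  δ i _ _ _ h := eqToIso (by obtain rfl := Subsingleton.elim i 0; exact h.at_eq.symm)
  natural i x y z x' y' z' h h' f g k H := by
    obtain rfl := Subsingleton.elim i 0
    apply eq_of_heq
    exact (comp_eqToHom_heq (f 0 ⊗ₘ g 0) h'.at_eq.symm).trans
      (H.at_eq.symm.trans (eqToHom_comp_heq (k 0) h.at_eq.symm).symm)
  unit_obj x i h := by
    obtain rfl := Subsingleton.elim i 0
    exact h
  unit_map f i h _ _ := by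
    obtain rfl := Subsingleton.elim i 0
    exact h
  unit_δ i x y z h _ := by
    obtain rfl := Subsingleton.elim i 0
    exact ⟨h.at_eq.symm, rfl⟩
  δ_assoc i x y z xy yz l r h₁ h₂ h₃ h₄ m hm := by
    obtain rfl := Subsingleton.elim i 0
    have e₁ : x 0 ⊗ y 0 = xy 0 := h₁.at_eq.symm
    have e₂ : xy 0 ⊗ z 0 = l 0 := h₂.at_eq.symm
    have e₃ : y 0 ⊗ z 0 = yz 0 := h₃.at_eq.symm
    have e₄ : x 0 ⊗ yz 0 = r 0 := h₄.at_eq.symm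
    have hm := hm.at_eq
    change (eqToHom e₁ ▷ z 0) ≫ eqToHom e₂ ≫ m 0 = (α_ (x 0) (y 0) (z 0)).hom ≫
      (x 0 ◁ eqToHom e₃) ≫ eqToHom e₄
    generalize m 0 = m₀ at hm ⊢
    generalize l 0 = l₀ at *
    generalize r 0 = r₀ at *
    generalize xy 0 = p at *
    generalize yz 0 = q at *
    subst e₁ e₃ e₂ e₄
    cases hm
    simp
  δ_symm i x y z w h₁ h₂ m hm := by
    obtain rfl := Subsingleton.elim i 0
    apply eq_of_heq
    exact (eqToHom_comp_heq (m 0) h₁.at_eq.symm).trans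
      (hm.at_eq.trans (comp_eqToHom_heq (β_ (x 0) (y 0)).hom h₂.at_eq.symm).symm)
  δ_comm i j h := absurd (Subsingleton.elim i j) h

/-- The multicategory of strictly unital symmetric monoidal categories and multilinear functors. -/
noncomputable def SMC : CatMultiData.{u + 1, u, u} where
  Obj := SMCat.{u}
  Hom a b := LinFun a b
  one := LinFun.one
  comp _ _ _ := LinFun.compFunctor (e := finSigmaFinEquiv)
  act e _ _ := LinFun.actFunctor e

end LinearLemmas


/-! ### Based categories -/

/-- Small based categories. -/
structure BasedCat : Type (u + 1) where
  carrier : Type u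
  [cat : SmallCategory carrier]
  pt : carrier

instance : CoeSort BasedCat.{u} (Type u) := ⟨BasedCat.carrier⟩
attribute [instance] BasedCat.cat

/-- Based functors. -/
@[ext]
structure BasedFunctor (A B : BasedCat.{u}) where
  functor : A ⥤ B
  map_pt : functor.obj A.pt = B.pt

instance : Category BasedCat.{u} where
  Hom A B := BasedFunctor A B
  id A := ⟨𝟭 A, rfl⟩
  comp F G := ⟨F.functor ⋙ G.functor, by simp [F.map_pt, G.map_pt]⟩

@[simp] theorem BasedCat.id_functor (A : BasedCat.{u}) : BasedFunctor.functor (𝟙 A) = 𝟭 A := rfl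

@[simp] theorem BasedCat.comp_functor {A B C : BasedCat.{u}} (F : A ⟶ B) (G : B ⟶ C) :
    BasedFunctor.functor (F ≫ G) = F.functor ⋙ G.functor := rfl

/-! ### The category of tuples of objects of `Δᵒᵖ` -/

/-- A tuple `([m₁], …, [m_r])`. -/
structure EObj where
  r : ℕ
  m : Fin r → SimplexCategory

/-- A morphism `([m₁], …, [m_r]) ⟶ ([m₁'], …, [m_s'])` is an injection `q` together with a morphism
`q_*([m₁], …, [m_r]) ⟶ ([m₁'], …, [m_s'])` of `(Δᵒᵖ)ˢ`, where `q_*([m₁], …, [m_r])` has `[mᵢ]` at the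
place `k = q i` and `[1]` at the places which are not in the image of `q`. It is given by morphisms
`[m_k'] ⟶ [mᵢ]` of `Δ` for `k = q i` and `[m_k'] ⟶ [1]` for `k` not in the image. -/
structure EHom (a b : EObj) where
  q : Fin a.r ↪ Fin b.r
  β : ∀ i k, q i = k → (b.m k ⟶ a.m i)
  γ : ∀ k, (∀ i, q i ≠ k) → (b.m k ⟶ SimplexCategory.mk 1)

theorem EHom.ext' {a b : EObj} {f g : EHom a b} (hq : ∀ i, f.q i = g.q i)
    (hβ : ∀ i k h h', f.β i k h = g.β i k h') (hγ : ∀ k h h', f.γ k h = g.γ k h') : f = g := by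
  obtain ⟨q, β, γ⟩ := f
  obtain ⟨q', β', γ'⟩ := g
  obtain rfl : q = q' := by ext i; exact congrArg _ (hq i)
  congr
  · ext i k h : 3
    exact hβ i k h h
  · ext k h : 2
    exact hγ k h h

open Classical in
/-- Composition in the Grothendieck construction. -/
noncomputable def EHom.comp {a b c : EObj} (f : EHom a b) (g : EHom b c) : EHom a c where
  q := f.q.trans g.q
  β i k h := g.β (f.q i) k h ≫ f.β i (f.q i) rfl
  γ k h :=
    if h' : ∃ j, g.q j = k then
      g.β h'.choose k h'.choose_spec ≫
        f.γ h'.choose fun i hi => h i ((congrArg g.q hi).trans h'.choose_spec)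
    else g.γ k fun j hj => h' ⟨j, hj⟩

theorem EHom.comp_β {a b c : EObj} (f : EHom a b) (g : EHom b c) (i j k) (hj : f.q i = j)
    (hk : g.q j = k) (h : (f.comp g).q i = k) :
    (f.comp g).β i k h = g.β j k hk ≫ f.β i j hj := by
  subst hj; rfl

theorem EHom.comp_γ {a b c : EObj} (f : EHom a b) (g : EHom b c) (j k) (hk : g.q j = k)
    (hj : ∀ i, f.q i ≠ j) (h : ∀ i, (f.comp g).q i ≠ k) :
    (f.comp g).γ k h = g.β j k hk ≫ f.γ j hj := by
  have h' : ∃ j, g.q j = k := ⟨j, hk⟩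
  have hc : h'.choose = j := g.q.injective (h'.choose_spec.trans hk.symm)
  have key : ∀ j' (hj' : j' = j) (h₁ : g.q j' = k) (h₂ : ∀ i, f.q i ≠ j'),
      g.β j' k h₁ ≫ f.γ j' h₂ = g.β j k hk ≫ f.γ j hj := by
    rintro _ rfl _ _; rfl
  simp only [EHom.comp, h', dif_pos]
  exact key _ hc _ _

theorem EHom.comp_γ' {a b c : EObj} (f : EHom a b) (g : EHom b c) (k) (hk : ∀ j, g.q j ≠ k)
    (h : ∀ i, (f.comp g).q i ≠ k) : (f.comp g).γ k h = g.γ k hk := by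
  have h' : ¬ ∃ j, g.q j = k := fun ⟨j, hj⟩ => hk j hj
  simp only [EHom.comp, h', dif_neg, not_false_eq_true]

/-- The isomorphism of tuples given by a bijection of the index sets. -/
def EHom.perm {a b : EObj} (e : Fin a.r ≃ Fin b.r) (h : ∀ i, b.m (e i) = a.m i) : EHom a b where
  q := e.toEmbedding
  β i k hk := eqToHom (by rw [← hk]; exact h i)
  γ k hk := absurd (e.apply_symm_apply k) (hk _)

theorem EHom.id_comp {a b : EObj} (f : EHom a b) :
    EHom.comp (EHom.perm (Equiv.refl _) fun _ => rfl) f = f := by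
  refine EHom.ext' (fun i => rfl) (fun i k h h' => ?_) (fun k h h' => ?_)
  · exact Category.comp_id _
  · exact EHom.comp_γ' _ _ _ h' h

theorem EHom.comp_id {a b : EObj} (f : EHom a b) :
    EHom.comp f (EHom.perm (Equiv.refl _) fun _ => rfl) = f := by
  refine EHom.ext' (fun i => rfl) (fun i k h h' => ?_) (fun k h h' => ?_)
  · rw [EHom.comp_β f _ i k k h' rfl]
    exact Category.id_comp _
  · rw [EHom.comp_γ f _ k k rfl h']
    exact Category.id_comp _

theorem EHom.assoc {a b c d : EObj} (f : EHom a b) (g : EHom b c) (h : EHom c d) :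
    (f.comp g).comp h = f.comp (g.comp h) := by
  refine EHom.ext' (fun i => rfl) (fun i k _ _ => ?_) (fun k h₁ h₂ => ?_)
  · exact (Category.assoc _ _ _).symm
  · by_cases hk : ∃ j, h.q j = k
    · obtain ⟨j, hj⟩ := hk
      have hj' : ∀ i, (f.comp g).q i ≠ j := fun i hi => h₁ i ((congrArg h.q hi).trans hj)
      rw [EHom.comp_γ _ h j k hj hj']
      by_cases hl : ∃ l, g.q l = j
      · obtain ⟨l, hl⟩ := hl
        have hl' : ∀ i, f.q i ≠ l := fun i hi => hj' i ((congrArg g.q hi).trans hl)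
        have hk : (g.comp h).q l = k := (congrArg h.q hl).trans hj
        rw [EHom.comp_γ f g l j hl hl', EHom.comp_γ f (g.comp h) l k hk hl',
          EHom.comp_β g h l j k hl hj, Category.assoc]
      · have hl' : ∀ l, g.q l ≠ j := fun l h => hl ⟨l, h⟩
        have hk' : ∀ l, (g.comp h).q l ≠ k := fun l h' => hl' l (h.q.injective (h'.trans hj.symm))
        rw [EHom.comp_γ' f g j hl', EHom.comp_γ' f (g.comp h) k hk', EHom.comp_γ g h j k hj hl']
    · have hk' : ∀ l, h.q l ≠ k := fun l h => hk ⟨l, h⟩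
      have hk'' : ∀ l, (g.comp h).q l ≠ k := fun l => hk' _
      rw [EHom.comp_γ' _ h k hk', EHom.comp_γ' f (g.comp h) k hk'', EHom.comp_γ' g h k hk']

noncomputable instance : Category EObj where
  Hom := EHom
  id _ := EHom.perm (Equiv.refl _) fun _ => rfl
  comp := EHom.comp
  id_comp := EHom.id_comp
  comp_id := EHom.comp_id
  assoc := EHom.assoc

/-- The isomorphism of tuples given by a bijection of the index sets. -/
def EObj.perm {a b : EObj} (e : Fin a.r ≃ Fin b.r) (h : ∀ i, b.m (e i) = a.m i) : a ⟶ b :=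
  EHom.perm e h

section Odot

variable {k : ℕ}

/-- The entry of a concatenation of tuples at a place. -/
abbrev entry (m : Fin k → EObj) (p : Σ i, Fin (m i).r) : SimplexCategory := (m p.1).m p.2

/-- The concatenation of tuples. -/
def odot (m : Fin k → EObj) : EObj where
  r := ∑ i, (m i).r
  m s := entry m (finSigmaFinEquiv.symm s)

/-- The place of an entry of a concatenation. -/
def splitPlace (m : Fin k → EObj) : Fin (odot m).r ≃ Σ i, Fin (m i).r := finSigmaFinEquiv.symm

/-- The concatenation of morphisms. -/
def odotMap {m m' : Fin k → EObj} (f : ∀ i, m i ⟶ m' i) : odot m ⟶ odot m' where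
  q := ((splitPlace m).toEmbedding.trans
    ((Function.Embedding.refl (Fin k)).sigmaMap fun i => (f i).q)).trans
      (splitPlace m').symm.toEmbedding
  β s t h := eqToHom (congrArg (entry m') ((Equiv.symm_apply_eq _).1 h).symm) ≫
    (f (splitPlace m s).1).β (splitPlace m s).2 _ rfl
  γ t h := (f (splitPlace m' t).1).γ (splitPlace m' t).2 fun j hj =>
    h ((splitPlace m).symm ⟨_, j⟩) (by
      change (splitPlace m').symm (Sigma.map id (fun i => (f i).q)
        (splitPlace m ((splitPlace m).symm ⟨_, j⟩))) = t
      rw [Equiv.apply_symm_apply, Equiv.symm_apply_eq, Sigma.map, hj]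
      rfl)

end Odot

section EStar

theorem pi_isId {ι : Type*} {A : ι → Type*} [∀ i, Category (A i)] {x y : ∀ i, A i} {f : x ⟶ y}
    (H : ∀ i, IsId (f i)) : IsId f := by
  obtain rfl : x = y := funext fun j => (H j).1
  exact ⟨rfl, funext fun j => by obtain ⟨_, h⟩ := H j; simpa using h⟩

theorem heq_of_pi {ι : Type*} {A : ι → Type*} [∀ i, Category (A i)] {x y x' y' : ∀ i, A i}
    {f : x ⟶ y} {g : x' ⟶ y'} (hx : x = x') (hy : y = y') (H : ∀ i, HEq (f i) (g i)) :
    HEq f g := by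
  subst hx; subst hy; exact heq_of_eq (funext fun j => eq_of_heq (H j))

theorem heq_comp {A : Type*} [Category A] {X Y Z X' Y' Z' : A} {f : X ⟶ Y} {g : Y ⟶ Z}
    {f' : X' ⟶ Y'} {g' : Y' ⟶ Z'} (hx : X = X') (hy : Y = Y') (hz : Z = Z') (H : HEq f f')
    (H' : HEq g g') : HEq (f ≫ g) (f' ≫ g') := by
  subst hx; subst hy; subst hz; cases H; cases H'; rfl

theorem functor_map_heq {A B : Type*} [Category A] [Category B] {F G : A ⥤ B} (h : F = G)
    {x y : A} (f : x ⟶ y) : HEq (F.map f) (G.map f) := by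
  subst h; rfl

theorem app_heq {A B : Type*} [Category A] [Category B] {F G : A ⥤ B} (φ : F ⟶ G) {x y : A}
    (h : x = y) : HEq (φ.app x) (φ.app y) := by
  subst h; rfl

variable {k : ℕ}

theorem eobj_perm_β {a b : EObj} (e : Fin a.r ≃ Fin b.r) (h : ∀ i, b.m (e i) = a.m i)
    {c : EObj} (f : c ⟶ a) (i j l) (hj : f.q i = j) (hl : e j = l) (hk) :
    HEq (EHom.β (f ≫ EObj.perm e h) i l hk) (EHom.β f i j hj) := by
  subst hl
  refine (heq_of_eq (EHom.comp_β f (EHom.perm e h) i j (e j) hj rfl hk)).trans ?_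
  exact eqToHom_comp_heq _ (h j)

theorem eobj_perm_γ {a b : EObj} (e : Fin a.r ≃ Fin b.r) (h : ∀ i, b.m (e i) = a.m i)
    {c : EObj} (f : c ⟶ a) (j l) (hj : ∀ i, f.q i ≠ j) (hl : e j = l) (hk) :
    HEq (EHom.γ (f ≫ EObj.perm e h) l hk) (EHom.γ f j hj) := by
  subst hl
  refine (heq_of_eq (EHom.comp_γ f (EHom.perm e h) j (e j) rfl hj hk)).trans ?_
  exact eqToHom_comp_heq _ (h j)

theorem perm_eobj_β {a b : EObj} (e : Fin a.r ≃ Fin b.r) (h : ∀ i, b.m (e i) = a.m i)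
    {c : EObj} (f : b ⟶ c) (i j l) (hj : e i = j) (hl : f.q j = l) (hk) :
    HEq (EHom.β (EObj.perm e h ≫ f) i l hk) (EHom.β f j l hl) := by
  subst hj
  refine (heq_of_eq (EHom.comp_β (EHom.perm e h) f i _ l rfl hl hk)).trans ?_
  exact comp_eqToHom_heq _ (h i)

theorem perm_eobj_γ {a b : EObj} (e : Fin a.r ≃ Fin b.r) (h : ∀ i, b.m (e i) = a.m i)
    {c : EObj} (f : b ⟶ c) (l) (hl : ∀ j, f.q j ≠ l) (hk) :
    HEq (EHom.γ (EObj.perm e h ≫ f) l hk) (EHom.γ f l hl) :=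
  heq_of_eq (EHom.comp_γ' (EHom.perm e h) f l hl hk)

/-- The place of an entry of a concatenation. -/
def oplace (m : Fin k → EObj) (i : Fin k) (j : Fin (m i).r) : Fin (odot m).r := place i j

theorem exists_oplace (m : Fin k → EObj) (s : Fin (odot m).r) : ∃ i j, s = oplace m i j :=
  ⟨(splitPlace m s).1, (splitPlace m s).2, ((splitPlace m).symm_apply_apply s).symm⟩

theorem splitPlace_oplace (m : Fin k → EObj) (i : Fin k) (j : Fin (m i).r) :
    splitPlace m (oplace m i j) = ⟨i, j⟩ := (splitPlace m).apply_symm_apply _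

theorem oplace_inj {m : Fin k → EObj} {i i' : Fin k} {j : Fin (m i).r} {j' : Fin (m i').r}
    (h : oplace m i j = oplace m i' j') : (⟨i, j⟩ : Σ i, Fin (m i).r) = ⟨i', j'⟩ :=
  (splitPlace m).symm.injective h

theorem odot_m (m : Fin k → EObj) (i : Fin k) (j : Fin (m i).r) :
    (odot m).m (oplace m i j) = (m i).m j := congrArg (entry m) (splitPlace_oplace m i j)

theorem odotMap_q {m m' : Fin k → EObj} (f : ∀ i, m i ⟶ m' i) (i : Fin k) (j : Fin (m i).r) :
    (odotMap f).q (oplace m i j) = oplace m' i ((f i).q j) := by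
  change (splitPlace m').symm (Sigma.map id (fun i => (f i).q) (splitPlace m (oplace m i j))) = _
  rw [splitPlace_oplace]
  rfl

theorem odotMap_β {m m' : Fin k → EObj} (f : ∀ i, m i ⟶ m' i) (i : Fin k) (j : Fin (m i).r)
    (l : Fin (m' i).r) (hl : (f i).q j = l) (h) :
    HEq ((odotMap f).β (oplace m i j) (oplace m' i l) h) ((f i).β j l hl) := by
  have key : ∀ (p : Σ i, Fin (m i).r) (hp : p = ⟨i, j⟩),
      HEq ((f p.1).β p.2 ((f p.1).q p.2) rfl) ((f i).β j l hl) := by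
    rintro _ rfl; subst hl; rfl
  exact (eqToHom_comp_heq _ _).trans (key _ (splitPlace_oplace m i j))

theorem odotMap_γ {m m' : Fin k → EObj} (f : ∀ i, m i ⟶ m' i) (i : Fin k) 
    (l : Fin (m' i).r) (hl : ∀ j, (f i).q j ≠ l) (h) :
    HEq ((odotMap f).γ (oplace m' i l) h) ((f i).γ l hl) := by
  have key : ∀ (p : Σ i, Fin (m' i).r) (hp : p = ⟨i, l⟩) (hp' : ∀ j, (f p.1).q j ≠ p.2),
      HEq ((f p.1).γ p.2 hp') ((f i).γ l hl) := by
    rintro _ rfl _; rfl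
  exact key _ (splitPlace_oplace m' i l) _

theorem odotMap_range {m m' : Fin k → EObj} (f : ∀ i, m i ⟶ m' i) {i : Fin k}
    {l : Fin (m' i).r} : (∀ s, (odotMap f).q s ≠ oplace m' i l) ↔ ∀ j, (f i).q j ≠ l := by
  constructor
  · intro h j hj
    exact h (oplace m i j) ((odotMap_q f i j).trans (congrArg _ hj))
  · intro h s hs
    obtain ⟨i', j, rfl⟩ := exists_oplace m s
    rw [odotMap_q] at hs
    have := oplace_inj hs
    cases this
    exact h j rfl

theorem blockAssoc_place {n : ℕ} (k : Fin n → ℕ) (l : Fin (∑ i, k i) → ℕ) (i : Fin n)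
    (j : Fin (k i)) (x : Fin (l (place i j))) :
    blockAssoc k l (place i (place (p := fun j => l (place i j)) j x)) =
      place (place i j) x := by
  have h₁ : ∀ (p : Σ i, Fin (∑ j, l (place i j))), p = ⟨i, place j x⟩ →
      ((Equiv.sigmaCongrRight fun _ => finSigmaFinEquiv.symm) p :
        Σ i, Σ j, Fin (l (place i j))) = ⟨i, j, x⟩ := by
    rintro _ rfl
    exact congrArg (Sigma.mk i) (finSigmaFinEquiv.symm_apply_apply _)
  have h₂ := h₁ _ (finSigmaFinEquiv.symm_apply_apply _)
  exact congrArg (fun p : Σ i, Σ j, Fin (l (place i j)) =>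
    (finSigmaFinEquiv ((Equiv.sigmaCongrLeft (β := fun s => Fin (l s)) finSigmaFinEquiv)
      ((Equiv.sigmaAssoc fun i j => Fin (l (place i j))).symm p)))) h₂

/-- The identification of a concatenation of concatenations with the concatenation of the whole
family. -/
def assocE {n : ℕ} {k : Fin n → ℕ} (m : Fin (∑ i, k i) → EObj) :
    odot (fun i => odot fun j => m (place i j)) ⟶ odot m :=
  EObj.perm (blockAssoc k fun s => (m s).r) fun s => by
    obtain ⟨i, t, rfl⟩ := exists_oplace _ s
    obtain ⟨j, x, rfl⟩ := exists_oplace _ t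
    rw [odot_m, odot_m]
    refine Eq.trans (congrArg (odot m).m ?_) (odot_m m (place i j) x)
    exact blockAssoc_place k (fun s => (m s).r) i j x
theorem assocE_natural {n : ℕ} {k : Fin n → ℕ} {m m' : Fin (∑ i, k i) → EObj}
    (f : ∀ s, m s ⟶ m' s) :
    odotMap (fun i => odotMap fun j => f (place i j)) ≫ assocE m' = assocE m ≫ odotMap f := by
  have hl : ∀ (m : Fin (∑ i, k i) → EObj) (i j) (x : Fin (m (place i j)).r),
      blockAssoc k (fun s => (m s).r) (oplace (fun i => odot fun j => m (place i j)) i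
        (oplace (fun j => m (place i j)) j x)) = oplace m (place i j) x := fun m i j x =>
    blockAssoc_place k (fun s => (m s).r) i j x
  have hq : ∀ s, (odotMap (fun i => odotMap fun j => f (place i j)) ≫ assocE m').q s =
      (assocE m ≫ odotMap f).q s := by
    intro s
    obtain ⟨i, t, rfl⟩ := exists_oplace _ s
    obtain ⟨j, x, rfl⟩ := exists_oplace _ t
    have e₁ := odotMap_q (fun i => odotMap fun j => f (place i j)) i
      (oplace (fun j => m (place i j)) j x)
    rw [odotMap_q (fun j => f (place i j))] at e₁
    refine (congrArg (blockAssoc k fun s => (m' s).r) e₁).trans ?_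
    exact (hl m' i j _).trans
      ((odotMap_q f _ _).symm.trans (congrArg (odotMap f).q (hl m i j x)).symm)
  refine EHom.ext' hq (fun s l h h' => eq_of_heq ?_) (fun l h h' => eq_of_heq ?_)
  · obtain ⟨i, t, rfl⟩ := exists_oplace _ s
    obtain ⟨j, x, rfl⟩ := exists_oplace _ t
    have hx : l = oplace m' (place i j) ((f (place i j)).q x) := by
      refine h'.symm.trans ((congrArg (odotMap f).q (hl m i j x)).trans (odotMap_q f _ _))
    subst hx
    refine (eobj_perm_β _ _ _ _ (oplace (fun i => odot fun j => m' (place i j)) i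
        (oplace (fun j => m' (place i j)) j ((f (place i j)).q x))) _ ?_ (hl m' i j _) h).trans ?_
    · rw [odotMap_q, odotMap_q]
    refine HEq.trans (odotMap_β _ i _ _ (odotMap_q _ _ _) _) ?_
    refine HEq.trans (odotMap_β (fun j => f (place i j)) j x _ rfl _) ?_
    refine HEq.trans ?_ (perm_eobj_β _ _ _ _ (oplace m (place i j) x) _ (hl m i j x)
      (odotMap_q f _ _) h').symm
    exact (odotMap_β f (place i j) x _ rfl _).symm
  · obtain ⟨s, y, rfl⟩ := exists_oplace _ l
    obtain ⟨i, j, rfl⟩ : ∃ i j, s = place i j :=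
      ⟨(finSigmaFinEquiv.symm s).1, (finSigmaFinEquiv.symm s).2,
        (finSigmaFinEquiv.apply_symm_apply s).symm⟩
    have hl' : ∀ u, (odotMap f).q u ≠ oplace m' (place i j) y := by
      intro u hu
      refine h' ((blockAssoc k fun s => (m s).r).symm u) (Eq.trans ?_ hu)
      exact congrArg (odotMap f).q ((blockAssoc k fun s => (m s).r).apply_symm_apply u)
    have hy := (odotMap_range f).1 hl'
    have hy' := (odotMap_range (fun j => f (place i j))).2 hy
    have hy'' := (odotMap_range (fun i => odotMap fun j => f (place i j))).2 hy'
    refine (eobj_perm_γ _ _ _ (oplace (fun i => odot fun j => m' (place i j)) i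
        (oplace (fun j => m' (place i j)) j y)) _ hy'' (hl m' i j _) h).trans ?_
    refine HEq.trans (odotMap_γ _ i _ hy' _) ?_
    refine HEq.trans (odotMap_γ _ j _ hy _) ?_
    refine HEq.trans ?_ (perm_eobj_γ _ _ _ _ hl' h').symm
    exact (odotMap_γ f (place i j) y hy _).symm

theorem blockPerm_place {k l : ℕ} (e : Fin k ≃ Fin l) (p : Fin l → ℕ) (i : Fin k)
    (j : Fin (p (e i))) :
    blockPerm e p (place (p := fun i => p (e i)) i j) = place (e i) j :=
  congrArg (fun x => finSigmaFinEquiv ((Equiv.sigmaCongrLeft (β := fun i => Fin (p i)) e) x))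
    (finSigmaFinEquiv.symm_apply_apply (⟨i, j⟩ : Σ i, Fin (p (e i))))

/-- The permutation of the blocks of a concatenation. -/
def permE {k l : ℕ} (e : Fin k ≃ Fin l) (m : Fin l → EObj) : odot (fun i => m (e i)) ⟶ odot m :=
  EObj.perm (blockPerm e fun i => (m i).r) fun s => by
    obtain ⟨i, j, rfl⟩ := exists_oplace _ s
    rw [odot_m]
    exact Eq.trans (congrArg (odot m).m (blockPerm_place e (fun i => (m i).r) i j)) (odot_m m _ j)

theorem permE_natural {k l : ℕ} (e : Fin k ≃ Fin l) {m m' : Fin l → EObj}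
    (f : ∀ i, m i ⟶ m' i) : odotMap (fun i => f (e i)) ≫ permE e m' = permE e m ≫ odotMap f := by
  have hl : ∀ (m : Fin l → EObj) (i) (x : Fin (m (e i)).r),
      blockPerm e (fun s => (m s).r) (oplace (fun i => m (e i)) i x) = oplace m (e i) x :=
    fun m i x => blockPerm_place e (fun s => (m s).r) i x
  have hq : ∀ s, (odotMap (fun i => f (e i)) ≫ permE e m').q s =
      (permE e m ≫ odotMap f).q s := by
    intro s
    obtain ⟨i, x, rfl⟩ := exists_oplace _ s
    change blockPerm e (fun s => (m' s).r) ((odotMap _).q _) =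
      (odotMap f).q (blockPerm e (fun s => (m s).r) _)
    rw [odotMap_q, hl, hl, odotMap_q]
  refine EHom.ext' hq (fun s t h h' => eq_of_heq ?_) (fun t h h' => eq_of_heq ?_)
  · obtain ⟨i, x, rfl⟩ := exists_oplace _ s
    have hx : t = oplace m' (e i) ((f (e i)).q x) :=
      h'.symm.trans ((congrArg (odotMap f).q (hl m i x)).trans (odotMap_q f _ _))
    subst hx
    refine (eobj_perm_β _ _ _ _ (oplace (fun i => m' (e i)) i ((f (e i)).q x)) _ ?_
      (hl m' i _) h).trans ?_
    · rw [odotMap_q]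
    refine HEq.trans (odotMap_β (fun i => f (e i)) i x _ rfl _) ?_
    refine HEq.trans ?_ (perm_eobj_β _ _ _ _ (oplace m (e i) x) _ (hl m i x)
      (odotMap_q f _ _) h').symm
    exact (odotMap_β f (e i) x _ rfl _).symm
  · obtain ⟨s, y, rfl⟩ := exists_oplace _ t
    obtain ⟨i, rfl⟩ := e.surjective s
    have hl' : ∀ u, (odotMap f).q u ≠ oplace m' (e i) y := by
      intro u hu
      refine h' ((blockPerm e fun s => (m s).r).symm u) (Eq.trans ?_ hu)
      exact congrArg (odotMap f).q ((blockPerm e fun s => (m s).r).apply_symm_apply u)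
    have hy := (odotMap_range f).1 hl'
    have hy' := (odotMap_range (fun i => f (e i))).2 hy
    refine (eobj_perm_γ _ _ _ (oplace (fun i => m' (e i)) i y) _ hy' (hl m' i _) h).trans ?_
    refine HEq.trans (odotMap_γ _ i _ hy _) ?_
    refine HEq.trans ?_ (perm_eobj_γ _ _ _ _ hl' h').symm
    exact (odotMap_γ f (e i) y hy _).symm

/-- The places of a concatenation of a family of one tuple. -/
def unitEquiv (m : Fin 1 → EObj) : Fin (m 0).r ≃ Fin (odot m).r :=
  (Equiv.uniqueSigma fun i => Fin (m i).r).symm.trans finSigmaFinEquiv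

/-- The identification of a tuple with the concatenation of a family of one tuple. -/
def unitE (m : Fin 1 → EObj) : m 0 ⟶ odot m :=
  EObj.perm (unitEquiv m) (odot_m m 0)

theorem eobj_comp_q {a b c : EObj} (f : a ⟶ b) (g : b ⟶ c) (i) :
    EHom.q (f ≫ g) i = EHom.q g (EHom.q f i) := rfl

theorem unitE_natural_aux {m m' : Fin 1 → EObj} (f : ∀ i, m i ⟶ m' i)
    (e : Fin (m 0).r ≃ Fin (odot m).r) (e' : Fin (m' 0).r ≃ Fin (odot m').r)
    (h : ∀ i, (odot m).m (e i) = (m 0).m i) (h' : ∀ i, (odot m').m (e' i) = (m' 0).m i)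
    (he : ∀ x, e x = oplace m 0 x) (he' : ∀ x, e' x = oplace m' 0 x) :
    f 0 ≫ EObj.perm e' h' = EObj.perm e h ≫ odotMap f := by
  have hq : ∀ s, (f 0 ≫ EObj.perm e' h').q s = (EObj.perm e h ≫ odotMap f).q s := by
    intro x
    exact (he' _).trans ((odotMap_q f 0 x).symm.trans (congrArg (odotMap f).q (he x).symm))
  refine EHom.ext' hq (fun x t ht ht' => eq_of_heq ?_) (fun t ht ht' => eq_of_heq ?_)
  · have hx : t = oplace m' 0 ((f 0).q x) := ht.symm.trans (he' _)
    subst hx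
    refine (eobj_perm_β e' h' (f 0) x ((f 0).q x) _ rfl (he' _) ht).trans ?_
    refine HEq.trans ?_ (perm_eobj_β e h (odotMap f) x (oplace m 0 x) _
      (he x) (odotMap_q f 0 x) ht').symm
    exact (odotMap_β f 0 x _ rfl _).symm
  · obtain ⟨s, y, rfl⟩ := exists_oplace _ t
    obtain rfl := Subsingleton.elim s 0
    have hl' : ∀ u, (odotMap f).q u ≠ oplace m' 0 y := by
      intro u hu
      obtain ⟨x, rfl⟩ := e.surjective u
      exact ht' x hu
    have hy := (odotMap_range f).1 hl'
    refine (eobj_perm_γ e' h' (f 0) y _ hy (he' _) ht).trans ?_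
    refine HEq.trans ?_ (perm_eobj_γ e h (odotMap f) _ hl' ht').symm
    exact (odotMap_γ f 0 y hy _).symm

theorem unitE_natural {m m' : Fin 1 → EObj} (f : ∀ i, m i ⟶ m' i) :
    f 0 ≫ unitE m' = unitE m ≫ odotMap f :=
  unitE_natural_aux f _ _ _ _ (fun _ => rfl) fun _ => rfl

/-! ### The multicategory of `E_*`-categories -/

/-- An `E_*`-category: a functor to based categories whose value at `([m₁], …, [m_r])` is the
category with one object and one morphism if some `mᵢ` is `0`. -/
structure EStar : Type (u + 1) where
  F : EObj ⥤ BasedCat.{u}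
  obj_eq : ∀ (m : EObj) (i : Fin m.r), m.m i = SimplexCategory.mk 0 →
    ∀ x : F.obj m, x = (F.obj m).pt
  map_eq : ∀ (m : EObj) (i : Fin m.r), m.m i = SimplexCategory.mk 0 →
    ∀ {x y : F.obj m} (f : x ⟶ y), IsId f

/-- The functor underlying `X(f)`. -/
abbrev EStar.fmap (X : EStar.{u}) {m m' : EObj} (f : m ⟶ m') : X.F.obj m ⥤ X.F.obj m' :=
  (X.F.map f).functor

/-- The `k`-ary morphisms `(X₁, …, X_k) ⟶ Y` of `E_*`-categories: natural transformations
`X₁ × ⋯ × X_k ⟶ Y ∘ ⊙` of functors on `k`-tuples of objects which factor through the smash product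
of based categories. -/
@[ext]
structure EMap (X : Fin k → EStar.{u}) (Y : EStar.{u}) where
  app : ∀ m : Fin k → EObj, (∀ i, (X i).F.obj (m i)) ⥤ Y.F.obj (odot m)
  natural : ∀ {m m' : Fin k → EObj} (f : ∀ i, m i ⟶ m' i),
    Functor.pi (fun i => (X i).fmap (f i)) ⋙ app m' = app m ⋙ Y.fmap (odotMap f)
  base_obj : ∀ (m : Fin k → EObj) (x : ∀ i, (X i).F.obj (m i)) (i : Fin k),
    x i = ((X i).F.obj (m i)).pt → (app m).obj x = (Y.F.obj (odot m)).pt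
  base_map : ∀ (m : Fin k → EObj) {x y : ∀ i, (X i).F.obj (m i)} (f : x ⟶ y) (i : Fin k),
    x i = ((X i).F.obj (m i)).pt → IsId (f i) → IsId ((app m).map f)

/-- The `k`-ary cells: modifications compatible with the base points. -/
@[ext]
structure EMap.Hom {X : Fin k → EStar.{u}} {Y : EStar.{u}} (F G : EMap X Y) where
  app : ∀ m : Fin k → EObj, F.app m ⟶ G.app m
  natural : ∀ {m m' : Fin k → EObj} (f : ∀ i, m i ⟶ m' i) (x : ∀ i, (X i).F.obj (m i)),
    HEq ((app m').app ((Functor.pi fun i => (X i).fmap (f i)).obj x))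
      ((Y.fmap (odotMap f)).map ((app m).app x))
  base : ∀ (m : Fin k → EObj) (x : ∀ i, (X i).F.obj (m i)) (i : Fin k),
    x i = ((X i).F.obj (m i)).pt → IsId ((app m).app x)

theorem EMap.natural_obj {X : Fin k → EStar.{u}} {Y : EStar.{u}} (F : EMap X Y)
    {m m' : Fin k → EObj} (f : ∀ i, m i ⟶ m' i) (x : ∀ i, (X i).F.obj (m i)) :
    (F.app m').obj ((Functor.pi fun i => (X i).fmap (f i)).obj x) =
      (Y.fmap (odotMap f)).obj ((F.app m).obj x) :=
  Functor.congr_obj (F.natural f) x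

instance {X : Fin k → EStar.{u}} {Y : EStar.{u}} : Category (EMap X Y) where
  Hom F G := EMap.Hom F G
  id F := ⟨fun m => 𝟙 _, fun f x => by
    rw [NatTrans.id_app, NatTrans.id_app, CategoryTheory.Functor.map_id, F.natural_obj], fun _ _ _ _ => IsId.id _⟩
  comp φ ψ := ⟨fun m => φ.app m ≫ ψ.app m, fun f x => by
    rw [NatTrans.comp_app, NatTrans.comp_app, Functor.map_comp]
    exact heq_comp (EMap.natural_obj _ f x) (EMap.natural_obj _ f x) (EMap.natural_obj _ f x)
      (φ.natural f x) (ψ.natural f x), fun m x i h => (φ.base m x i h).comp (ψ.base m x i h)⟩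
  id_comp φ := EMap.Hom.ext (funext fun m => Category.id_comp _)
  comp_id φ := EMap.Hom.ext (funext fun m => Category.comp_id _)
  assoc φ ψ χ := EMap.Hom.ext (funext fun m => Category.assoc _ _ _)

section EComp

variable {n : ℕ} {p : Fin n → ℕ} {X : Fin (∑ i, p i) → EStar.{u}} {Y : Fin n → EStar.{u}}
  {Z : EStar.{u}}

/-- The product of functors on the blocks of a tuple. -/
def blockProd {A : Fin (∑ i, p i) → Type u} [∀ s, Category.{u} (A s)] {B : Fin n → Type u}
    [∀ i, Category.{u} (B i)] (F : ∀ i, (∀ j, A (place i j)) ⥤ B i) : (∀ s, A s) ⥤ ∀ i, B i where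
  obj x i := (F i).obj fun j => x (place i j)
  map f i := (F i).map fun j => f (place i j)
  map_id _ := funext fun i => (F i).map_id _
  map_comp _ _ := funext fun i => (F i).map_comp _ _

/-- The product of natural transformations on the blocks of a tuple. -/
def blockProdMap {A : Fin (∑ i, p i) → Type u} [∀ s, Category.{u} (A s)] {B : Fin n → Type u}
    [∀ i, Category.{u} (B i)] {F G : ∀ i, (∀ j, A (place i j)) ⥤ B i} (φ : ∀ i, F i ⟶ G i) :
    blockProd F ⟶ blockProd G where
  app x := (fun i => (φ i).app fun j => x (place i j) :
    ∀ i, (blockProd F).obj x i ⟶ (blockProd G).obj x i)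
  naturality _ _ f := funext fun i => (φ i).naturality fun j => f (place i j)

theorem exists_place' (s : Fin (∑ i, p i)) : ∃ i j, s = place i j :=
  ⟨(finSigmaFinEquiv.symm s).1, (finSigmaFinEquiv.symm s).2,
    (finSigmaFinEquiv.apply_symm_apply s).symm⟩

theorem pi_comp_blockProd {A A' : Fin (∑ i, p i) → Type u} [∀ s, Category.{u} (A s)]
    [∀ s, Category.{u} (A' s)] {B B' : Fin n → Type u} [∀ i, Category.{u} (B i)]
    [∀ i, Category.{u} (B' i)] (H : ∀ s, A s ⥤ A' s) (K : ∀ i, B i ⥤ B' i)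
    (F : ∀ i, (∀ j, A (place i j)) ⥤ B i) (F' : ∀ i, (∀ j, A' (place i j)) ⥤ B' i)
    (h : ∀ i, Functor.pi (fun j => H (place i j)) ⋙ F' i = F i ⋙ K i) :
    Functor.pi H ⋙ blockProd F' = blockProd F ⋙ Functor.pi K := by
  refine CategoryTheory.Functor.hext (fun x => funext fun i => Functor.congr_obj (h i) _)
    fun x y f => ?_
  exact heq_of_pi (funext fun i => Functor.congr_obj (h i) _)
    (funext fun i => Functor.congr_obj (h i) _)
    fun i => functor_map_heq (h i) (fun j => f (place i j))

/-- The product of the components of a family of morphisms. -/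
def EMap.inner (F : ∀ i, EMap (fun j => X (place i j)) (Y i)) (m : Fin (∑ i, p i) → EObj) :
    (∀ s, (X s).F.obj (m s)) ⥤ ∀ i, (Y i).F.obj (odot fun j => m (place i j)) :=
  blockProd (A := fun s => (X s).F.obj (m s))
    (B := fun i => (Y i).F.obj (odot fun j => m (place i j)))
    fun i => (F i).app fun j => m (place i j)

/-- The product of the components of a family of cells. -/
def EMap.innerMap {F F' : ∀ i, EMap (fun j => X (place i j)) (Y i)} (ψ : F ⟶ F')
    (m : Fin (∑ i, p i) → EObj) : EMap.inner F m ⟶ EMap.inner F' m :=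
  blockProdMap (A := fun s => (X s).F.obj (m s))
    (B := fun i => (Y i).F.obj (odot fun j => m (place i j)))
    fun i => (ψ i).app fun j => m (place i j)

theorem EMap.inner_natural (F : ∀ i, EMap (fun j => X (place i j)) (Y i))
    {m m' : Fin (∑ i, p i) → EObj} (f : ∀ s, m s ⟶ m' s) :
    Functor.pi (fun s => (X s).fmap (f s)) ⋙ EMap.inner F m' =
      EMap.inner F m ⋙ Functor.pi (fun i => (Y i).fmap (odotMap fun j => f (place i j))) :=
  pi_comp_blockProd _ _ _ _ fun i => (F i).natural fun j => f (place i j)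

/-- The composite of a `k`-ary morphism with a family of morphisms. -/
def EMap.comp (G : EMap Y Z) (F : ∀ i, EMap (fun j => X (place i j)) (Y i)) : EMap X Z where
  app m := EMap.inner F m ⋙
    G.app (fun i => odot fun j => m (place i j)) ⋙ Z.fmap (assocE m)
  natural {m m'} f := by
    have h₁ := EMap.inner_natural F f
    have h₂ := G.natural fun i => odotMap fun j => f (place i j)
    have h₃ : Z.fmap (odotMap fun i => odotMap fun j => f (place i j)) ⋙ Z.fmap (assocE m') =
        Z.fmap (assocE m) ⋙ Z.fmap (odotMap f) := by
      have := congrArg (fun f => (Z.F.map f).functor) (assocE_natural f)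
      simpa only [CategoryTheory.Functor.map_comp, BasedCat.comp_functor] using this
    rw [← CategoryTheory.Functor.assoc, h₁, CategoryTheory.Functor.assoc,
      ← CategoryTheory.Functor.assoc (Functor.pi _), h₂, CategoryTheory.Functor.assoc, h₃]
    rfl
  base_obj m x s h := by
    obtain ⟨i, j, rfl⟩ := exists_place' s
    have h₁ := (F i).base_obj (fun j => m (place i j)) (fun j => x (place i j)) j h
    let y : ∀ i, (Y i).F.obj (odot fun j => m (place i j)) :=
      fun i => ((F i).app fun j => m (place i j)).obj fun j => x (place i j)
    have h₂ := G.base_obj (fun i => odot fun j => m (place i j)) y i h₁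
    exact (congrArg (Z.fmap (assocE m)).obj h₂).trans (Z.F.map (assocE m)).map_pt
  base_map m x y f s h hf := by
    obtain ⟨i, j, rfl⟩ := exists_place' s
    have h₁ := (F i).base_obj (fun j => m (place i j)) (fun j => x (place i j)) j h
    have h₂ := (F i).base_map (fun j => m (place i j)) (fun j => f (place i j)) j h hf
    exact (G.base_map (fun i => odot fun j => m (place i j)) _ i h₁ h₂).map _

/-- The horizontal composite of cells. -/
def EMap.compMap {G G' : EMap Y Z} {F F' : ∀ i, EMap (fun j => X (place i j)) (Y i)}
    (φ : G ⟶ G') (ψ : F ⟶ F') : EMap.comp G F ⟶ EMap.comp G' F' where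
  app m := EMap.innerMap ψ m ◫
    Functor.whiskerRight (φ.app fun i => odot fun j => m (place i j)) (Z.fmap (assocE m))
  natural {m m'} f x := by
    have h₁ := EMap.inner_natural F f
    have h₁' := EMap.inner_natural F' f
    have h₃ : Z.fmap (odotMap fun i => odotMap fun j => f (place i j)) ⋙ Z.fmap (assocE m') =
        Z.fmap (assocE m) ⋙ Z.fmap (odotMap f) := by
      have := congrArg (fun f => (Z.F.map f).functor) (assocE_natural f)
      simpa only [CategoryTheory.Functor.map_comp, BasedCat.comp_functor] using this
    have hm : ∀ {a b : Z.F.obj (odot fun i => odot fun j => m (place i j))}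
        {a' b' : Z.F.obj (odot fun i => odot fun j => m' (place i j))} (g : a ⟶ b) (g' : a' ⟶ b'),
        a' = (Z.fmap (odotMap fun i => odotMap fun j => f (place i j))).obj a →
        b' = (Z.fmap (odotMap fun i => odotMap fun j => f (place i j))).obj b →
        HEq g' ((Z.fmap (odotMap fun i => odotMap fun j => f (place i j))).map g) →
        HEq ((Z.fmap (assocE m')).map g')
          ((Z.fmap (odotMap f)).map ((Z.fmap (assocE m)).map g)) := by
      rintro a b _ _ g g' rfl rfl h
      cases h
      exact functor_map_heq h₃ g
    have e₁ := Functor.congr_obj h₁ x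
    have e₁' := Functor.congr_obj h₁' x
    have hψ : HEq ((EMap.innerMap ψ m').app
          ((Functor.pi fun s => (X s).fmap (f s)).obj x))
        ((Functor.pi fun i => (Y i).fmap (odotMap fun j => f (place i j))).map
          ((EMap.innerMap ψ m).app x)) :=
      heq_of_pi e₁ e₁' fun i => (ψ i).natural (fun j => f (place i j)) fun j => x (place i j)
    have hφ := φ.natural (fun i => odotMap fun j => f (place i j))
      ((EMap.inner F m).obj x)
    have hφ' : HEq ((φ.app fun i => odot fun j => m' (place i j)).app
          ((EMap.inner F m').obj
            ((Functor.pi fun s => (X s).fmap (f s)).obj x)))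
        ((Z.fmap (odotMap fun i => odotMap fun j => f (place i j))).map
          ((φ.app fun i => odot fun j => m (place i j)).app
            ((EMap.inner F m).obj x))) :=
      (app_heq _ e₁).trans hφ
    have g₁ := G.natural_obj (fun i => odotMap fun j => f (place i j))
    have g₁' := G'.natural_obj (fun i => odotMap fun j => f (place i j))
    rw [NatTrans.hcomp_app, NatTrans.hcomp_app, Functor.whiskerRight_app, Functor.whiskerRight_app,
      Functor.comp_map, Functor.comp_map, ← CategoryTheory.Functor.map_comp,
      ← CategoryTheory.Functor.map_comp]
    have c₁ := (congrArg (G.app fun i => odot fun j => m' (place i j)).obj e₁).trans (g₁ _)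
    have c₂ := (congrArg (G'.app fun i => odot fun j => m' (place i j)).obj e₁).trans (g₁' _)
    have c₃ := (congrArg (G'.app fun i => odot fun j => m' (place i j)).obj e₁').trans (g₁' _)
    refine hm _ _ c₁ c₃ ?_
    rw [CategoryTheory.Functor.map_comp]
    refine heq_comp c₁ c₂ c₃ hφ' ?_
    refine HEq.trans (map_heq _ e₁ e₁' hψ) ?_
    exact functor_map_heq (G'.natural fun i => odotMap fun j => f (place i j)) _
  base m x s h := by
    obtain ⟨i, j, rfl⟩ := exists_place' s
    have h₁ := (F i).base_obj (fun j => m (place i j)) (fun j => x (place i j)) j h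
    have h₂ := (ψ i).base (fun j => m (place i j)) (fun j => x (place i j)) j h
    rw [NatTrans.hcomp_app]
    exact ((φ.base _ _ i h₁).map _).comp ((G'.base_map _ _ i h₁ h₂).map _)

/-- Composition of `k`-ary morphisms and cells. -/
def EMap.compFunctor : (EMap Y Z × ∀ i, EMap (fun j => X (place i j)) (Y i)) ⥤ EMap X Z where
  obj q := EMap.comp q.1 q.2
  map f := EMap.compMap f.1 f.2
  map_id q := EMap.Hom.ext (funext fun m => by
    apply NatTrans.ext
    funext x
    exact (congrArg₂ (· ≫ ·) ((Z.fmap (assocE m)).map_id _)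
      ((congrArg (Z.fmap (assocE m)).map ((q.1.app _).map_id _)).trans
        ((Z.fmap (assocE m)).map_id _))).trans (Category.comp_id _))
  map_comp f g := EMap.Hom.ext (funext fun m => by
    change (EMap.innerMap f.2 m ≫ EMap.innerMap g.2 m) ◫
      Functor.whiskerRight ((f.1.app fun i => odot fun j => m (place i j)) ≫
        (g.1.app fun i => odot fun j => m (place i j))) (Z.fmap (assocE m)) = _
    rw [Functor.whiskerRight_comp]
    exact NatTrans.exchange _ _ _ _)

end EComp

section EAct

variable {k l : ℕ} (e : Fin k ≃ Fin l) {X : Fin l → EStar.{u}} {Y : EStar.{u}}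

/-- The functor that permutes the variables. -/
def permVars {A : Fin l → Type u} [∀ i, Category.{u} (A i)] :
    (∀ i, A i) ⥤ ∀ i, A (e i) where
  obj x i := x (e i)
  map f i := f (e i)

/-- Permutation of the variables of a `k`-ary morphism. -/
def EMap.act (F : EMap (fun i => X (e i)) Y) : EMap X Y where
  app m := permVars e ⋙ F.app (fun i => m (e i)) ⋙ Y.fmap (permE e m)
  natural {m m'} f := by
    have h₁ : Functor.pi (fun i => (X i).fmap (f i)) ⋙ permVars e =
        permVars e ⋙ Functor.pi (fun i => (X (e i)).fmap (f (e i))) := rfl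
    have h₂ := F.natural fun i => f (e i)
    have h₃ : Y.fmap (odotMap fun i => f (e i)) ⋙ Y.fmap (permE e m') =
        Y.fmap (permE e m) ⋙ Y.fmap (odotMap f) := by
      have := congrArg (fun f => (Y.F.map f).functor) (permE_natural e f)
      simpa only [CategoryTheory.Functor.map_comp, BasedCat.comp_functor] using this
    rw [← CategoryTheory.Functor.assoc, h₁, CategoryTheory.Functor.assoc,
      ← CategoryTheory.Functor.assoc (Functor.pi _), h₂, CategoryTheory.Functor.assoc, h₃]
    rfl
  base_obj m x s h := by
    obtain ⟨i, rfl⟩ := e.surjective s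
    exact (congrArg (Y.fmap (permE e m)).obj (F.base_obj _ _ i h)).trans
      (Y.F.map (permE e m)).map_pt
  base_map m x y f s h hf := by
    obtain ⟨i, rfl⟩ := e.surjective s
    exact (F.base_map (fun i => m (e i)) (fun i => f (e i)) i h hf).map _

/-- Permutation of the variables, as a functor. -/
def EMap.actFunctor : EMap (fun i => X (e i)) Y ⥤ EMap X Y where
  obj F := EMap.act e F
  map {F G} φ :=
    { app := fun m => Functor.whiskerLeft (permVars e)
        (Functor.whiskerRight (φ.app fun i => m (e i)) (Y.fmap (permE e m)))
      natural := fun {m m'} f x => by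
        have h₃ : Y.fmap (odotMap fun i => f (e i)) ⋙ Y.fmap (permE e m') =
            Y.fmap (permE e m) ⋙ Y.fmap (odotMap f) := by
          have := congrArg (fun f => (Y.F.map f).functor) (permE_natural e f)
          simpa only [CategoryTheory.Functor.map_comp, BasedCat.comp_functor] using this
        refine HEq.trans (map_heq _ (F.natural_obj (fun i => f (e i)) _)
          (G.natural_obj (fun i => f (e i)) _) (φ.natural (fun i => f (e i)) _)) ?_
        exact functor_map_heq h₃ _
      base := fun m x s h => by
        obtain ⟨i, rfl⟩ := e.surjective s
        exact (φ.base _ _ i h).map _ }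
  map_id F := EMap.Hom.ext (funext fun m => by
    apply NatTrans.ext
    funext x
    exact (Y.fmap (permE e m)).map_id _)
  map_comp f g := EMap.Hom.ext (funext fun m => by
    apply NatTrans.ext
    funext x
    exact (Y.fmap (permE e m)).map_comp _ _)

end EAct

/-- The identity `1`-ary morphism. -/
def EMap.one (X : EStar.{u}) : EMap (fun _ : Fin 1 => X) X where
  app m := Pi.eval _ 0 ⋙ X.fmap (unitE m)
  natural {m m'} f := by
    have h₃ : X.fmap (f 0) ⋙ X.fmap (unitE m') = X.fmap (unitE m) ⋙ X.fmap (odotMap f) := by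
      have := congrArg (fun f => (X.F.map f).functor) (unitE_natural f)
      simpa only [CategoryTheory.Functor.map_comp, BasedCat.comp_functor] using this
    change Pi.eval (fun i => X.F.obj (m i)) 0 ⋙ (X.fmap (f 0) ⋙ X.fmap (unitE m')) =
      Pi.eval (fun i => X.F.obj (m i)) 0 ⋙ (X.fmap (unitE m) ⋙ X.fmap (odotMap f))
    rw [h₃]
  base_obj m x i h := by
    obtain rfl := Subsingleton.elim i 0
    exact (congrArg (X.fmap (unitE m)).obj h).trans (X.F.map (unitE m)).map_pt
  base_map m x y f i h hf := by
    obtain rfl := Subsingleton.elim i 0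
    exact hf.map _

/-- The multicategory of `E_*`-categories. -/
def EStarCat : CatMultiData.{u + 1, u, u} where
  Obj := EStar.{u}
  Hom a b := EMap a b
  one := EMap.one
  comp _ _ _ := EMap.compFunctor
  act e _ _ := EMap.actFunctor e

end EStar

section Spectra

/-! ### Combinatorics of the reindexings -/

theorem blockSum_place {k : ℕ} {p p' : Fin k → ℕ} (e : ∀ i, Fin (p i) ≃ Fin (p' i)) (i : Fin k)
    (j : Fin (p i)) : blockSum e (place i j) = place i (e i j) :=
  congrArg (fun x => finSigmaFinEquiv (Equiv.sigmaCongrRight e x))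
    (finSigmaFinEquiv.symm_apply_apply (⟨i, j⟩ : Σ i, Fin (p i)))

theorem shuffle_left {k : ℕ} (p m : Fin k → ℕ) (i : Fin k) (j : Fin (p i)) :
    shuffle p m (Fin.castAdd _ (place i j)) = place i (Fin.castAdd (m i) j) := by
  have h : finSigmaFinEquiv.symm (place i j) = (⟨i, j⟩ : Σ i, Fin (p i)) :=
    finSigmaFinEquiv.symm_apply_apply _
  simp only [shuffle, Equiv.trans_apply, finSumFinEquiv_symm_apply_castAdd, Equiv.sumCongr_apply,
    Sum.map_inl, h]
  rfl

theorem shuffle_right {k : ℕ} (p m : Fin k → ℕ) (i : Fin k) (j : Fin (m i)) :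
    shuffle p m (Fin.natAdd _ (place i j)) = place i (Fin.natAdd (p i) j) := by
  have h : finSigmaFinEquiv.symm (place i j) = (⟨i, j⟩ : Σ i, Fin (m i)) :=
    finSigmaFinEquiv.symm_apply_apply _
  simp only [shuffle, Equiv.trans_apply, finSumFinEquiv_symm_apply_natAdd, Equiv.sumCongr_apply,
    Sum.map_inr, h]
  rfl

theorem sumPerm_left {n n' m m' : ℕ} (e : Fin n ≃ Fin n') (f : Fin m ≃ Fin m') (i : Fin n) :
    sumPerm e f (Fin.castAdd _ i) = Fin.castAdd _ (e i) := by
  simp [sumPerm]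

theorem sumPerm_right {n n' m m' : ℕ} (e : Fin n ≃ Fin n') (f : Fin m ≃ Fin m') (i : Fin m) :
    sumPerm e f (Fin.natAdd _ i) = Fin.natAdd _ (f i) := by
  simp [sumPerm]

/-- The concatenation of tuples. -/
def flat {k : ℕ} {m : Fin k → ℕ} {J : Type*} (j : ∀ i, Fin (m i) → J) (s : Fin (∑ i, m i)) : J :=
  j (finSigmaFinEquiv.symm s).1 (finSigmaFinEquiv.symm s).2

theorem flat_place {k : ℕ} {m : Fin k → ℕ} {J : Type*} (j : ∀ i, Fin (m i) → J) (i : Fin k)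
    (t : Fin (m i)) : flat j (place i t) = j i t :=
  congrArg (fun x : Σ i, Fin (m i) => j x.1 x.2) (finSigmaFinEquiv.symm_apply_apply _)

/-- The places of a concatenation of a family of one tuple. -/
def unitPlaces (p : Fin 1 → ℕ) : Fin (p 0) ≃ Fin (∑ i, p i) :=
  (Equiv.uniqueSigma fun i => Fin (p i)).symm.trans finSigmaFinEquiv

theorem unitPlaces_apply (p : Fin 1 → ℕ) (j : Fin (p 0)) : unitPlaces p j = place 0 j := rfl

theorem equiv_ext_place {k m : ℕ} {p : Fin k → ℕ} {e f : Fin (∑ i, p i) ≃ Fin m}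
    (h : ∀ i j, e (place i j) = f (place i j)) : e = f := by
  ext s
  obtain ⟨i, j, rfl⟩ := exists_place' s
  rw [h]

theorem equiv_ext_sum {n m l : ℕ} {e f : Fin (n + m) ≃ Fin l}
    (h : ∀ i, e (Fin.castAdd m i) = f (Fin.castAdd m i))
    (h' : ∀ i, e (Fin.natAdd n i) = f (Fin.natAdd n i)) : e = f := by
  ext s
  induction s using Fin.addCases with
  | left i => rw [h]
  | right i => rw [h']

/-! ### The simplicial circle -/

open Classical in
/-- The simplicial circle `S¹ = Δ[1]/∂Δ[1]` with `S¹_q = {0, …, q}`, based at `0`: the map `θ^*`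
sends `i` to `j` if `θ (j - 1) < i ≤ θ j`, and to `0` if there is no such `j`. -/
noncomputable def circle {q' q : SimplexCategory} (θ : q' ⟶ q) (i : Fin (q.len + 1)) :
    Fin (q'.len + 1) :=
  if h : ∃ j : Fin q'.len, θ.toOrderHom j.castSucc < i ∧ i ≤ θ.toOrderHom j.succ then
    h.choose.succ
  else 0

theorem circle_eq_succ {q' q : SimplexCategory} (θ : q' ⟶ q) (i : Fin (q.len + 1))
    (j : Fin q'.len) :
    circle θ i = j.succ ↔ θ.toOrderHom j.castSucc < i ∧ i ≤ θ.toOrderHom j.succ := by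
  have huniq : ∀ j j' : Fin q'.len, θ.toOrderHom j.castSucc < i → i ≤ θ.toOrderHom j'.succ →
      j ≤ j' := by
    intro j j' h h'
    by_contra hlt
    have : j'.succ ≤ j.castSucc := by
      rw [Fin.le_iff_val_le_val]
      simp only [Fin.val_succ, Fin.val_castSucc]
      omega
    exact absurd (h'.trans (θ.toOrderHom.monotone this)) (not_le.2 h)
  unfold circle
  split_ifs with h
  · constructor
    · intro hj
      rw [← Fin.succ_injective _ hj]
      exact h.choose_spec
    · intro hj
      congr 1
      exact le_antisymm (huniq _ _ h.choose_spec.1 hj.2) (huniq _ _ hj.1 h.choose_spec.2)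
  · constructor
    · intro hj
      exact absurd hj.symm (Fin.succ_ne_zero j)
    · intro hj
      exact absurd ⟨j, hj⟩ h

theorem circle_zero {q' q : SimplexCategory} (θ : q' ⟶ q) : circle θ 0 = 0 := by
  unfold circle
  rw [dif_neg]
  rintro ⟨j, h, _⟩
  exact absurd h (Fin.not_lt_zero _)

theorem fin_eq_of_succ {n : ℕ} {a b : Fin (n + 1)} (h : ∀ j : Fin n, a = j.succ ↔ b = j.succ) :
    a = b := by
  induction a using Fin.cases with
  | zero =>
    induction b using Fin.cases with
    | zero => rfl
    | succ j => exact (h j).2 rfl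
  | succ j => exact ((h j).1 rfl).symm

theorem circle_id (q : SimplexCategory) (i : Fin (q.len + 1)) : circle (𝟙 q) i = i := by
  refine fin_eq_of_succ fun j => ?_
  rw [circle_eq_succ]
  simp only [SimplexCategory.id_toOrderHom, OrderHom.id_coe, id_eq]
  constructor
  · rintro ⟨h, h'⟩
    exact le_antisymm h' (Fin.castSucc_lt_iff_succ_le.1 h)
  · rintro rfl
    exact ⟨Fin.castSucc_lt_succ, le_rfl⟩

theorem circle_comp {p q r : SimplexCategory} (θ : p ⟶ q) (θ' : q ⟶ r) (i : Fin (r.len + 1)) :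
    circle (θ ≫ θ') i = circle θ (circle θ' i) := by
  refine fin_eq_of_succ fun j => ?_
  rw [circle_eq_succ, circle_eq_succ]
  simp only [SimplexCategory.comp_toOrderHom, OrderHom.comp_coe, Function.comp_apply]
  constructor
  · rintro ⟨h₁, h₂⟩
    obtain ⟨b, hb, hmin⟩ := wellFounded_lt.has_min {x | i ≤ θ'.toOrderHom x} ⟨_, h₂⟩
    have hb' : b ≤ θ.toOrderHom j.succ := not_lt.1 fun h => hmin _ h₂ h
    have ha : θ.toOrderHom j.castSucc < b := by
      by_contra h
      exact absurd (hb.trans (θ'.toOrderHom.monotone (not_lt.1 h))) (not_le.2 h₁)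
    induction b using Fin.cases with
    | zero => exact absurd ha (Fin.not_lt_zero _)
    | succ l =>
      have hc : circle θ' i = l.succ :=
        (circle_eq_succ _ _ _).2 ⟨not_le.1 fun h => hmin _ h Fin.castSucc_lt_succ, hb⟩
      rw [hc]
      exact ⟨ha, hb'⟩
  · rintro ⟨h₁, h₂⟩
    generalize hc : circle θ' i = c at h₁ h₂
    induction c using Fin.cases with
    | zero => exact absurd h₁ (Fin.not_lt_zero _)
    | succ l =>
      rw [circle_eq_succ] at hc
      refine ⟨lt_of_le_of_lt (θ'.toOrderHom.monotone ?_) hc.1,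
        hc.2.trans (θ'.toOrderHom.monotone h₂)⟩
      exact Fin.le_castSucc_iff.2 h₁

/-! ### Symmetric spectra in simplicial based categories -/

/-- The iterated structure maps `L n ∧ J ∧ ⋯ ∧ J ⟶ L (n + m)`, given on the summand of
`(j₁, …, j_m)`. -/
def iterMap {J : Type} (L : ℕ → BasedCat.{u}) (s : ∀ n, J → (L n ⟶ L (n + 1))) (n : ℕ) :
    ∀ m : ℕ, (Fin m → J) → (L n ⟶ L (n + m))
  | 0, _ => 𝟙 (L n)
  | m + 1, j => iterMap L s n m (fun i => j i.castSucc) ≫ s (n + m) (j (Fin.last m))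

/-- A symmetric spectrum in simplicial based categories: based simplicial categories `level n` with
actions of the symmetric groups (indexed by bijections `Fin n ≃ Fin n'`, so that `n = n'`) and
structure maps `level n ∧ S¹ ⟶ level (n + 1)`, given in simplicial degree `q` by a based functor
`σ n q j` for every `j ∈ S¹_q`, which is constant for the base point `j = 0`, such that the iterated
structure maps `level n ∧ S¹ ∧ ⋯ ∧ S¹ ⟶ level (n + m)` are equivariant. -/
structure SymSpec : Type (u + 1) where
  level : ℕ → SimplexCategoryᵒᵖ ⥤ BasedCat.{u}
  act : ∀ {n n' : ℕ}, (Fin n ≃ Fin n') → (level n ⟶ level n')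
  act_refl : ∀ n : ℕ, act (Equiv.refl (Fin n)) = 𝟙 (level n)
  act_trans : ∀ {n n' n'' : ℕ} (e : Fin n ≃ Fin n') (e' : Fin n' ≃ Fin n''),
    act (e.trans e') = act e ≫ act e'
  σ : ∀ (n : ℕ) (q : SimplexCategory), Fin (q.len + 1) →
    ((level n).obj (op q) ⟶ (level (n + 1)).obj (op q))
  σ_obj_zero : ∀ (n : ℕ) (q : SimplexCategory) (x : (level n).obj (op q)),
    (σ n q 0).functor.obj x = ((level (n + 1)).obj (op q)).pt
  σ_map_zero : ∀ (n : ℕ) (q : SimplexCategory) {x y : (level n).obj (op q)} (f : x ⟶ y),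
    IsId ((σ n q 0).functor.map f)
  σ_natural : ∀ (n : ℕ) {q' q : SimplexCategory} (θ : q' ⟶ q) (j : Fin (q.len + 1)),
    (level n).map θ.op ≫ σ n q' (circle θ j) = σ n q j ≫ (level (n + 1)).map θ.op
  equivariant : ∀ {n n' m m' : ℕ} (e : Fin n ≃ Fin n') (f : Fin m ≃ Fin m') (q : SimplexCategory)
    (j : Fin m' → Fin (q.len + 1)),
    (act e).app (op q) ≫ iterMap (fun n => (level n).obj (op q)) (fun n => σ n q) n' m' j =
      iterMap (fun n => (level n).obj (op q)) (fun n => σ n q) n m (fun i => j (f i)) ≫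
        (act (sumPerm e f)).app (op q)

namespace SymSpec

variable (X : SymSpec.{u})

/-- The simplicial degree `q` of the level `n`. -/
abbrev lev (n : ℕ) (q : SimplexCategory) : BasedCat.{u} := (X.level n).obj (op q)

/-- The simplicial structure. -/
abbrev res (n : ℕ) {q' q : SimplexCategory} (θ : q' ⟶ q) : X.lev n q ⥤ X.lev n q' :=
  ((X.level n).map θ.op).functor

/-- The action of the symmetric groups. -/
abbrev perm {n n' : ℕ} (e : Fin n ≃ Fin n') (q : SimplexCategory) : X.lev n q ⥤ X.lev n' q :=
  ((X.act e).app (op q)).functor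

/-- The iterated structure maps. -/
abbrev iter (n m : ℕ) (q : SimplexCategory) (j : Fin m → Fin (q.len + 1)) :
    X.lev n q ⥤ X.lev (n + m) q :=
  (iterMap (fun n => X.lev n q) (fun n => X.σ n q) n m j).functor

theorem perm_trans {n n' n'' : ℕ} (e : Fin n ≃ Fin n') (e' : Fin n' ≃ Fin n'')
    (q : SimplexCategory) : X.perm e q ⋙ X.perm e' q = X.perm (e.trans e') q := by
  unfold perm
  rw [X.act_trans]
  rfl

theorem perm_res {n n' : ℕ} (e : Fin n ≃ Fin n') {q' q : SimplexCategory} (θ : q' ⟶ q) :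
    X.res n θ ⋙ X.perm e q' = X.perm e q ⋙ X.res n' θ :=
  congrArg BasedFunctor.functor ((X.act e).naturality θ.op)

theorem perm_iter {n n' m m' : ℕ} (e : Fin n ≃ Fin n') (f : Fin m ≃ Fin m') (q : SimplexCategory)
    (j : Fin m' → Fin (q.len + 1)) :
    X.perm e q ⋙ X.iter n' m' q j = X.iter n m q (fun i => j (f i)) ⋙ X.perm (sumPerm e f) q :=
  congrArg BasedFunctor.functor (X.equivariant e f q j)

end SymSpec

/-- `α'` restricts to `α` along the functors `H` and `K`. -/
def CellNat {A A' B B' : Type u} [Category.{u} A] [Category.{u} A'] [Category.{u} B]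
    [Category.{u} B'] (H : A ⥤ A') (K : B ⥤ B') {F G : A ⥤ B} {F' G' : A' ⥤ B'} (α : F ⟶ G)
    (α' : F' ⟶ G') : Prop :=
  ∀ x : A, HEq (α'.app (H.obj x)) (K.map (α.app x))

/-- The `k`-linear maps `(X₁, …, X_k) ⟶ Z` of symmetric spectra: maps
`X₁(p₁) ∧ ⋯ ∧ X_k(p_k) ⟶ Z(p₁ + ⋯ + p_k)` of simplicial based categories that are equivariant and
compatible with the (iterated) structure maps in all the variables, up to the shuffle of the places.
The maps of based categories out of a smash product are given as functors on the product. -/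
@[ext]
structure SMap {k : ℕ} (X : Fin k → SymSpec.{u}) (Z : SymSpec.{u}) where
  app : ∀ (p : Fin k → ℕ) (q : SimplexCategory), (∀ i, (X i).lev (p i) q) ⥤ Z.lev (∑ i, p i) q
  natural : ∀ (p : Fin k → ℕ) {q' q : SimplexCategory} (θ : q' ⟶ q),
    Functor.pi (fun i => (X i).res (p i) θ) ⋙ app p q' = app p q ⋙ Z.res _ θ
  equivariant : ∀ {p p' : Fin k → ℕ} (e : ∀ i, Fin (p i) ≃ Fin (p' i)) (q : SimplexCategory),
    Functor.pi (fun i => (X i).perm (e i) q) ⋙ app p' q = app p q ⋙ Z.perm (blockSum e) q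
  linear : ∀ (p m : Fin k → ℕ) (q : SimplexCategory) (j : ∀ i, Fin (m i) → Fin (q.len + 1)),
    Functor.pi (fun i => (X i).iter (p i) (m i) q (j i)) ⋙ app (fun i => p i + m i) q =
      app p q ⋙ (Z.iter (∑ i, p i) (∑ i, m i) q (flat j) ⋙ Z.perm (shuffle p m) q)
  base_obj : ∀ (p : Fin k → ℕ) (q : SimplexCategory) (x : ∀ i, (X i).lev (p i) q) (i : Fin k),
    x i = ((X i).lev (p i) q).pt → (app p q).obj x = (Z.lev _ q).pt
  base_map : ∀ (p : Fin k → ℕ) (q : SimplexCategory) {x y : ∀ i, (X i).lev (p i) q} (f : x ⟶ y)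
    (i : Fin k), x i = ((X i).lev (p i) q).pt → IsId (f i) → IsId ((app p q).map f)

/-- The `k`-linear cells: based natural transformations compatible with the simplicial structure, the
actions and the structure maps. -/
@[ext]
structure SMap.Hom {k : ℕ} {X : Fin k → SymSpec.{u}} {Z : SymSpec.{u}} (F G : SMap X Z) where
  app : ∀ (p : Fin k → ℕ) (q : SimplexCategory), F.app p q ⟶ G.app p q
  natural : ∀ (p : Fin k → ℕ) {q' q : SimplexCategory} (θ : q' ⟶ q),
    CellNat (Functor.pi fun i => (X i).res (p i) θ) (Z.res _ θ) (app p q) (app p q')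
  equivariant : ∀ {p p' : Fin k → ℕ} (e : ∀ i, Fin (p i) ≃ Fin (p' i)) (q : SimplexCategory),
    CellNat (Functor.pi fun i => (X i).perm (e i) q) (Z.perm (blockSum e) q) (app p q) (app p' q)
  linear : ∀ (p m : Fin k → ℕ) (q : SimplexCategory) (j : ∀ i, Fin (m i) → Fin (q.len + 1)),
    CellNat (Functor.pi fun i => (X i).iter (p i) (m i) q (j i))
      (Z.iter (∑ i, p i) (∑ i, m i) q (flat j) ⋙ Z.perm (shuffle p m) q)
      (app p q) (app (fun i => p i + m i) q)
  base : ∀ (p : Fin k → ℕ) (q : SimplexCategory) (x : ∀ i, (X i).lev (p i) q) (i : Fin k),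
    x i = ((X i).lev (p i) q).pt → IsId ((app p q).app x)

section CellNat

variable {A A' B B' : Type u} [Category.{u} A] [Category.{u} A'] [Category.{u} B]
  [Category.{u} B']

theorem CellNat.id {H : A ⥤ A'} {K : B ⥤ B'} {F : A ⥤ B} {F' : A' ⥤ B'} (h : H ⋙ F' = F ⋙ K) :
    CellNat H K (𝟙 F) (𝟙 F') := fun x => by
  have hx : F'.obj (H.obj x) = K.obj (F.obj x) := Functor.congr_obj h x
  rw [NatTrans.id_app, NatTrans.id_app, CategoryTheory.Functor.map_id, hx]

theorem CellNat.vcomp {H : A ⥤ A'} {K : B ⥤ B'} {F₁ F₂ F₃ : A ⥤ B} {F₁' F₂' F₃' : A' ⥤ B'}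
    (h₁ : H ⋙ F₁' = F₁ ⋙ K) (h₂ : H ⋙ F₂' = F₂ ⋙ K) (h₃ : H ⋙ F₃' = F₃ ⋙ K) {α : F₁ ⟶ F₂}
    {α' : F₁' ⟶ F₂'} {β : F₂ ⟶ F₃} {β' : F₂' ⟶ F₃'} (hα : CellNat H K α α')
    (hβ : CellNat H K β β') : CellNat H K (α ≫ β) (α' ≫ β') := fun x => by
  rw [NatTrans.comp_app, NatTrans.comp_app, CategoryTheory.Functor.map_comp]
  exact heq_comp (Functor.congr_obj h₁ x) (Functor.congr_obj h₂ x) (Functor.congr_obj h₃ x)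
    (hα x) (hβ x)

theorem CellNat.hcomp {D D' E E' : Type u} [Category.{u} D] [Category.{u} D'] [Category.{u} E]
    [Category.{u} E'] {H : A ⥤ A'} {K : B ⥤ B'} {L : D ⥤ D'} {M : E ⥤ E'} {F G : A ⥤ B}
    {F' G' : A' ⥤ B'} {P Q : B ⥤ D} {P' Q' : B' ⥤ D'} {W : D ⥤ E} {W' : D' ⥤ E'}
    (hF : H ⋙ F' = F ⋙ K) (hG : H ⋙ G' = G ⋙ K) (hP : K ⋙ P' = P ⋙ L) (hQ : K ⋙ Q' = Q ⋙ L)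
    (hW : L ⋙ W' = W ⋙ M) {α : F ⟶ G} {α' : F' ⟶ G'} {β : P ⟶ Q} {β' : P' ⟶ Q'}
    (hα : CellNat H K α α') (hβ : CellNat K L β β') :
    CellNat H M (α ◫ Functor.whiskerRight β W) (α' ◫ Functor.whiskerRight β' W') := fun x => by
  have e₁ : F'.obj (H.obj x) = K.obj (F.obj x) := Functor.congr_obj hF x
  have e₂ : G'.obj (H.obj x) = K.obj (G.obj x) := Functor.congr_obj hG x
  have c₁ : P'.obj (F'.obj (H.obj x)) = L.obj (P.obj (F.obj x)) :=
    (congrArg P'.obj e₁).trans (Functor.congr_obj hP _)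
  have c₂ : Q'.obj (F'.obj (H.obj x)) = L.obj (Q.obj (F.obj x)) :=
    (congrArg Q'.obj e₁).trans (Functor.congr_obj hQ _)
  have c₃ : Q'.obj (G'.obj (H.obj x)) = L.obj (Q.obj (G.obj x)) :=
    (congrArg Q'.obj e₂).trans (Functor.congr_obj hQ _)
  rw [NatTrans.hcomp_app, NatTrans.hcomp_app, Functor.whiskerRight_app, Functor.whiskerRight_app,
    Functor.comp_map, Functor.comp_map, ← CategoryTheory.Functor.map_comp,
    ← CategoryTheory.Functor.map_comp]
  have hm : ∀ {a b : D} {a' b' : D'} (g : a ⟶ b) (g' : a' ⟶ b'), a' = L.obj a → b' = L.obj b →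
      HEq g' (L.map g) → HEq (W'.map g') (M.map (W.map g)) := by
    rintro a b _ _ g g' rfl rfl h
    cases h
    exact functor_map_heq hW g
  refine hm _ _ c₁ c₃ ?_
  rw [CategoryTheory.Functor.map_comp]
  refine heq_comp c₁ c₂ c₃ ((app_heq _ e₁).trans (hβ _)) ?_
  exact (map_heq _ e₁ e₂ (hα x)).trans (functor_map_heq hQ _)

end CellNat

instance {k : ℕ} {X : Fin k → SymSpec.{u}} {Z : SymSpec.{u}} : Category (SMap X Z) where
  Hom F G := SMap.Hom F G
  id F :=
    { app := fun p q => 𝟙 _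
      natural := fun p _ _ θ => CellNat.id (F.natural p θ)
      equivariant := fun e q => CellNat.id (F.equivariant e q)
      linear := fun p m q j => CellNat.id (F.linear p m q j)
      base := fun _ _ _ _ _ => IsId.id _ }
  comp {F G K} φ ψ :=
    { app := fun p q => φ.app p q ≫ ψ.app p q
      natural := fun p _ _ θ => CellNat.vcomp (F.natural p θ) (G.natural p θ) (K.natural p θ)
        (φ.natural p θ) (ψ.natural p θ)
      equivariant := fun e q => CellNat.vcomp (F.equivariant e q) (G.equivariant e q)
        (K.equivariant e q) (φ.equivariant e q) (ψ.equivariant e q)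
      linear := fun p m q j => CellNat.vcomp (F.linear p m q j) (G.linear p m q j)
        (K.linear p m q j) (φ.linear p m q j) (ψ.linear p m q j)
      base := fun p q x i h => (φ.base p q x i h).comp (ψ.base p q x i h) }
  id_comp φ := SMap.Hom.ext (funext fun p => funext fun q => Category.id_comp _)
  comp_id φ := SMap.Hom.ext (funext fun p => funext fun q => Category.comp_id _)
  assoc φ ψ χ := SMap.Hom.ext (funext fun p => funext fun q => Category.assoc _ _ _)

section SComp

variable {n : ℕ} {k : Fin n → ℕ} {X : Fin (∑ i, k i) → SymSpec.{u}} {Y : Fin n → SymSpec.{u}}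
  {Z : SymSpec.{u}}

/-- The product of the components of a family of multilinear maps. -/
def SMap.inner (F : ∀ i, SMap (fun j => X (place i j)) (Y i)) (p : Fin (∑ i, k i) → ℕ)
    (q : SimplexCategory) :
    (∀ s, (X s).lev (p s) q) ⥤ ∀ i, (Y i).lev (∑ j, p (place i j)) q :=
  blockProd (A := fun s => (X s).lev (p s) q) (B := fun i => (Y i).lev (∑ j, p (place i j)) q)
    fun i => (F i).app (fun j => p (place i j)) q

/-- The product of the components of a family of cells. -/
def SMap.innerMap {F F' : ∀ i, SMap (fun j => X (place i j)) (Y i)} (ψ : F ⟶ F')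
    (p : Fin (∑ i, k i) → ℕ) (q : SimplexCategory) : SMap.inner F p q ⟶ SMap.inner F' p q :=
  blockProdMap (A := fun s => (X s).lev (p s) q) (B := fun i => (Y i).lev (∑ j, p (place i j)) q)
    fun i => (ψ i).app (fun j => p (place i j)) q

theorem pi_comp_pi {ι : Type} {A B C : ι → Type u} [∀ i, Category.{u} (A i)]
    [∀ i, Category.{u} (B i)] [∀ i, Category.{u} (C i)] (F : ∀ i, A i ⥤ B i)
    (G : ∀ i, B i ⥤ C i) : Functor.pi F ⋙ Functor.pi G = Functor.pi fun i => F i ⋙ G i := rfl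

/-- Compatibility of a multilinear map with the structure maps and the actions. -/
theorem SMap.linear' {k : ℕ} {Y : Fin k → SymSpec.{u}} (G : SMap Y Z) (p m r : Fin k → ℕ)
    (q : SimplexCategory) (j : ∀ i, Fin (m i) → Fin (q.len + 1))
    (e : ∀ i, Fin (p i + m i) ≃ Fin (r i)) :
    Functor.pi (fun i => (Y i).iter (p i) (m i) q (j i) ⋙ (Y i).perm (e i) q) ⋙ G.app r q =
      G.app p q ⋙ (Z.iter (∑ i, p i) (∑ i, m i) q (flat j) ⋙
        Z.perm ((shuffle p m).trans (blockSum e)) q) := by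
  rw [← pi_comp_pi, CategoryTheory.Functor.assoc, G.equivariant, ← CategoryTheory.Functor.assoc,
    G.linear, ← SymSpec.perm_trans]
  rfl

theorem SMap.Hom.linear' {k : ℕ} {Y : Fin k → SymSpec.{u}} {G G' : SMap Y Z} (φ : G ⟶ G')
    (p m r : Fin k → ℕ) (q : SimplexCategory) (j : ∀ i, Fin (m i) → Fin (q.len + 1))
    (e : ∀ i, Fin (p i + m i) ≃ Fin (r i)) :
    CellNat (Functor.pi (fun i => (Y i).iter (p i) (m i) q (j i) ⋙ (Y i).perm (e i) q))
      (Z.iter (∑ i, p i) (∑ i, m i) q (flat j) ⋙ Z.perm ((shuffle p m).trans (blockSum e)) q)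
      (φ.app p q) (φ.app r q) := by
  intro x
  have h₁ := φ.linear p m q j x
  have h₂ := φ.equivariant e q ((Functor.pi fun i => (Y i).iter (p i) (m i) q (j i)).obj x)
  rw [← SymSpec.perm_trans]
  exact h₂.trans (map_heq (Z.perm (blockSum e) q) (Functor.congr_obj (G.linear p m q j) x)
    (Functor.congr_obj (G'.linear p m q j) x) h₁)

theorem flat_blockAssoc {m : Fin (∑ i, k i) → ℕ} {J : Type} (j : ∀ s, Fin (m s) → J) :
    (fun s => flat j (blockAssoc k m s)) =
      flat fun i => flat (m := fun t => m (place i t)) fun t => j (place i t) := by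
  funext s
  obtain ⟨i, t, rfl⟩ := exists_place' s
  obtain ⟨t, x, rfl⟩ := exists_place' t
  rw [blockAssoc_place, flat_place, flat_place, flat_place]

theorem blockAssoc_natural {p p' : Fin (∑ i, k i) → ℕ} (e : ∀ s, Fin (p s) ≃ Fin (p' s)) :
    (blockSum fun i => blockSum fun j => e (place i j)).trans (blockAssoc k p') =
      (blockAssoc k p).trans (blockSum e) := by
  refine equiv_ext_place fun i s => ?_
  obtain ⟨j, x, rfl⟩ := exists_place' s
  rw [Equiv.trans_apply, Equiv.trans_apply, blockSum_place, blockSum_place, blockAssoc_place,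
    blockAssoc_place, blockSum_place]

theorem blockAssoc_shuffle (p m : Fin (∑ i, k i) → ℕ) :
    ((shuffle (fun i => ∑ j, p (place i j)) (fun i => ∑ j, m (place i j))).trans
        (blockSum fun i => shuffle (fun j => p (place i j)) (fun j => m (place i j)))).trans
      (blockAssoc k fun s => p s + m s) =
    (sumPerm (blockAssoc k p) (blockAssoc k m)).trans (shuffle p m) := by
  refine equiv_ext_sum (fun s => ?_) fun s => ?_ <;>
  obtain ⟨i, s, rfl⟩ := exists_place' s <;>
  obtain ⟨j, x, rfl⟩ := exists_place' s
  · rw [Equiv.trans_apply, Equiv.trans_apply, Equiv.trans_apply, shuffle_left, blockSum_place,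
      shuffle_left, blockAssoc_place, sumPerm_left, blockAssoc_place, shuffle_left]
  · rw [Equiv.trans_apply, Equiv.trans_apply, Equiv.trans_apply, shuffle_right, blockSum_place,
      shuffle_right, blockAssoc_place, sumPerm_right, blockAssoc_place, shuffle_right]

/-- The compatibility of the reassociation with the structure maps. -/
theorem assoc_linear (p m : Fin (∑ i, k i) → ℕ) (q : SimplexCategory)
    (j : ∀ s, Fin (m s) → Fin (q.len + 1)) :
    (Z.iter _ _ q (flat fun i => flat (m := fun t => m (place i t)) fun t => j (place i t)) ⋙
        Z.perm ((shuffle (fun i => ∑ j, p (place i j)) (fun i => ∑ j, m (place i j))).trans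
          (blockSum fun i => shuffle (fun j => p (place i j)) (fun j => m (place i j)))) q) ⋙
      Z.perm (blockAssoc k fun s => p s + m s) q =
    Z.perm (blockAssoc k p) q ⋙ (Z.iter _ _ q (flat j) ⋙ Z.perm (shuffle p m) q) := by
  rw [CategoryTheory.Functor.assoc, SymSpec.perm_trans, blockAssoc_shuffle,
    ← CategoryTheory.Functor.assoc, SymSpec.perm_iter _ (blockAssoc k p) (blockAssoc k m),
    flat_blockAssoc, CategoryTheory.Functor.assoc, SymSpec.perm_trans]

theorem comp_square {A A' B B' D D' E E' : Type u} [Category.{u} A] [Category.{u} A']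
    [Category.{u} B] [Category.{u} B'] [Category.{u} D] [Category.{u} D'] [Category.{u} E]
    [Category.{u} E'] {H : A ⥤ A'} {K : B ⥤ B'} {L : D ⥤ D'} {M : E ⥤ E'} {F : A ⥤ B}
    {F' : A' ⥤ B'} {P : B ⥤ D} {P' : B' ⥤ D'} {W : D ⥤ E} {W' : D' ⥤ E'}
    (hF : H ⋙ F' = F ⋙ K) (hP : K ⋙ P' = P ⋙ L) (hW : L ⋙ W' = W ⋙ M) :
    H ⋙ (F' ⋙ P' ⋙ W') = (F ⋙ P ⋙ W) ⋙ M := by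
  rw [← CategoryTheory.Functor.assoc, hF, CategoryTheory.Functor.assoc,
    ← CategoryTheory.Functor.assoc K, hP, CategoryTheory.Functor.assoc, hW]
  rfl

theorem SMap.inner_natural (F : ∀ i, SMap (fun j => X (place i j)) (Y i))
    (p : Fin (∑ i, k i) → ℕ) {q' q : SimplexCategory} (θ : q' ⟶ q) :
    Functor.pi (fun s => (X s).res (p s) θ) ⋙ SMap.inner F p q' =
      SMap.inner F p q ⋙ Functor.pi (fun i => (Y i).res (∑ j, p (place i j)) θ) :=
  pi_comp_blockProd _ _ _ _ fun i => (F i).natural _ θ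

theorem SMap.inner_equivariant (F : ∀ i, SMap (fun j => X (place i j)) (Y i))
    {p p' : Fin (∑ i, k i) → ℕ} (e : ∀ s, Fin (p s) ≃ Fin (p' s)) (q : SimplexCategory) :
    Functor.pi (fun s => (X s).perm (e s) q) ⋙ SMap.inner F p' q =
      SMap.inner F p q ⋙ Functor.pi (fun i => (Y i).perm (blockSum fun j => e (place i j)) q) :=
  pi_comp_blockProd _ _ _ _ fun i => (F i).equivariant (fun j => e (place i j)) q

theorem SMap.inner_linear (F : ∀ i, SMap (fun j => X (place i j)) (Y i))
    (p m : Fin (∑ i, k i) → ℕ) (q : SimplexCategory) (j : ∀ s, Fin (m s) → Fin (q.len + 1)) :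
    Functor.pi (fun s => (X s).iter (p s) (m s) q (j s)) ⋙ SMap.inner F (fun s => p s + m s) q =
      SMap.inner F p q ⋙ Functor.pi (fun i => (Y i).iter (∑ j, p (place i j)) (∑ j, m (place i j)) q
        (flat (m := fun t => m (place i t)) fun t => j (place i t)) ⋙
        (Y i).perm (shuffle (fun j => p (place i j)) (fun j => m (place i j))) q) :=
  pi_comp_blockProd _ _ _ _ fun i =>
    (F i).linear (fun j => p (place i j)) (fun j => m (place i j)) q fun t => j (place i t)

theorem SymSpec.perm_equiv {n₁ n₂ n₃ n₄ : ℕ} (e₁ : Fin n₁ ≃ Fin n₂) (e₂ : Fin n₂ ≃ Fin n₄)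
    (e₃ : Fin n₁ ≃ Fin n₃) (e₄ : Fin n₃ ≃ Fin n₄) (h : e₁.trans e₂ = e₃.trans e₄)
    (q : SimplexCategory) : Z.perm e₁ q ⋙ Z.perm e₂ q = Z.perm e₃ q ⋙ Z.perm e₄ q := by
  rw [Z.perm_trans, Z.perm_trans, h]

/-- The composite of a multilinear map with a family of multilinear maps. -/
def SMap.comp (G : SMap Y Z) (F : ∀ i, SMap (fun j => X (place i j)) (Y i)) : SMap X Z where
  app p q := SMap.inner F p q ⋙ G.app (fun i => ∑ j, p (place i j)) q ⋙ Z.perm (blockAssoc k p) q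
  natural p _ _ θ := comp_square (SMap.inner_natural F p θ) (G.natural _ θ)
    (Z.perm_res (blockAssoc k p) θ).symm.symm
  equivariant {p p'} e q := comp_square (SMap.inner_equivariant F e q) (G.equivariant _ q)
    (SymSpec.perm_equiv _ _ _ _ (blockAssoc_natural e) q)
  linear p m q j := comp_square (SMap.inner_linear F p m q j) (G.linear' _ _ _ q _ _)
    (assoc_linear p m q j)
  base_obj p q x s h := by
    obtain ⟨i, j, rfl⟩ := exists_place' s
    have h₁ := (F i).base_obj (fun j => p (place i j)) q (fun j => x (place i j)) j h
    have h₂ := G.base_obj (fun i => ∑ j, p (place i j)) q ((SMap.inner F p q).obj x) i h₁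
    exact (congrArg (Z.perm (blockAssoc k p) q).obj h₂).trans
      ((Z.act (blockAssoc k p)).app (op q)).map_pt
  base_map p q x y f s h hf := by
    obtain ⟨i, j, rfl⟩ := exists_place' s
    have h₁ := (F i).base_obj (fun j => p (place i j)) q (fun j => x (place i j)) j h
    have h₂ := (F i).base_map (fun j => p (place i j)) q (fun j => f (place i j)) j h hf
    exact (G.base_map (fun i => ∑ j, p (place i j)) q ((SMap.inner F p q).map f) i h₁ h₂).map _

/-- The horizontal composite of cells. -/
def SMap.compMap {G G' : SMap Y Z} {F F' : ∀ i, SMap (fun j => X (place i j)) (Y i)}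
    (φ : G ⟶ G') (ψ : F ⟶ F') : SMap.comp G F ⟶ SMap.comp G' F' where
  app p q := SMap.innerMap ψ p q ◫
    Functor.whiskerRight (φ.app (fun i => ∑ j, p (place i j)) q) (Z.perm (blockAssoc k p) q)
  natural p _ _ θ := CellNat.hcomp (SMap.inner_natural F p θ) (SMap.inner_natural F' p θ)
    (G.natural _ θ) (G'.natural _ θ) (Z.perm_res (blockAssoc k p) θ)
    (fun x => heq_of_pi (Functor.congr_obj (SMap.inner_natural F p θ) x)
      (Functor.congr_obj (SMap.inner_natural F' p θ) x)
      fun i => (ψ i).natural (fun j => p (place i j)) θ fun j => x (place i j))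
    (φ.natural _ θ)
  equivariant {p p'} e q := CellNat.hcomp (SMap.inner_equivariant F e q)
    (SMap.inner_equivariant F' e q) (G.equivariant _ q) (G'.equivariant _ q)
    (SymSpec.perm_equiv _ _ _ _ (blockAssoc_natural e) q)
    (fun x => heq_of_pi (Functor.congr_obj (SMap.inner_equivariant F e q) x)
      (Functor.congr_obj (SMap.inner_equivariant F' e q) x)
      fun i => (ψ i).equivariant (fun j => e (place i j)) q fun j => x (place i j))
    (φ.equivariant _ q)
  linear p m q j := CellNat.hcomp (SMap.inner_linear F p m q j) (SMap.inner_linear F' p m q j)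
    (G.linear' _ _ _ q _ _) (G'.linear' _ _ _ q _ _) (assoc_linear p m q j)
    (fun x => heq_of_pi (Functor.congr_obj (SMap.inner_linear F p m q j) x)
      (Functor.congr_obj (SMap.inner_linear F' p m q j) x)
      fun i => (ψ i).linear (fun j => p (place i j)) (fun j => m (place i j)) q
        (fun t => j (place i t)) fun j => x (place i j))
    (SMap.Hom.linear' φ _ _ _ q _ _)
  base p q x s h := by
    obtain ⟨i, j, rfl⟩ := exists_place' s
    have h₁ := (F i).base_obj (fun j => p (place i j)) q (fun j => x (place i j)) j h
    have h₂ := (ψ i).base (fun j => p (place i j)) q (fun j => x (place i j)) j h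
    rw [NatTrans.hcomp_app]
    exact ((φ.base _ q ((SMap.inner F p q).obj x) i h₁).map _).comp
      ((G'.base_map _ q ((SMap.innerMap ψ p q).app x) i h₁ h₂).map _)

/-- Composition of multilinear maps and cells. -/
def SMap.compFunctor : (SMap Y Z × ∀ i, SMap (fun j => X (place i j)) (Y i)) ⥤ SMap X Z where
  obj a := SMap.comp a.1 a.2
  map f := SMap.compMap f.1 f.2
  map_id a := SMap.Hom.ext (funext fun p => funext fun q => by
    apply NatTrans.ext
    funext x
    exact (congrArg₂ (· ≫ ·) ((Z.perm (blockAssoc k p) q).map_id _)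
      ((congrArg (Z.perm (blockAssoc k p) q).map ((a.1.app _ q).map_id _)).trans
        ((Z.perm (blockAssoc k p) q).map_id _))).trans (Category.comp_id _))
  map_comp f g := SMap.Hom.ext (funext fun p => funext fun q => by
    change (SMap.innerMap f.2 p q ≫ SMap.innerMap g.2 p q) ◫
      Functor.whiskerRight ((f.1.app (fun i => ∑ j, p (place i j)) q) ≫
        (g.1.app (fun i => ∑ j, p (place i j)) q)) (Z.perm (blockAssoc k p) q) = _
    rw [Functor.whiskerRight_comp]
    exact NatTrans.exchange _ _ _ _)

end SComp

section SAct

variable {k l : ℕ} (e : Fin k ≃ Fin l) {X : Fin l → SymSpec.{u}} {Z : SymSpec.{u}}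

theorem blockPerm_natural {p p' : Fin l → ℕ} (f : ∀ s, Fin (p s) ≃ Fin (p' s)) :
    (blockSum fun i => f (e i)).trans (blockPerm e p') = (blockPerm e p).trans (blockSum f) := by
  refine equiv_ext_place fun i s => ?_
  rw [Equiv.trans_apply, Equiv.trans_apply, blockSum_place, blockPerm_place, blockPerm_place,
    blockSum_place]

theorem blockPerm_shuffle (p m : Fin l → ℕ) :
    (shuffle (fun i => p (e i)) (fun i => m (e i))).trans (blockPerm e fun s => p s + m s) =
      (sumPerm (blockPerm e p) (blockPerm e m)).trans (shuffle p m) := by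
  refine equiv_ext_sum (fun s => ?_) fun s => ?_ <;>
  obtain ⟨i, s, rfl⟩ := exists_place' s
  · rw [Equiv.trans_apply, Equiv.trans_apply, shuffle_left, sumPerm_left, blockPerm_place,
      blockPerm_place, shuffle_left]
  · rw [Equiv.trans_apply, Equiv.trans_apply, shuffle_right, sumPerm_right, blockPerm_place,
      blockPerm_place, shuffle_right]

theorem perm_linear (p m : Fin l → ℕ) (q : SimplexCategory)
    (j : ∀ s, Fin (m s) → Fin (q.len + 1)) :
    (Z.iter _ _ q (flat fun i => j (e i)) ⋙
        Z.perm (shuffle (fun i => p (e i)) (fun i => m (e i))) q) ⋙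
      Z.perm (blockPerm e fun s => p s + m s) q =
    Z.perm (blockPerm e p) q ⋙ (Z.iter _ _ q (flat j) ⋙ Z.perm (shuffle p m) q) := by
  have h : (fun s => flat j (blockPerm e m s)) = flat fun i => j (e i) := by
    funext s
    obtain ⟨i, t, rfl⟩ := exists_place' s
    rw [blockPerm_place, flat_place, flat_place]
  rw [CategoryTheory.Functor.assoc, SymSpec.perm_trans, blockPerm_shuffle,
    ← CategoryTheory.Functor.assoc, SymSpec.perm_iter _ (blockPerm e p) (blockPerm e m),
    h, CategoryTheory.Functor.assoc, SymSpec.perm_trans]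

/-- Permutation of the variables of a multilinear map. -/
def SMap.act (F : SMap (fun i => X (e i)) Z) : SMap X Z where
  app p q := permVars e ⋙ F.app (fun i => p (e i)) q ⋙ Z.perm (blockPerm e p) q
  natural p _ _ θ := comp_square (K := Functor.pi fun i => (X (e i)).res (p (e i)) θ) rfl
    (F.natural _ θ) (Z.perm_res (blockPerm e p) θ)
  equivariant {p p'} f q := comp_square
    (K := Functor.pi fun i => (X (e i)).perm (f (e i)) q) rfl
    (F.equivariant _ q) (SymSpec.perm_equiv _ _ _ _ (blockPerm_natural e f) q)
  linear p m q j := comp_square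
    (K := Functor.pi fun i => (X (e i)).iter (p (e i)) (m (e i)) q (j (e i))) rfl
    (F.linear _ _ q _) (perm_linear e p m q j)
  base_obj p q x s h := by
    obtain ⟨i, rfl⟩ := e.surjective s
    exact (congrArg (Z.perm (blockPerm e p) q).obj (F.base_obj _ q _ i h)).trans
      ((Z.act (blockPerm e p)).app (op q)).map_pt
  base_map p q x y f s h hf := by
    obtain ⟨i, rfl⟩ := e.surjective s
    exact (F.base_map (fun i => p (e i)) q (fun i => f (e i)) i h hf).map _

theorem CellNat.act {A A' B B' D D' E E' : Type u} [Category.{u} A] [Category.{u} A']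
    [Category.{u} B] [Category.{u} B'] [Category.{u} D] [Category.{u} D'] [Category.{u} E]
    [Category.{u} E'] {H : A ⥤ A'} {K : B ⥤ B'} {L : D ⥤ D'} {M : E ⥤ E'} {F : A ⥤ B}
    {F' : A' ⥤ B'} {P Q : B ⥤ D} {P' Q' : B' ⥤ D'} {W : D ⥤ E} {W' : D' ⥤ E'}
    (hF : H ⋙ F' = F ⋙ K) (hP : K ⋙ P' = P ⋙ L) (hQ : K ⋙ Q' = Q ⋙ L) (hW : L ⋙ W' = W ⋙ M)
    {β : P ⟶ Q} {β' : P' ⟶ Q'} (hβ : CellNat K L β β') :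
    CellNat H M (Functor.whiskerLeft F (Functor.whiskerRight β W))
      (Functor.whiskerLeft F' (Functor.whiskerRight β' W')) := by
  intro x
  have e₁ : F'.obj (H.obj x) = K.obj (F.obj x) := Functor.congr_obj hF x
  have h := (app_heq β' e₁).trans (hβ (F.obj x))
  have c₁ : P'.obj (F'.obj (H.obj x)) = L.obj (P.obj (F.obj x)) :=
    (congrArg P'.obj e₁).trans (Functor.congr_obj hP _)
  have c₂ : Q'.obj (F'.obj (H.obj x)) = L.obj (Q.obj (F.obj x)) :=
    (congrArg Q'.obj e₁).trans (Functor.congr_obj hQ _)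
  exact (map_heq W' c₁ c₂ h).trans (functor_map_heq hW (β.app (F.obj x)))

/-- Permutation of the variables, as a functor. -/
def SMap.actFunctor : SMap (fun i => X (e i)) Z ⥤ SMap X Z where
  obj F := SMap.act e F
  map {F G} φ :=
    { app := fun p q => Functor.whiskerLeft (permVars e)
        (Functor.whiskerRight (φ.app (fun i => p (e i)) q) (Z.perm (blockPerm e p) q))
      natural := fun p _ _ θ => CellNat.act (F := permVars e) (F' := permVars e)
        (H := Functor.pi fun i => (X i).res (p i) θ)
        (K := Functor.pi fun i => (X (e i)).res (p (e i)) θ) rfl (F.natural _ θ) (G.natural _ θ)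
        (Z.perm_res (blockPerm e p) θ) (φ.natural _ θ)
      equivariant := fun {p p'} f q => CellNat.act (F := permVars e) (F' := permVars e)
        (H := Functor.pi fun i => (X i).perm (f i) q)
        (K := Functor.pi fun i => (X (e i)).perm (f (e i)) q) rfl (F.equivariant _ q)
        (G.equivariant _ q) (SymSpec.perm_equiv _ _ _ _ (blockPerm_natural e f) q)
        (φ.equivariant _ q)
      linear := fun p m q j => CellNat.act (F := permVars e) (F' := permVars e)
        (H := Functor.pi fun i => (X i).iter (p i) (m i) q (j i))
        (K := Functor.pi fun i => (X (e i)).iter (p (e i)) (m (e i)) q (j (e i))) rfl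
        (F.linear _ _ q _) (G.linear _ _ q _) (perm_linear e p m q j) (φ.linear _ _ q _)
      base := fun p q x s h => by
        obtain ⟨i, rfl⟩ := e.surjective s
        exact (φ.base _ q _ i h).map _ }
  map_id F := SMap.Hom.ext (funext fun p => funext fun q => by
    apply NatTrans.ext
    funext x
    exact (Z.perm (blockPerm e p) q).map_id _)
  map_comp f g := SMap.Hom.ext (funext fun p => funext fun q => by
    apply NatTrans.ext
    funext x
    exact (Z.perm (blockPerm e p) q).map_comp _ _)

end SAct

theorem unit_natural {p p' : Fin 1 → ℕ} (e : ∀ i, Fin (p i) ≃ Fin (p' i)) :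
    (e 0).trans (unitPlaces p') = (unitPlaces p).trans (blockSum e) :=
  Equiv.ext fun s => by
    rw [Equiv.trans_apply, Equiv.trans_apply, unitPlaces_apply, unitPlaces_apply, blockSum_place]

theorem SymSpec.perm_pt (X : SymSpec.{u}) {n n' : ℕ} (e : Fin n ≃ Fin n') (q : SimplexCategory)
    (x : X.lev n q) (h : x = (X.lev n q).pt) : (X.perm e q).obj x = (X.lev n' q).pt :=
  h ▸ ((X.act e).app (op q)).map_pt

theorem unit_linear (X : SymSpec.{u}) (p m : Fin 1 → ℕ) (q : SimplexCategory)
    (j : ∀ s, Fin (m s) → Fin (q.len + 1)) :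
    X.iter (p 0) (m 0) q (j 0) ⋙ X.perm (unitPlaces fun s => p s + m s) q =
      X.perm (unitPlaces p) q ⋙ (X.iter _ _ q (flat j) ⋙ X.perm (shuffle p m) q) := by
  have h : (fun s => flat j (unitPlaces m s)) = j 0 := funext fun s => by
    rw [unitPlaces_apply, flat_place]
  have h' : unitPlaces (fun s => p s + m s) =
      (sumPerm (unitPlaces p) (unitPlaces m)).trans (shuffle p m) := by
    refine equiv_ext_sum (fun s => ?_) fun s => ?_
    · rw [Equiv.trans_apply, sumPerm_left, unitPlaces_apply, unitPlaces_apply, shuffle_left]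
    · rw [Equiv.trans_apply, sumPerm_right, unitPlaces_apply, unitPlaces_apply, shuffle_right]
  rw [h', ← SymSpec.perm_trans, ← CategoryTheory.Functor.assoc (X.perm _ q),
    SymSpec.perm_iter _ (unitPlaces p) (unitPlaces m), h]
  rfl

/-- The identity `1`-linear map. -/
def SMap.one (X : SymSpec.{u}) : SMap (fun _ : Fin 1 => X) X where
  app p q := Pi.eval _ 0 ⋙ X.perm (unitPlaces p) q
  natural p q' q θ := by
    change Pi.eval (fun i => X.lev (p i) q) 0 ⋙ (X.res (p 0) θ ⋙ X.perm (unitPlaces p) q') =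
      Pi.eval (fun i => X.lev (p i) q) 0 ⋙ (X.perm (unitPlaces p) q ⋙ X.res _ θ)
    rw [X.perm_res]
  equivariant {p p'} e q := by
    change Pi.eval (fun i => X.lev (p i) q) 0 ⋙ (X.perm (e 0) q ⋙ X.perm (unitPlaces p') q) =
      Pi.eval (fun i => X.lev (p i) q) 0 ⋙ (X.perm (unitPlaces p) q ⋙ X.perm (blockSum e) q)
    rw [X.perm_trans, X.perm_trans, unit_natural]
  linear p m q j := by
    change Pi.eval (fun i => X.lev (p i) q) 0 ⋙ (X.iter (p 0) (m 0) q (j 0) ⋙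
        X.perm (unitPlaces fun s => p s + m s) q) =
      Pi.eval (fun i => X.lev (p i) q) 0 ⋙ (X.perm (unitPlaces p) q ⋙
        (X.iter _ _ q (flat j) ⋙ X.perm (shuffle p m) q))
    rw [unit_linear]
  base_obj p q x i h := by
    obtain rfl := Subsingleton.elim i 0
    exact X.perm_pt (unitPlaces p) q (x 0) h
  base_map p q x y f i h hf := by
    obtain rfl := Subsingleton.elim i 0
    exact hf.map _

/-- The multicategory of symmetric spectra in simplicial based categories. -/
def SpecSCat : CatMultiData.{u + 1, u, u} where
  Obj := SymSpec.{u}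
  Hom a b := SMap a b
  one := SMap.one
  comp _ _ _ := SMap.compFunctor
  act e _ _ := SMap.actFunctor e

end Spectra

section ToSpec

/-! ### From `E_*`-categories to symmetric spectra -/

/-- The diagonal `Δᵒᵖ ⟶ (Δᵒᵖ)ⁿ`, followed by the inclusion into the category of tuples. -/
noncomputable def diagE (n : ℕ) : SimplexCategoryᵒᵖ ⥤ EObj where
  obj q := ⟨n, fun _ => q.unop⟩
  map θ := ⟨Function.Embedding.refl _, fun _ _ _ => θ.unop, fun k h => absurd rfl (h k)⟩
  map_id q := EHom.ext' (fun _ => rfl) (fun _ _ _ _ => rfl) fun k h _ => absurd rfl (h k)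
  map_comp f g := EHom.ext' (fun _ => rfl) (fun _ _ _ _ => rfl) fun k h _ => absurd rfl (h k)

/-- The permutations of the diagonal tuples. -/
noncomputable def diagPerm {n n' : ℕ} (e : Fin n ≃ Fin n') : diagE n ⟶ diagE n' where
  app q := EObj.perm (a := (diagE n).obj q) (b := (diagE n').obj q) e fun _ => rfl
  naturality q q' f := EHom.ext' (fun _ => rfl)
    (fun i k h h' => by
      refine eq_of_heq ((eobj_perm_β _ _ ((diagE n).map f) i i k rfl h _).trans ?_)
      exact (perm_eobj_β (a := (diagE n).obj q) (b := (diagE n').obj q) e (fun _ => rfl)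
        ((diagE n').map f) i _ k rfl h' h').symm)
    fun k h _ => absurd (e.apply_symm_apply k) (h _)

/-- The map `β^j : [q] ⟶ [1]` that sends `0, …, j - 1` to `0` and `j, …, q` to `1`. -/
def threshold {q : SimplexCategory} (j : Fin (q.len + 1)) : q ⟶ SimplexCategory.mk 1 :=
  SimplexCategory.Hom.mk ⟨fun x => if j ≤ x then (1 : Fin 2) else 0, by
    intro x y h
    dsimp only
    split_ifs with h₁ h₂
    · exact le_rfl
    · exact absurd (h₁.trans h) h₂
    · exact Fin.zero_le _
    · exact le_rfl⟩

/-- The morphism `(ι_n, (id, …, id, β^j))`. -/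
noncomputable def suspE (n : ℕ) (q : SimplexCategory) (j : Fin (q.len + 1)) :
    (diagE n).obj (op q) ⟶ (diagE (n + 1)).obj (op q) :=
  EHom.mk (a := (diagE n).obj (op q)) (b := (diagE (n + 1)).obj (op q)) Fin.castSuccEmb
    (fun _ _ _ => 𝟙 q) fun _ _ => threshold j

/-- The iterates of the preceding morphisms. -/
noncomputable def stabE (n m : ℕ) (q : SimplexCategory) (j : Fin m → Fin (q.len + 1)) :
    (diagE n).obj (op q) ⟶ (diagE (n + m)).obj (op q) :=
  EHom.mk (a := (diagE n).obj (op q)) (b := (diagE (n + m)).obj (op q)) (Fin.castAddEmb m)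
    (fun _ _ _ => 𝟙 q) fun k _ => threshold (Fin.addCases (motive := fun _ => Fin (q.len + 1))
      (fun _ => 0) j k)

theorem stabE_zero (n : ℕ) (q : SimplexCategory) (j : Fin 0 → Fin (q.len + 1)) :
    stabE n 0 q j = 𝟙 _ :=
  EHom.ext' (fun _ => rfl) (fun _ _ _ _ => rfl) fun k h _ => absurd rfl (h k)

theorem stabE_succ (n m : ℕ) (q : SimplexCategory) (j : Fin (m + 1) → Fin (q.len + 1)) :
    stabE n (m + 1) q j = stabE n m q (fun i => j i.castSucc) ≫ suspE (n + m) q (j (Fin.last m)) := by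
  refine EHom.ext' (fun i => rfl) (fun i k h h' => ?_) fun k h h' => ?_
  · exact (Category.comp_id (𝟙 q)).symm
  · induction k using Fin.addCases (m := n) (n := m + 1) with
    | left i => exact absurd rfl (h i)
    | right t =>
      induction t using Fin.lastCases with
      | last =>
        have hk : ∀ i : Fin (n + m), Fin.castSucc i ≠ Fin.natAdd n (Fin.last m) := by
          intro i hi
          have := congrArg Fin.val hi
          simp at this
          omega
        refine Eq.trans ?_ (EHom.comp_γ' (stabE n m q fun i => j i.castSucc)
          (suspE (n + m) q (j (Fin.last m))) (Fin.natAdd n (Fin.last m)) hk h').symm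
        exact congrArg threshold (Fin.addCases_right _)
      | cast t =>
        refine Eq.trans ?_ (EHom.comp_γ (stabE n m q fun i => j i.castSucc)
          (suspE (n + m) q (j (Fin.last m))) (Fin.natAdd n t) (Fin.natAdd n t.castSucc) rfl ?_
          h').symm
        · refine Eq.trans ?_ (Category.id_comp _).symm
          refine (congrArg threshold (Fin.addCases_right _)).trans
            (congrArg threshold (Fin.addCases_right _)).symm
        · intro i hi
          have := congrArg Fin.val hi
          change i.val = n + t.val at this
          have hlt : i.val < n := i.isLt
          omega

theorem stabE_perm {n n' m m' : ℕ} (e : Fin n ≃ Fin n') (f : Fin m ≃ Fin m')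
    (q : SimplexCategory) (j : Fin m' → Fin (q.len + 1)) :
    (diagPerm e).app (op q) ≫ stabE n' m' q j =
      stabE n m q (fun i => j (f i)) ≫ (diagPerm (sumPerm e f)).app (op q) := by
  refine EHom.ext' (fun i => (sumPerm_left e f i).symm) (fun i k h h' => ?_) fun k h h' => ?_
  · exact eq_of_heq ((perm_eobj_β (a := (diagE n).obj (op q)) (b := (diagE n').obj (op q)) e
      (fun _ => rfl) (stabE n' m' q j) i _ k rfl h h).trans
      (eobj_perm_β (a := (diagE (n + m)).obj (op q)) (b := (diagE (n' + m')).obj (op q))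
      (sumPerm e f) (fun _ => rfl) (stabE n m q fun i => j (f i)) i _ k rfl h' h').symm)
  · induction k using Fin.addCases (m := n') (n := m') with
    | left i => exact absurd (congrArg (Fin.castAdd m') (e.apply_symm_apply i)) (h (e.symm i))
    | right t =>
      obtain ⟨t, rfl⟩ := f.surjective t
      have h₁ : ∀ i : Fin n', Fin.castAdd m' i ≠ Fin.natAdd n' (f t) := by
        intro i hi
        have := congrArg Fin.val hi
        simp at this
        omega
      have h₂ : ∀ i : Fin n, Fin.castAdd m i ≠ Fin.natAdd n t := by
        intro i hi
        have := congrArg Fin.val hi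
        simp at this
        omega
      refine eq_of_heq ((perm_eobj_γ (a := (diagE n).obj (op q)) (b := (diagE n').obj (op q)) e
        (fun _ => rfl) (stabE n' m' q j) _ h₁ h).trans (HEq.trans ?_
        (eobj_perm_γ (a := (diagE (n + m)).obj (op q)) (b := (diagE (n' + m')).obj (op q))
        (sumPerm e f) (fun _ => rfl) (stabE n m q fun i => j (f i)) (Fin.natAdd n t) _ h₂
        (sumPerm_right e f t) h').symm))
      exact heq_of_eq ((congrArg threshold (Fin.addCases_right _)).trans
        (congrArg threshold (Fin.addCases_right _)).symm)

/-- The replacement of the entry `k` of a tuple by `[0]`. -/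
def zeroAt (b : EObj) (k : Fin b.r) : EObj := ⟨b.r, Function.update b.m k (SimplexCategory.mk 0)⟩

theorem zeroAt_ne (b : EObj) (k l : Fin b.r) (h : l ≠ k) : (zeroAt b k).m l = b.m l := by
  simp [zeroAt, h]

theorem factor_zeroAt {a b : EObj} (f : a ⟶ b) (k : Fin b.r) (hk : ∀ i, EHom.q f i ≠ k)
    (c : Fin 2) (hc : EHom.γ f k hk = SimplexCategory.const _ (SimplexCategory.mk 1) c) :
    ∃ (g : a ⟶ zeroAt b k) (h : zeroAt b k ⟶ b), f = g ≫ h := by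
  classical
  let d : ∀ l : Fin b.r, b.m l ⟶ (zeroAt b k).m l := fun l =>
    if hl : l = k then SimplexCategory.const _ _ 0 else eqToHom (zeroAt_ne b k l hl).symm
  let v : ∀ l : Fin b.r, (∀ i, EHom.q f i ≠ l) → ((zeroAt b k).m l ⟶ SimplexCategory.mk 1) :=
    fun l h => if hl : l = k then SimplexCategory.const _ (SimplexCategory.mk 1) c
      else eqToHom (zeroAt_ne b k l hl) ≫ EHom.γ f l h
  have hd : ∀ l (hl : l ≠ k), d l = eqToHom (zeroAt_ne b k l hl).symm := fun l hl => dif_neg hl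
  have hv : ∀ l h (hl : l ≠ k), v l h = eqToHom (zeroAt_ne b k l hl) ≫ EHom.γ f l h :=
    fun l h hl => dif_neg hl
  have hv' : ∀ h, v k h = SimplexCategory.const _ (SimplexCategory.mk 1) c := fun h => dif_pos rfl
  let g : EHom a (zeroAt b k) :=
    ⟨(show Fin a.r ↪ Fin b.r from EHom.q f),
      fun i l h => eqToHom (zeroAt_ne b k l (h ▸ hk i)) ≫ EHom.β f i l h, v⟩
  let h : EHom (zeroAt b k) b :=
    ⟨Function.Embedding.refl (Fin b.r), fun i l h => eqToHom (congrArg b.m (Eq.symm h)) ≫ d i,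
      fun l h => absurd rfl (h l)⟩
  refine ⟨g, h, EHom.ext' (fun i => rfl) (fun i l h₁ h₂ => ?_) fun l h₁ h₂ => ?_⟩
  · subst h₁
    refine Eq.trans ?_ (EHom.comp_β g h i _ _ rfl rfl h₂).symm
    change EHom.β f i _ _ = (𝟙 _ ≫ d (EHom.q f i)) ≫ (eqToHom (zeroAt_ne b k _ (hk i)) ≫ EHom.β f i _ rfl)
    rw [hd _ (hk i), Category.id_comp, eqToHom_trans_assoc, eqToHom_refl, Category.id_comp]
  · refine Eq.trans ?_ (EHom.comp_γ g h l l rfl h₁ h₂).symm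
    change EHom.γ f l h₁ = (𝟙 _ ≫ d l) ≫ v l h₁
    by_cases hl : l = k
    · subst hl
      rw [hv', hc]
      rfl
    · rw [hd l hl, hv l h₁ hl, Category.id_comp, eqToHom_trans_assoc, eqToHom_refl,
        Category.id_comp]

theorem EStar.map_const (X : EStar.{u}) {a b : EObj} (f : a ⟶ b) (k : Fin b.r)
    (hk : ∀ i, EHom.q f i ≠ k) (c : Fin 2)
    (hc : EHom.γ f k hk = SimplexCategory.const _ (SimplexCategory.mk 1) c) :
    (∀ x, (X.fmap f).obj x = (X.F.obj b).pt) ∧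
      ∀ {x y} (u : x ⟶ y), IsId ((X.fmap f).map u) := by
  obtain ⟨g, h, rfl⟩ := factor_zeroAt f k hk c hc
  have hz : (zeroAt b k).m k = SimplexCategory.mk 0 := Function.update_self _ _ _
  have e : X.fmap (g ≫ h) = X.fmap g ⋙ X.fmap h := by
    unfold EStar.fmap
    rw [CategoryTheory.Functor.map_comp]
    rfl
  rw [e]
  constructor
  · intro x
    exact (congrArg (X.fmap h).obj (X.obj_eq (zeroAt b k) k hz _)).trans (X.F.map h).map_pt
  · intro x y u
    exact (X.map_eq (zeroAt b k) k hz _).map _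

theorem threshold_zero (q : SimplexCategory) :
    threshold (0 : Fin (q.len + 1)) = SimplexCategory.const _ (SimplexCategory.mk 1) (1 : Fin 2) := by
  ext x
  simp [threshold]

theorem comp_threshold_succ {q' q : SimplexCategory} (θ : q' ⟶ q) (j : Fin (q.len + 1))
    (l : Fin q'.len) (h : circle θ j = l.succ) : θ ≫ threshold j = threshold (circle θ j) := by
  have h' := (circle_eq_succ _ _ _).1 h
  rw [h]
  have key : ∀ x, j ≤ θ.toOrderHom x ↔ l.succ ≤ x := by
    intro x
    constructor
    · intro hx
      by_contra hlt
      have := θ.toOrderHom.monotone (Fin.le_castSucc_iff.2 (not_le.1 hlt))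
      exact absurd (hx.trans this) (not_le.2 h'.1)
    · intro hx
      exact h'.2.trans (θ.toOrderHom.monotone hx)
  ext x
  exact congrArg Fin.val (if_congr (key x) rfl rfl : (if j ≤ θ.toOrderHom x then (1 : Fin 2) else 0) =
    if l.succ ≤ x then 1 else 0)

theorem comp_threshold_zero {q' q : SimplexCategory} (θ : q' ⟶ q) (j : Fin (q.len + 1))
    (h : circle θ j = 0) :
    ∃ c : Fin 2, θ ≫ threshold j = SimplexCategory.const _ (SimplexCategory.mk 1) c := by
  have key : ∀ x, j ≤ θ.toOrderHom x ↔ j ≤ θ.toOrderHom 0 := by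
    intro x
    induction x using Fin.induction with
    | zero => rfl
    | succ x ih =>
      rw [← ih]
      constructor
      · intro hx
        by_contra hlt
        have := (circle_eq_succ θ j x).2 ⟨not_le.1 hlt, hx⟩
        rw [h] at this
        exact Fin.succ_ne_zero _ this.symm
      · intro hx
        exact hx.trans (θ.toOrderHom.monotone Fin.castSucc_lt_succ.le)
  refine ⟨if j ≤ θ.toOrderHom 0 then 1 else 0, ?_⟩
  ext x
  exact congrArg Fin.val (if_congr (key x) rfl rfl : (if j ≤ θ.toOrderHom x then (1 : Fin 2) else 0) =
    if j ≤ θ.toOrderHom 0 then 1 else 0)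

theorem BasedFunctor.ext_triv {A B : BasedCat.{u}} {F G : A ⟶ B}
    (hF : (∀ x, F.functor.obj x = B.pt) ∧ ∀ {x y} (u : x ⟶ y), IsId (F.functor.map u))
    (hG : (∀ x, G.functor.obj x = B.pt) ∧ ∀ {x y} (u : x ⟶ y), IsId (G.functor.map u)) : F = G :=
  BasedFunctor.ext (CategoryTheory.Functor.hext (fun x => (hF.1 x).trans (hG.1 x).symm)
    fun x y u => (hF.2 u).heq' ((hF.1 x).trans (hG.1 x).symm) (hG.2 u))

theorem iterMap_suspE (X : EStar.{u}) (q : SimplexCategory) (n m : ℕ)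
    (j : Fin m → Fin (q.len + 1)) :
    iterMap (fun n => X.F.obj ((diagE n).obj (op q))) (fun n j => X.F.map (suspE n q j)) n m j =
      X.F.map (stabE n m q j) := by
  induction m with
  | zero =>
    rw [stabE_zero, CategoryTheory.Functor.map_id]
    rfl
  | succ m ih =>
    rw [stabE_succ, CategoryTheory.Functor.map_comp, ← ih]
    rfl

/-- The symmetric spectrum of an `E_*`-category `X`: its level `n` is the diagonal of
`X([q], …, [q])`, and the structure map on the summand of `j ∈ S¹_q` is induced by
`(ι_n, (id, …, id, β^j))`. -/
noncomputable def toSpec (X : EStar.{u}) : SymSpec.{u} where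
  level n := diagE n ⋙ X.F
  act e := Functor.whiskerRight (diagPerm e) X.F
  act_refl n := NatTrans.ext (funext fun q => X.F.map_id ((diagE n).obj q))
  act_trans {n n' n''} e e' := by
    refine NatTrans.ext (funext fun q => ?_)
    refine Eq.trans ?_ (X.F.map_comp ((diagPerm e).app q) ((diagPerm e').app q))
    refine congrArg X.F.map (EHom.ext' (fun _ => rfl) (fun i k h h' => ?_)
      fun k h _ => absurd ((e.trans e').apply_symm_apply k) (h _))
    exact (Category.id_comp (𝟙 q.unop)).symm
  σ n q j := X.F.map (suspE n q j)
  σ_obj_zero n q := (X.map_const (suspE n q 0) (Fin.last n) (fun i => (Fin.castSucc_lt_last i).ne) 1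
    (threshold_zero q)).1
  σ_map_zero n q := (X.map_const (suspE n q 0) (Fin.last n)
    (fun i => (Fin.castSucc_lt_last i).ne) 1 (threshold_zero q)).2
  σ_natural n q' q θ j := by
    let t : (q' ⟶ SimplexCategory.mk 1) → ((diagE n).obj (op q) ⟶ (diagE (n + 1)).obj (op q')) :=
      fun r => EHom.mk (a := (diagE n).obj (op q)) (b := (diagE (n + 1)).obj (op q'))
        Fin.castSuccEmb (fun _ _ _ => θ) fun _ _ => r
    have e₁ : (diagE n).map θ.op ≫ suspE n q' (circle θ j) = t (threshold (circle θ j)) :=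
      EHom.ext' (fun _ => rfl) (fun _ _ _ _ => Category.id_comp θ)
        fun k h h' => EHom.comp_γ' ((diagE n).map θ.op) (suspE n q' (circle θ j)) k h' h
    have e₂ : suspE n q j ≫ (diagE (n + 1)).map θ.op = t (θ ≫ threshold j) :=
      EHom.ext' (fun _ => rfl) (fun _ _ _ _ => Category.comp_id θ)
        fun k h h' => EHom.comp_γ (suspE n q j) ((diagE (n + 1)).map θ.op) k k rfl h' h
    refine (X.F.map_comp _ _).symm.trans (Eq.trans ?_ (X.F.map_comp _ _))
    rw [e₁, e₂]
    rcases Fin.eq_zero_or_eq_succ (circle θ j) with h | ⟨l, h⟩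
    · obtain ⟨c, hc⟩ := comp_threshold_zero θ j h
      have hk : ∀ i : Fin n, Fin.castSucc i ≠ Fin.last n := fun i => (Fin.castSucc_lt_last i).ne
      have h' : threshold (circle θ j) = SimplexCategory.const _ (SimplexCategory.mk 1) (1 : Fin 2) :=
        h ▸ threshold_zero q'
      exact BasedFunctor.ext_triv (X.map_const (t _) (Fin.last n) hk 1 h')
        (X.map_const (t _) (Fin.last n) hk c hc)
    · exact congrArg (fun r => X.F.map (t r)) (comp_threshold_succ θ j l h).symm
  equivariant e f q j := by
    have h := congrArg X.F.map (stabE_perm e f q j)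
    rw [CategoryTheory.Functor.map_comp, CategoryTheory.Functor.map_comp, ← iterMap_suspE,
      ← iterMap_suspE] at h
    exact h

end ToSpec

/-! ### The construction of Elmendorf and Mandell -/

section StrictUnitLemmas

variable {C : Type*} [Category C] [MonoidalCategory C] [SymmetricCategory C] [StrictUnit C]

theorem IsId.of_comp {X Y Z : C} {f : X ⟶ Y} {g : Y ⟶ Z} (h : IsId (f ≫ g)) (hg : IsId g) :
    IsId f := by
  obtain ⟨rfl, rfl⟩ := hg
  simpa using h

theorem IsId.inv {X Y : C} {f : X ≅ Y} (h : IsId f.hom) : IsId f.inv := by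
  obtain ⟨rfl, h⟩ := h
  have := f.hom_inv_id
  rw [h] at this
  exact ⟨rfl, by simpa using this⟩

theorem IsId.hom {X Y : C} {f : X ≅ Y} (h : IsId f.inv) : IsId f.hom :=
  IsId.inv (f := f.symm) h

theorem IsId.whiskerRight {X Y : C} {f : X ⟶ Y} (h : IsId f) (Z : C) : IsId (f ▷ Z) := by
  obtain ⟨rfl, rfl⟩ := h
  simpa using IsId.id _

theorem IsId.whiskerLeft {X Y : C} {f : X ⟶ Y} (h : IsId f) (Z : C) : IsId (Z ◁ f) := by
  obtain ⟨rfl, rfl⟩ := h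
  simpa using IsId.id _

theorem unit_tensor (X : C) : 𝟙_ C ⊗ X = X := (StrictUnit.left X).1

theorem tensor_unit (X : C) : X ⊗ 𝟙_ C = X := (StrictUnit.right X).1

theorem isId_assoc (X Y Z : C) (h : X = 𝟙_ C ∨ Y = 𝟙_ C ∨ Z = 𝟙_ C) : IsId (α_ X Y Z).hom := by
  rcases h with rfl | rfl | rfl
  · refine IsId.hom (IsId.of_comp (g := (λ_ Y).hom ▷ Z) ?_ ((StrictUnit.left Y).whiskerRight Z))
    rw [← leftUnitor_tensor_hom]
    exact StrictUnit.left _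
  · refine IsId.of_comp (g := X ◁ (λ_ Z).hom) ?_ ((StrictUnit.left Z).whiskerLeft X)
    rw [triangle]
    exact (StrictUnit.right X).whiskerRight Z
  · refine IsId.of_comp (g := X ◁ (ρ_ Y).hom) ?_ ((StrictUnit.right Y).whiskerLeft X)
    rw [← rightUnitor_tensor_hom]
    exact StrictUnit.right _

theorem isId_braiding (X Y : C) (h : X = 𝟙_ C ∨ Y = 𝟙_ C) : IsId (β_ X Y).hom := by
  rcases h with rfl | rfl
  · refine IsId.of_comp (g := (ρ_ Y).hom) ?_ (StrictUnit.right Y)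
    rw [braiding_rightUnitor]
    exact StrictUnit.left _
  · refine IsId.of_comp (g := (λ_ X).hom) ?_ (StrictUnit.left X)
    rw [braiding_leftUnitor]
    exact StrictUnit.right _

theorem isId_tensorμ (X₁ X₂ Y₁ Y₂ : C) (h : (X₁ = 𝟙_ C ∧ X₂ = 𝟙_ C) ∨ (Y₁ = 𝟙_ C ∧ Y₂ = 𝟙_ C) ∨
    (X₁ = 𝟙_ C ∧ Y₁ = 𝟙_ C) ∨ (X₂ = 𝟙_ C ∧ Y₂ = 𝟙_ C)) : IsId (tensorμ X₁ X₂ Y₁ Y₂) := by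
  have key : IsId (α_ X₁ X₂ (Y₁ ⊗ Y₂)).hom → IsId (α_ X₂ Y₁ Y₂).hom → IsId (β_ X₂ Y₁).hom →
      IsId (α_ Y₁ X₂ Y₂).hom → IsId (α_ X₁ Y₁ (X₂ ⊗ Y₂)).hom → IsId (tensorμ X₁ X₂ Y₁ Y₂) := by
    intro h₁ h₂ h₃ h₄ h₅
    exact h₁.comp ((h₂.inv.whiskerLeft _).comp (((h₃.whiskerRight _).whiskerLeft _).comp
      ((h₄.whiskerLeft _).comp h₅.inv)))
  have hu : 𝟙_ C ⊗ 𝟙_ C = 𝟙_ C := unit_tensor _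
  rcases h with ⟨rfl, rfl⟩ | ⟨rfl, rfl⟩ | ⟨rfl, rfl⟩ | ⟨rfl, rfl⟩ <;> apply key <;>
    first
    | exact isId_assoc _ _ _ (Or.inl rfl)
    | exact isId_assoc _ _ _ (Or.inr (Or.inl rfl))
    | exact isId_assoc _ _ _ (Or.inr (Or.inr rfl))
    | exact isId_assoc _ _ _ (Or.inr (Or.inr hu))
    | exact isId_braiding _ _ (Or.inl rfl)
    | exact isId_braiding _ _ (Or.inr rfl)

theorem tensorHom_unit_heq {X Y Z W : C} (f : X ⟶ Y) {g : Z ⟶ W} (hg : IsId g)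
    (h : Z = 𝟙_ C) : HEq (f ⊗ₘ g) f := by
  obtain ⟨rfl, rfl⟩ := hg
  subst h
  have : f ⊗ₘ eqToHom rfl = (ρ_ X).hom ≫ f ≫ (ρ_ Y).inv := by
    simp
  rw [this]
  exact (IsId.comp_heq (StrictUnit.right X) _).trans
    (IsId.heq_comp (IsId.inv (StrictUnit.right Y)) f)

theorem unit_tensorHom_heq {X Y Z W : C} (f : X ⟶ Y) {g : Z ⟶ W} (hg : IsId g)
    (h : Z = 𝟙_ C) : HEq (g ⊗ₘ f) f := by
  obtain ⟨rfl, rfl⟩ := hg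
  subst h
  have : eqToHom rfl ⊗ₘ f = (λ_ X).hom ≫ f ≫ (λ_ Y).inv := by
    simp
  rw [this]
  exact (IsId.comp_heq (StrictUnit.left X) _).trans
    (IsId.heq_comp (IsId.inv (StrictUnit.left Y)) f)

theorem IsId.of_heq {X Y X' Y' : C} {f : X ⟶ Y} {g : X' ⟶ Y'} (hx : X = X') (hy : Y = Y')
    (h : HEq f g) (hg : IsId g) : IsId f := by
  subst hx; subst hy; cases h; exact hg

end StrictUnitLemmas

section Bar

variable {ι : Type} (M : ι → Type) [∀ i, Zero (M i)]

/-- Tuples of subsets of the based sets `Mᵢ` that do not contain the base point (written `0`). -/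
def BSub : Type := {S : ∀ i, Set (M i) // ∀ i, 0 ∉ S i}

variable {M}

/-- `Sᵢ` is the disjoint union of `Tᵢ` and `Uᵢ`, and the three tuples agree in all other places. -/
structure SplitAt (i : ι) (T U S : BSub M) : Prop where
  union : S.1 i = T.1 i ∪ U.1 i
  disjoint : Disjoint (T.1 i) (U.1 i)
  left : ∀ j, j ≠ i → T.1 j = S.1 j
  right : ∀ j, j ≠ i → U.1 j = S.1 j

/-- The objects of the category `C̄(M₁, …, M_n)`: systems `{C_S, ρ_{S,i,T,U}}`. -/
structure BarObj (A : SMCat.{u}) (M : ι → Type) [∀ i, Zero (M i)] where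
  obj : BSub M → A
  ρ : ∀ (i : ι) {T U S : BSub M}, SplitAt i T U S → (obj T ⊗ obj U ≅ obj S)
  unit_obj : ∀ (S : BSub M) (k : ι), S.1 k = ∅ → obj S = 𝟙_ A
  unit_ρ : ∀ (i : ι) {T U S : BSub M} (h : SplitAt i T U S),
    ((∃ k, S.1 k = ∅) ∨ T.1 i = ∅ ∨ U.1 i = ∅) → IsId (ρ i h).hom
  symm : ∀ (i : ι) {T U S : BSub M} (h : SplitAt i T U S) (h' : SplitAt i U T S),
    (ρ i h).hom = (β_ (obj T) (obj U)).hom ≫ (ρ i h').hom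
  assoc : ∀ (i : ι) {T U V TU UV S : BSub M} (h₁ : SplitAt i T U TU) (h₂ : SplitAt i TU V S)
    (h₃ : SplitAt i U V UV) (h₄ : SplitAt i T UV S),
    ((ρ i h₁).hom ▷ obj V) ≫ (ρ i h₂).hom =
      (α_ (obj T) (obj U) (obj V)).hom ≫ (obj T ◁ (ρ i h₃).hom) ≫ (ρ i h₄).hom
  comm : ∀ (i j : ι), i ≠ j → ∀ {TV UV TW UW SV SW TS US S : BSub M} (h₁ : SplitAt i TV UV SV)
    (h₂ : SplitAt i TW UW SW) (h₃ : SplitAt j SV SW S) (h₄ : SplitAt j TV TW TS)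
    (h₅ : SplitAt j UV UW US) (h₆ : SplitAt i TS US S),
    ((ρ i h₁).hom ⊗ₘ (ρ i h₂).hom) ≫ (ρ j h₃).hom =
      tensorμ (obj TV) (obj UV) (obj TW) (obj UW) ≫
        ((ρ j h₄).hom ⊗ₘ (ρ j h₅).hom) ≫ (ρ i h₆).hom

variable {A : SMCat.{u}}

/-- The morphisms of the category `C̄(M₁, …, M_n)`. -/
@[ext]
structure BarObj.Hom (X Y : BarObj A M) where
  app : ∀ S : BSub M, X.obj S ⟶ Y.obj S
  unit : ∀ (S : BSub M) (k : ι), S.1 k = ∅ → IsId (app S)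
  comm : ∀ (i : ι) {T U S : BSub M} (h : SplitAt i T U S),
    (X.ρ i h).hom ≫ app S = (app T ⊗ₘ app U) ≫ (Y.ρ i h).hom

instance : Category (BarObj A M) where
  Hom X Y := BarObj.Hom X Y
  id X := ⟨fun S => 𝟙 _, fun _ _ _ => IsId.id _, fun i _ _ _ h => by simp⟩
  comp f g := ⟨fun S => f.app S ≫ g.app S, fun S k h => (f.unit S k h).comp (g.unit S k h),
    fun i T U S h => by
      rw [← Category.assoc, f.comm, Category.assoc, g.comm, ← tensorHom_comp_tensorHom,
        Category.assoc]⟩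
  id_comp f := BarObj.Hom.ext (funext fun S => Category.id_comp _)
  comp_id f := BarObj.Hom.ext (funext fun S => Category.comp_id _)
  assoc f g h := BarObj.Hom.ext (funext fun S => Category.assoc _ _ _)

theorem BarObj.ext' {X Y : BarObj A M} (h : ∀ S, X.obj S = Y.obj S)
    (h' : ∀ (i : ι) (T U S : BSub M) (H : SplitAt i T U S), HEq (X.ρ i H).hom (Y.ρ i H).hom) :
    X = Y := by
  obtain ⟨c, r, _⟩ := X
  obtain ⟨c', r', _⟩ := Y
  obtain rfl : c = c' := funext h
  congr
  funext i T U S H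
  exact Iso.ext (eq_of_heq (h' i T U S H))

theorem BarObj.hom_heq {X X' Y Y' : BarObj A M} {f : X ⟶ Y} {g : X' ⟶ Y'} (hx : X = X')
    (hy : Y = Y') (h : ∀ S, HEq (f.app S) (g.app S)) : HEq f g := by
  subst hx; subst hy
  exact heq_of_eq (BarObj.Hom.ext (funext fun S => eq_of_heq (h S)))

theorem BarObj.ρ_heq (X : BarObj A M) (i : ι) {T U S T' U' S' : BSub M} (h : SplitAt i T U S)
    (h' : SplitAt i T' U' S') (hT : T = T') (hU : U = U') (hS : S = S') :
    HEq (X.ρ i h).hom (X.ρ i h').hom := by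
  subst hT; subst hU; subst hS; rfl

/-- The base object of `C̄(M₁, …, M_n)`. -/
def BarObj.base (A : SMCat.{u}) (M : ι → Type) [∀ i, Zero (M i)] : BarObj A M where
  obj _ := 𝟙_ A
  ρ _ _ _ _ _ := λ_ (𝟙_ A)
  unit_obj _ _ _ := rfl
  unit_ρ _ _ _ _ _ _ := StrictUnit.left _
  symm _ _ _ _ _ _ := (StrictUnit.left _).eq
    ((isId_braiding _ _ (Or.inl rfl)).comp (StrictUnit.left _))
  assoc _ _ _ _ _ _ _ _ _ _ _ :=
    (((StrictUnit.left _).whiskerRight _).comp (StrictUnit.left _)).eq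
      ((isId_assoc _ _ _ (Or.inl rfl)).comp
        (((StrictUnit.left _).whiskerLeft _).comp (StrictUnit.left _)))
  comm _ _ _ _ _ _ _ _ _ _ _ _ _ _ _ _ _ _ :=
    (((StrictUnit.left _).tensor (StrictUnit.left _)).comp (StrictUnit.left _)).eq
      ((isId_tensorμ _ _ _ _ (Or.inl ⟨rfl, rfl⟩)).comp
        (((StrictUnit.left _).tensor (StrictUnit.left _)).comp (StrictUnit.left _)))

/-- The based category `C̄(M₁, …, M_n)`. -/
def barCat (A : SMCat.{u}) (M : ι → Type) [∀ i, Zero (M i)] : BasedCat.{u} where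
  carrier := BarObj A M
  pt := BarObj.base A M

end Bar

section BarFunctor

variable {A : SMCat.{u}}

/-- The tuple of based sets `(S¹_{m₁}, …, S¹_{m_r})`. -/
abbrev circM (a : EObj) (i : Fin a.r) : Type := Fin ((a.m i).len + 1)

/-- The tuple of preimages under the maps of based sets given by a morphism of tuples. -/
noncomputable def pull {a b : EObj} (f : a ⟶ b) (S : BSub (circM b)) : BSub (circM a) :=
  ⟨fun i => circle (EHom.β f i _ rfl) ⁻¹' S.1 (EHom.q f i), fun i h => S.2 (EHom.q f i) (by
    have h' : circle (EHom.β f i _ rfl) 0 ∈ S.1 (EHom.q f i) := h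
    rwa [circle_zero] at h')⟩

/-- At the places which are not in the image of the injection, the preimages under the maps of
based sets given by a morphism of tuples are equal to `{1}`, and not empty. -/
def Flag {a b : EObj} (f : a ⟶ b) (S : BSub (circM b)) : Prop :=
  ∀ k h, circle (EHom.γ f k h) (1 : Fin 2) ∈ S.1 k

section Splits

variable {a b c : EObj} (f : a ⟶ b) {S T U : BSub (circM b)}

theorem pull_val (S : BSub (circM b)) (i : Fin a.r) (k : Fin b.r) (h : EHom.q f i = k) :
    (pull f S).1 i = circle (EHom.β f i k h) ⁻¹' S.1 k := by
  subst h; rfl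

theorem pull_split {i : Fin a.r} {k : Fin b.r} (hi : EHom.q f i = k) (h : SplitAt k T U S) :
    SplitAt i (pull f T) (pull f U) (pull f S) := by
  subst hi
  refine ⟨?_, ?_, fun j hj => ?_, fun j hj => ?_⟩
  · exact congrArg (fun X => circle (EHom.β f i _ rfl) ⁻¹' X) h.union
  · exact h.disjoint.preimage _
  · exact congrArg (fun X => circle (EHom.β f j _ rfl) ⁻¹' X)
      (h.left _ fun e => hj ((EHom.q f).injective e))
  · exact congrArg (fun X => circle (EHom.β f j _ rfl) ⁻¹' X)
      (h.right _ fun e => hj ((EHom.q f).injective e))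

theorem flag_left {i : Fin a.r} {k : Fin b.r} (hi : EHom.q f i = k) (h : SplitAt k T U S) :
    Flag f T ↔ Flag f S :=
  forall_congr' fun l => forall_congr' fun hl => by
    rw [h.left l fun e => hl i (hi.trans e.symm)]

theorem flag_right {i : Fin a.r} {k : Fin b.r} (hi : EHom.q f i = k) (h : SplitAt k T U S) :
    Flag f U ↔ Flag f S :=
  forall_congr' fun l => forall_congr' fun hl => by
    rw [h.right l fun e => hl i (hi.trans e.symm)]

theorem pull_left {k : Fin b.r} (hk : ∀ i, EHom.q f i ≠ k) (h : SplitAt k T U S) :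
    pull f T = pull f S :=
  Subtype.ext (funext fun i =>
    congrArg (fun X => circle (EHom.β f i _ rfl) ⁻¹' X) (h.left _ (hk i)))

theorem pull_right {k : Fin b.r} (hk : ∀ i, EHom.q f i ≠ k) (h : SplitAt k T U S) :
    pull f U = pull f S :=
  Subtype.ext (funext fun i =>
    congrArg (fun X => circle (EHom.β f i _ rfl) ⁻¹' X) (h.right _ (hk i)))

theorem SplitAt.sub_left {ι : Type} {M : ι → Type} [∀ i, Zero (M i)] {k : ι} {T U S : BSub M}
    (h : SplitAt k T U S) (l : ι) : T.1 l ⊆ S.1 l := by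
  by_cases e : l = k
  · subst e; rw [h.union]; exact Set.subset_union_left
  · exact (h.left l e).subset

theorem SplitAt.sub_right {ι : Type} {M : ι → Type} [∀ i, Zero (M i)] {k : ι} {T U S : BSub M}
    (h : SplitAt k T U S) (l : ι) : U.1 l ⊆ S.1 l := by
  by_cases e : l = k
  · subst e; rw [h.union]; exact Set.subset_union_right
  · exact (h.right l e).subset

theorem Flag.of_left {k : Fin b.r} (h : SplitAt k T U S) (H : Flag f T) : Flag f S :=
  fun l hl => h.sub_left l (H l hl)

theorem Flag.of_right {k : Fin b.r} (h : SplitAt k T U S) (H : Flag f U) : Flag f S :=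
  fun l hl => h.sub_right l (H l hl)

theorem flag_or {k : Fin b.r} (hk : ∀ i, EHom.q f i ≠ k) (h : SplitAt k T U S) (H : Flag f S) :
    (Flag f T ∧ ¬ Flag f U) ∨ (¬ Flag f T ∧ Flag f U) := by
  have h₁ := H k hk
  rw [h.union] at h₁
  have aux : ∀ V : BSub (circM b), (∀ j, j ≠ k → V.1 j = S.1 j) →
      circle (EHom.γ f k hk) (1 : Fin 2) ∈ V.1 k → Flag f V := by
    intro V hV hc l hl
    by_cases e : l = k
    · subst e; exact hc
    · rw [hV l e]; exact H l hl
  rcases h₁ with h₁ | h₁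
  · exact Or.inl ⟨aux T h.left h₁, fun h' => Set.disjoint_left.1 h.disjoint h₁ (h' k hk)⟩
  · exact Or.inr ⟨fun h' => Set.disjoint_left.1 h.disjoint (h' k hk) h₁, aux U h.right h₁⟩

end Splits

section Transport

variable {C : Type*} [Category C] [MonoidalCategory C] [SymmetricCategory C]

theorem symm_transport {t u s t' u' s' : C} {r : t ⊗ u ⟶ s} {r' : u ⊗ t ⟶ s}
    {q : t' ⊗ u' ⟶ s'} {q' : u' ⊗ t' ⟶ s'} (ht : t = t') (hu : u = u') (hs : s = s')
    (h : HEq r q) (h' : HEq r' q') (H : q = (β_ t' u').hom ≫ q') : r = (β_ t u).hom ≫ r' := by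
  subst ht hu hs; cases h; cases h'; exact H

theorem assoc_transport {t u v tu uv s t₁ u₁ v₁ tu₁ uv₁ s₁ : C} {r₁ : t ⊗ u ⟶ tu}
    {r₂ : tu ⊗ v ⟶ s} {r₃ : u ⊗ v ⟶ uv} {r₄ : t ⊗ uv ⟶ s} {q₁ : t₁ ⊗ u₁ ⟶ tu₁}
    {q₂ : tu₁ ⊗ v₁ ⟶ s₁} {q₃ : u₁ ⊗ v₁ ⟶ uv₁} {q₄ : t₁ ⊗ uv₁ ⟶ s₁} (ht : t = t₁) (hu : u = u₁)
    (hv : v = v₁) (htu : tu = tu₁) (huv : uv = uv₁) (hs : s = s₁) (h₁ : HEq r₁ q₁)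
    (h₂ : HEq r₂ q₂) (h₃ : HEq r₃ q₃) (h₄ : HEq r₄ q₄)
    (H : (q₁ ▷ v₁) ≫ q₂ = (α_ t₁ u₁ v₁).hom ≫ (t₁ ◁ q₃) ≫ q₄) :
    (r₁ ▷ v) ≫ r₂ = (α_ t u v).hom ≫ (t ◁ r₃) ≫ r₄ := by
  subst ht hu hv htu huv hs; cases h₁; cases h₂; cases h₃; cases h₄; exact H

theorem comm_transport {a b c d ab cd ac bd s a' b' c' d' ab' cd' ac' bd' s' : C}
    {r₁ : a ⊗ b ⟶ ab} {r₂ : c ⊗ d ⟶ cd} {r₃ : ab ⊗ cd ⟶ s} {r₄ : a ⊗ c ⟶ ac} {r₅ : b ⊗ d ⟶ bd}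
    {r₆ : ac ⊗ bd ⟶ s} {q₁ : a' ⊗ b' ⟶ ab'} {q₂ : c' ⊗ d' ⟶ cd'} {q₃ : ab' ⊗ cd' ⟶ s'}
    {q₄ : a' ⊗ c' ⟶ ac'} {q₅ : b' ⊗ d' ⟶ bd'} {q₆ : ac' ⊗ bd' ⟶ s'} (ha : a = a') (hb : b = b')
    (hc : c = c') (hd : d = d') (hab : ab = ab') (hcd : cd = cd') (hac : ac = ac')
    (hbd : bd = bd') (hs : s = s') (h₁ : HEq r₁ q₁) (h₂ : HEq r₂ q₂) (h₃ : HEq r₃ q₃)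
    (h₄ : HEq r₄ q₄) (h₅ : HEq r₅ q₅) (h₆ : HEq r₆ q₆)
    (H : (q₁ ⊗ₘ q₂) ≫ q₃ = tensorμ a' b' c' d' ≫ (q₄ ⊗ₘ q₅) ≫ q₆) :
    (r₁ ⊗ₘ r₂) ≫ r₃ = tensorμ a b c d ≫ (r₄ ⊗ₘ r₅) ≫ r₆ := by
  subst ha hb hc hd hab hcd hac hbd hs
  cases h₁; cases h₂; cases h₃; cases h₄; cases h₅; cases h₆; exact H

theorem hom_transport {t u s x y z t' u' s' x' y' z' : C} {r : t ⊗ u ⟶ s} {p : s ⟶ z}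
    {f : t ⟶ x} {g : u ⟶ y} {q : x ⊗ y ⟶ z} {r' : t' ⊗ u' ⟶ s'} {p' : s' ⟶ z'}
    {f' : t' ⟶ x'} {g' : u' ⟶ y'} {q' : x' ⊗ y' ⟶ z'} (ht : t = t') (hu : u = u') (hs : s = s')
    (hx : x = x') (hy : y = y') (hz : z = z') (hr : HEq r r') (hp : HEq p p') (hf : HEq f f')
    (hg : HEq g g') (hq : HEq q q') (H : r' ≫ p' = (f' ⊗ₘ g') ≫ q') :
    r ≫ p = (f ⊗ₘ g) ≫ q := by
  subst ht hu hs hx hy hz; cases hr; cases hp; cases hf; cases hg; cases hq; exact H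

end Transport

variable {a b c : EObj}

open Classical in
/-- The objects of the image of a system `{C_S, ρ}` under a morphism of tuples: `D_S` is the object
`C_R`, where `R` is the tuple of preimages of `S`, if the sets of `S` at the places which are not in
the image of the injection have the preimage `{1}`, and the unit otherwise. So, reindexing along maps
of based sets is taking preimages, and the extension by the based set `{0, 1}` is given by
`D_{S, {1}} = C_S` and `D_{S, ∅} = e`. -/
noncomputable def pushPart (f : a ⟶ b) (X : BarObj A (circM a)) (S : BSub (circM b)) : A :=
  if Flag f S then X.obj (pull f S) else 𝟙_ A

section

variable (f : a ⟶ b) (X : BarObj A (circM a)) {S T U : BSub (circM b)}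

theorem pushPart_of (h : Flag f S) : pushPart f X S = X.obj (pull f S) := if_pos h

theorem pushPart_not (h : ¬ Flag f S) : pushPart f X S = 𝟙_ A := if_neg h

theorem pushPart_split {k : Fin b.r} (h : SplitAt k T U S)
    (H : ¬ (Flag f S ∧ ∃ i, EHom.q f i = k)) :
    pushPart f X T ⊗ pushPart f X U = pushPart f X S := by
  by_cases hS : Flag f S
  · have hk : ∀ i, EHom.q f i ≠ k := fun i hi => H ⟨hS, i, hi⟩
    rcases flag_or f hk h hS with ⟨hT, hU⟩ | ⟨hT, hU⟩
    · rw [pushPart_of f X hT, pushPart_not f X hU, pushPart_of f X hS, pull_left f hk h,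
        tensor_unit]
    · rw [pushPart_not f X hT, pushPart_of f X hU, pushPart_of f X hS, pull_right f hk h,
        unit_tensor]
  · rw [pushPart_not f X hS, pushPart_not f X fun h' => hS (h'.of_left f h),
      pushPart_not f X fun h' => hS (h'.of_right f h), unit_tensor]

theorem pushPart_tensor {i : Fin a.r} {k : Fin b.r} (hi : EHom.q f i = k) (h : SplitAt k T U S)
    (hS : Flag f S) :
    pushPart f X T ⊗ pushPart f X U = X.obj (pull f T) ⊗ X.obj (pull f U) := by
  rw [pushPart_of f X ((flag_left f hi h).2 hS), pushPart_of f X ((flag_right f hi h).2 hS)]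

open Classical in
/-- The isomorphisms of the image of a system `{C_S, ρ}`: at the place `q i`, they are the isomorphisms
of the given system at the place `i`; at the places which are not in the image of the injection, and
between the unit objects, they are identities. -/
noncomputable def pushρ {k : Fin b.r} (h : SplitAt k T U S) :
    pushPart f X T ⊗ pushPart f X U ≅ pushPart f X S :=
  if H : Flag f S ∧ ∃ i, EHom.q f i = k then
    eqToIso (pushPart_tensor f X H.2.choose_spec h H.1) ≪≫
      X.ρ H.2.choose (pull_split f H.2.choose_spec h) ≪≫ eqToIso (pushPart_of f X H.1).symm
  else eqToIso (pushPart_split f X h H)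

theorem pushρ_heq {i : Fin a.r} {k : Fin b.r} (hi : EHom.q f i = k) (h : SplitAt k T U S)
    (hS : Flag f S) : HEq (pushρ f X h).hom (X.ρ i (pull_split f hi h)).hom := by
  have H : Flag f S ∧ ∃ i, EHom.q f i = k := ⟨hS, i, hi⟩
  have key : ∀ (j : Fin a.r) (hj : EHom.q f j = k), j = i →
      HEq (X.ρ j (pull_split f hj h)).hom (X.ρ i (pull_split f hi h)).hom := by
    rintro j hj rfl; rfl
  rw [pushρ, dif_pos H]
  refine HEq.trans ?_ (key H.2.choose H.2.choose_spec
    ((EHom.q f).injective (H.2.choose_spec.trans hi.symm)))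
  simp only [Iso.trans_hom, eqToIso.hom]
  exact (eqToHom_comp_heq _ _).trans (comp_eqToHom_heq _ _)

theorem pushρ_isId {k : Fin b.r} (h : SplitAt k T U S)
    (H : ¬ (Flag f S ∧ ∃ i, EHom.q f i = k)) : IsId (pushρ f X h).hom := by
  rw [pushρ, dif_neg H]
  exact ⟨pushPart_split f X h H, rfl⟩

end

/-- The system which is the image of a system `{C_S, ρ}` under a morphism of tuples. -/
noncomputable def pushObj (f : a ⟶ b) (X : BarObj A (circM a)) : BarObj A (circM b) where
  obj := pushPart f X
  ρ _ _ _ _ h := pushρ f X h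
  unit_obj S k hk := by
    by_cases hS : Flag f S
    · by_cases hi : ∃ i, EHom.q f i = k
      · obtain ⟨i, rfl⟩ := hi
        rw [pushPart_of f X hS]
        refine X.unit_obj _ i ?_
        rw [pull_val f S i _ rfl, hk, Set.preimage_empty]
      · exact absurd (hk ▸ hS k fun i h => hi ⟨i, h⟩) (Set.notMem_empty _)
    · exact pushPart_not f X hS
  unit_ρ k T U S h H := by
    by_cases hH : Flag f S ∧ ∃ i, EHom.q f i = k
    · obtain ⟨hS, i, hi⟩ := hH
      have hT := (flag_left f hi h).2 hS
      have hU := (flag_right f hi h).2 hS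
      refine IsId.of_heq (pushPart_tensor f X hi h hS) (pushPart_of f X hS)
        (pushρ_heq f X hi h hS) (X.unit_ρ i _ ?_)
      rcases H with ⟨l, hl⟩ | H | H
      · by_cases hj : ∃ j, EHom.q f j = l
        · obtain ⟨j, hj⟩ := hj
          exact Or.inl ⟨j, by rw [pull_val f S j l hj, hl, Set.preimage_empty]⟩
        · exact absurd (hl ▸ hS l fun i h => hj ⟨i, h⟩) (Set.notMem_empty _)
      · exact Or.inr (Or.inl (by rw [pull_val f T i k hi, H, Set.preimage_empty]))
      · exact Or.inr (Or.inr (by rw [pull_val f U i k hi, H, Set.preimage_empty]))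
    · exact pushρ_isId f X h hH
  symm k T U S h h' := by
    by_cases hH : Flag f S ∧ ∃ i, EHom.q f i = k
    · obtain ⟨hS, i, hi⟩ := hH
      exact symm_transport (pushPart_of f X ((flag_left f hi h).2 hS))
        (pushPart_of f X ((flag_right f hi h).2 hS)) (pushPart_of f X hS) (pushρ_heq f X hi h hS)
        (pushρ_heq f X hi h' hS) (X.symm i _ _)
    · refine (pushρ_isId f X h hH).eq (IsId.comp (isId_braiding _ _ ?_) (pushρ_isId f X h' hH))
      by_cases hS : Flag f S
      · rcases flag_or f (fun i hi => hH ⟨hS, i, hi⟩) h hS with H | H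
        · exact Or.inr (pushPart_not f X H.2)
        · exact Or.inl (pushPart_not f X H.1)
      · exact Or.inl (pushPart_not f X fun h' => hS (h'.of_left f h))
  assoc k T U V TU UV S h₁ h₂ h₃ h₄ := by
    by_cases hS : Flag f S
    · by_cases hk : ∃ i, EHom.q f i = k
      · obtain ⟨i, hi⟩ := hk
        have hTU := (flag_left f hi h₂).2 hS
        have hUV := (flag_right f hi h₄).2 hS
        exact assoc_transport (pushPart_of f X ((flag_left f hi h₁).2 hTU))
          (pushPart_of f X ((flag_right f hi h₁).2 hTU))
          (pushPart_of f X ((flag_right f hi h₂).2 hS)) (pushPart_of f X hTU)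
          (pushPart_of f X hUV) (pushPart_of f X hS) (pushρ_heq f X hi h₁ hTU)
          (pushρ_heq f X hi h₂ hS) (pushρ_heq f X hi h₃ hUV) (pushρ_heq f X hi h₄ hS)
          (X.assoc i _ _ _ _)
      · have hid : ∀ {T U S : BSub (circM b)} (h : SplitAt k T U S), IsId (pushρ f X h).hom :=
          fun h => pushρ_isId f X h fun h' => hk h'.2
        refine (((hid h₁).whiskerRight _).comp (hid h₂)).eq
          ((isId_assoc _ _ _ ?_).comp (((hid h₃).whiskerLeft _).comp (hid h₄)))
        by_cases hTU : Flag f TU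
        · rcases flag_or f (fun i hi => hk ⟨i, hi⟩) h₁ hTU with H | H
          · exact Or.inr (Or.inl (pushPart_not f X H.2))
          · exact Or.inl (pushPart_not f X H.1)
        · exact Or.inl (pushPart_not f X fun h' => hTU (h'.of_left f h₁))
    · have hTU : ¬ Flag f TU := fun h' => hS (h'.of_left f h₂)
      have hUV : ¬ Flag f UV := fun h' => hS (h'.of_right f h₄)
      have hid : ∀ {T U S : BSub (circM b)} (h : SplitAt k T U S), ¬ Flag f S →
          IsId (pushρ f X h).hom := fun h hS => pushρ_isId f X h fun h' => hS h'.1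
      exact (((hid h₁ hTU).whiskerRight _).comp (hid h₂ hS)).eq
        ((isId_assoc _ _ _ (Or.inl (pushPart_not f X fun h' => hTU (h'.of_left f h₁)))).comp
          (((hid h₃ hUV).whiskerLeft _).comp (hid h₄ hS)))
  comm k l hkl TV UV TW UW SV SW TS US S h₁ h₂ h₃ h₄ h₅ h₆ := by
    by_cases hS : Flag f S
    · by_cases hk : ∃ i, EHom.q f i = k
      · obtain ⟨i, hi⟩ := hk
        by_cases hl : ∃ j, EHom.q f j = l
        · obtain ⟨j, hj⟩ := hl
          have hij : i ≠ j := fun e => hkl (hi.symm.trans ((congrArg (EHom.q f) e).trans hj))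
          have hSV := (flag_left f hj h₃).2 hS
          have hSW := (flag_right f hj h₃).2 hS
          have hTS := (flag_left f hi h₆).2 hS
          have hUS := (flag_right f hi h₆).2 hS
          exact comm_transport (pushPart_of f X ((flag_left f hi h₁).2 hSV))
            (pushPart_of f X ((flag_right f hi h₁).2 hSV))
            (pushPart_of f X ((flag_left f hi h₂).2 hSW))
            (pushPart_of f X ((flag_right f hi h₂).2 hSW)) (pushPart_of f X hSV)
            (pushPart_of f X hSW) (pushPart_of f X hTS) (pushPart_of f X hUS) (pushPart_of f X hS)
            (pushρ_heq f X hi h₁ hSV) (pushρ_heq f X hi h₂ hSW) (pushρ_heq f X hj h₃ hS)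
            (pushρ_heq f X hj h₄ hTS) (pushρ_heq f X hj h₅ hUS) (pushρ_heq f X hi h₆ hS)
            (X.comm i j hij _ _ _ _ _ _)
        · have hl' : ∀ i, EHom.q f i ≠ l := fun i hi => hl ⟨i, hi⟩
          have hid : ∀ {T U S : BSub (circM b)} (h : SplitAt l T U S), IsId (pushρ f X h).hom :=
            fun h => pushρ_isId f X h fun h' => hl h'.2
          have key : ∀ {T T' U U' R R' : BSub (circM b)} (h : SplitAt k T U R)
              (h' : SplitAt k T' U' R'), Flag f R → Flag f R' → pull f T = pull f T' →
              pull f U = pull f U' → pull f R = pull f R' →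
              HEq (pushρ f X h).hom (pushρ f X h').hom := fun h h' hR hR' e₁ e₂ e₃ =>
            (pushρ_heq f X hi h hR).trans ((X.ρ_heq i _ _ e₁ e₂ e₃).trans
              (pushρ_heq f X hi h' hR').symm)
          rcases flag_or f hl' h₃ hS with ⟨hV, hW⟩ | ⟨hV, hW⟩
          · have nT : pushPart f X TW = 𝟙_ A :=
              pushPart_not f X fun h' => hW (h'.of_left f h₂)
            have nU : pushPart f X UW = 𝟙_ A :=
              pushPart_not f X fun h' => hW (h'.of_right f h₂)
            refine eq_of_heq (((hid h₃).heq_comp _).trans ((tensorHom_unit_heq _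
              (pushρ_isId f X h₂ fun h' => hW h'.1) (by rw [nT, nU, unit_tensor])).trans
              (HEq.trans ?_ ((isId_tensorμ _ _ _ _ (Or.inr (Or.inl ⟨nT, nU⟩))).comp_heq _).symm)))
            refine HEq.trans ?_ (((hid h₄).tensor (hid h₅)).comp_heq _).symm
            exact key _ _ hV hS (pull_left f hl' h₄) (pull_left f hl' h₅) (pull_left f hl' h₃)
          · have nT : pushPart f X TV = 𝟙_ A :=
              pushPart_not f X fun h' => hV (h'.of_left f h₁)
            have nU : pushPart f X UV = 𝟙_ A :=
              pushPart_not f X fun h' => hV (h'.of_right f h₁)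
            refine eq_of_heq (((hid h₃).heq_comp _).trans ((unit_tensorHom_heq _
              (pushρ_isId f X h₁ fun h' => hV h'.1) (by rw [nT, nU, unit_tensor])).trans
              (HEq.trans ?_ ((isId_tensorμ _ _ _ _ (Or.inl ⟨nT, nU⟩)).comp_heq _).symm)))
            refine HEq.trans ?_ (((hid h₄).tensor (hid h₅)).comp_heq _).symm
            exact key _ _ hW hS (pull_right f hl' h₄) (pull_right f hl' h₅) (pull_right f hl' h₃)
      · have hk' : ∀ i, EHom.q f i ≠ k := fun i hi => hk ⟨i, hi⟩
        have hid : ∀ {T U S : BSub (circM b)} (h : SplitAt k T U S), IsId (pushρ f X h).hom :=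
          fun h => pushρ_isId f X h fun h' => hk h'.2
        by_cases hl : ∃ j, EHom.q f j = l
        · obtain ⟨j, hj⟩ := hl
          have key : ∀ {T T' U U' R R' : BSub (circM b)} (h : SplitAt l T U R)
              (h' : SplitAt l T' U' R'), Flag f R → Flag f R' → pull f T = pull f T' →
              pull f U = pull f U' → pull f R = pull f R' →
              HEq (pushρ f X h).hom (pushρ f X h').hom := fun h h' hR hR' e₁ e₂ e₃ =>
            (pushρ_heq f X hj h hR).trans ((X.ρ_heq j _ _ e₁ e₂ e₃).trans
              (pushρ_heq f X hj h' hR').symm)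
          rcases flag_or f hk' h₆ hS with ⟨hT, hU⟩ | ⟨hT, hU⟩
          · have nV : pushPart f X UV = 𝟙_ A :=
              pushPart_not f X fun h' => hU (h'.of_left f h₅)
            have nW : pushPart f X UW = 𝟙_ A :=
              pushPart_not f X fun h' => hU (h'.of_right f h₅)
            refine eq_of_heq ((((hid h₁).tensor (hid h₂)).comp_heq _).trans (HEq.trans ?_
              ((isId_tensorμ _ _ _ _ (Or.inr (Or.inr (Or.inr ⟨nV, nW⟩)))).comp_heq _).symm))
            refine HEq.trans ?_ (((hid h₆).heq_comp _).trans (tensorHom_unit_heq _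
              (pushρ_isId f X h₅ fun h' => hU h'.1) (by rw [nV, nW, unit_tensor]))).symm
            exact key _ _ hS hT (pull_left f hk' h₁).symm (pull_left f hk' h₂).symm
              (pull_left f hk' h₆).symm
          · have nV : pushPart f X TV = 𝟙_ A :=
              pushPart_not f X fun h' => hT (h'.of_left f h₄)
            have nW : pushPart f X TW = 𝟙_ A :=
              pushPart_not f X fun h' => hT (h'.of_right f h₄)
            refine eq_of_heq ((((hid h₁).tensor (hid h₂)).comp_heq _).trans (HEq.trans ?_
              ((isId_tensorμ _ _ _ _ (Or.inr (Or.inr (Or.inl ⟨nV, nW⟩)))).comp_heq _).symm))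
            refine HEq.trans ?_ (((hid h₆).heq_comp _).trans (unit_tensorHom_heq _
              (pushρ_isId f X h₄ fun h' => hT h'.1) (by rw [nV, nW, unit_tensor]))).symm
            exact key _ _ hS hU (pull_right f hk' h₁).symm (pull_right f hk' h₂).symm
              (pull_right f hk' h₆).symm
        · have hl' : ∀ i, EHom.q f i ≠ l := fun i hi => hl ⟨i, hi⟩
          have hid' : ∀ {T U S : BSub (circM b)} (h : SplitAt l T U S), IsId (pushρ f X h).hom :=
            fun h => pushρ_isId f X h fun h' => hl h'.2
          refine (((hid h₁).tensor (hid h₂)).comp (hid' h₃)).eq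
            ((isId_tensorμ _ _ _ _ ?_).comp (((hid' h₄).tensor (hid' h₅)).comp (hid h₆)))
          rcases flag_or f hl' h₃ hS with ⟨hV, hW⟩ | ⟨hV, hW⟩
          · exact Or.inr (Or.inl ⟨pushPart_not f X fun h' => hW (h'.of_left f h₂),
              pushPart_not f X fun h' => hW (h'.of_right f h₂)⟩)
          · exact Or.inl ⟨pushPart_not f X fun h' => hV (h'.of_left f h₁),
              pushPart_not f X fun h' => hV (h'.of_right f h₁)⟩
    · have hid : ∀ {m} {T U S : BSub (circM b)} (h : SplitAt m T U S), ¬ Flag f S →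
          IsId (pushρ f X h).hom := fun h hS => pushρ_isId f X h fun h' => hS h'.1
      have hSV : ¬ Flag f SV := fun h' => hS (h'.of_left f h₃)
      have hSW : ¬ Flag f SW := fun h' => hS (h'.of_right f h₃)
      have hTS : ¬ Flag f TS := fun h' => hS (h'.of_left f h₆)
      have hUS : ¬ Flag f US := fun h' => hS (h'.of_right f h₆)
      exact (((hid h₁ hSV).tensor (hid h₂ hSW)).comp (hid h₃ hS)).eq
        ((isId_tensorμ _ _ _ _ (Or.inl ⟨pushPart_not f X fun h' => hSV (h'.of_left f h₁),
          pushPart_not f X fun h' => hSV (h'.of_right f h₁)⟩)).comp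
          (((hid h₄ hTS).tensor (hid h₅ hUS)).comp (hid h₆ hS)))


section

variable (f : a ⟶ b) {X Y : BarObj A (circM a)} (φ : X ⟶ Y) {S T U : BSub (circM b)}

open Classical in
/-- The components of the image of a morphism of systems. -/
noncomputable def pushApp (S : BSub (circM b)) : pushPart f X S ⟶ pushPart f Y S :=
  if H : Flag f S then
    eqToHom (pushPart_of f X H) ≫ BarObj.Hom.app φ (pull f S) ≫ eqToHom (pushPart_of f Y H).symm
  else eqToHom ((pushPart_not f X H).trans (pushPart_not f Y H).symm)

theorem pushApp_heq (H : Flag f S) : HEq (pushApp f φ S) (BarObj.Hom.app φ (pull f S)) := by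
  rw [pushApp, dif_pos H]
  exact (eqToHom_comp_heq _ _).trans (comp_eqToHom_heq _ _)

theorem pushApp_isId (H : ¬ Flag f S) : IsId (pushApp f φ S) := by
  rw [pushApp, dif_neg H]
  exact ⟨(pushPart_not f X H).trans (pushPart_not f Y H).symm, rfl⟩

/-- The image of a morphism of systems under a morphism of tuples. -/
noncomputable def pushMap : pushObj f X ⟶ pushObj f Y :=
  BarObj.Hom.mk (X := pushObj f X) (Y := pushObj f Y) (pushApp f φ)
    (fun S k hk => by
      by_cases hS : Flag f S
      · by_cases hi : ∃ i, EHom.q f i = k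
        · obtain ⟨i, hi⟩ := hi
          exact IsId.of_heq (pushPart_of f X hS) (pushPart_of f Y hS) (pushApp_heq f φ hS)
            (BarObj.Hom.unit φ _ i (by rw [pull_val f S i k hi, hk, Set.preimage_empty]))
        · exact absurd (hk ▸ hS k fun i h => hi ⟨i, h⟩) (Set.notMem_empty _)
      · exact pushApp_isId f φ hS)
    (fun k T U S h => by
      change (pushρ f X h).hom ≫ pushApp f φ S =
        (pushApp f φ T ⊗ₘ pushApp f φ U) ≫ (pushρ f Y h).hom
      by_cases hS : Flag f S
      · by_cases hi : ∃ i, EHom.q f i = k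
        · obtain ⟨i, hi⟩ := hi
          have hT := (flag_left f hi h).2 hS
          have hU := (flag_right f hi h).2 hS
          exact hom_transport (pushPart_of f X hT) (pushPart_of f X hU) (pushPart_of f X hS)
            (pushPart_of f Y hT) (pushPart_of f Y hU) (pushPart_of f Y hS)
            (pushρ_heq f X hi h hS) (pushApp_heq f φ hS) (pushApp_heq f φ hT)
            (pushApp_heq f φ hU) (pushρ_heq f Y hi h hS) (BarObj.Hom.comm φ i _)
        · have hk : ∀ i, EHom.q f i ≠ k := fun i h => hi ⟨i, h⟩
          have key : ∀ {R : BSub (circM b)}, Flag f R → pull f R = pull f S →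
              HEq (pushApp f φ S) (pushApp f φ R) := by
            intro R hR e
            refine (pushApp_heq f φ hS).trans (HEq.trans ?_ (pushApp_heq f φ hR).symm)
            rw [e]
          refine eq_of_heq (((pushρ_isId f X h fun h' => hi h'.2).comp_heq _).trans
            (HEq.trans ?_ ((pushρ_isId f Y h fun h' => hi h'.2).heq_comp _).symm))
          rcases flag_or f hk h hS with ⟨hT, hU⟩ | ⟨hT, hU⟩
          · exact (key hT (pull_left f hk h)).trans (tensorHom_unit_heq _ (pushApp_isId f φ hU)
              (pushPart_not f X hU)).symm
          · exact (key hU (pull_right f hk h)).trans (unit_tensorHom_heq _ (pushApp_isId f φ hT)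
              (pushPart_not f X hT)).symm
      · exact ((pushρ_isId f X h fun h' => hS h'.1).comp (pushApp_isId f φ hS)).eq
          (((pushApp_isId f φ fun h' => hS (h'.of_left f h)).tensor
            (pushApp_isId f φ fun h' => hS (h'.of_right f h))).comp
            (pushρ_isId f Y h fun h' => hS h'.1)))

end

/-- The functor `C̄(S¹_{m₁}, …, S¹_{m_r}) ⟶ C̄(S¹_{m₁'}, …, S¹_{m_s'})` given by a morphism of
tuples. -/
noncomputable def pushFunctor (A : SMCat.{u}) (f : a ⟶ b) :
    BarObj A (circM a) ⥤ BarObj A (circM b) where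
  obj X := pushObj f X
  map φ := pushMap f φ
  map_id X := BarObj.Hom.ext (funext fun S => by
    change pushApp f (𝟙 X) S = 𝟙 (pushPart f X S)
    by_cases hS : Flag f S
    · refine eq_of_heq ((pushApp_heq f (𝟙 X) hS).trans ?_)
      exact (IsId.id _).heq' (pushPart_of f X hS).symm (IsId.id _)
    · exact (pushApp_isId f _ hS).eq (IsId.id _))
  map_comp {X Y Z} φ ψ := BarObj.Hom.ext (funext fun S => by
    change pushApp f (φ ≫ ψ) S = pushApp f φ S ≫ pushApp f ψ S
    by_cases hS : Flag f S
    · refine eq_of_heq ((pushApp_heq f (φ ≫ ψ) hS).trans ?_)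
      exact (heq_comp (pushPart_of f X hS) (pushPart_of f Y hS) (pushPart_of f Z hS)
        (pushApp_heq f φ hS) (pushApp_heq f ψ hS)).symm
    · exact (pushApp_isId f _ hS).eq ((pushApp_isId f _ hS).comp (pushApp_isId f _ hS)))

theorem pushObj_base (A : SMCat.{u}) (f : a ⟶ b) :
    pushObj f (BarObj.base A (circM a)) = BarObj.base A (circM b) := by
  have h₁ : ∀ S, pushPart f (BarObj.base A (circM a)) S = 𝟙_ A := by
    intro S
    by_cases hS : Flag f S
    · exact pushPart_of f _ hS
    · exact pushPart_not f _ hS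
  refine BarObj.ext' h₁ fun k T U S h => ?_
  refine IsId.heq' (f := (pushρ f (BarObj.base A (circM a)) h).hom)
    (congrArg₂ (· ⊗ ·) (h₁ T) (h₁ U)) ?_ (StrictUnit.left _)
  by_cases hH : Flag f S ∧ ∃ i, EHom.q f i = k
  · obtain ⟨hS, i, hi⟩ := hH
    exact IsId.of_heq (pushPart_tensor f _ hi h hS) (pushPart_of f _ hS) (pushρ_heq f _ hi h hS)
      (StrictUnit.left _)
  · exact pushρ_isId f _ h hH

theorem pull_id (S : BSub (circM a)) : pull (𝟙 a) S = S :=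
  Subtype.ext (funext fun i => Set.ext fun x => by
    change circle (𝟙 (a.m i)) x ∈ S.1 i ↔ _
    rw [circle_id])

theorem flag_id (S : BSub (circM a)) : Flag (𝟙 a) S := fun k h => absurd rfl (h k)

theorem pull_comp (f : a ⟶ b) (g : b ⟶ c) (S : BSub (circM c)) :
    pull (f ≫ g) S = pull f (pull g S) :=
  Subtype.ext (funext fun i => Set.ext fun x => by
    change circle (EHom.β g (EHom.q f i) _ rfl ≫ EHom.β f i _ rfl) x ∈
        S.1 (EHom.q g (EHom.q f i)) ↔
      circle (EHom.β g (EHom.q f i) _ rfl) (circle (EHom.β f i _ rfl) x) ∈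
        S.1 (EHom.q g (EHom.q f i))
    rw [circle_comp])

theorem flag_comp (f : a ⟶ b) (g : b ⟶ c) (S : BSub (circM c)) :
    Flag (f ≫ g) S ↔ Flag g S ∧ Flag f (pull g S) := by
  constructor
  · intro H
    constructor
    · intro k hk
      have h : ∀ i, EHom.q (f ≫ g) i ≠ k := fun i => hk _
      have e : EHom.γ (f ≫ g) k h = EHom.γ g k hk := EHom.comp_γ' f g k hk h
      have := H k h
      rwa [e] at this
    · intro j hj
      have h : ∀ i, EHom.q (f ≫ g) i ≠ EHom.q g j := fun i hi => hj i ((EHom.q g).injective hi)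
      have e : EHom.γ (f ≫ g) _ h = EHom.β g j _ rfl ≫ EHom.γ f j hj :=
        EHom.comp_γ f g j _ rfl hj h
      have := H _ h
      rw [e, circle_comp] at this
      exact this
  · rintro ⟨H₁, H₂⟩ k h
    by_cases hk : ∃ j, EHom.q g j = k
    · obtain ⟨j, rfl⟩ := hk
      have hj : ∀ i, EHom.q f i ≠ j := fun i hi => h i (congrArg (EHom.q g) hi)
      have e : EHom.γ (f ≫ g) _ h = EHom.β g j _ rfl ≫ EHom.γ f j hj :=
        EHom.comp_γ f g j _ rfl hj h
      rw [e, circle_comp]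
      exact H₂ j hj
    · have hk' : ∀ j, EHom.q g j ≠ k := fun j hj => hk ⟨j, hj⟩
      have e : EHom.γ (f ≫ g) k h = EHom.γ g k hk' := EHom.comp_γ' f g k hk' h
      rw [e]
      exact H₁ k hk'

theorem pushPart_heq_of (f : a ⟶ b) (X : BarObj A (circM a)) (Y : BarObj A (circM b))
    (h₁ : ∀ S, Flag f S → X.obj (pull f S) = Y.obj S) (h₂ : ∀ S, ¬ Flag f S → Y.obj S = 𝟙_ A)
    (h₃ : ∀ (i k) (hi : EHom.q f i = k) {T U S : BSub (circM b)} (h : SplitAt k T U S), Flag f S →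
      HEq (X.ρ i (pull_split f hi h)).hom (Y.ρ k h).hom)
    (h₄ : ∀ (k) {T U S : BSub (circM b)} (h : SplitAt k T U S),
      ¬ (Flag f S ∧ ∃ i, EHom.q f i = k) → IsId (Y.ρ k h).hom) : pushObj f X = Y := by
  have e : ∀ S, pushPart f X S = Y.obj S := by
    intro S
    by_cases hS : Flag f S
    · exact (pushPart_of f X hS).trans (h₁ S hS)
    · exact (pushPart_not f X hS).trans (h₂ S hS).symm
  refine BarObj.ext' e fun k T U S h => ?_
  by_cases hH : Flag f S ∧ ∃ i, EHom.q f i = k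
  · obtain ⟨hS, i, hi⟩ := hH
    exact (pushρ_heq f X hi h hS).trans (h₃ i k hi h hS)
  · exact IsId.heq' (f := (pushρ f X h).hom) (congrArg₂ (· ⊗ ·) (e T) (e U))
      (pushρ_isId f X h hH) (h₄ k h hH)

theorem pushFunctor_id (A : SMCat.{u}) (a : EObj) : pushFunctor A (𝟙 a) = 𝟭 _ := by
  have hX : ∀ X : BarObj A (circM a), pushObj (𝟙 a) X = X := fun X =>
    pushPart_heq_of (𝟙 a) X X (fun S _ => by rw [pull_id]) (fun S h => absurd (flag_id S) h)
      (fun i k hi T U S h _ => by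
        obtain rfl : i = k := hi
        exact X.ρ_heq i _ _ (pull_id T) (pull_id U) (pull_id S))
      (fun k T U S h h' => absurd ⟨flag_id S, k, rfl⟩ h')
  refine CategoryTheory.Functor.hext hX fun X Y φ => ?_
  refine BarObj.hom_heq (hX X) (hX Y) fun S => ?_
  refine (pushApp_heq (𝟙 a) φ (flag_id S)).trans ?_
  change HEq (BarObj.Hom.app φ (pull (𝟙 a) S)) (BarObj.Hom.app φ S)
  rw [pull_id]

theorem pushFunctor_comp (A : SMCat.{u}) (f : a ⟶ b) (g : b ⟶ c) :
    pushFunctor A (f ≫ g) = pushFunctor A f ⋙ pushFunctor A g := by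
  have e₁ : ∀ (X : BarObj A (circM a)) (S), pushPart (f ≫ g) X S = pushPart g (pushObj f X) S := by
    intro X S
    by_cases hg : Flag g S
    · by_cases hf : Flag f (pull g S)
      · refine (pushPart_of _ X ((flag_comp f g S).2 ⟨hg, hf⟩)).trans (Eq.trans ?_
          ((pushPart_of g _ hg).trans (pushPart_of f X hf)).symm)
        rw [pull_comp]
      · exact (pushPart_not _ X fun h => hf ((flag_comp f g S).1 h).2).trans
          ((pushPart_of g _ hg).trans (pushPart_not f X hf)).symm
    · exact (pushPart_not _ X fun h => hg ((flag_comp f g S).1 h).1).trans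
        (pushPart_not g _ hg).symm
  have hX : ∀ X : BarObj A (circM a), pushObj (f ≫ g) X = pushObj g (pushObj f X) := by
    intro X
    refine BarObj.ext' (e₁ X) fun k T U S h => ?_
    change HEq (pushρ (f ≫ g) X h).hom (pushρ g (pushObj f X) h).hom
    by_cases hg : Flag g S ∧ ∃ j, EHom.q g j = k
    · obtain ⟨hg, j, hj⟩ := hg
      refine HEq.trans ?_ (pushρ_heq g (pushObj f X) hj h hg).symm
      change HEq _ (pushρ f X (pull_split g hj h)).hom
      by_cases hf : Flag f (pull g S) ∧ ∃ i, EHom.q f i = j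
      · obtain ⟨hf, i, hi⟩ := hf
        refine HEq.trans ?_ (pushρ_heq f X hi (pull_split g hj h) hf).symm
        refine (pushρ_heq (f ≫ g) X (i := i) ((congrArg (EHom.q g) hi).trans hj) h
          ((flag_comp f g S).2 ⟨hg, hf⟩)).trans ?_
        exact X.ρ_heq i _ _ (pull_comp f g T) (pull_comp f g U) (pull_comp f g S)
      · refine IsId.heq' (congrArg₂ (· ⊗ ·) ((e₁ X T).trans ?_) ((e₁ X U).trans ?_))
          (pushρ_isId (f ≫ g) X h ?_) (pushρ_isId f X _ hf)
        · exact pushPart_of g _ ((flag_left g hj h).2 hg)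
        · exact pushPart_of g _ ((flag_right g hj h).2 hg)
        · rintro ⟨h', i, hi⟩
          exact hf ⟨((flag_comp f g S).1 h').2, i, (EHom.q g).injective (hi.trans hj.symm)⟩
    · refine IsId.heq' (congrArg₂ (· ⊗ ·) (e₁ X T) (e₁ X U)) (pushρ_isId (f ≫ g) X h ?_)
        (pushρ_isId g _ h hg)
      rintro ⟨h', i, hi⟩
      exact hg ⟨((flag_comp f g S).1 h').1, _, hi⟩
  refine CategoryTheory.Functor.hext hX fun X Y φ => ?_
  refine BarObj.hom_heq (hX X) (hX Y) fun S => ?_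
  change HEq (pushApp (f ≫ g) φ S) (pushApp g (pushMap f φ) S)
  by_cases hg : Flag g S
  · refine HEq.trans ?_ (pushApp_heq g (pushMap f φ) hg).symm
    change HEq _ (pushApp f φ (pull g S))
    by_cases hf : Flag f (pull g S)
    · refine (pushApp_heq (f ≫ g) φ ((flag_comp f g S).2 ⟨hg, hf⟩)).trans
        (HEq.trans ?_ (pushApp_heq f φ hf).symm)
      rw [pull_comp]
    · exact IsId.heq' ((e₁ X S).trans (pushPart_of g _ hg))
        (pushApp_isId (f ≫ g) φ fun h => hf ((flag_comp f g S).1 h).2) (pushApp_isId f φ hf)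
  · exact IsId.heq' (e₁ X S) (pushApp_isId (f ≫ g) φ fun h => hg ((flag_comp f g S).1 h).1)
      (pushApp_isId g _ hg)

theorem bsub_zero (m : EObj) (i : Fin m.r) (h : m.m i = SimplexCategory.mk 0)
    (S : BSub (circM m)) : S.1 i = ∅ := by
  refine Set.eq_empty_of_forall_notMem fun x hx => S.2 i ?_
  have hl : (m.m i).len = 0 := by rw [h]
  have : x = 0 := by
    apply Fin.ext
    have := x.isLt
    rw [Fin.val_zero]
    omega
  rwa [this] at hx

/-- The `E_*`-category `C̄`: its value at `([m₁], …, [m_r])` is `C̄(S¹_{m₁}, …, S¹_{m_r})`. -/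
noncomputable def Bar (A : SMCat.{u}) : EStar.{u} where
  F :=
    { obj := fun m => barCat A (circM m)
      map := fun f => BasedFunctor.mk (A := barCat A (circM _)) (B := barCat A (circM _))
        (pushFunctor A f) (pushObj_base A f)
      map_id := fun m => BasedFunctor.ext (pushFunctor_id A m)
      map_comp := fun f g => BasedFunctor.ext (pushFunctor_comp A f g) }
  obj_eq m i h X := by
    change BarObj A (circM m) at X
    change X = BarObj.base A (circM m)
    have e : ∀ S, X.obj S = 𝟙_ A := fun S => X.unit_obj S i (bsub_zero m i h S)
    refine BarObj.ext' e fun k T U S H => ?_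
    exact IsId.heq' (congrArg₂ (· ⊗ ·) (e T) (e U))
      (X.unit_ρ k H (Or.inl ⟨i, bsub_zero m i h S⟩)) (StrictUnit.left _)
  map_eq m i h X Y φ := by
    change BarObj A (circM m) at X
    change BarObj A (circM m) at Y
    change BarObj.Hom X Y at φ
    have e : ∀ (X : BarObj A (circM m)) S, X.obj S = 𝟙_ A :=
      fun X S => X.unit_obj S i (bsub_zero m i h S)
    have hXY : X = Y := by
      refine BarObj.ext' (fun S => (e X S).trans (e Y S).symm) fun k T U S H => ?_
      exact IsId.heq' (congrArg₂ (· ⊗ ·) ((e X T).trans (e Y T).symm)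
        ((e X U).trans (e Y U).symm))
        (X.unit_ρ k H (Or.inl ⟨i, bsub_zero m i h S⟩))
        (Y.unit_ρ k H (Or.inl ⟨i, bsub_zero m i h S⟩))
    subst hXY
    exact ⟨rfl, BarObj.Hom.ext (funext fun S =>
      (φ.unit S i (bsub_zero m i h S)).eq (IsId.id _))⟩

end BarFunctor

/-- The value of a multifunctor on `k`-ary morphisms. -/
abbrev EnrichedMultifunctor.onHom {M : CatMultiData.{u, v, w}} {N : CatMultiData.{u', v', w'}}
    {φ : M.Obj → N.Obj} (J : EnrichedMultifunctor M N φ) {k : ℕ} {a : Fin k → M.Obj} {b : M.Obj}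
    (f : M.Hom a b) : N.Hom (fun i => φ (a i)) (φ b) :=
  (J.map a b).obj f

/-- The value of a multifunctor on `k`-ary cells. -/
abbrev EnrichedMultifunctor.onCell {M : CatMultiData.{u, v, w}} {N : CatMultiData.{u', v', w'}}
    {φ : M.Obj → N.Obj} (J : EnrichedMultifunctor M N φ) {k : ℕ} {a : Fin k → M.Obj} {b : M.Obj}
    {f g : M.Hom a b} (α : f ⟶ g) : J.onHom f ⟶ J.onHom g :=
  (J.map a b).map α

section Formulas

/-! ### Explicit descriptions of the multifunctors -/

variable {k : ℕ}

/-- The `i`-th block of a tuple of subsets of the based sets that belong to a concatenation. -/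
def subBlock (m : Fin k → EObj) (S : BSub (circM (odot m))) (i : Fin k) : BSub (circM (m i)) :=
  ⟨fun j => Fin.cast (congrArg (fun q : SimplexCategory => q.len + 1) (odot_m m i j).symm) ⁻¹'
    S.1 (oplace m i j), fun j h => S.2 (oplace m i j) h⟩

theorem oplace_injective (m : Fin k → EObj) (i : Fin k) {j j' : Fin (m i).r}
    (h : oplace m i j = oplace m i j') : j = j' := by
  have := finSigmaFinEquiv.injective h
  simpa using this

theorem subBlock_split (m : Fin k → EObj) (i : Fin k) (j : Fin (m i).r)
    {T U S : BSub (circM (odot m))} (h : SplitAt (oplace m i j) T U S) :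
    SplitAt j (subBlock m T i) (subBlock m U i) (subBlock m S i) := by
  refine ⟨?_, ?_, fun l hl => ?_, fun l hl => ?_⟩
  · exact congrArg (fun X => Fin.cast _ ⁻¹' X) h.union
  · exact h.disjoint.preimage _
  · exact congrArg (fun X => Fin.cast _ ⁻¹' X)
      (h.left (oplace m i l) fun e => hl (oplace_injective m i e))
  · exact congrArg (fun X => Fin.cast _ ⁻¹' X)
      (h.right (oplace m i l) fun e => hl (oplace_injective m i e))

/-- The tuple `(C¹_{S₁}, …, C^k_{S_k})` of objects of a `k`-tuple of systems, where `S_i` is the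
`i`-th block of `S`. -/
def entries {C : Fin k → SMCat.{u}} (m : Fin k → EObj) (x : ∀ i, BarObj (C i) (circM (m i)))
    (S : BSub (circM (odot m))) : ∀ i, C i :=
  fun i => (x i).obj (subBlock m S i)

/-- The morphism between such tuples that is given by a `k`-tuple of morphisms of systems. -/
def entriesMap {C : Fin k → SMCat.{u}} (m : Fin k → EObj)
    {x y : ∀ i, BarObj (C i) (circM (m i))} (f : ∀ i, x i ⟶ y i) (S : BSub (circM (odot m))) :
    entries m x S ⟶ entries m y S :=
  (fun i => BarObj.Hom.app (f i) (subBlock m S i) : ∀ i, entries m x S i ⟶ entries m y S i)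

/-- The `k`-ary morphism `G` of `E_*`-categories is the one which is given by the `k`-linear functor
`F`: it sends systems `{Cⁱ, ρⁱ}` to the system of the objects `F(C¹_{S₁}, …, C^k_{S_k})` with the
isomorphisms `F(…, ρⁱ, …) ∘ δᵢ`, and morphisms `fⁱ` of systems to `F(f¹_{S₁}, …, f^k_{S_k})`. Here
`y` is the tuple `(C¹_{S₁}, …, Cⁱ_{Tᵢ} ⊗ Cⁱ_{Uᵢ}, …, C^k_{S_k})` and `r` is the morphism of tuples
`(id, …, ρⁱ, …, id)`. -/
structure BarDescr {C : Fin k → SMCat.{u}} {D : SMCat.{u}} (F : LinFun C D)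
    (G : EMap (fun i => Bar (C i)) (Bar D)) : Prop where
  obj : ∀ (m : Fin k → EObj) (x : ∀ i, BarObj (C i) (circM (m i))) (S : BSub (circM (odot m))),
    BarObj.obj (M := circM (odot m)) ((G.app m).obj x) S = F.F.obj (entries m x S)
  ρ : ∀ (m : Fin k → EObj) (x : ∀ i, BarObj (C i) (circM (m i))) (i : Fin k) (j : Fin (m i).r)
    {T U S : BSub (circM (odot m))} (h : SplitAt (oplace m i j) T U S) {y : ∀ i, C i}
    (h' : AddAt i (entries m x T) (entries m x U) y) (r : y ⟶ entries m x S),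
    OnlyAt i r ((x i).ρ j (subBlock_split m i j h)).hom →
    HEq (BarObj.ρ (M := circM (odot m)) ((G.app m).obj x) (oplace m i j) h).hom
      ((F.δ i h').hom ≫ F.F.map r)
  map : ∀ (m : Fin k → EObj) {x y : ∀ i, BarObj (C i) (circM (m i))} (f : ∀ i, x i ⟶ y i)
    (S : BSub (circM (odot m))),
    HEq (BarObj.Hom.app (M := circM (odot m)) (X := (G.app m).obj x) (Y := (G.app m).obj y)
      ((G.app m).map f) S) (F.F.map (entriesMap m f S))

/-- The cell `ψ` of `E_*`-categories is the one which is given by the `k`-linear transformation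
`φ`. -/
def CellDescr {C : Fin k → SMCat.{u}} {D : SMCat.{u}} {F F' : LinFun C D} (φ : F ⟶ F')
    {G G' : EMap (fun i => Bar (C i)) (Bar D)} (ψ : G ⟶ G') : Prop :=
  ∀ (m : Fin k → EObj) (x : ∀ i, BarObj (C i) (circM (m i))) (S : BSub (circM (odot m))),
    HEq (BarObj.Hom.app (M := circM (odot m)) (X := (G.app m).obj x) (Y := (G'.app m).obj x)
      ((EMap.Hom.app ψ m).app x) S) ((LinFun.Hom.app φ).app (entries m x S))

/-- The tuples `([q], …, [q])` of length `p i`. -/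
noncomputable abbrev diagTuple (p : Fin k → ℕ) (q : SimplexCategory) (i : Fin k) : EObj :=
  (diagE (p i)).obj (op q)

/-- The morphism from the empty tuple to `([1])`. -/
noncomputable def extE (q : SimplexCategoryᵒᵖ) :
    (diagE 0).obj q ⟶ (⟨1, fun _ => SimplexCategory.mk 1⟩ : EObj) :=
  EHom.mk (a := (diagE 0).obj q) (b := ⟨1, fun _ => SimplexCategory.mk 1⟩)
    ⟨Fin.elim0, fun i => i.elim0⟩ (fun i => i.elim0) fun _ _ => 𝟙 _

end Formulas

end EM

namespace EM

/-! ### Order preserving identifications of places -/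

/-! The multicategory axioms are proved by representing cells as functions. A cell `φ : F ⟶ G` acts
on a tuple of arrows `f : x ⟶ y` by the diagonal `F(f) ≫ φ y` of its naturality square. For an
identity cell this is the action of `F` on arrows, and on identity arrows it gives the components of
`φ`, so that functors and transformations can both be recovered. By naturality the horizontal
composition of cells becomes the substitution of functions (`arrowApp_hcomp`). Unit laws,
associativity and equivariance are thereby reduced to the same laws for substitution, together with
a comparison of permutations of places. The laws for `k`-ary morphisms are the special case of
identity cells.

The bookkeeping is kept small by collecting the arrows over all tuples in one type, `PermCat.Tot`,
on which permutations act. Two bracketings of a concatenation differ by a bijection that preserves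
values, and such a bijection acts as the identity on `Tot` (`PermCat.Tot.push_eq_self`).
`Realization` states what is required of the functions, and `Components` constructs them from
functors and transformations indexed by tuples. In the multicategories of `E_*`-categories and of
spectra a morphism is determined by its components. A multilinear functor also has distributivity
isomorphisms. Those of a composite are nested expressions of the form "δ followed by the image of a
morphism in one variable", and `LinFun.δ_map_heq` shows that such an expression depends only on its
ends and on that morphism.

For the multifunctor `J`, the isomorphism of the system `F(C¹, …, C^k)` at a place of the `i`-th
block is `F(id, …, ρⁱ, …, id) ∘ δᵢ`. Symmetry and associativity are inherited from `ρⁱ` and `δᵢ`.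
For two places of the same block, condition (5) holds because a multilinear functor is lax symmetric
monoidal in each variable and hence respects the middle interchange (`LinFun.interchange`). For
places of different blocks it is the compatibility of two distributivities (`LinFun.comm'`).
Naturality in `E` holds because preimages and the condition at the new places are computed block by
block (`subBlock_pull`, `flag_odotMap`), and a block that fails the condition supplies a unit
variable, on which `F` is the unit. `J` preserves composition because both sides carry the
isomorphisms `G(Fᵢ(ρ) ∘ δⱼ) ∘ δᵢ` (`pushObj_assocE`).

For the multifunctor `I`, concatenations of tuples `([q], …, [q])` are again of this form. A
concatenation of iterated structure morphisms is the iterated structure morphism of the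
concatenation followed by a shuffle (`odotMap_stabE`). Naturality of a `k`-ary morphism at these
morphisms is then `k`-linearity, and the multifunctor laws hold by definition.

At level `0`, a system over the empty tuple is a single object. A system over `{0, 1}` is determined
by its value at `{1}`, since the unit conditions prescribe everything else. -/

theorem place_val {k : ℕ} {p : Fin k → ℕ} (i : Fin k) (j : Fin (p i)) :
    (place i j).val = ∑ l : Fin i.val, p (Fin.castLE i.2.le l) + j.val :=
  finSigmaFinEquiv_apply ⟨i, j⟩

/-- The blocks up to and including the `i`-th contain `place i j`, and a place of a later block lies
beyond their total length. Inside one block the order is that of the second coordinate. -/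
theorem place_lt {k : ℕ} {p : Fin k → ℕ} {i i' : Fin k} {j : Fin (p i)} {j' : Fin (p i')}
    (h : i < i' ∨ (i = i' ∧ j.val < j'.val)) : place i j < place i' j' := by
  rcases h with h | ⟨rfl, h⟩
  -- The number `n` of blocks in the sum is left free so that the last block can be split off in an
  -- induction.
  · have aux : ∀ n (hn : n ≤ k) (h' : i.val < n),
        (place i j).val < ∑ l : Fin n, p (Fin.castLE hn l) := by
      intro n
      induction n with
      | zero => intro _ h'; omega
      | succ n ih =>
        intro hn h'
        rw [Fin.sum_univ_castSucc]
        rcases Nat.lt_succ_iff_lt_or_eq.1 h' with h' | rfl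
        · exact Nat.lt_add_right _ (ih (by omega) h')
        · rw [place_val]
          exact Nat.add_lt_add_left j.2 _
    rw [Fin.lt_def, place_val i' j']
    exact Nat.lt_add_right _ (aux _ _ h)
  · rw [Fin.lt_def, place_val, place_val]
    omega

theorem place_lt_iff {k : ℕ} {p : Fin k → ℕ} {i i' : Fin k} {j : Fin (p i)} {j' : Fin (p i')} :
    place i j < place i' j' ↔ i < i' ∨ (i = i' ∧ j.val < j'.val) := by
  refine ⟨fun h => ?_, place_lt⟩
  rcases lt_trichotomy i i' with h' | h' | h'
  · exact Or.inl h'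
  · refine Or.inr ⟨h', ?_⟩
    subst h'
    by_contra h''
    rcases (not_lt.1 h'').lt_or_eq with e | e
    · exact absurd h (place_lt (Or.inr ⟨rfl, e⟩)).asymm
    · rw [Fin.ext e] at h
      exact lt_irrefl _ h
  · exact absurd h (place_lt (Or.inl h')).asymm

/-- Block lengths often agree only propositionally; comparing places by value avoids transports
along such equalities. -/
theorem place_val_congr {k : ℕ} {p p' : Fin k → ℕ} (hp : p = p') {i i' : Fin k} {j : Fin (p i)}
    {j' : Fin (p' i')} (hi : i = i') (hj : j.val = j'.val) :
    (place i j).val = (place i' j').val := by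
  subst hp; subst hi; rw [Fin.ext hj]

/-- A bijection of initial segments of the natural numbers that preserves values. -/
def PreservesVal {n m : ℕ} (e : Fin n ≃ Fin m) : Prop := ∀ i, (e i).val = i.val

/-- A strictly monotone bijection is an order isomorphism, and a finite ordinal has no order
automorphism except the identity. -/
theorem preservesVal_of_strictMono {n m : ℕ} (e : Fin n ≃ Fin m) (h : StrictMono e) :
    PreservesVal e := by
  obtain rfl : n = m := by simpa using Fintype.card_congr e
  have : h.orderIsoOfSurjective _ e.surjective = OrderIso.refl _ := Subsingleton.elim _ _
  intro i
  exact congrArg Fin.val (DFunLike.congr_fun this i)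

/-- In both bracketings the places are ordered lexicographically by block, entry of the block and
place of the entry, so regrouping is monotone. -/
theorem preservesVal_blockAssoc {n : ℕ} (k : Fin n → ℕ) (l : Fin (∑ i, k i) → ℕ) :
    PreservesVal (blockAssoc k l) := by
  refine preservesVal_of_strictMono _ fun s s' h => ?_
  obtain ⟨i, t, rfl⟩ := exists_place' s
  obtain ⟨j, x, rfl⟩ := exists_place' t
  obtain ⟨i', t', rfl⟩ := exists_place' s'
  obtain ⟨j', x', rfl⟩ := exists_place' t'
  rw [blockAssoc_place, blockAssoc_place]
  refine place_lt ?_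
  rcases place_lt_iff.1 h with h | ⟨rfl, h⟩
  · exact Or.inl (place_lt (Or.inl h))
  · rcases place_lt_iff.1 (Fin.lt_def.2 h) with h | ⟨rfl, h⟩
    · exact Or.inl (place_lt (Or.inr ⟨rfl, h⟩))
    · exact Or.inr ⟨rfl, h⟩

theorem preservesVal_unitPlaces (p : Fin 1 → ℕ) : PreservesVal (unitPlaces p) := fun i => by
  rw [unitPlaces_apply, place_val]
  simp

/-- The identification of a tuple with the concatenation of a family of tuples of length one. -/
def singlePlaces (n : ℕ) : Fin n ≃ Fin (∑ _i : Fin n, 1) where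
  toFun i := place (p := fun _ => 1) i 0
  invFun s := (finSigmaFinEquiv.symm s).1
  left_inv i := congrArg Sigma.fst (finSigmaFinEquiv.symm_apply_apply (⟨i, 0⟩ : Σ _ : Fin n, Fin 1))
  right_inv s := by
    obtain ⟨i, j, rfl⟩ := exists_place' (p := fun _ : Fin n => 1) s
    obtain rfl := Subsingleton.elim j 0
    exact congrArg (fun x : Σ _ : Fin n, Fin 1 => place (p := fun _ => 1) x.1 0)
      (finSigmaFinEquiv.symm_apply_apply (⟨i, 0⟩ : Σ _ : Fin n, Fin 1))

theorem preservesVal_singlePlaces (n : ℕ) : PreservesVal (singlePlaces n) :=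
  preservesVal_of_strictMono _ fun _ _ h => place_lt (Or.inl h)

theorem PreservesVal.eq {n m : ℕ} {e : Fin n ≃ Fin m} (h : PreservesVal e) : n = m := by
  simpa using Fintype.card_congr e

/-- In a multicategory with `act_refl`, order preserving identifications act trivially. -/
theorem act_heq {M : CatMultiData.{u, v, w}}
    (H : ∀ {k : ℕ} (a : Fin k → M.Obj) (b : M.Obj), M.act (Equiv.refl (Fin k)) a b = 𝟭 _)
    {k l : ℕ} {e : Fin k ≃ Fin l} (he : PreservesVal e) (a : Fin l → M.Obj) (b : M.Obj)
    (f : M.Hom (fun i => a (e i)) b) : HEq ((M.act e a b).obj f) f := by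
  obtain rfl := he.eq
  obtain rfl : e = Equiv.refl _ := Equiv.ext fun i => Fin.ext (he i)
  exact heq_of_eq (Functor.congr_obj (H a b) f)

theorem act_map_heq {M : CatMultiData.{u, v, w}}
    (H : ∀ {k : ℕ} (a : Fin k → M.Obj) (b : M.Obj), M.act (Equiv.refl (Fin k)) a b = 𝟭 _)
    {k l : ℕ} {e : Fin k ≃ Fin l} (he : PreservesVal e) (a : Fin l → M.Obj) (b : M.Obj)
    {f g : M.Hom (fun i => a (e i)) b} (φ : f ⟶ g) : HEq ((M.act e a b).map φ) φ := by
  obtain rfl := he.eq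
  obtain rfl : e = Equiv.refl _ := Equiv.ext fun i => Fin.ext (he i)
  exact functor_map_heq (H a b) φ

/-! ### Categories with permutation actions -/

/-- Categories indexed by tuples of objects of `Δᵒᵖ`, with an action of the permutations of the
tuples. -/
structure PermCat where
  obj : EObj → Type u
  [cat : ∀ a, SmallCategory (obj a)]
  perm : ∀ {a b : EObj} (e : Fin a.r ≃ Fin b.r), (∀ i, b.m (e i) = a.m i) → (obj a ⥤ obj b)
  perm_refl : ∀ a, perm (Equiv.refl (Fin a.r)) (fun _ => rfl) = 𝟭 (obj a)
  perm_trans : ∀ {a b c : EObj} (e : Fin a.r ≃ Fin b.r) (h : ∀ i, b.m (e i) = a.m i)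
    (e' : Fin b.r ≃ Fin c.r) (h' : ∀ i, c.m (e' i) = b.m i),
    perm e h ⋙ perm e' h' = perm (e.trans e') fun i => (h' (e i)).trans (h i)

attribute [instance] PermCat.cat

/-- The arrows of all the categories of a family. -/
structure PermCat.Tot (P : PermCat.{u}) : Type u where
  shape : EObj
  arrow : Arrow (P.obj shape)

namespace PermCat

variable {P : PermCat.{u}}

/-- The action of a permutation on an arrow. -/
def Tot.push (t : P.Tot) {n n' : ℕ} (h : t.shape.r = n) (e : Fin n ≃ Fin n') : P.Tot :=
  ⟨⟨n', fun s => t.shape.m (Fin.cast h.symm (e.symm s))⟩,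
    (P.perm (a := t.shape) (b := ⟨n', fun s => t.shape.m (Fin.cast h.symm (e.symm s))⟩)
      ((finCongr h).trans e) fun i => by simp).mapArrow.obj t.arrow⟩

/-- The condition `h` determines the entries of `b`, so `b` is the shape that `Tot.push` constructs.
The action can then be computed with a target given in advance, such as a concatenation. -/
theorem Tot.push_mk {a b : EObj} (t : Arrow (P.obj a)) (e : Fin a.r ≃ Fin b.r)
    (h : ∀ i, b.m (e i) = a.m i) :
    Tot.push (P := P) ⟨a, t⟩ rfl e = ⟨b, (P.perm e h).mapArrow.obj t⟩ := by
  obtain ⟨r, m⟩ := b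
  change Fin a.r ≃ Fin r at e
  change ∀ i, m (e i) = a.m i at h
  have hm : m = fun s => a.m (e.symm s) := funext fun s => by rw [← h, e.apply_symm_apply]
  subst hm
  rfl

/-- The two bijections live on initial segments whose lengths are only propositionally equal, hence
the comparison by values. The two laws on the equivariance of composition end in a comparison of
this kind. -/
theorem Tot.push_congr {t t' : P.Tot} (ht : t = t') {n n' m m' : ℕ}
    (h : t.shape.r = n) (h' : t'.shape.r = m)
    (e : Fin n ≃ Fin n') (e' : Fin m ≃ Fin m')
    (he : ∀ (i : Fin n) (i' : Fin m), i.val = i'.val → (e i).val = (e' i').val) :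
    t.push h e = t'.push h' e' := by
  subst ht; subst h; subst h'
  obtain rfl : n' = m' := by
    have h₁ : t.shape.r = n' := by simpa using Fintype.card_congr e
    have h₂ : t.shape.r = m' := by simpa using Fintype.card_congr e'
    exact h₁.symm.trans h₂
  obtain rfl : e = e' := Equiv.ext fun i => Fin.ext (he i i rfl)
  rfl

/-- The shape is part of an element of `Tot`, so a regrouping of the places which keeps their values
is the identity map and not merely an isomorphism. This is where the identifications between
bracketings disappear. -/
theorem Tot.push_eq_self (t : P.Tot) {n n' : ℕ} (h : t.shape.r = n) {e : Fin n ≃ Fin n'}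
    (he : PreservesVal e) : t.push h e = t := by
  refine (Tot.push_congr rfl h rfl e (Equiv.refl _) fun i i' hi => (he i).trans hi).trans ?_
  obtain ⟨a, t⟩ := t
  refine (Tot.push_mk t (Equiv.refl _) fun _ => rfl).trans ?_
  rw [P.perm_refl]
  rfl

theorem Tot.push_push (t : P.Tot) {n n' n'' : ℕ} (h : t.shape.r = n) (e : Fin n ≃ Fin n')
    (e' : Fin n' ≃ Fin n'') : (t.push h e).push rfl e' = t.push h (e.trans e') := by
  subst h
  obtain ⟨a, t⟩ := t
  -- `b` and `c` are the shapes that two successive applications of `Tot.push` produce, so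
  -- `Tot.push_mk` applies with them as targets.
  let b : EObj := ⟨n', fun s => a.m (e.symm s)⟩
  let c : EObj := ⟨n'', fun s => a.m (e.symm (e'.symm s))⟩
  have h₁ : ∀ i, b.m (e i) = a.m i := fun i => by simp [b]
  have h₂ : ∀ i, c.m (e' i) = b.m i := fun i => by simp [b, c]
  have e₁ := Tot.push_mk (P := P) (a := a) (b := b) t e h₁
  have e₂ := Tot.push_mk (P := P) (a := b) (b := c) ((P.perm e h₁).mapArrow.obj t) e' h₂
  have e₃ := Tot.push_mk (P := P) (a := a) (b := c) t (e.trans e') fun i => (h₂ (e i)).trans (h₁ i)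
  refine Eq.trans ?_ (e₂.trans (Eq.trans ?_ e₃.symm))
  · refine Tot.push_congr e₁ _ _ _ _ fun i i' hi => ?_
    exact congrArg (fun i : Fin n' => (e' i).val) (Fin.ext hi)
  · exact congrArg (fun F : P.obj a ⥤ P.obj c => (⟨c, F.mapArrow.obj t⟩ : P.Tot))
      (P.perm_trans (a := a) (b := b) (c := c) e h₁ e' h₂)

end PermCat

/-- Blocks that keep their order keep the lexicographic order of all their places. -/
theorem preservesVal_blockPerm {k l : ℕ} {e : Fin k ≃ Fin l} (he : PreservesVal e)
    (p : Fin l → ℕ) : PreservesVal (blockPerm e p) := by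
  refine preservesVal_of_strictMono _ fun s s' h => ?_
  obtain ⟨i, t, rfl⟩ := exists_place' s
  obtain ⟨i', t', rfl⟩ := exists_place' s'
  rw [blockPerm_place, blockPerm_place]
  rcases place_lt_iff.1 h with h | ⟨rfl, h⟩
  · exact place_lt (Or.inl (by rwa [Fin.lt_def, he, he]))
  · exact place_lt (Or.inr ⟨rfl, h⟩)

/-- The axioms for the `k`-ary morphisms of a symmetric multicategory, up to a relation `r`. The
identifications of index sets are expressed by the action of order preserving bijections. -/
structure CatMultiData.ObjLaws (M : CatMultiData.{u, v, w})
    (r : ∀ ⦃k : ℕ⦄ ⦃a : Fin k → M.Obj⦄ ⦃b : M.Obj⦄, M.Hom a b → M.Hom a b → Prop) : Prop where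
  one_comp : ∀ {k : Fin 1 → ℕ} (a : Fin (∑ i, k i) → M.Obj) (c : M.Obj)
    (f : ∀ i : Fin 1, M.Hom (fun j => a (place i j)) c),
    r ((M.comp a (fun _ => c) c).obj (M.one c, f)) ((M.act (unitPlaces k) a c).obj (f 0))
  comp_one : ∀ {n : ℕ} (c : M.Obj) (a : Fin (∑ _i : Fin n, 1) → M.Obj)
    (g : ∀ i : Fin n, M.Hom (fun j : Fin 1 => a (place (p := fun _ => 1) i j))
      (a (singlePlaces n i)))
    (_ : ∀ i, HEq (g i) (M.one (a (singlePlaces n i))))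
    (f : M.Hom (fun i => a (singlePlaces n i)) c),
    r ((M.comp (k := fun _ => 1) a _ c).obj (f, g)) ((M.act (singlePlaces n) a c).obj f)
  assoc : ∀ {n : ℕ} {k : Fin n → ℕ} {l : Fin (∑ i, k i) → ℕ} (a : Fin (∑ s, l s) → M.Obj)
    (b : Fin (∑ i, k i) → M.Obj) (c : Fin n → M.Obj) (d : M.Obj) (h : M.Hom c d)
    (g : ∀ i, M.Hom (fun j => b (place i j)) (c i))
    (f : ∀ s, M.Hom (fun t => a (place s t)) (b s))
    (f' : ∀ i j, M.Hom (fun t => a (blockAssoc k l (place i (place j t)))) (b (place i j)))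
    (_ : ∀ i j, HEq (f' i j) (f (place i j))),
    r ((M.comp a b d).obj ((M.comp b c d).obj (h, g), f))
      ((M.act (blockAssoc k l) a d).obj ((M.comp (fun t => a (blockAssoc k l t)) c d).obj
        (h, fun i => (M.comp (fun t => a (blockAssoc k l (place i t)))
          (fun j => b (place i j)) (c i)).obj (g i, f' i))))
  act_refl : ∀ {k : ℕ} (a : Fin k → M.Obj) (b : M.Obj) (f : M.Hom a b),
    r ((M.act (Equiv.refl (Fin k)) a b).obj f) f
  act_trans : ∀ {k l m : ℕ} (e : Fin k ≃ Fin l) (e' : Fin l ≃ Fin m) (a : Fin m → M.Obj)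
    (b : M.Obj) (f : M.Hom (fun i => a (e' (e i))) b), r ((M.act (e.trans e') a b).obj f)
      ((M.act e' a b).obj ((M.act e (fun i => a (e' i)) b).obj f))
  act_comp : ∀ {n n' : ℕ} (e : Fin n ≃ Fin n') {k : Fin n' → ℕ} (a : Fin (∑ i, k i) → M.Obj)
    (b : Fin n' → M.Obj) (c : M.Obj) (f : M.Hom (fun i => b (e i)) c)
    (g : ∀ i, M.Hom (fun j => a (place i j)) (b i))
    (g' : ∀ i, M.Hom (fun j => a (blockPerm e k (place i j))) (b (e i)))
    (_ : ∀ i, HEq (g' i) (g (e i))),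
    r ((M.comp a b c).obj ((M.act e b c).obj f, g))
      ((M.act (blockPerm e k) a c).obj
        ((M.comp (fun s => a (blockPerm e k s)) (fun i => b (e i)) c).obj (f, g')))
  comp_act : ∀ {n : ℕ} {k k' : Fin n → ℕ} (e : ∀ i, Fin (k i) ≃ Fin (k' i))
    (a : Fin (∑ i, k' i) → M.Obj) (b : Fin n → M.Obj) (c : M.Obj) (f : M.Hom b c)
    (g : ∀ i, M.Hom (fun j => a (place i (e i j))) (b i))
    (g' : ∀ i, M.Hom (fun j => a (blockSum e (place i j))) (b i))
    (_ : ∀ i, HEq (g' i) (g i)),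
    r ((M.comp a b c).obj (f, fun i => (M.act (e i) (fun j => a (place i j)) (b i)).obj (g i)))
      ((M.act (blockSum e) a c).obj ((M.comp (fun s => a (blockSum e s)) b c).obj (f, g')))

/-- The axioms can be checked separately on two pieces of structure and then combined. For
multilinear functors the two pieces are the underlying functors and the distributivity isomorphisms.
-/
theorem CatMultiData.ObjLaws.imp {M : CatMultiData.{u, v, w}}
    {r r' r'' : ∀ ⦃k : ℕ⦄ ⦃a : Fin k → M.Obj⦄ ⦃b : M.Obj⦄, M.Hom a b → M.Hom a b → Prop}
    (h : M.ObjLaws r) (h' : M.ObjLaws r')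
    (H : ∀ ⦃k : ℕ⦄ ⦃a : Fin k → M.Obj⦄ ⦃b : M.Obj⦄ (f f' : M.Hom a b), r f f' → r' f f' → r'' f f') :
    M.ObjLaws r'' where
  one_comp a c f := H _ _ (h.one_comp a c f) (h'.one_comp a c f)
  comp_one c a g hg f := H _ _ (h.comp_one c a g hg f) (h'.comp_one c a g hg f)
  assoc a b c d p g f f' hf := H _ _ (h.assoc a b c d p g f f' hf) (h'.assoc a b c d p g f f' hf)
  act_refl a b f := H _ _ (h.act_refl a b f) (h'.act_refl a b f)
  act_trans e e' a b f := H _ _ (h.act_trans e e' a b f) (h'.act_trans e e' a b f)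
  act_comp e _ a b c f g g' hg := H _ _ (h.act_comp e a b c f g g' hg)
    (h'.act_comp e a b c f g g' hg)
  comp_act e a b c f g g' hg := H _ _ (h.comp_act e a b c f g g' hg)
    (h'.comp_act e a b c f g g' hg)

/-- A realization of the cells of a multicategory as functions on tuples of arrows. The function of
a cell `φ : F ⟶ G` sends a tuple of arrows `f : x ⟶ y` to `F(f) ≫ φ y`. -/
structure Realization (M : CatMultiData.{u, v, w}) where
  Q : Type
  R : M.Obj → Q → PermCat.{u'}
  T : ∀ {k : ℕ} {a : Fin k → M.Obj} {b : M.Obj} {f g : M.Hom a b} (_ : f ⟶ g) (q : Q),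
    (∀ i, (R (a i) q).Tot) → (R b q).Tot
  T_r : ∀ {k : ℕ} {a : Fin k → M.Obj} {b : M.Obj} {f g : M.Hom a b} (φ : f ⟶ g) (q : Q)
    (x : ∀ i, (R (a i) q).Tot), (T φ q x).shape.r = ∑ i, (x i).shape.r
  T_push : ∀ {k : ℕ} {a : Fin k → M.Obj} {b : M.Obj} {f g : M.Hom a b} (φ : f ⟶ g) (q : Q)
    (x : ∀ i, (R (a i) q).Tot) {n : Fin k → ℕ} (e : ∀ i, Fin (x i).shape.r ≃ Fin (n i)),
    T φ q (fun i => (x i).push rfl (e i)) = (T φ q x).push (T_r φ q x) (blockSum e)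
  T_one : ∀ (a : M.Obj) (q : Q) (x : Fin 1 → (R a q).Tot), T (𝟙 (M.one a)) q x = x 0
  T_comp : ∀ {n : ℕ} {k : Fin n → ℕ} {a : Fin (∑ i, k i) → M.Obj} {b : Fin n → M.Obj} {c : M.Obj}
    {f f' : M.Hom b c} {g g' : ∀ i, M.Hom (fun j => a (place i j)) (b i)} (φ : f ⟶ f') (ψ : g ⟶ g')
    (q : Q) (x : ∀ s, (R (a s) q).Tot),
    T ((M.comp a b c).map ((φ, ψ) : (f, g) ⟶ (f', g'))) q x =
      T φ q fun i => T (ψ i) q fun j => x (place i j)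
  T_act : ∀ {k l : ℕ} (e : Fin k ≃ Fin l) {a : Fin l → M.Obj} {b : M.Obj}
    {f g : M.Hom (fun i => a (e i)) b} (φ : f ⟶ g) (q : Q) (x : ∀ i, (R (a i) q).Tot),
    T ((M.act e a b).map φ) q x = (T φ q fun i => x (e i)).push (T_r φ q fun i => x (e i))
      (blockPerm e fun i => (x i).shape.r)
  ext : ∀ {k : ℕ} {a : Fin k → M.Obj} {b : M.Obj} {f g f' g' : M.Hom a b} (φ : f ⟶ g)
    (ψ : f' ⟶ g'), f = f' → g = g' → (∀ q x, T φ q x = T ψ q x) → HEq φ ψ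

/-! ### The axioms of a multicategory as identities between functions on tuples of arrows. -/

namespace Realization

variable {M : CatMultiData.{u, v, w}} (N : Realization.{u, v, w, u'} M)

/-- The inner cells on the two sides of an axiom have source tuples that are equal only
propositionally, and the cells are related by heterogeneous equality. Once the sources are
identified, nothing remains to be shown. -/
theorem T_congr {k : ℕ} {a a' : Fin k → M.Obj} (ha : a = a') {b : M.Obj} {f g : M.Hom a b}
    {f' g' : M.Hom a' b} (hf : HEq f f') (hg : HEq g g') {φ : f ⟶ g} {φ' : f' ⟶ g'}
    (hφ : HEq φ φ') (q : N.Q) {x : ∀ i, (N.R (a i) q).Tot} {x' : ∀ i, (N.R (a' i) q).Tot}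
    (hx : ∀ i, HEq (x i) (x' i)) : N.T φ q x = N.T φ' q x' := by
  subst ha; cases hf; cases hg; cases hφ
  obtain rfl : x = x' := funext fun i => eq_of_heq (hx i)
  rfl

theorem T_id_congr {k : ℕ} {a a' : Fin k → M.Obj} (ha : a = a') {b : M.Obj} {f : M.Hom a b}
    {f' : M.Hom a' b} (hf : HEq f f') (q : N.Q) {x : ∀ i, (N.R (a i) q).Tot}
    {x' : ∀ i, (N.R (a' i) q).Tot} (hx : ∀ i, HEq (x i) (x' i)) :
    N.T (𝟙 f) q x = N.T (𝟙 f') q x' := by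
  subst ha; cases hf
  exact N.T_congr rfl HEq.rfl HEq.rfl HEq.rfl q hx

/-- The permutation in `T_act` moves whole blocks, and these keep their order. -/
theorem T_act_preservesVal {k l : ℕ} {e : Fin k ≃ Fin l} (he : PreservesVal e)
    {a : Fin l → M.Obj} {b : M.Obj} {f g : M.Hom (fun i => a (e i)) b} (φ : f ⟶ g) (q : N.Q)
    (x : ∀ i, (N.R (a i) q).Tot) :
    N.T ((M.act e a b).map φ) q x = N.T φ q fun i => x (e i) := by
  exact (N.T_act e φ q x).trans (PermCat.Tot.push_eq_self _ _ (preservesVal_blockPerm he _))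

/-- Composition is substitution, and the identity morphism is realized by the projection to its only
argument. -/
theorem T_one_comp {k : Fin 1 → ℕ} (a : Fin (∑ i, k i) → M.Obj) (c : M.Obj)
    (f f' : ∀ i : Fin 1, M.Hom (fun j => a (place i j)) c) (φ : f ⟶ f') (q : N.Q)
    (x : ∀ i, (N.R (a i) q).Tot) :
    N.T ((M.comp a (fun _ => c) c).map ((𝟙 (M.one c), φ) : (M.one c, f) ⟶ (M.one c, f'))) q x =
      N.T ((M.act (unitPlaces k) a c).map (φ 0)) q x := by
  rw [N.T_comp]
  exact (N.T_one c q _).trans (N.T_act_preservesVal (preservesVal_unitPlaces k) (φ 0) q x).symm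

/-- Every inner function is the projection to its only argument, so the substitution gives `T φ` its
original arguments. The morphism `g i` is an identity only after its one-entry source is identified,
which explains the heterogeneous hypothesis. -/
theorem T_comp_one {n : ℕ} (c : M.Obj) (a : Fin (∑ _i : Fin n, 1) → M.Obj)
    (g : ∀ i : Fin n, M.Hom (fun j : Fin 1 => a (place (p := fun _ => 1) i j))
      (a (singlePlaces n i)))
    (hg : ∀ i, HEq (g i) (M.one (a (singlePlaces n i))))
    (f f' : M.Hom (fun i => a (singlePlaces n i)) c) (φ : f ⟶ f') (q : N.Q)
    (x : ∀ i, (N.R (a i) q).Tot) :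
    N.T ((M.comp (k := fun _ => 1) a _ c).map ((φ, 𝟙 g) : (f, g) ⟶ (f', g))) q x =
      N.T ((M.act (singlePlaces n) a c).map φ) q x := by
  rw [N.T_comp, N.T_act_preservesVal (preservesVal_singlePlaces n)]
  refine congrArg (N.T φ q) (funext fun i => ?_)
  refine (N.T_id_congr (funext fun j => ?_) (hg i) q (x' := fun _ => x (singlePlaces n i))
    fun j => ?_).trans (N.T_one _ q _)
  all_goals
    obtain rfl := Subsingleton.elim j 0
    rfl

/-- Substitution is associative. The arguments of the two sides are indexed by the two bracketings,
and `blockAssoc` preserves values. The primed families are the unprimed ones read along this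
reindexing. -/
theorem T_assoc {n : ℕ} {k : Fin n → ℕ} {l : Fin (∑ i, k i) → ℕ} (a : Fin (∑ s, l s) → M.Obj)
    (b : Fin (∑ i, k i) → M.Obj) (c : Fin n → M.Obj) (d : M.Obj) (h h₁ : M.Hom c d)
    (g g₁ : ∀ i, M.Hom (fun j => b (place i j)) (c i))
    (f f₁ : ∀ s, M.Hom (fun t => a (place s t)) (b s))
    (f' f₁' : ∀ i j, M.Hom (fun t => a (blockAssoc k l (place i (place j t)))) (b (place i j)))
    (hf : ∀ i j, HEq (f' i j) (f (place i j))) (hf₁ : ∀ i j, HEq (f₁' i j) (f₁ (place i j)))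
    (χ : h ⟶ h₁) (ψ : g ⟶ g₁) (φ : f ⟶ f₁) (φ' : ∀ i j, f' i j ⟶ f₁' i j)
    (hφ : ∀ i j, HEq (φ' i j) (φ (place i j))) (q : N.Q) (x : ∀ i, (N.R (a i) q).Tot) :
    N.T ((M.comp a b d).map
        (((M.comp b c d).map ((χ, ψ) : (h, g) ⟶ (h₁, g₁)), φ) :
          ((M.comp b c d).obj (h, g), f) ⟶ ((M.comp b c d).obj (h₁, g₁), f₁))) q x =
      N.T ((M.act (blockAssoc k l) a d).map ((M.comp (fun t => a (blockAssoc k l t)) c d).map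
        ((χ, fun i => (M.comp (fun t => a (blockAssoc k l (place i t)))
            (fun j => b (place i j)) (c i)).map ((ψ i, φ' i) : (g i, f' i) ⟶ (g₁ i, f₁' i))) :
          (h, fun i => (M.comp (fun t => a (blockAssoc k l (place i t)))
            (fun j => b (place i j)) (c i)).obj (g i, f' i)) ⟶
          (h₁, fun i => (M.comp (fun t => a (blockAssoc k l (place i t)))
            (fun j => b (place i j)) (c i)).obj (g₁ i, f₁' i))))) q x := by
  rw [N.T_comp, N.T_comp, N.T_act_preservesVal (preservesVal_blockAssoc k l), N.T_comp]
  refine congrArg (N.T χ q) (funext fun i => ?_)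
  refine Eq.trans ?_ (N.T_comp (ψ i) (φ' i) q fun s => x (blockAssoc k l (place i s))).symm
  refine congrArg (N.T (ψ i) q) (funext fun j => ?_)
  refine (N.T_congr (funext fun t => ?_) (hf i j) (hf₁ i j) (hφ i j) q fun t => ?_).symm
  · rw [blockAssoc_place]
  · rw [blockAssoc_place]

theorem T_act_refl {k : ℕ} (a : Fin k → M.Obj) (b : M.Obj) {f g : M.Hom a b} (φ : f ⟶ g) (q : N.Q)
    (x : ∀ i, (N.R (a i) q).Tot) :
    N.T ((M.act (Equiv.refl (Fin k)) a b).map φ) q x = N.T φ q x :=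
  N.T_act_preservesVal (e := Equiv.refl (Fin k)) (fun _ => rfl) φ q x

theorem blockPerm_trans {k l m : ℕ} (e : Fin k ≃ Fin l) (e' : Fin l ≃ Fin m) (p : Fin m → ℕ) :
    blockPerm (e.trans e') p = (blockPerm e fun i => p (e' i)).trans (blockPerm e' p) :=
  equiv_ext_place (p := fun i => p (e' (e i))) fun i j => by
    rw [Equiv.trans_apply, blockPerm_place e fun i => p (e' i), blockPerm_place]
    exact blockPerm_place (e.trans e') p i j

theorem push_T_congr {P : PermCat.{u'}} {t t' : P.Tot} (ht : t = t') {n n' : ℕ} (h : t.shape.r = n)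
    {e e' : Fin n ≃ Fin n'} (he : e = e') : t.push h e = t'.push (ht ▸ h) e' := by
  subst ht; subst he; rfl

/-- Permuting the variables twice permutes the blocks of the result twice, and the actions on `Tot`
compose. -/
theorem T_act_trans {k l m : ℕ} (e : Fin k ≃ Fin l) (e' : Fin l ≃ Fin m) (a : Fin m → M.Obj)
    (b : M.Obj) {f g : M.Hom (fun i => a (e' (e i))) b} (φ : f ⟶ g) (q : N.Q)
    (x : ∀ i, (N.R (a i) q).Tot) : N.T ((M.act (e.trans e') a b).map φ) q x =
      N.T ((M.act e' a b).map ((M.act e (fun i => a (e' i)) b).map φ)) q x := by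
  rw [N.T_act (e.trans e') φ q x, N.T_act e']
  refine Eq.trans ?_ (push_T_congr (N.T_act e φ q fun i => x (e' i)).symm rfl rfl)
  rw [PermCat.Tot.push_push]
  exact push_T_congr rfl _ (blockPerm_trans e e' _)

/-- Here `p i` is the total length of the entries of the `i`-th block. Moving this block as a whole,
or moving its entries one after another, sends the place `t` of the `j`-th entry of the block `e i`
to the same position. -/
theorem blockPerm_blockPerm_val {n n' : ℕ} (e : Fin n ≃ Fin n') (k : Fin n' → ℕ)
    (l : Fin (∑ i, k i) → ℕ) (p : Fin n' → ℕ) (hp : ∀ i, p i = ∑ j, l (place i j))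
    (s : Fin (∑ i, p (e i))) (s' : Fin (∑ s, l (blockPerm e k s))) (h : s.val = s'.val) :
    (blockPerm e p s).val = (blockPerm (blockPerm e k) l s').val := by
  obtain rfl : p = _ := funext hp
  obtain ⟨i, t, rfl⟩ := exists_place' s
  obtain ⟨j, t, rfl⟩ := exists_place' t
  have hl := congrArg l (blockPerm_place e k i j)
  -- This is the same position in the other bracketing; it has the same value because `blockAssoc`
  -- preserves values.
  obtain rfl : place (place i j) (Fin.cast hl.symm t) = s' := Fin.ext (by
    rw [← h, ← blockAssoc_place, preservesVal_blockAssoc]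
    exact place_val_congr (funext fun i => Finset.sum_congr rfl fun j _ =>
      congrArg l (blockPerm_place e k i j)) rfl (place_val_congr (funext fun j =>
        congrArg l (blockPerm_place e k i j)) rfl rfl))
  rw [blockPerm_place e _ i, blockPerm_place, ← preservesVal_blockAssoc, blockAssoc_place]
  exact place_val_congr rfl (blockPerm_place e k i j).symm rfl

/-- In each block, `ε i` permutes whole entries according to `e i`. Side by side these permutations
move the entries of the full concatenation according to `blockSum e`. -/
theorem blockSum_blockPerm_val {n : ℕ} {k k' : Fin n → ℕ} (e : ∀ i, Fin (k i) ≃ Fin (k' i))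
    (l : Fin (∑ i, k' i) → ℕ) {p : Fin n → ℕ} (hp : ∀ i, p i = ∑ j, l (place i (e i j)))
    (ε : ∀ i, Fin (p i) ≃ Fin (∑ j, l (place i j)))
    (hε : ∀ i s s', s.val = s'.val →
      (ε i s).val = (blockPerm (e i) (fun j => l (place i j)) s').val)
    (s : Fin (∑ i, p i)) (s' : Fin (∑ s, l (blockSum e s))) (h : s.val = s'.val) :
    (blockSum ε s).val = (blockPerm (blockSum e) l s').val := by
  obtain rfl : p = _ := funext hp
  obtain rfl : ε = fun i => blockPerm (e i) fun j => l (place i j) :=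
    funext fun i => Equiv.ext fun s => Fin.ext (hε i s s rfl)
  obtain ⟨i, t, rfl⟩ := exists_place' s
  obtain ⟨j, t, rfl⟩ := exists_place' t
  have hl := congrArg l (blockSum_place e i j)
  obtain rfl : place (place i j) (Fin.cast hl.symm t) = s' := Fin.ext (by
    rw [← h, ← blockAssoc_place, preservesVal_blockAssoc]
    exact place_val_congr (funext fun i => Finset.sum_congr rfl fun j _ =>
      congrArg l (blockSum_place e i j)) rfl (place_val_congr (funext fun j =>
        congrArg l (blockSum_place e i j)) rfl rfl))
  rw [blockSum_place, blockPerm_place (e i) fun j => l (place i j), blockPerm_place (blockSum e),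
    ← preservesVal_blockAssoc, blockAssoc_place]
  exact place_val_congr rfl (blockSum_place e i j).symm rfl

/-- Both sides evaluate `φ` on the same inner results, taken in the order given by `e`. Afterwards
one side permutes these results as blocks and the other permutes all entries, which is the same
permutation of places by `blockPerm_blockPerm_val`. -/
theorem T_act_comp {n n' : ℕ} (e : Fin n ≃ Fin n') {k : Fin n' → ℕ}
    (a : Fin (∑ i, k i) → M.Obj) (b : Fin n' → M.Obj) (c : M.Obj)
    (f f₁ : M.Hom (fun i => b (e i)) c) (g g₁ : ∀ i, M.Hom (fun j => a (place i j)) (b i))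
    (g' g₁' : ∀ i, M.Hom (fun j => a (blockPerm e k (place i j))) (b (e i)))
    (hg : ∀ i, HEq (g' i) (g (e i))) (hg₁ : ∀ i, HEq (g₁' i) (g₁ (e i)))
    (φ : f ⟶ f₁) (ψ : g ⟶ g₁) (ψ' : g' ⟶ g₁') (hψ : ∀ i, HEq (ψ' i) (ψ (e i))) (q : N.Q)
    (x : ∀ i, (N.R (a i) q).Tot) :
    N.T ((M.comp a b c).map (((M.act e b c).map φ, ψ) :
        ((M.act e b c).obj f, g) ⟶ ((M.act e b c).obj f₁, g₁))) q x =
      N.T ((M.act (blockPerm e k) a c).map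
        ((M.comp (fun s => a (blockPerm e k s)) (fun i => b (e i)) c).map
          ((φ, ψ') : (f, g') ⟶ (f₁, g₁')))) q x := by
  have key : N.T ((M.comp (fun s => a (blockPerm e k s)) (fun i => b (e i)) c).map
      ((φ, ψ') : (f, g') ⟶ (f₁, g₁'))) q (fun s => x (blockPerm e k s)) =
      N.T φ q fun i => N.T (ψ (e i)) q fun j => x (place (e i) j) := by
    refine (N.T_comp (a := fun s => a (blockPerm e k s))
      (b := fun i => b (e i)) (g := g') (g' := g₁') φ ψ' q _).trans (congrArg (N.T φ q) (funext fun i => ?_))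
    refine N.T_congr (funext fun j => ?_) (hg i) (hg₁ i) (hψ i) q fun j => ?_
    · rw [blockPerm_place e k]
    · rw [blockPerm_place e k]
  rw [N.T_comp, N.T_act, N.T_act]
  exact PermCat.Tot.push_congr key.symm _ _ _ _ fun s s' hs => blockPerm_blockPerm_val e k
    (fun i => (x i).shape.r) (fun i => (N.T (ψ i) q fun j => x (place i j)).shape.r) (fun i => N.T_r _ _ _) s s' hs

/-- Each inner permutation acts on an argument of `T φ`. By `T_push` all of them together leave `T
φ` as a block sum, which `blockSum_blockPerm_val` identifies with the permutation of the entries. -/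
theorem T_comp_act {n : ℕ} {k k' : Fin n → ℕ} (e : ∀ i, Fin (k i) ≃ Fin (k' i))
    (a : Fin (∑ i, k' i) → M.Obj) (b : Fin n → M.Obj) (c : M.Obj) (f f₁ : M.Hom b c)
    (g g₁ : ∀ i, M.Hom (fun j => a (place i (e i j))) (b i))
    (g' g₁' : ∀ i, M.Hom (fun j => a (blockSum e (place i j))) (b i))
    (hg : ∀ i, HEq (g' i) (g i)) (hg₁ : ∀ i, HEq (g₁' i) (g₁ i))
    (φ : f ⟶ f₁) (ψ : g ⟶ g₁) (ψ' : g' ⟶ g₁') (hψ : ∀ i, HEq (ψ' i) (ψ i)) (q : N.Q)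
    (x : ∀ i, (N.R (a i) q).Tot) :
    N.T ((M.comp a b c).map
        ((φ, fun i => (M.act (e i) (fun j => a (place i j)) (b i)).map (ψ i)) :
          (f, fun i => (M.act (e i) (fun j => a (place i j)) (b i)).obj (g i)) ⟶
          (f₁, fun i => (M.act (e i) (fun j => a (place i j)) (b i)).obj (g₁ i)))) q x =
      N.T ((M.act (blockSum e) a c).map
        ((M.comp (fun s => a (blockSum e s)) b c).map ((φ, ψ') : (f, g') ⟶ (f₁, g₁')))) q x := by
  have key : N.T ((M.comp (fun s => a (blockSum e s)) b c).map ((φ, ψ') : (f, g') ⟶ (f₁, g₁'))) q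
      (fun s => x (blockSum e s)) =
      N.T φ q fun i => N.T (ψ i) q fun j => x (place i (e i j)) := by
    refine (N.T_comp (a := fun s => a (blockSum e s))
      (g := g') (g' := g₁') φ ψ' q _).trans (congrArg (N.T φ q) (funext fun i => ?_))
    refine N.T_congr (funext fun j => ?_) (hg i) (hg₁ i) (hψ i) q fun j => ?_
    · rw [blockSum_place e]
    · rw [blockSum_place e]
  have h : ∀ i, N.T ((M.act (e i) (fun j => a (place i j)) (b i)).map (ψ i)) q
      (fun j => x (place i j)) = (N.T (ψ i) q fun j => x (place i (e i j))).push rfl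
      ((finCongr (N.T_r _ _ _)).trans (blockPerm (e i) fun j => (x (place i j)).shape.r)) :=
    fun i => (N.T_act (e i) (ψ i) q fun j => x (place i j)).trans
      (PermCat.Tot.push_congr rfl _ _ _ _ fun s s' hs =>
        congrArg (fun s => (blockPerm (e i) (fun j => (x (place i j)).shape.r) s).val) (Fin.ext hs))
  rw [N.T_comp, N.T_act]
  refine ((congrArg (N.T φ q) (funext h)).trans (N.T_push φ q _ _)).trans ?_
  refine PermCat.Tot.push_congr key.symm _ _ _ _ fun s s' hs => ?_
  refine blockSum_blockPerm_val e (fun i => (x i).shape.r) (fun i => N.T_r _ _ _) _ ?_ s s' hs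
  intro i s s' hs
  exact congrArg (fun s => (blockPerm (e i) (fun j => (x (place i j)).shape.r) s).val) (Fin.ext hs)

/-- Composition is a functor, so the identity cell of a composite is a composite of identity cells.
The laws for morphisms are therefore instances of the laws for cells. -/
theorem T_id_comp {n : ℕ} {k : Fin n → ℕ} (a : Fin (∑ i, k i) → M.Obj) (b : Fin n → M.Obj)
    (c : M.Obj) (f : M.Hom b c) (g : ∀ i, M.Hom (fun j => a (place i j)) (b i)) (q : N.Q)
    (x : ∀ s, (N.R (a s) q).Tot) : N.T (𝟙 ((M.comp a b c).obj (f, g))) q x =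
      N.T ((M.comp a b c).map ((𝟙 f, fun i => 𝟙 (g i)) : (f, g) ⟶ (f, g))) q x := by
  rw [← (M.comp a b c).map_id]
  rfl

theorem T_id_act {k l : ℕ} (e : Fin k ≃ Fin l) (a : Fin l → M.Obj) (b : M.Obj)
    (f : M.Hom (fun i => a (e i)) b) (q : N.Q) (x : ∀ i, (N.R (a i) q).Tot) :
    N.T (𝟙 ((M.act e a b).obj f)) q x = N.T ((M.act e a b).map (𝟙 f)) q x := by
  rw [← (M.act e a b).map_id]

theorem id_heq {k k' : ℕ} {a : Fin k → M.Obj} {a' : Fin k' → M.Obj} {b : M.Obj} {f : M.Hom a b}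
    {f' : M.Hom a' b} (hk : k = k') (ha : HEq a a') (h : HEq f f') : HEq (𝟙 f) (𝟙 f') := by
  subst hk; cases ha; cases h; rfl

/-- The axioms of a symmetric multicategory for the functions given by the identity cells of the
`k`-ary morphisms. -/
theorem objLaws : M.ObjLaws fun _ _ _ f f' => ∀ q x, N.T (𝟙 f) q x = N.T (𝟙 f') q x where
  one_comp {k} a c f := fun q x =>
    (N.T_id_comp a (fun _ => c) c (M.one c) f q x).trans
      ((N.T_one_comp a c f f (fun i => 𝟙 (f i)) q x).trans
        (N.T_id_act (unitPlaces k) a c (f 0) q x).symm)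
  comp_one {n} c a g hg f := fun q x =>
    (N.T_id_comp (k := fun _ => 1) a (fun i => a (singlePlaces n i)) c f g q x).trans
      ((N.T_comp_one c a g hg f f (𝟙 f) q x).trans
        (N.T_id_act (singlePlaces n) a c f q x).symm)
  assoc {n k l} a b c d h g f f' hf := fun q x => by
    refine (N.T_id_comp a b d ((M.comp b c d).obj (h, g)) f q x).trans (Eq.trans ?_
      (N.T_id_act (blockAssoc k l) a d _ q x).symm)
    refine Eq.trans ?_ ((N.T_assoc a b c d h h g g f f f' f' hf hf (𝟙 h) (fun i => 𝟙 (g i))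
      (fun s => 𝟙 (f s)) (fun i j => 𝟙 (f' i j)) (fun i j => ?_) q x).trans ?_)
    · exact congrArg (fun χ : (M.comp b c d).obj (h, g) ⟶ (M.comp b c d).obj (h, g) =>
        N.T ((M.comp a b d).map ((χ, fun s => 𝟙 (f s)) :
          ((M.comp b c d).obj (h, g), f) ⟶ ((M.comp b c d).obj (h, g), f))) q x)
        ((M.comp b c d).map_id (h, g)).symm
    · exact id_heq rfl (heq_of_eq (funext fun t => congrArg a (blockAssoc_place k l i j t))) (hf i j)
    · refine congrArg (fun χ => N.T ((M.act (blockAssoc k l) a d).map χ) q x) ?_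
      refine Eq.trans ?_ ((M.comp (fun t => a (blockAssoc k l t)) c d).map_id _)
      refine congrArg (M.comp (fun t => a (blockAssoc k l t)) c d).map (Prod.ext rfl ?_)
      exact funext fun i => (M.comp (fun t => a (blockAssoc k l (place i t)))
        (fun j => b (place i j)) (c i)).map_id (g i, f' i)
  act_refl a b f := fun q x =>
    (N.T_id_act (Equiv.refl _) a b f q x).trans (N.T_act_refl a b (𝟙 f) q x)
  act_trans e e' a b f := fun q x =>
    (N.T_id_act (e.trans e') a b f q x).trans ((N.T_act_trans e e' a b (𝟙 f) q x).trans
      ((congrArg (fun χ => N.T ((M.act e' a b).map χ) q x)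
        ((M.act e (fun i => a (e' i)) b).map_id f)).trans
        (N.T_id_act e' a b ((M.act e (fun i => a (e' i)) b).obj f) q x).symm))
  act_comp {n n'} e k a b c f g g' hg := fun q x => by
    refine (N.T_id_comp a b c ((M.act e b c).obj f) g q x).trans (Eq.trans ?_
      ((N.T_act_comp e a b c f f g g g' g' hg hg (𝟙 f) (fun i => 𝟙 (g i)) (fun i => 𝟙 (g' i))
      (fun i => ?_) q x).trans (Eq.trans ?_ (N.T_id_act (blockPerm e k) a c _ q x).symm)))
    · exact congrArg (fun χ : (M.act e b c).obj f ⟶ (M.act e b c).obj f =>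
        N.T ((M.comp a b c).map ((χ, fun s => 𝟙 (g s)) :
          ((M.act e b c).obj f, g) ⟶ ((M.act e b c).obj f, g))) q x)
        ((M.act e b c).map_id f).symm
    · exact id_heq rfl (heq_of_eq (funext fun j => congrArg a (blockPerm_place e k i j))) (hg i)
    · exact congrArg (fun χ => N.T ((M.act (blockPerm e k) a c).map χ) q x)
        ((M.comp (fun s => a (blockPerm e k s)) (fun i => b (e i)) c).map_id (f, g'))
  comp_act {n k k'} e a b c f g g' hg := fun q x => by
    refine (N.T_id_comp a b c f _ q x).trans (Eq.trans ?_
      ((N.T_comp_act e a b c f f g g g' g' hg hg (𝟙 f) (fun i => 𝟙 (g i))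
      (fun i => 𝟙 (g' i)) (fun i => ?_) q x).trans (Eq.trans ?_
        (N.T_id_act (blockSum e) a c _ q x).symm)))
    · refine congrArg (fun χ => N.T ((M.comp a b c).map χ) q x) (Prod.ext rfl ?_)
      exact funext fun i => ((M.act (e i) (fun j => a (place i j)) (b i)).map_id (g i)).symm
    · exact id_heq rfl (heq_of_eq (funext fun j => congrArg a (blockSum_place e i j))) (hg i)
    · exact congrArg (fun χ => N.T ((M.act (blockSum e) a c).map χ) q x)
        ((M.comp (fun s => a (blockSum e s)) b c).map_id (f, g'))

/-- On morphisms this is part of `H`; on cells it follows because the realization separates cells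
with the same ends. -/
theorem act_refl_eq (N : Realization.{u, v, w, u'} M) (H : M.ObjLaws fun _ _ _ f f' => f = f') {k : ℕ} (a : Fin k → M.Obj) (b : M.Obj) :
    M.act (Equiv.refl (Fin k)) a b = 𝟭 _ :=
  CategoryTheory.Functor.hext (fun f => H.act_refl a b f) fun f g φ =>
    N.ext _ _ (H.act_refl a b f) (H.act_refl a b g) (N.T_act_refl a b φ)

/-- A realized multicategory whose `k`-ary morphisms satisfy the axioms is a symmetric multicategory
enriched in categories. -/
theorem isSymmetricMulticategory (N : Realization.{u, v, w, u'} M) (H : M.ObjLaws fun _ _ _ f f' => f = f') : M.IsSymmetricMulticategory where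
  one_comp a c f := (heq_of_eq (H.one_comp a c f)).trans
    (act_heq (N.act_refl_eq H) (preservesVal_unitPlaces _) a c (f 0))
  one_comp_map a c f f' φ := (N.ext _ _ (H.one_comp a c f) (H.one_comp a c f')
    (N.T_one_comp a c f f' φ)).trans
    (act_map_heq (N.act_refl_eq H) (preservesVal_unitPlaces _) a c (φ 0))
  comp_one {n} b c a g hb hg f := by
    -- Each inner morphism has one input, and `place i 0` is `singlePlaces n i` by definition. Hence
    -- the hypothesis on the sources determines `b`.
    obtain rfl : b = fun i => a (singlePlaces n i) := funext fun i => (hb i 0).symm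
    exact (heq_of_eq (H.comp_one c a g hg f)).trans
      (act_heq (N.act_refl_eq H) (preservesVal_singlePlaces n) a c f)
  comp_one_map {n} b c a g hb hg f f' φ := by
    obtain rfl : b = fun i => a (singlePlaces n i) := funext fun i => (hb i 0).symm
    exact (N.ext _ _ (H.comp_one c a g hg f) (H.comp_one c a g hg f')
      (N.T_comp_one c a g hg f f' φ)).trans
      (act_map_heq (N.act_refl_eq H) (preservesVal_singlePlaces n) a c φ)
  assoc {n k l} a b c d h g f f' hf := (heq_of_eq (H.assoc a b c d h g f f' hf)).trans
    (act_heq (N.act_refl_eq H) (preservesVal_blockAssoc k l) a d _)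
  assoc_map {n k l} a b c d h h₁ g g₁ f f₁ f' f₁' hf hf₁ χ ψ φ φ' hφ :=
    (N.ext _ _ (H.assoc a b c d h g f f' hf) (H.assoc a b c d h₁ g₁ f₁ f₁' hf₁)
      (N.T_assoc a b c d h h₁ g g₁ f f₁ f' f₁' hf hf₁ χ ψ φ φ' hφ)).trans
      (act_map_heq (N.act_refl_eq H) (preservesVal_blockAssoc k l) a d _)
  act_refl a b := N.act_refl_eq H a b
  act_trans e e' a b := CategoryTheory.Functor.hext (fun f => H.act_trans e e' a b f)
    fun f g φ => N.ext _ _ (H.act_trans e e' a b f) (H.act_trans e e' a b g)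
      (N.T_act_trans e e' a b φ)
  act_comp e _ a b c f g g' hg := H.act_comp e a b c f g g' hg
  act_comp_map e _ a b c f f₁ g g₁ g' g₁' hg hg₁ φ ψ ψ' hψ :=
    N.ext _ _ (H.act_comp e a b c f g g' hg) (H.act_comp e a b c f₁ g₁ g₁' hg₁)
      (N.T_act_comp e a b c f f₁ g g₁ g' g₁' hg hg₁ φ ψ ψ' hψ)
  comp_act e a b c f g g' hg := H.comp_act e a b c f g g' hg
  comp_act_map e a b c f f₁ g g₁ g' g₁' hg hg₁ φ ψ ψ' hψ :=
    N.ext _ _ (H.comp_act e a b c f g g' hg) (H.comp_act e a b c f₁ g₁ g₁' hg₁)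
      (N.T_comp_act e a b c f f₁ g g₁ g' g₁' hg hg₁ φ ψ ψ' hψ)

end Realization

/-! ### Natural transformations as functions on arrows -/

section Arrows

variable {A B D E : Type*} [Category A] [Category B] [Category D] [Category E]

/-- The diagonal of the naturality square of a natural transformation. -/
def arrowApp {F G : A ⥤ B} (φ : F ⟶ G) (t : Arrow A) : Arrow B :=
  Arrow.mk (F.map t.hom ≫ φ.app t.right)

theorem arrowApp_id (F : A ⥤ B) (t : Arrow A) : arrowApp (𝟙 F) t = F.mapArrow.obj t :=
  congrArg Arrow.mk (Category.comp_id _)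

/-- Naturality of `ψ` at the component of `φ` allows the two factors to be exchanged. Because of
this identity the cells are represented by diagonals of naturality squares: composition of cells
becomes composition of functions. -/
theorem arrowApp_hcomp {F G : A ⥤ B} {P Q : B ⥤ D} (φ : F ⟶ G) (ψ : P ⟶ Q) (t : Arrow A) :
    arrowApp (φ ◫ ψ) t = arrowApp ψ (arrowApp φ t) := by
  refine congrArg Arrow.mk ?_
  change P.map (F.map t.hom) ≫ ψ.app _ ≫ Q.map (φ.app _) = P.map (F.map t.hom ≫ φ.app _) ≫ ψ.app _
  rw [P.map_comp, Category.assoc, ψ.naturality]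

theorem arrowApp_whiskerRight {F G : A ⥤ B} (φ : F ⟶ G) (K : B ⥤ D) (t : Arrow A) :
    arrowApp (Functor.whiskerRight φ K) t = K.mapArrow.obj (arrowApp φ t) :=
  congrArg Arrow.mk (K.map_comp _ _).symm

theorem arrow_mk_heq {X Y X' Y' : A} {f : X ⟶ Y} {f' : X' ⟶ Y'} (hX : X = X') (hY : Y = Y')
    (h : HEq f f') : Arrow.mk f = Arrow.mk f' := by
  subst hX; subst hY; cases h; rfl

/-- The objects are recovered from the identity arrows, so no separate hypothesis about them is
required. -/
theorem functor_ext_arrow {F G : A ⥤ B} (h : ∀ t, F.mapArrow.obj t = G.mapArrow.obj t) :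
    F = G := by
  refine CategoryTheory.Functor.hext (fun x => congrArg Comma.left (h (Arrow.mk (𝟙 x)))) ?_
  intro x y f
  have h' := h (Arrow.mk f)
  have : ∀ {s t : Arrow B}, s = t → HEq s.hom t.hom := by rintro s _ rfl; rfl
  exact this h'

/-- On an identity arrow the diagonal is the component itself. -/
theorem natTrans_ext_arrow {F G : A ⥤ B} {φ ψ : F ⟶ G} (h : ∀ t, arrowApp φ t = arrowApp ψ t) :
    φ = ψ := by
  ext x
  have h' := (Arrow.mk_inj _ _).1 (h (Arrow.mk (𝟙 x)))
  change F.map (𝟙 x) ≫ φ.app x = F.map (𝟙 x) ≫ ψ.app x at h'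
  rwa [F.map_id, Category.id_comp, Category.id_comp] at h'

end Arrows

/-- The squares of functors handle the arrow, and the compatibility of the cells is used at its
target. This puts the equivariance of cells into the form in which a realization needs it. -/
theorem CellNat.arrowApp {A A' B B' : Type u} [Category.{u} A] [Category.{u} A'] [Category.{u} B]
    [Category.{u} B'] {H : A ⥤ A'} {K : B ⥤ B'} {F G : A ⥤ B} {F' G' : A' ⥤ B'} {α : F ⟶ G}
    {α' : F' ⟶ G'} (hF : H ⋙ F' = F ⋙ K) (hG : H ⋙ G' = G ⋙ K) (h : CellNat H K α α')
    (t : Arrow A) : arrowApp α' (H.mapArrow.obj t) = K.mapArrow.obj (arrowApp α t) := by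
  refine arrow_mk_heq (Functor.congr_obj hF _) (Functor.congr_obj hG _) ?_
  refine HEq.trans ?_ (heq_of_eq (K.map_comp _ _).symm)
  exact heq_comp (Functor.congr_obj hF _) (Functor.congr_obj hF _) (Functor.congr_obj hG _)
    (functor_map_heq hF t.hom) (h t.right)

/-- A family of arrows as an arrow of the product. -/
def piArrow {ι : Type} {A : ι → Type u} [∀ i, Category.{u} (A i)] (t : ∀ i, Arrow (A i)) :
    Arrow (∀ i, A i) :=
  Arrow.mk (X := fun i => (t i).left) (Y := fun i => (t i).right) fun i => (t i).hom

/-- The components of a family of cells at the tuples of objects of `Δᵒᵖ`. -/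
structure Components (M : CatMultiData.{u, v, w}) where
  Q : Type
  R : M.Obj → Q → PermCat.{u'}
  F : ∀ {k : ℕ} {a : Fin k → M.Obj} {b : M.Obj} (_ : M.Hom a b) (q : Q) (m : Fin k → EObj),
    (∀ i, (R (a i) q).obj (m i)) ⥤ (R b q).obj (odot m)
  C : ∀ {k : ℕ} {a : Fin k → M.Obj} {b : M.Obj} {f g : M.Hom a b} (_ : f ⟶ g) (q : Q)
    (m : Fin k → EObj), F f q m ⟶ F g q m
  C_id : ∀ {k : ℕ} {a : Fin k → M.Obj} {b : M.Obj} (f : M.Hom a b) (q : Q) (m : Fin k → EObj),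
    C (𝟙 f) q m = 𝟙 _
  equivariant : ∀ {k : ℕ} {a : Fin k → M.Obj} {b : M.Obj} (f : M.Hom a b) (q : Q)
    {m m' : Fin k → EObj} (e : ∀ i, Fin (m i).r ≃ Fin (m' i).r)
    (h : ∀ i j, (m' i).m (e i j) = (m i).m j) (h'),
    Functor.pi (fun i => (R (a i) q).perm (e i) (h i)) ⋙ F f q m' =
      F f q m ⋙ (R b q).perm (a := odot m) (b := odot m') (blockSum e) h'
  equivariant_cell : ∀ {k : ℕ} {a : Fin k → M.Obj} {b : M.Obj} {f g : M.Hom a b} (φ : f ⟶ g)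
    (q : Q) {m m' : Fin k → EObj} (e : ∀ i, Fin (m i).r ≃ Fin (m' i).r)
    (h : ∀ i j, (m' i).m (e i j) = (m i).m j) (h'),
    CellNat (Functor.pi fun i => (R (a i) q).perm (e i) (h i))
      ((R b q).perm (a := odot m) (b := odot m') (blockSum e) h') (C φ q m) (C φ q m')
  one : ∀ (a : M.Obj) (q : Q) (m : Fin 1 → EObj) (h),
    F (M.one a) q m = Pi.eval _ 0 ⋙ (R a q).perm (a := m 0) (b := odot m) (unitEquiv m) h
  comp : ∀ {n : ℕ} {k : Fin n → ℕ} {a : Fin (∑ i, k i) → M.Obj} {b : Fin n → M.Obj} {c : M.Obj}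
    {f f' : M.Hom b c} {g g' : ∀ i, M.Hom (fun j => a (place i j)) (b i)} (φ : f ⟶ f') (ψ : g ⟶ g')
    (q : Q) (m : Fin (∑ i, k i) → EObj) (t : ∀ s, Arrow ((R (a s) q).obj (m s))) (h),
    arrowApp (C ((M.comp a b c).map ((φ, ψ) : (f, g) ⟶ (f', g'))) q m) (piArrow t) =
      ((R c q).perm (a := odot fun i => odot fun j => m (place i j)) (b := odot m)
        (blockAssoc k fun s => (m s).r) h).mapArrow.obj
        (arrowApp (C φ q fun i => odot fun j => m (place i j))
          (piArrow fun i => arrowApp (C (ψ i) q fun j => m (place i j))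
            (piArrow fun j => t (place i j))))
  act : ∀ {k l : ℕ} (e : Fin k ≃ Fin l) {a : Fin l → M.Obj} {b : M.Obj}
    {f g : M.Hom (fun i => a (e i)) b} (φ : f ⟶ g) (q : Q) (m : Fin l → EObj)
    (t : ∀ s, Arrow ((R (a s) q).obj (m s))) (h),
    arrowApp (C ((M.act e a b).map φ) q m) (piArrow t) =
      ((R b q).perm (a := odot fun i => m (e i)) (b := odot m)
        (blockPerm e fun s => (m s).r) h).mapArrow.obj
        (arrowApp (C φ q fun i => m (e i)) (piArrow fun i => t (e i)))
  ext : ∀ {k : ℕ} {a : Fin k → M.Obj} {b : M.Obj} {f g : M.Hom a b} (φ ψ : f ⟶ g),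
    (∀ q m, C φ q m = C ψ q m) → φ = ψ

theorem blockSum_m {k : ℕ} {m m' : Fin k → EObj} (e : ∀ i, Fin (m i).r ≃ Fin (m' i).r)
    (h : ∀ i j, (m' i).m (e i j) = (m i).m j) (s : Fin (odot m).r) :
    (odot m').m (blockSum e s) = (odot m).m s := by
  obtain ⟨i, j, rfl⟩ := exists_oplace m s
  rw [odot_m, ← h]
  exact (congrArg (odot m').m (blockSum_place e i j)).trans (odot_m m' i (e i j))

theorem blockAssoc_m {n : ℕ} {k : Fin n → ℕ} (m : Fin (∑ i, k i) → EObj)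
    (s : Fin (odot fun i => odot fun j => m (place i j)).r) :
    (odot m).m (blockAssoc k (fun s => (m s).r) s) =
      (odot fun i => odot fun j => m (place i j)).m s := by
  obtain ⟨i, t, rfl⟩ := exists_oplace _ s
  obtain ⟨j, x, rfl⟩ := exists_oplace _ t
  rw [odot_m, odot_m]
  exact (congrArg (odot m).m (blockAssoc_place k (fun s => (m s).r) i j x)).trans
    (odot_m m (place i j) x)

theorem blockPerm_m {k l : ℕ} (e : Fin k ≃ Fin l) (m : Fin l → EObj)
    (s : Fin (odot fun i => m (e i)).r) :
    (odot m).m (blockPerm e (fun i => (m i).r) s) = (odot fun i => m (e i)).m s := by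
  obtain ⟨i, j, rfl⟩ := exists_oplace _ s
  rw [odot_m]
  exact (congrArg (odot m).m (blockPerm_place e (fun i => (m i).r) i j)).trans (odot_m m _ j)

theorem preservesVal_unitEquiv (m : Fin 1 → EObj) : PreservesVal (unitEquiv m) :=
  preservesVal_unitPlaces fun i => (m i).r

/-! ### Realizations obtained from functors and transformations indexed by tuples. -/

namespace Components

variable {M : CatMultiData.{u, v, w}} (N : Components.{u, v, w, u'} M)

/-- The function of a cell on tuples of arrows. -/
def tot {k : ℕ} {a : Fin k → M.Obj} {b : M.Obj} {f g : M.Hom a b} (φ : f ⟶ g) (q : N.Q)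
    (x : ∀ i, (N.R (a i) q).Tot) : (N.R b q).Tot :=
  ⟨odot fun i => (x i).shape, arrowApp (N.C φ q fun i => (x i).shape)
    (piArrow (A := fun i => (N.R (a i) q).obj (x i).shape) fun i => (x i).arrow)⟩

/-- The equivariance of the components enters here. The target shapes `m'` are prescribed, so that
the result lies over their concatenation. -/
theorem tot_perm {k : ℕ} {a : Fin k → M.Obj} {b : M.Obj} {f g : M.Hom a b} (φ : f ⟶ g) (q : N.Q)
    (x : ∀ i, (N.R (a i) q).Tot) {m' : Fin k → EObj} (e : ∀ i, Fin (x i).shape.r ≃ Fin (m' i).r)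
    (h : ∀ i j, (m' i).m (e i j) = (x i).shape.m j) :
    N.tot φ q (fun i => ⟨m' i, ((N.R (a i) q).perm (e i) (h i)).mapArrow.obj (x i).arrow⟩) =
      (N.tot φ q x).push rfl (blockSum e) := by
  have h₂ := PermCat.Tot.push_mk (P := N.R b q) (a := odot fun i => (x i).shape) (b := odot m')
    (arrowApp (N.C φ q fun i => (x i).shape)
      (piArrow (A := fun i => (N.R (a i) q).obj (x i).shape) fun i => (x i).arrow))
    (blockSum e) (blockSum_m e h)
  refine Eq.trans ?_ h₂.symm
  have h₃ := (N.equivariant_cell φ q e h (blockSum_m e h)).arrowApp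
    (N.equivariant f q e h (blockSum_m e h)) (N.equivariant g q e h (blockSum_m e h))
    (piArrow (A := fun i => (N.R (a i) q).obj (x i).shape) fun i => (x i).arrow)
  exact congrArg (PermCat.Tot.mk (P := N.R b q) (odot m')) h₃

theorem tot_push {k : ℕ} {a : Fin k → M.Obj} {b : M.Obj} {f g : M.Hom a b} (φ : f ⟶ g) (q : N.Q)
    (x : ∀ i, (N.R (a i) q).Tot) {n : Fin k → ℕ} (e : ∀ i, Fin (x i).shape.r ≃ Fin (n i)) :
    N.tot φ q (fun i => (x i).push rfl (e i)) = (N.tot φ q x).push rfl (blockSum e) := by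
  let m' : Fin k → EObj := fun i => ⟨n i, fun s => (x i).shape.m ((e i).symm s)⟩
  have h : ∀ i j, (m' i).m (e i j) = (x i).shape.m j := fun i j => by simp [m']
  refine Eq.trans (congrArg (N.tot φ q) (funext fun i => ?_)) (N.tot_perm φ q x (m' := m') e h)
  exact PermCat.Tot.push_mk (P := N.R (a i) q) (b := m' i) (x i).arrow (e i) (h i)

/-- The component of the identity morphism is the projection followed by the relabelling
`unitEquiv`, which preserves values and so acts trivially on `Tot`. -/
theorem tot_one (a : M.Obj) (q : N.Q) (x : Fin 1 → (N.R a q).Tot) :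
    N.tot (𝟙 (M.one a)) q x = x 0 := by
  have h₁ := PermCat.Tot.push_mk (P := N.R a q) (a := (x 0).shape)
    (b := odot fun i => (x i).shape) (x 0).arrow (unitEquiv fun i => (x i).shape)
    (odot_m (fun i => (x i).shape) 0)
  refine Eq.trans ?_ (h₁.symm.trans (PermCat.Tot.push_eq_self (x 0) rfl
    (preservesVal_unitEquiv fun i => (x i).shape)))
  refine congrArg (PermCat.Tot.mk (P := N.R a q) _) ?_
  rw [N.C_id, arrowApp_id, N.one a q _ (odot_m (fun i => (x i).shape) 0)]
  rfl

/-- The components of a composite differ from the composite of the components by the action of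
`blockAssoc`, which is trivial on `Tot`. -/
theorem tot_comp {n : ℕ} {k : Fin n → ℕ} {a : Fin (∑ i, k i) → M.Obj} {b : Fin n → M.Obj}
    {c : M.Obj} {f f' : M.Hom b c} {g g' : ∀ i, M.Hom (fun j => a (place i j)) (b i)}
    (φ : f ⟶ f') (ψ : g ⟶ g') (q : N.Q) (x : ∀ s, (N.R (a s) q).Tot) :
    N.tot ((M.comp a b c).map ((φ, ψ) : (f, g) ⟶ (f', g'))) q x =
      N.tot φ q fun i => N.tot (ψ i) q fun j => x (place i j) := by
  have h₁ := N.comp φ ψ q _ (fun i => (x i).arrow) (blockAssoc_m fun i => (x i).shape)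
  refine (congrArg (PermCat.Tot.mk (P := N.R c q) (odot fun i => (x i).shape)) h₁).trans ?_
  refine (PermCat.Tot.push_mk (P := N.R c q)
    (a := odot fun i => odot fun j => (x (place i j)).shape) (b := odot fun i => (x i).shape)
    _ (blockAssoc k fun s => (x s).shape.r) (blockAssoc_m fun i => (x i).shape)).symm.trans ?_
  exact PermCat.Tot.push_eq_self _ _ (preservesVal_blockAssoc _ _)

theorem tot_act {k l : ℕ} (e : Fin k ≃ Fin l) {a : Fin l → M.Obj} {b : M.Obj}
    {f g : M.Hom (fun i => a (e i)) b} (φ : f ⟶ g) (q : N.Q) (x : ∀ i, (N.R (a i) q).Tot) :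
    N.tot ((M.act e a b).map φ) q x = (N.tot φ q fun i => x (e i)).push rfl
      (blockPerm e fun i => (x i).shape.r) := by
  have h₁ := N.act e φ q _ (fun i => (x i).arrow) (blockPerm_m e fun i => (x i).shape)
  refine (congrArg (PermCat.Tot.mk (P := N.R b q) (odot fun i => (x i).shape)) h₁).trans ?_
  exact (PermCat.Tot.push_mk (P := N.R b q) (a := odot fun i => (x (e i)).shape)
    (b := odot fun i => (x i).shape) _ (blockPerm e fun i => (x i).shape.r)
    (blockPerm_m e fun i => (x i).shape)).symm

/-- An arrow of a product category is the tuple of its coordinates, so it occurs as an argument of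
`tot`. Both results lie over the same shape, which allows the arrows to be extracted. -/
theorem arrow_eq_of_tot {k : ℕ} {a : Fin k → M.Obj} {b : M.Obj} {f g f' g' : M.Hom a b} (φ : f ⟶ g)
    (ψ : f' ⟶ g') (q : N.Q) (h : ∀ x, N.tot φ q x = N.tot ψ q x) (m : Fin k → EObj)
    (t : Arrow (∀ i, (N.R (a i) q).obj (m i))) :
    arrowApp (N.C φ q m) t = arrowApp (N.C ψ q m) t :=
  eq_of_heq (PermCat.Tot.mk.inj (h fun i => ⟨m i, Arrow.mk (t.hom i)⟩)).2

/-- The realization of a multicategory given by components. -/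
def realization : Realization.{u, v, w, u'} M where
  Q := N.Q
  R := N.R
  T := N.tot
  T_r _ _ _ := rfl
  T_push φ q x _ e := N.tot_push φ q x e
  T_one := N.tot_one
  T_comp := N.tot_comp
  T_act := N.tot_act
  ext {k a b f g f' g'} φ ψ hf hg h := by
    subst hf; subst hg
    exact heq_of_eq (N.ext φ ψ fun q m => natTrans_ext_arrow (N.arrow_eq_of_tot φ ψ q (h q) m))

/-- The function of an identity cell is the action of the functor on arrows, and this action
determines the functor. -/
theorem F_eq {k : ℕ} {a : Fin k → M.Obj} {b : M.Obj} {f f' : M.Hom a b} (q : N.Q)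
    (h : ∀ x, N.tot (𝟙 f) q x = N.tot (𝟙 f') q x) (m : Fin k → EObj) :
    N.F f q m = N.F f' q m := by
  refine functor_ext_arrow fun t => ?_
  have h' := N.arrow_eq_of_tot _ _ q h m t
  rwa [N.C_id, N.C_id, arrowApp_id, arrowApp_id] at h'

/-- The laws of the realization, read on identity cells, are rewritten in terms of functors. Only
one relation is weakened, so it is supplied to `ObjLaws.imp` twice. -/
theorem objLaws : M.ObjLaws fun _ _ _ f f' => ∀ q m, N.F f q m = N.F f' q m :=
  N.realization.objLaws.imp N.realization.objLaws fun _ _ _ _ _ h _ q => N.F_eq q (h q)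

/-- A multicategory with components is a symmetric multicategory if the `k`-ary morphisms are
determined by their components. -/
theorem isSymmetricMulticategory (N : Components.{u, v, w, u'} M)
    (H : ∀ {k : ℕ} {a : Fin k → M.Obj} {b : M.Obj} (f f' : M.Hom a b),
      (∀ q m, N.F f q m = N.F f' q m) → f = f') : M.IsSymmetricMulticategory :=
  N.realization.isSymmetricMulticategory (N.objLaws.imp N.objLaws fun _ _ _ f f' h _ => H f f' h)

end Components

/-! ### The components in the three multicategories; the axioms for `E_*`-categories and for
symmetric spectra. -/

theorem EObj.perm_trans {a b c : EObj} (e : Fin a.r ≃ Fin b.r) (h : ∀ i, b.m (e i) = a.m i)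
    (e' : Fin b.r ≃ Fin c.r) (h' : ∀ i, c.m (e' i) = b.m i) :
    EObj.perm e h ≫ EObj.perm e' h' = EObj.perm (e.trans e') fun i => (h' (e i)).trans (h i) := by
  refine EHom.ext' (fun _ => rfl) (fun i k hk _ => ?_) fun k hk _ =>
    absurd ((e.trans e').apply_symm_apply k) (hk _)
  exact (EHom.comp_β (EHom.perm e h) (EHom.perm e' h') i (e i) k rfl hk _).trans
    (eqToHom_trans ((congrArg c.m hk).symm.trans (h' (e i))) (h i))

/-- Because of this, naturality of a `k`-ary morphism along permutations in each variable becomes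
equivariance along their block sum. -/
theorem odotMap_perm {k : ℕ} {m m' : Fin k → EObj} (e : ∀ i, Fin (m i).r ≃ Fin (m' i).r)
    (h : ∀ i j, (m' i).m (e i j) = (m i).m j) :
    odotMap (fun i => EObj.perm (e i) (h i)) =
      EObj.perm (a := odot m) (b := odot m') (blockSum e) (blockSum_m e h) := by
  refine EHom.ext' (fun s => ?_) (fun s t hs ht => ?_) fun k _ hk =>
    absurd ((blockSum e).apply_symm_apply k) (hk _)
  · obtain ⟨i, j, rfl⟩ := exists_oplace m s
    rw [odotMap_q]
    exact (blockSum_place e i j).symm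
  · exact eqToHom_trans _ (h (splitPlace m s).1 (splitPlace m s).2)

/-- The categories of an `E_*`-category with the actions of the permutations. -/
def EStar.permCat (X : EStar.{u}) : PermCat.{u} where
  obj a := X.F.obj a
  perm e h := X.fmap (EObj.perm e h)
  perm_refl a := congrArg BasedFunctor.functor (X.F.map_id a)
  perm_trans e h e' h' := by
    have := congrArg (fun f => (X.F.map f).functor) (EObj.perm_trans e h e' h')
    simpa only [CategoryTheory.Functor.map_comp, BasedCat.comp_functor] using this

/-- The components of the cells of the multicategory of `E_*`-categories. -/
def eStarComponents : Components.{u + 1, u, u, u} EStarCat.{u} where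
  -- No further index is needed, since the tuples of objects of `Δᵒᵖ` already index the values of an
  -- `E_*`-category.
  Q := Unit
  R X _ := EStar.permCat X
  F f _ m := EMap.app f m
  C φ _ m := EMap.Hom.app φ m
  C_id _ _ _ := rfl
  equivariant {_ _ b} f _ m _ e h _ := (EMap.natural f fun i => EObj.perm (e i) (h i)).trans
    (congrArg (fun g => EMap.app f m ⋙ EStar.fmap b g) (odotMap_perm e h))
  equivariant_cell {_ _ b _ _} φ _ _ _ e h _ x :=
    (EMap.Hom.natural φ (fun i => EObj.perm (e i) (h i)) x).trans
    (functor_map_heq (congrArg (fun g => EStar.fmap b g) (odotMap_perm e h)) _)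
  one _ _ _ _ := rfl
  comp {_ _ _ _ c _ _ _ _} φ ψ _ m t _ :=
    (arrowApp_hcomp (EMap.innerMap ψ m) (Functor.whiskerRight (EMap.Hom.app φ
      fun i => odot fun j => m (place i j)) (EStar.fmap c (assocE m))) (piArrow t)).trans
      (arrowApp_whiskerRight _ _ _)
  act {k l} e a b f g φ q m t h := arrowApp_whiskerRight (EMap.Hom.app φ fun i => m (e i))
    (EStar.fmap b (permE e m)) (piArrow fun i => t (e i))
  ext φ ψ h := EMap.Hom.ext (funext fun m => h () m)

theorem eStarCat_isSymmetricMulticategory : EStarCat.{u}.IsSymmetricMulticategory :=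
  eStarComponents.isSymmetricMulticategory fun _ _ h => EMap.ext (funext fun m => h () m)

/-- The categories of the levels of a symmetric spectrum in a simplicial degree with the actions of
the permutations. -/
def SymSpec.permCat (X : SymSpec.{u}) (q : SimplexCategory) : PermCat.{u} where
  obj a := X.lev a.r q
  perm e _ := X.perm e q
  perm_refl a :=
    congrArg (fun f : X.level a.r ⟶ X.level a.r => (NatTrans.app f (op q)).functor) (X.act_refl a.r)
  perm_trans e _ e' _ := X.perm_trans e e' q

/-- The components of the cells of the multicategory of symmetric spectra. -/
def specComponents : Components.{u + 1, u, u, u} SpecSCat.{u} where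
  -- The simplicial degree is the extra index. Of a shape only the length is used, which is the
  -- level of the spectrum.
  Q := SimplexCategory
  R X q := SymSpec.permCat X q
  F f q m := SMap.app f (fun i => (m i).r) q
  C φ q m := SMap.Hom.app φ (fun i => (m i).r) q
  C_id _ _ _ := rfl
  equivariant f q m m' e h h' := SMap.equivariant f e q
  equivariant_cell φ q m m' e h h' := SMap.Hom.equivariant φ e q
  one _ _ _ _ := rfl
  comp {n k a b c f f' g g'} φ ψ q m t h :=
    (arrowApp_hcomp (SMap.innerMap ψ (fun s => (m s).r) q) (Functor.whiskerRight (SMap.Hom.app φ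
      (fun i => ∑ j, (m (place i j)).r) q) (SymSpec.perm c (blockAssoc k fun s => (m s).r) q))
      (piArrow t)).trans (arrowApp_whiskerRight _ _ _)
  act {k l} e a b f g φ q m t h := arrowApp_whiskerRight (SMap.Hom.app φ (fun i => (m (e i)).r) q)
    (SymSpec.perm b (blockPerm e fun s => (m s).r) q) (piArrow fun i => t (e i))
  ext φ ψ h := SMap.Hom.ext (funext fun p => funext fun q =>
    -- The entries `[0]` are a filler: only the length `p i` matters.
    h q fun i => ⟨p i, fun _ => SimplexCategory.mk 0⟩)

theorem specSCat_isSymmetricMulticategory : SpecSCat.{u}.IsSymmetricMulticategory :=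
  specComponents.isSymmetricMulticategory fun _ _ h => SMap.ext (funext fun p => funext fun q =>
    h q fun i => ⟨p i, fun _ => SimplexCategory.mk 0⟩)

/-- The categories of a symmetric monoidal category with the trivial actions of the permutations. -/
def SMCat.permCat (A : SMCat.{u}) : PermCat.{u} where
  obj _ := A
  perm _ _ := 𝟭 A
  perm_refl _ := rfl
  perm_trans _ _ _ _ := rfl

theorem LinFun.arrowApp_compMap {n : ℕ} {k : Fin n → ℕ} {A : Fin (∑ i, k i) → SMCat.{u}}
    {B : Fin n → SMCat.{u}} {D : SMCat.{u}} {G G' : LinFun B D}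
    {F F' : ∀ i, LinFun (fun j : Fin (k i) => A (place i j)) (B i)} (φ : G ⟶ G') (ψ : F ⟶ F')
    (t : ∀ s, Arrow (A s)) :
    arrowApp (LinFun.compMap (e := finSigmaFinEquiv) φ ψ).app (piArrow t) =
      arrowApp φ.app (piArrow fun i => arrowApp (ψ i).app (piArrow fun j => t (place i j))) :=
  arrowApp_hcomp (innerMap (e := finSigmaFinEquiv) ψ) φ.app (piArrow t)

/-- The components of the cells of the multicategory of symmetric monoidal categories. -/
noncomputable def smcComponents : Components.{u + 1, u, u, u} SMC.{u} where
  -- Shapes play no role here: every shape carries the same category and permutations act by the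
  -- identity functor. The conditions about permutations therefore hold by definition.
  Q := Unit
  R X _ := SMCat.permCat X
  F f _ _ := LinFun.F f
  C φ _ _ := LinFun.Hom.app φ
  C_id _ _ _ := rfl
  equivariant _ _ _ _ _ _ _ := rfl
  equivariant_cell _ _ _ _ _ _ _ _ := HEq.rfl
  one _ _ _ _ := rfl
  comp φ ψ _ _ t _ := LinFun.arrowApp_compMap φ ψ t
  act _ _ _ _ _ _ _ _ _ _ := rfl
  ext _ _ h := LinFun.Hom.ext (h () fun _ => ⟨0, Fin.elim0⟩)

/-! ### Distributivity isomorphisms and their behaviour under composition and permutation. -/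

section Distributivity

variable {ι : Type} {C : ι → SMCat.{u}} {D : SMCat.{u}}

/-- Apart from the functor, the distributivity isomorphisms are the only data of a multilinear
functor. Only their underlying morphisms have to be compared. -/
theorem LinFun.ext' {F G : LinFun C D} (hF : F.F = G.F)
    (hδ : ∀ (i : ι) {x y z : ∀ j, C j} (h : AddAt i x y z), HEq (F.δ i h).hom (G.δ i h).hom) :
    F = G := by
  obtain ⟨F, δ, _, _, _, _, _, _, _⟩ := F
  obtain ⟨G, δ', _, _, _, _, _, _, _⟩ := G
  obtain rfl : F = G := hF
  obtain rfl : @δ = @δ' := by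
    funext i x y z h
    exact Iso.ext (eq_of_heq (hδ i h))
  rfl

/-- The summands prescribe the entry at `i` and all the others, so two constructions of an
intermediate tuple always coincide. -/
theorem AddAt.eq_of_eq {i : ι} {x y z z' : ∀ j, C j} (h : AddAt i x y z) (h' : AddAt i x y z') :
    z = z' := by
  funext j
  by_cases e : j = i
  · subst e; exact h.at_eq.trans h'.at_eq.symm
  · exact (h.left j e).symm.trans (h'.left j e)

theorem OnlyAt.of_heq {i : ι} {x y : ∀ j, C j} {m : x ⟶ y} {a b a' b' : C i} {f : a ⟶ b}
    {f' : a' ⟶ b'} (h : OnlyAt i m f) (hf : HEq f f') : OnlyAt i m f' :=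
  ⟨h.at_eq.trans hf, h.others⟩

/-- A distributivity isomorphism followed by the image of a morphism in one variable is determined
by its sources and its target. -/
theorem LinFun.δ_map_heq (F : LinFun C D) (i : ι) {x y w z x' y' w' z' : ∀ j, C j}
    (hx : x = x') (hy : y = y') (hz : z = z') (h : AddAt i x y w) (h' : AddAt i x' y' w')
    {m : w ⟶ z} {m' : w' ⟶ z'} {a b a' b' : C i} {f : a ⟶ b} {f' : a' ⟶ b'} (hm : OnlyAt i m f)
    (hm' : OnlyAt i m' f') (hf : HEq f f') :
    HEq ((F.δ i h).hom ≫ F.F.map m) ((F.δ i h').hom ≫ F.F.map m') := by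
  subst hx; subst hy; subst hz
  obtain rfl := h.eq_of_eq h'
  obtain rfl := (hm.of_heq hf).unique hm'
  rfl

theorem OnlyAt.id {i : ι} {x : ∀ j, C j} {a b : C i} {f : a ⟶ b} (h : x i = a) (hf : IsId f) :
    OnlyAt i (𝟙 x) f :=
  ⟨IsId.heq' h (IsId.id _) hf, fun _ _ => IsId.id _⟩

end Distributivity

section Comp

variable {n : ℕ} {k : Fin n → ℕ} {A : Fin (∑ i, k i) → SMCat.{u}} {B : Fin n → SMCat.{u}}
  {D : SMCat.{u}} (G : LinFun B D) (F : ∀ i, LinFun (fun j : Fin (k i) => A (place i j)) (B i))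

/-- The tuple of the values of a family of multilinear functors on the blocks of a tuple. -/
abbrev innerObj (x : ∀ s, A s) : ∀ i, B i := fun i => (F i).F.obj fun j => x (place i j)

/-- The morphisms of tuples given by a family of multilinear functors. -/
abbrev innerHom {x y : ∀ s, A s} (m : x ⟶ y) : innerObj F x ⟶ innerObj F y :=
  fun i => (F i).F.map fun j => m (place i j)

/-- The composite of multilinear functors. -/
noncomputable def LinFun.blockComp : LinFun A D := LinFun.comp (e := finSigmaFinEquiv) G F

theorem AddAt.placeBlock {i : Fin n} {j : Fin (k i)} {x y z : ∀ s, A s}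
    (h : AddAt (place i j) x y z) : AddAt (C := fun j => A (place i j)) j (fun j => x (place i j))
      (fun j => y (place i j)) fun j => z (place i j) :=
  h.block (e := finSigmaFinEquiv)

/-- The definition chooses an intermediate tuple and an isomorphism out of it. Here both are known
only through `AddAt` and `OnlyAt`, which determine them, so that later arguments do not depend on
the choice. -/
theorem LinFun.blockComp_δ_exists {i : Fin n} {j : Fin (k i)} {x y z : ∀ s, A s}
    (h : AddAt (place i j) x y z) : ∃ (w : ∀ i, B i)
    (hw : AddAt i (innerObj F x) (innerObj F y) w) (m : w ⟶ innerObj F z),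
    OnlyAt i m ((F i).δ j h.placeBlock).hom ∧
    ((G.blockComp F).δ (place i j) h).hom = (G.δ i hw).hom ≫ G.F.map m :=
  ⟨_, _, _, midIso_onlyAt (e := finSigmaFinEquiv) F h, compδ'_eq (e := finSigmaFinEquiv) G F h⟩

/-- The blocks other than the `i`-th contain only identities, and functors preserve these. -/
theorem innerHom_onlyAt {i : Fin n} {j : Fin (k i)} {x y : ∀ s, A s} {m : x ⟶ y}
    {a b : A (place i j)} {f : a ⟶ b} (hm : OnlyAt (place i j) m f) :
    OnlyAt i (innerHom F m) ((F i).F.map fun j => m (place i j)) :=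
  ⟨HEq.rfl, fun i' hi => IsId.map (F i').F (isId_pi fun j' =>
    hm.others _ fun h => hi (congrArg Sigma.fst (finSigmaFinEquiv.injective h)))⟩

theorem OnlyAt.placeBlock {i : Fin n} {j : Fin (k i)} {x y : ∀ s, A s} {m : x ⟶ y}
    {a b : A (place i j)} {f : a ⟶ b} (hm : OnlyAt (place i j) m f) :
    OnlyAt (C := fun j => A (place i j)) (x := fun j => x (place i j)) (y := fun j => y (place i j))
      j (fun j => m (place i j)) f :=
  hm.block (e := finSigmaFinEquiv)

end Comp

/-- In the definition of `act` the variable is `e.symm s`. An explicit preimage `j` of `s` removes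
this inverse. -/
theorem LinFun.act_δ {ι κ : Type} (e : κ ≃ ι) {A : ι → SMCat.{u}} {D : SMCat.{u}}
    (F : LinFun (fun j => A (e j)) D) {j : κ} {s : ι} (hs : e j = s) {x y z : ∀ i, A i}
    (h : AddAt s x y z) (h' : AddAt (C := fun j => A (e j)) j (fun j => x (e j)) (fun j => y (e j))
      fun j => z (e j)) : ((LinFun.act e F).δ s h).hom = (F.δ j h').hom := by
  subst hs
  exact congrArg Iso.hom (LinFun.δ_reindex_eq e F h)

/-- Multilinear functors in the same variables, in two ways of indexing. -/
theorem LinFun.reindex_congr {ι κ : Type} {A : ι → SMCat.{u}} {D : SMCat.{u}} {v w : κ → ι}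
    (hv : v = w) {F : LinFun (fun j => A (v j)) D} {G : LinFun (fun j => A (w j)) D}
    (hF : HEq F G) : (∀ x : ∀ i, A i, F.F.obj (fun j => x (v j)) = G.F.obj fun j => x (w j)) ∧
      ∀ (j : κ) (x y z : ∀ i, A i) (h : AddAt (C := fun j => A (v j)) j (fun j => x (v j))
        (fun j => y (v j)) fun j => z (v j)) (h' : AddAt (C := fun j => A (w j)) j (fun j => x (w j))
        (fun j => y (w j)) fun j => z (w j)), HEq (F.δ j h).hom (G.δ j h').hom := by
  subst hv; cases hF
  exact ⟨fun _ => rfl, fun _ _ _ _ _ _ => HEq.rfl⟩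

theorem AddAt.reindex_of_eq {ι κ : Type} (v : κ → ι) (hv : Function.Injective v)
    {A : ι → SMCat.{u}} {j : κ} {s : ι} (hs : v j = s) {x y z : ∀ i, A i} (h : AddAt s x y z) :
    AddAt (C := fun j => A (v j)) j (fun j => x (v j)) (fun j => y (v j)) fun j => z (v j) := by
  subst hs
  exact ⟨h.at_eq, fun _ hj => h.left _ (hv.ne hj), fun _ hj => h.right _ (hv.ne hj)⟩

/-! ### The multicategory axioms for the distributivity isomorphisms. -/

section Laws

/-- Multilinear functors have the same distributivity isomorphisms. -/
def SameDistributivity {ι : Type} {C : ι → SMCat.{u}} {D : SMCat.{u}} (F F' : LinFun C D) : Prop :=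
  ∀ (i : ι) {x y z : ∀ j, C j} (h : AddAt i x y z), HEq (F.δ i h).hom (F'.δ i h).hom

/-- The distributivity of the identity functor is an equality of objects, so in the composite only
the isomorphism of `f 0` is left. -/
theorem sameDistributivity_one_comp {k : Fin 1 → ℕ} (a : Fin (∑ i, k i) → SMCat.{u})
    (c : SMCat.{u}) (f : ∀ i : Fin 1, LinFun (fun j => a (place i j)) c) :
    SameDistributivity ((LinFun.one c).blockComp f) (LinFun.act (unitPlaces k) (f 0)) := by
  intro s x y z h
  obtain ⟨i, j, rfl⟩ := exists_place' s
  obtain rfl := Subsingleton.elim i 0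
  obtain ⟨w, hw, m, hm, e⟩ := LinFun.blockComp_δ_exists (LinFun.one c) f h
  have e' : ((LinFun.act (unitPlaces k) (f 0)).δ (place 0 j) h).hom =
      ((f 0).δ j h.placeBlock).hom :=
    LinFun.act_δ (A := a) (unitPlaces k) (f 0) (unitPlaces_apply k j) h h.placeBlock
  have e'' : ((LinFun.one c).δ 0 hw).hom ≫ (LinFun.one c).F.map m = eqToHom hw.at_eq.symm ≫ m 0 :=
    rfl
  rw [e']
  refine (heq_of_eq (e.trans e'')).trans ?_
  exact (eqToHom_comp_heq (m 0) hw.at_eq.symm).trans hm.at_eq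

/-- Each `g i` is an identity functor in its one variable, with an identity as distributivity. The
composite therefore has the isomorphism of `f` followed by the image of an identity. -/
theorem sameDistributivity_comp_one {n : ℕ} (c : SMCat.{u}) (a : Fin (∑ _i : Fin n, 1) → SMCat.{u})
    (g : ∀ i : Fin n, LinFun (fun j : Fin 1 => a (place (p := fun _ => 1) i j))
      (a (singlePlaces n i))) (hg : ∀ i, HEq (g i) (LinFun.one (a (singlePlaces n i))))
    (f : LinFun (fun i => a (singlePlaces n i)) c) :
    SameDistributivity (LinFun.blockComp (k := fun _ => 1) f g)
      (LinFun.act (singlePlaces n) f) := by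
  intro s x y z h
  obtain ⟨i, j, rfl⟩ := exists_place' (p := fun _ : Fin n => 1) s
  obtain rfl := Subsingleton.elim j 0
  -- The equality of `g i` with the identity functor, read on tuples indexed by all places, without
  -- a transport of its source.
  have hc : ∀ i, (∀ x : ∀ s, a s, (g i).F.obj (fun j => x (place (p := fun _ => 1) i j)) =
      x (singlePlaces n i)) ∧ ∀ (x y z : ∀ s, a s) (h : AddAt
        (C := fun j => a (place (p := fun _ => 1) i j)) 0 (fun j => x (place (p := fun _ => 1) i j))
        (fun j => y (place (p := fun _ => 1) i j)) fun j => z (place (p := fun _ => 1) i j)),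
        IsId ((g i).δ 0 h).hom := fun i => by
    have hv : (fun j => place (p := fun _ => 1) i j) = fun _ : Fin 1 => singlePlaces n i :=
      funext fun j => by obtain rfl := Subsingleton.elim j 0; rfl
    obtain ⟨h₁, h₂⟩ := LinFun.reindex_congr (A := a) hv (hg i)
    refine ⟨h₁, fun x y z h => ?_⟩
    exact IsId.of_heq ((congrArg₂ _ (h₁ x) (h₁ y)) ) (h₁ z) (h₂ 0 x y z h ⟨h.at_eq,
      fun j hj => absurd (Subsingleton.elim j 0) hj, fun j hj => absurd (Subsingleton.elim j 0) hj⟩)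
      ⟨h.at_eq.symm, rfl⟩
  obtain ⟨w, hw, m, hm, e⟩ := LinFun.blockComp_δ_exists (k := fun _ => 1) f g h
  have hw' : AddAt (C := fun i => a (singlePlaces n i)) i (fun i => x (singlePlaces n i))
      (fun i => y (singlePlaces n i)) fun i => z (singlePlaces n i) :=
    AddAt.reindex_of_eq (singlePlaces n) (singlePlaces n).injective rfl h
  refine (heq_of_eq e).trans (HEq.trans ?_ (heq_of_eq
    (LinFun.act_δ (singlePlaces n) f (j := i) rfl h hw').symm))
  refine (f.δ_map_heq i (funext fun i => (hc i).1 x) (funext fun i => (hc i).1 y)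
    (funext fun i => (hc i).1 z) hw hw' (m' := 𝟙 _) hm (OnlyAt.id
      (C := fun i => a (singlePlaces n i)) (x := fun i => z (singlePlaces n i)) (i := i)
      (f := 𝟙 (z (singlePlaces n i))) rfl (IsId.id _)) (IsId.heq' ?_ ((hc i).2 x y z _) (IsId.id _))).trans
      (IsId.heq_comp ((IsId.id _).map f.F) _)
  exact ((congrArg₂ (· ⊗ ·) ((hc i).1 x) ((hc i).1 y))).trans h.at_eq.symm

/-- Both bracketings give the isomorphism of `h`, followed by the image under `h` of the isomorphism
of `g`, followed by the image under `h` and `g` of the isomorphism of `f`. Applying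
`LinFun.δ_map_heq` to `h` and then to `g` reduces the comparison to the innermost isomorphisms,
which are related by `hf`. -/
theorem sameDistributivity_assoc {n : ℕ} {k : Fin n → ℕ} {l : Fin (∑ i, k i) → ℕ}
    (a : Fin (∑ s, l s) → SMCat.{u}) (b : Fin (∑ i, k i) → SMCat.{u}) (c : Fin n → SMCat.{u})
    (d : SMCat.{u}) (h : LinFun c d) (g : ∀ i, LinFun (fun j => b (place i j)) (c i))
    (f : ∀ s, LinFun (fun t => a (place s t)) (b s))
    (f' : ∀ i j, LinFun (fun t => a (blockAssoc k l (place i (place j t)))) (b (place i j)))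
    (hf : ∀ i j, HEq (f' i j) (f (place i j))) :
    SameDistributivity ((h.blockComp g).blockComp f)
      (LinFun.act (blockAssoc k l) (LinFun.blockComp (A := fun t => a (blockAssoc k l t)) h fun i =>
          LinFun.blockComp (A := fun t => a (blockAssoc k l (place i t)))
            (B := fun j => b (place i j)) (g i) (f' i))) := by
  intro s x y z H
  obtain ⟨s, t, rfl⟩ := exists_place' s
  obtain ⟨i, j, rfl⟩ := exists_place' s
  have hp := blockAssoc_place k l i j t
  have H' := AddAt.reindex_of_eq (blockAssoc k l) (blockAssoc k l).injective hp H
  have hc := fun i j => LinFun.reindex_congr (A := a) (funext (blockAssoc_place k l i j)) (hf i j)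
  obtain ⟨w₁, hw₁, m₁, hm₁, e₁⟩ := LinFun.blockComp_δ_exists (h.blockComp g) f H
  obtain ⟨w₂, hw₂, m₂, hm₂, e₂⟩ := LinFun.blockComp_δ_exists h g hw₁
  obtain ⟨w₃, hw₃, m₃, hm₃, e₃⟩ := LinFun.blockComp_δ_exists (A := fun t => a (blockAssoc k l t)) h
    (fun i => LinFun.blockComp (A := fun t => a (blockAssoc k l (place i t)))
            (B := fun j => b (place i j)) (g i) (f' i)) H'
  obtain ⟨w₄, hw₄, m₄, hm₄, e₄⟩ := LinFun.blockComp_δ_exists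
    (A := fun t => a (blockAssoc k l (place i t))) (B := fun j => b (place i j)) (g i) (f' i)
    H'.placeBlock
  -- The two images under `h` are joined into one, which is the shape required by
  -- `LinFun.δ_map_heq`.
  have e₁₂ : (((h.blockComp g).blockComp f).δ _ H).hom =
      (h.δ i hw₂).hom ≫ h.F.map (m₂ ≫ innerHom g m₁) :=
    e₁.trans ((congrArg (· ≫ h.F.map (innerHom g m₁)) e₂).trans ((Category.assoc _ _ _).trans
      (congrArg ((h.δ i hw₂).hom ≫ ·) (h.F.map_comp m₂ (innerHom g m₁)).symm)))
  have hb : ∀ (x : ∀ s, a s) (i), (fun j => innerObj f x (place i j)) =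
      innerObj (A := fun t => a (blockAssoc k l (place i t))) (B := fun j => b (place i j)) (f' i)
        (fun t => x (blockAssoc k l (place i t))) := fun x i =>
    funext fun j => ((hc i j).1 x).symm
  have ho : ∀ x : ∀ s, a s, innerObj g (innerObj f x) = innerObj
      (A := fun t => a (blockAssoc k l t)) (fun i => LinFun.blockComp
      (A := fun t => a (blockAssoc k l (place i t))) (B := fun j => b (place i j)) (g i) (f' i))
      fun t => x (blockAssoc k l t) := fun x => funext fun i => congrArg (g i).F.obj (hb x i)
  refine (heq_of_eq e₁₂).trans (HEq.trans ?_ (heq_of_eq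
    ((LinFun.act_δ (blockAssoc k l) _ hp H H').trans e₃).symm))
  refine h.δ_map_heq i (ho x) (ho y) (ho z) hw₂ hw₃
    (hm₂.comp hw₂.at_eq rfl rfl (innerHom_onlyAt g hm₁)) hm₃ (HEq.trans ?_ (heq_of_eq e₄.symm))
  exact (g i).δ_map_heq j (hb x i) (hb y i) (hb z i) hw₁.placeBlock hw₄ hm₁.placeBlock hm₄
    ((hc i j).2 t x y z H'.placeBlock.placeBlock H.placeBlock).symm

/-- The outer permutation only renames the variable of the outer isomorphism: the block `e i` of the
tuple is the `i`-th variable of `f`. -/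
theorem sameDistributivity_act_comp {n n' : ℕ} (e : Fin n ≃ Fin n') {k : Fin n' → ℕ}
    (a : Fin (∑ i, k i) → SMCat.{u}) (b : Fin n' → SMCat.{u}) (c : SMCat.{u})
    (f : LinFun (fun i => b (e i)) c) (g : ∀ i, LinFun (fun j => a (place i j)) (b i))
    (g' : ∀ i, LinFun (fun j => a (blockPerm e k (place i j))) (b (e i)))
    (hg : ∀ i, HEq (g' i) (g (e i))) :
    SameDistributivity ((LinFun.act e f).blockComp g) (LinFun.act (blockPerm e k)
      (LinFun.blockComp (A := fun s => a (blockPerm e k s)) f g')) := by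
  intro s x y z H
  obtain ⟨i', j, rfl⟩ := exists_place' s
  obtain ⟨i, rfl⟩ := e.surjective i'
  have hp := blockPerm_place e k i j
  have H' := AddAt.reindex_of_eq (blockPerm e k) (blockPerm e k).injective hp H
  have hc := fun i => LinFun.reindex_congr (A := a) (funext (blockPerm_place e k i)) (hg i)
  obtain ⟨w₁, hw₁, m₁, hm₁, e₁⟩ := LinFun.blockComp_δ_exists (LinFun.act e f) g H
  obtain ⟨w₂, hw₂, m₂, hm₂, e₂⟩ := LinFun.blockComp_δ_exists (A := fun s => a (blockPerm e k s))
    f g' H'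
  have hw₃ := AddAt.reindex_of_eq e e.injective rfl hw₁
  have e₃ : (((LinFun.act e f).blockComp g).δ _ H).hom =
      (f.δ i hw₃).hom ≫ f.F.map (fun i => m₁ (e i)) :=
    e₁.trans (congrArg (· ≫ f.F.map fun i => m₁ (e i)) (LinFun.act_δ e f rfl hw₁ hw₃))
  have ho : ∀ x : ∀ s, a s, (fun i => innerObj g x (e i)) = innerObj
      (A := fun s => a (blockPerm e k s)) g' fun s => x (blockPerm e k s) := fun x =>
    funext fun i => ((hc i).1 x).symm
  refine (heq_of_eq e₃).trans (HEq.trans ?_ (heq_of_eq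
    ((LinFun.act_δ (blockPerm e k) _ hp H H').trans e₂).symm))
  exact f.δ_map_heq i (ho x) (ho y) (ho z) hw₃ hw₂ (hm₁.reindex e) hm₂
    ((hc i).2 j x y z H'.placeBlock H.placeBlock).symm

/-- The permutations stay inside the blocks. The outer isomorphism is in the same variable on both
sides, and only the inner one is renamed. -/
theorem sameDistributivity_comp_act {n : ℕ} {k k' : Fin n → ℕ} (e : ∀ i, Fin (k i) ≃ Fin (k' i))
    (a : Fin (∑ i, k' i) → SMCat.{u}) (b : Fin n → SMCat.{u}) (c : SMCat.{u}) (f : LinFun b c)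
    (g : ∀ i, LinFun (fun j => a (place i (e i j))) (b i))
    (g' : ∀ i, LinFun (fun j => a (blockSum e (place i j))) (b i))
    (hg : ∀ i, HEq (g' i) (g i)) :
    SameDistributivity
      (f.blockComp fun i => LinFun.act (A := fun j => a (place i j)) (e i) (g i))
      (LinFun.act (blockSum e) (LinFun.blockComp (A := fun s => a (blockSum e s)) f g')) := by
  intro s x y z H
  obtain ⟨i, j', rfl⟩ := exists_place' s
  obtain ⟨j, rfl⟩ := (e i).surjective j'
  have hp := blockSum_place e i j
  have H' := AddAt.reindex_of_eq (blockSum e) (blockSum e).injective hp H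
  have hc := fun i => LinFun.reindex_congr (A := a) (funext (blockSum_place e i)) (hg i)
  obtain ⟨w₁, hw₁, m₁, hm₁, e₁⟩ := LinFun.blockComp_δ_exists f
    (fun i => LinFun.act (A := fun j => a (place i j)) (e i) (g i)) H
  obtain ⟨w₂, hw₂, m₂, hm₂, e₂⟩ := LinFun.blockComp_δ_exists (A := fun s => a (blockSum e s))
    f g' H'
  have hb := AddAt.reindex_of_eq (A := fun j => a (place i j)) (e i) (e i).injective rfl
    H.placeBlock
  have ho : ∀ x : ∀ s, a s, (innerObj (fun i => LinFun.act (A := fun j => a (place i j)) (e i)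
      (g i)) x) = innerObj (A := fun s => a (blockSum e s)) g' fun s => x (blockSum e s) := fun x =>
    funext fun i => ((hc i).1 x).symm
  refine (heq_of_eq e₁).trans (HEq.trans ?_ (heq_of_eq
    ((LinFun.act_δ (blockSum e) _ hp H H').trans e₂).symm))
  exact f.δ_map_heq i (ho x) (ho y) (ho z) hw₁ hw₂ hm₁ hm₂ ((heq_of_eq (LinFun.act_δ
    (A := fun j => a (place i j)) (e i) (g i) rfl H.placeBlock hb)).trans
      ((hc i).2 j x y z H'.placeBlock hb).symm)

theorem smc_sameDistributivity : SMC.{u}.ObjLaws fun _ _ _ f f' =>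
    SameDistributivity (C := _) (D := _) f f' where
  one_comp a c f := sameDistributivity_one_comp a c f
  comp_one c a g hg f := sameDistributivity_comp_one c a g hg f
  assoc a b c d h g f f' hf := sameDistributivity_assoc a b c d h g f f' hf
  -- Permutations act on distributivities by renaming variables, so this law and the next hold by
  -- definition.
  act_refl _ _ _ _ _ _ _ _ := HEq.rfl
  act_trans _ _ _ _ _ _ _ _ _ _ := HEq.rfl
  act_comp e _ a b c f g g' hg := sameDistributivity_act_comp e a b c f g g' hg
  comp_act e a b c f g g' hg := sameDistributivity_comp_act e a b c f g g' hg

end Laws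

/-- The components determine only the underlying functors. The laws for these are combined with
those for the distributivities, and together the two give equality of multilinear functors. -/
theorem smc_isSymmetricMulticategory : SMC.{u}.IsSymmetricMulticategory :=
  smcComponents.realization.isSymmetricMulticategory
    (smcComponents.objLaws.imp smc_sameDistributivity fun _ _ _ _ _ h h' =>
      LinFun.ext' (h () fun _ => ⟨0, Fin.elim0⟩) h')

/-! ### Systems given by multilinear functors -/

section Spread

variable {ι : Type} {C : ι → SMCat.{u}} {D : SMCat.{u}} (F : LinFun C D)

open Classical in
theorem update_addAt (i : ι) {x y z : ∀ j, C j} (hx : ∀ j, j ≠ i → x j = z j)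
    (hy : ∀ j, j ≠ i → y j = z j) : AddAt i x y (Function.update z i (x i ⊗ y i)) :=
  ⟨by simp, fun j hj => by simp [hj, hx j hj], fun j hj => by simp [hj, hy j hj]⟩

open Classical in
/-- The isomorphism `F(id, …, r, …, id) ∘ δᵢ` for an isomorphism `r : xᵢ ⊗ yᵢ ≅ zᵢ`. -/
noncomputable def LinFun.spread (i : ι) {x y z : ∀ j, C j} (hx : ∀ j, j ≠ i → x j = z j)
    (hy : ∀ j, j ≠ i → y j = z j) (r : x i ⊗ y i ≅ z i) : F.F.obj x ⊗ F.F.obj y ≅ F.F.obj z :=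
  F.δ i (update_addAt i hx hy) ≪≫ F.F.mapIso (onlyIso i
    (fun j hj => Function.update_of_ne hj _ _) (eqToIso (update_addAt i hx hy).at_eq ≪≫ r))

/-- As for composites, the choice of the intermediate tuple is hidden behind `AddAt` and `OnlyAt`.
-/
theorem LinFun.exists_spread (i : ι) {x y z : ∀ j, C j} (hx : ∀ j, j ≠ i → x j = z j)
    (hy : ∀ j, j ≠ i → y j = z j) (r : x i ⊗ y i ≅ z i) :
    ∃ (w : ∀ j, C j) (h : AddAt i x y w) (m : w ⟶ z), OnlyAt i m r.hom ∧
      (F.spread i hx hy r).hom = (F.δ i h).hom ≫ F.F.map m := by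
  classical
  refine ⟨_, update_addAt i hx hy, _, (onlyIso_onlyAt i
    (fun j hj => Function.update_of_ne hj _ _)
    (eqToIso (update_addAt i hx hy).at_eq ≪≫ r)).of_heq ?_, rfl⟩
  exact eqToHom_comp_heq r.hom (update_addAt i hx hy).at_eq

/-- The ends and the isomorphism `r` determine the result, so any other presentation may replace the
chosen one. -/
theorem LinFun.spread_heq (i : ι) {x y z x' y' z' w : ∀ j, C j} (hx : ∀ j, j ≠ i → x j = z j)
    (hy : ∀ j, j ≠ i → y j = z j) (r : x i ⊗ y i ≅ z i) (ex : x = x') (ey : y = y') (ez : z = z')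
    (h : AddAt i x' y' w) {m : w ⟶ z'} {a b : C i} {f : a ⟶ b} (hm : OnlyAt i m f)
    (hf : HEq r.hom f) : HEq (F.spread i hx hy r).hom ((F.δ i h).hom ≫ F.F.map m) := by
  obtain ⟨w', h', m', hm', e⟩ := F.exists_spread i hx hy r
  rw [e]
  exact F.δ_map_heq i ex ey ez h' h hm' hm hf

/-- A unit in the variable `i` makes `δᵢ` an identity, and then `r` has to be one as well. A unit in
another variable makes all the values of `F` units and the image of the morphism an identity,
whatever `r` is. -/
theorem LinFun.spread_isId (i : ι) {x y z : ∀ j, C j} (hx : ∀ j, j ≠ i → x j = z j)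
    (hy : ∀ j, j ≠ i → y j = z j) (r : x i ⊗ y i ≅ z i)
    (H : ((x i = 𝟙_ (C i) ∨ y i = 𝟙_ (C i)) ∧ IsId r.hom) ∨ ∃ j, j ≠ i ∧ z j = 𝟙_ (C j)) :
    IsId (F.spread i hx hy r).hom := by
  obtain ⟨w, h, m, hm, e⟩ := F.exists_spread i hx hy r
  rw [e]
  rcases H with ⟨H, hr⟩ | ⟨j, hj, H⟩
  · refine IsId.comp (F.unit_δ i h (H.imp id Or.inl)) (IsId.map _ (isId_pi fun j => ?_))
    by_cases hj : j = i
    · subst hj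
      exact IsId.of_heq h.at_eq rfl hm.at_eq hr
    · exact hm.others j hj
  · have hw : w j = 𝟙_ (C j) := (hm.others j hj).1.trans H
    exact IsId.comp (F.unit_δ i h (Or.inr (Or.inr ⟨j, hj, hw⟩)))
      (isId_of_heq (F.unit_obj _ j hw) (F.unit_obj _ j H)
        (F.unit_map _ j ((hm.others j hj).heq hw) hw H))

end Spread

/-! ### The system of the objects `F(C¹_{S₁}, …, C^k_{S_k})`. -/

section LinBar

variable {k : ℕ} {C : Fin k → SMCat.{u}} {D : SMCat.{u}}

theorem oplace_ne {m : Fin k → EObj} {i i' : Fin k} (j : Fin (m i).r) (j' : Fin (m i').r)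
    (h : i' ≠ i) : oplace m i' j' ≠ oplace m i j :=
  fun e => h (congrArg Sigma.fst (oplace_inj e))

theorem subBlock_left {m : Fin k → EObj} {i : Fin k} {j : Fin (m i).r}
    {T U S : BSub (circM (odot m))} (h : SplitAt (oplace m i j) T U S) (i' : Fin k) (hi : i' ≠ i) :
    subBlock m T i' = subBlock m S i' :=
  Subtype.ext (funext fun j' => congrArg (fun X => Fin.cast _ ⁻¹' X)
    (h.left _ (oplace_ne j j' hi)))

theorem subBlock_right {m : Fin k → EObj} {i : Fin k} {j : Fin (m i).r}
    {T U S : BSub (circM (odot m))} (h : SplitAt (oplace m i j) T U S) (i' : Fin k) (hi : i' ≠ i) :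
    subBlock m U i' = subBlock m S i' :=
  Subtype.ext (funext fun j' => congrArg (fun X => Fin.cast _ ⁻¹' X)
    (h.right _ (oplace_ne j j' hi)))

theorem subBlock_empty {m : Fin k → EObj} {i : Fin k} {j : Fin (m i).r}
    {S : BSub (circM (odot m))} (h : S.1 (oplace m i j) = ∅) : (subBlock m S i).1 j = ∅ :=
  congrArg (fun X => Fin.cast _ ⁻¹' X) h

variable (F : LinFun C D) (m : Fin k → EObj) (x : ∀ i, BarObj (C i) (circM (m i)))

/-- The isomorphism `F(id, …, ρⁱ, …, id) ∘ δᵢ` at a place of the `i`-th block. -/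
noncomputable def linρ {p : Σ i, Fin (m i).r} {T U S : BSub (circM (odot m))}
    (h : SplitAt ((splitPlace m).symm p) T U S) :
    F.F.obj (entries m x T) ⊗ F.F.obj (entries m x U) ≅ F.F.obj (entries m x S) :=
  F.spread p.1 (fun i' hi => congrArg (x i').obj (subBlock_left h i' hi))
    (fun i' hi => congrArg (x i').obj (subBlock_right h i' hi))
    ((x p.1).ρ p.2 (subBlock_split m p.1 p.2 h))

/-- The isomorphisms `F(id, …, ρⁱ, …, id) ∘ δᵢ`. -/
noncomputable def linρ' (s : Fin (odot m).r) {T U S : BSub (circM (odot m))}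
    (h : SplitAt s T U S) :
    F.F.obj (entries m x T) ⊗ F.F.obj (entries m x U) ≅ F.F.obj (entries m x S) :=
  linρ F m x (p := splitPlace m s) (by rwa [Equiv.symm_apply_apply])

/-- `linρ'` recovers the block of a place by `splitPlace`. The type of the splitting depends on the
resulting pair, so the equality of pairs is eliminated for arbitrary pairs in `key`. -/
theorem linρ'_eq {i : Fin k} {j : Fin (m i).r} {T U S : BSub (circM (odot m))}
    (h : SplitAt (oplace m i j) T U S) :
    linρ' F m x _ h = linρ F m x (p := ⟨i, j⟩) h := by
  have key : ∀ (p q : Σ i, Fin (m i).r) (hq : SplitAt ((splitPlace m).symm q) T U S)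
      (hp : SplitAt ((splitPlace m).symm p) T U S), p = q → linρ F m x hp = linρ F m x hq := by
    rintro p _ hq hp rfl; rfl
  exact key _ ⟨i, j⟩ h _ (splitPlace_oplace m i j)

theorem exists_linρ' {i : Fin k} {j : Fin (m i).r} {T U S : BSub (circM (odot m))}
    (h : SplitAt (oplace m i j) T U S) : ∃ (w : ∀ i, C i)
      (hw : AddAt i (entries m x T) (entries m x U) w) (r : w ⟶ entries m x S),
      OnlyAt (C := C) i r ((x i).ρ j (subBlock_split m i j h)).hom ∧
      (linρ' F m x _ h).hom = (F.δ i hw).hom ≫ F.F.map r := by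
  rw [linρ'_eq]
  exact F.exists_spread i (x := entries m x T) (y := entries m x U) (z := entries m x S) _ _
    ((x i).ρ j (subBlock_split m i j h))

/-- Used to compare systems over different tuples: the three tuples of entries need only be
propositionally equal to given ones, and any presentation of the isomorphism is allowed on the
right. -/
theorem linρ'_heq {i : Fin k} {j : Fin (m i).r} {T U S : BSub (circM (odot m))}
    (h : SplitAt (oplace m i j) T U S) {y z t w : ∀ i, C i} (hy : entries m x T = y)
    (hz : entries m x U = z) (ht : entries m x S = t) (hw : AddAt i y z w) {r : w ⟶ t}
    {a b : C i} {f : a ⟶ b} (hr : OnlyAt i r f)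
    (hf : HEq ((x i).ρ j (subBlock_split m i j h)).hom f) :
    HEq (linρ' F m x _ h).hom ((F.δ i hw).hom ≫ F.F.map r) := by
  rw [linρ'_eq]
  exact F.spread_heq i _ _ _ hy hz ht hw hr hf

/-- The system of the objects `F(C¹_{S₁}, …, C^k_{S_k})`. -/
noncomputable def linBarObj : BarObj D (circM (odot m)) where
  obj S := F.F.obj (entries m x S)
  ρ s _ _ _ h := linρ' F m x s h
  unit_obj S s h := by
    obtain ⟨i, j, rfl⟩ := exists_oplace m s
    exact F.unit_obj _ i ((x i).unit_obj _ j (subBlock_empty h))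
  unit_ρ s T U S h H := by
    obtain ⟨i, j, rfl⟩ := exists_oplace m s
    rw [linρ'_eq]
    refine F.spread_isId i _ _ _ ?_
    -- A part of an empty set is empty. So an empty set in the `i`-th block of `S` already makes the
    -- entry of `T` in this block a unit.
    have aux : ∀ j', (subBlock m S i).1 j' = ∅ ∨ (subBlock m T i).1 j' = ∅ →
        (subBlock m T i).1 j' = ∅ := fun j' h' => h'.elim
      (fun h' => Set.subset_eq_empty ((subBlock_split m i j h).sub_left j') h') id
    rcases H with ⟨s', hs⟩ | H | H
    · obtain ⟨i', j', rfl⟩ := exists_oplace m s'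
      -- An empty set in the block of the splitting gives a unit in the variable `i` and an identity
      -- `ρ`; an empty set in another block gives a unit in another variable. These are the two
      -- cases of `LinFun.spread_isId`.
      by_cases hi : i' = i
      · subst hi
        exact Or.inl ⟨Or.inl ((x i').unit_obj _ j' (aux j' (Or.inl (subBlock_empty hs)))),
          (x i').unit_ρ j _ (Or.inl ⟨j', subBlock_empty hs⟩)⟩
      · exact Or.inr ⟨i', hi, (x i').unit_obj _ j' (subBlock_empty hs)⟩
    · exact Or.inl ⟨Or.inl ((x i).unit_obj _ j (subBlock_empty H)),
        (x i).unit_ρ j _ (Or.inr (Or.inl (subBlock_empty H)))⟩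
    · exact Or.inl ⟨Or.inr ((x i).unit_obj _ j (subBlock_empty H)),
        (x i).unit_ρ j _ (Or.inr (Or.inr (subBlock_empty H)))⟩
  symm s T U S h h' := by
    obtain ⟨i, j, rfl⟩ := exists_oplace m s
    obtain ⟨w, hw, r, hr, e⟩ := exists_linρ' F m x h
    obtain ⟨w', hw', r', hr', e'⟩ := exists_linρ' F m x h'
    rw [e, e']
    -- `LinFun.symm'` allows a further morphism between the targets, as composition requires; here
    -- the targets coincide and it is the identity.
    have := F.symm' i hw hw' r r' (𝟙 _) _ _ hr hr' (fun _ _ => IsId.id _)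
      ((Category.comp_id _).trans ((x i).symm j _ _))
    rwa [F.F.map_id, Category.comp_id] at this
  assoc s T U V TU UV S h₁ h₂ h₃ h₄ := by
    obtain ⟨i, j, rfl⟩ := exists_oplace m s
    obtain ⟨w₁, hw₁, r₁, hr₁, e₁⟩ := exists_linρ' F m x h₁
    obtain ⟨w₂, hw₂, r₂, hr₂, e₂⟩ := exists_linρ' F m x h₂
    obtain ⟨w₃, hw₃, r₃, hr₃, e₃⟩ := exists_linρ' F m x h₃
    obtain ⟨w₄, hw₄, r₄, hr₄, e₄⟩ := exists_linρ' F m x h₄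
    rw [e₁, e₂, e₃, e₄]
    have := F.assoc' i hw₁ hw₂ hw₃ hw₄ r₁ r₂ r₃ r₄ (𝟙 _) _ _ _ _ hr₁ hr₂ hr₃ hr₄
      (fun _ _ => IsId.id _) ((congrArg _ (Category.comp_id _)).trans ((x i).assoc j _ _ _ _))
    rwa [F.F.map_id, Category.comp_id] at this
  comm s s' hs TV UV TW UW SV SW TS US S h₁ h₂ h₃ h₄ h₅ h₆ := by
    obtain ⟨i, j, rfl⟩ := exists_oplace m s
    obtain ⟨i', j', rfl⟩ := exists_oplace m s'
    obtain ⟨w₁, hw₁, r₁, hr₁, e₁⟩ := exists_linρ' F m x h₁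
    obtain ⟨w₂, hw₂, r₂, hr₂, e₂⟩ := exists_linρ' F m x h₂
    obtain ⟨w₃, hw₃, r₃, hr₃, e₃⟩ := exists_linρ' F m x h₃
    obtain ⟨w₄, hw₄, r₄, hr₄, e₄⟩ := exists_linρ' F m x h₄
    obtain ⟨w₅, hw₅, r₅, hr₅, e₅⟩ := exists_linρ' F m x h₅
    obtain ⟨w₆, hw₆, r₆, hr₆, e₆⟩ := exists_linρ' F m x h₆
    rw [e₁, e₂, e₃, e₄, e₅, e₆]
    -- Two places of one block concern a single variable, where condition (5) of the system `x i` is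
    -- transported by the middle interchange. Places of two blocks concern two variables, whose
    -- distributivities are compatible.
    by_cases hi : i = i'
    · subst hi
      exact F.interchange i hw₁ hw₂ hw₃ hw₄ hw₅ hw₆ r₁ r₂ r₃ r₄ r₅ r₆ hr₁ hr₂ hr₃ hr₄ hr₅ hr₆
        ((x i).comm j j' (fun h => hs (by rw [h])) _ _ _ _ _ _)
    · have hi' : i' ≠ i := fun h => hi h.symm
      -- A splitting in one of the two blocks leaves the other block unchanged. Consequently the
      -- isomorphisms of each system on the different sides of the diagram are the same, as
      -- `LinFun.comm'` requires.
      have a₁ := subBlock_left h₄ i hi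
      have a₂ := subBlock_right h₄ i hi
      have a₃ := subBlock_left h₅ i hi
      have a₄ := subBlock_right h₅ i hi
      have a₅ := subBlock_left h₃ i hi
      have a₆ := subBlock_right h₃ i hi
      have b₁ := subBlock_left h₁ i' hi'
      have b₂ := subBlock_right h₁ i' hi'
      have b₃ := subBlock_left h₂ i' hi'
      have b₄ := subBlock_right h₂ i' hi'
      have b₅ := subBlock_left h₆ i' hi'
      have b₆ := subBlock_right h₆ i' hi'
      exact F.comm' i i' hi hw₁ hw₂ hw₃ hw₄ hw₅ hw₆ r₁ r₂ r₃ r₄ r₅ r₆ hr₁ hr₂ hr₃ hr₄ hr₅ hr₆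
        ((x i).ρ_heq j _ _ (a₁.trans a₂.symm) (a₃.trans a₄.symm) (a₅.trans a₆.symm))
        ((x i).ρ_heq j _ _ a₁ a₃ a₅)
        ((x i').ρ_heq j' _ _ (b₁.trans b₂.symm) (b₃.trans b₄.symm) (b₅.trans b₆.symm))
        ((x i').ρ_heq j' _ _ b₁ b₃ b₅)
        (congrArg (x i).obj (a₁.trans a₂.symm)) (congrArg (x i).obj (a₃.trans a₄.symm))
        (congrArg (x i).obj (a₅.trans a₆.symm)) (congrArg (x i').obj (b₁.trans b₂.symm))
        (congrArg (x i').obj (b₃.trans b₄.symm)) (congrArg (x i').obj (b₅.trans b₆.symm))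

variable {x} {y : ∀ i, BarObj (C i) (circM (m i))} (f : ∀ i, x i ⟶ y i)

theorem BarObj.app_heq {ι : Type} {M : ι → Type} [∀ i, Zero (M i)] {X Y : BarObj D M} (g : X ⟶ Y)
    {S S' : BSub M} (h : S = S') : HEq (BarObj.Hom.app g S) (BarObj.Hom.app g S') := by
  subst h; rfl

/-- The morphism of systems with the components `F(f¹_{S₁}, …, f^k_{S_k})`. -/
noncomputable def linBarMap : linBarObj F m x ⟶ linBarObj F m y :=
  BarObj.Hom.mk (X := linBarObj F m x) (Y := linBarObj F m y)
    (fun S => F.F.map (entriesMap m f S))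
    (fun S s h => by
      obtain ⟨i, j, rfl⟩ := exists_oplace m s
      have hx : ∀ x : ∀ i, BarObj (C i) (circM (m i)), entries m x S i = 𝟙_ (C i) :=
        fun x => (x i).unit_obj _ j (subBlock_empty h)
      exact isId_of_heq (F.unit_obj _ i (hx x)) (F.unit_obj _ i (hx y))
        (F.unit_map _ i (((BarObj.Hom.unit (f i)) _ j (subBlock_empty h)).heq (hx x)) (hx x) (hx y)))
    (fun s T U S h => by
      obtain ⟨i, j, rfl⟩ := exists_oplace m s
      obtain ⟨w, hw, r, hr, e⟩ := exists_linρ' F m x h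
      obtain ⟨w', hw', r', hr', e'⟩ := exists_linρ' F m y h
      change (linρ' F m x _ h).hom ≫ _ = _ ≫ (linρ' F m y _ h).hom
      rw [e, e', Category.assoc]
      -- In the variable `i` the square is the compatibility of `f i` with the isomorphisms `ρ`. The
      -- remaining variables have the same components for `T`, `U` and `S`.
      exact (F.nat' i hw hw' r r' _ _ hr hr' (entriesMap m f T) (entriesMap m f U)
        (entriesMap m f S) ((BarObj.Hom.comm (f i)) j _).symm
        (fun i' hi => BarObj.app_heq (f i') (subBlock_left h i' hi))
        (fun i' hi => BarObj.app_heq (f i') (subBlock_right h i' hi))).symm)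

variable (C) in
/-- The functor which sends systems `{Cⁱ, ρⁱ}` to the system of the objects
`F(C¹_{S₁}, …, C^k_{S_k})`. -/
noncomputable def linBarFunctor :
    (∀ i, BarObj (C i) (circM (m i))) ⥤ BarObj D (circM (odot m)) where
  obj x := linBarObj F m x
  map f := linBarMap F m f
  map_id x := BarObj.Hom.ext (funext fun S => F.F.map_id (entries m x S))
  map_comp f g := BarObj.Hom.ext (funext fun S =>
    F.F.map_comp (entriesMap m f S) (entriesMap m g S))

end LinBar

/-! ### Naturality in `E`, base points, and the values of `J` on morphisms and cells. -/

section

variable {k : ℕ}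

/-- Entries of a concatenation equal entries of its blocks only propositionally; the casts identify
the corresponding based sets. -/
theorem circle_heq {a b a' b' : SimplexCategory} {θ : a ⟶ b} {θ' : a' ⟶ b'} (ha : a = a')
    (hb : b = b') (h : HEq θ θ') (x : Fin (b.len + 1)) :
    circle θ' (Fin.cast (congrArg (fun q : SimplexCategory => q.len + 1) hb) x) =
      Fin.cast (congrArg (fun q : SimplexCategory => q.len + 1) ha) (circle θ x) := by
  subst ha; subst hb; cases h; rfl

/-- On the places of the `i`-th block the concatenated morphism is `f i`, so the preimages may be
taken in each block separately. -/
theorem subBlock_pull {m m' : Fin k → EObj} (f : ∀ i, m i ⟶ m' i) (S : BSub (circM (odot m')))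
    (i : Fin k) : subBlock m (pull (odotMap f) S) i = pull (f i) (subBlock m' S i) := by
  refine Subtype.ext (funext fun j => ?_)
  refine (congrArg (fun X => Fin.cast _ ⁻¹' X) (pull_val (odotMap f) S (oplace m i j)
    (oplace m' i (EHom.q (f i) j)) (odotMap_q f i j))).trans ?_
  refine Set.ext fun x => ?_
  have := circle_heq (odot_m m' i _).symm (odot_m m i j).symm
    (odotMap_β f i j _ rfl (odotMap_q f i j)).symm x
  exact iff_of_eq (congrArg (· ∈ S.1 (oplace m' i (EHom.q (f i) j))) this)

/-- A place of a concatenation is outside the image of the concatenated injection if and only if it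
is outside the image of the injection of its own block, and there the two maps to `[1]` agree. -/
theorem flag_odotMap {m m' : Fin k → EObj} (f : ∀ i, m i ⟶ m' i) (S : BSub (circM (odot m'))) :
    Flag (odotMap f) S ↔ ∀ i, Flag (f i) (subBlock m' S i) := by
  have key : ∀ (i) (l : Fin (m' i).r) (hl : ∀ j, EHom.q (f i) j ≠ l)
      (h : ∀ s, EHom.q (odotMap f) s ≠ oplace m' i l),
      circle (EHom.γ (odotMap f) _ h) (1 : Fin 2) =
        Fin.cast (congrArg (fun q : SimplexCategory => q.len + 1) (odot_m m' i l).symm)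
          (circle (EHom.γ (f i) l hl) (1 : Fin 2)) := fun i l hl h =>
    circle_heq (odot_m m' i l).symm rfl (odotMap_γ f i l hl h).symm (1 : Fin 2)
  constructor
  · intro H i l hl
    have h := (odotMap_range f).2 hl
    have := H _ h
    rw [key i l hl h] at this
    exact this
  · intro H s h
    obtain ⟨i, l, rfl⟩ := exists_oplace m' s
    have hl := (odotMap_range f).1 h
    rw [key i l hl h]
    exact H i l hl

variable {C : Fin k → SMCat.{u}} {D : SMCat.{u}} (F : LinFun C D) {m m' : Fin k → EObj}

theorem linρ'_isId (x : ∀ i, BarObj (C i) (circM (m i))) {i : Fin k} {j : Fin (m i).r}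
    {T U S : BSub (circM (odot m))} (h : SplitAt (oplace m i j) T U S)
    (H : ((entries m x T i = 𝟙_ (C i) ∨ entries m x U i = 𝟙_ (C i)) ∧
      IsId ((x i).ρ j (subBlock_split m i j h)).hom) ∨ ∃ i', i' ≠ i ∧
        entries m x S i' = 𝟙_ (C i')) : IsId (linρ' F m x _ h).hom := by
  rw [linρ'_eq]
  exact F.spread_isId i _ _ _ H

/-- If the condition at the new places holds for the concatenation, it holds in every block, so none
of the systems has been replaced by the unit. -/
theorem entries_push (f : ∀ i, m i ⟶ m' i) (x : ∀ i, BarObj (C i) (circM (m i)))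
    {S : BSub (circM (odot m'))} (hS : Flag (odotMap f) S) :
    entries m x (pull (odotMap f) S) = entries m' (fun i => pushObj (f i) (x i)) S :=
  funext fun i => (congrArg (x i).obj (subBlock_pull f S i)).trans
    (pushPart_of (f i) (x i) ((flag_odotMap f S).1 hS i)).symm

/-- Where all blocks satisfy the condition at the new places, both systems are computed from the
same preimages. If some block fails it, that variable is the unit, and a multilinear functor takes
the value unit, as does the extension on the other side. The isomorphisms at the old places then
agree, and the others are identities on both sides. -/
theorem pushObj_linBarObj (f : ∀ i, m i ⟶ m' i) (x : ∀ i, BarObj (C i) (circM (m i))) :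
    pushObj (odotMap f) (linBarObj F m x) = linBarObj F m' fun i => pushObj (f i) (x i) := by
  refine pushPart_heq_of (odotMap f) _ _ (fun S hS => ?_) (fun S hS => ?_)
    (fun s s' hs T U S h hS => ?_) (fun s T U S h H => ?_)
  · exact congrArg F.F.obj (entries_push f x hS)
  · rw [flag_odotMap] at hS
    obtain ⟨i, hi⟩ := not_forall.1 hS
    exact F.unit_obj _ i (pushPart_not (f i) (x i) hi)
  · obtain ⟨i, j, rfl⟩ := exists_oplace m s
    rw [odotMap_q] at hs
    subst hs
    obtain ⟨w, hw, r, hr, e⟩ := exists_linρ' F m' (fun i => pushObj (f i) (x i)) h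
    have hT := (flag_left (odotMap f) (odotMap_q f i j) h).2 hS
    have hU := (flag_right (odotMap f) (odotMap_q f i j) h).2 hS
    refine HEq.trans ?_ (heq_of_eq e.symm)
    refine linρ'_heq F m x (pull_split (odotMap f) (odotMap_q f i j) h) (entries_push f x hT) (entries_push f x hU) (entries_push f x hS) hw hr
      (HEq.trans ?_ (pushρ_heq (f i) (x i) rfl (subBlock_split m' i _ h)
        ((flag_odotMap f S).1 hS i)).symm)
    exact (x i).ρ_heq j _ _ (subBlock_pull f T i) (subBlock_pull f U i) (subBlock_pull f S i)
  · obtain ⟨i, l, rfl⟩ := exists_oplace m' s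
    refine linρ'_isId F _ h ?_
    -- With the flag, the place is a new one, and one of the two parts of the set loses the element
    -- that the flag of the block requires; so one summand in the variable `i` is the unit. Without
    -- the flag some block fails, which gives a unit summand if it is the `i`-th block and a unit in
    -- another variable otherwise.
    by_cases hS : Flag (odotMap f) S
    · have hl : ∀ j, EHom.q (f i) j ≠ l := (odotMap_range f).1 fun s hs => H ⟨hS, s, hs⟩
      refine Or.inl ⟨?_, pushρ_isId (f i) (x i) (subBlock_split m' i l h) fun h' => hl _ h'.2.choose_spec⟩
      rcases flag_or (f i) hl (subBlock_split m' i l h) ((flag_odotMap f S).1 hS i) with h' | h'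
      · exact Or.inr (pushPart_not (f i) (x i) h'.2)
      · exact Or.inl (pushPart_not (f i) (x i) h'.1)
    · rw [flag_odotMap] at hS
      obtain ⟨i', hi'⟩ := not_forall.1 hS
      by_cases e : i' = i
      · subst e
        refine Or.inl ⟨Or.inl (pushPart_not (f i') (x i') fun h' => hi'
          (h'.of_left (f i') (subBlock_split m' i' l h))),
          pushρ_isId (f i') (x i') (subBlock_split m' i' l h) fun h' => hi' h'.1⟩
      · exact Or.inr ⟨i', e, pushPart_not (f i') (x i') hi'⟩

/-- If the condition at the new places holds, both components are the same value of `F`; otherwise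
some variable carries the identity of the unit, and both components are identities. -/
theorem linBarFunctor_natural (f : ∀ i, m i ⟶ m' i) :
    Functor.pi (fun i => pushFunctor (C i) (f i)) ⋙ linBarFunctor C F m' =
      linBarFunctor C F m ⋙ pushFunctor D (odotMap f) := by
  refine CategoryTheory.Functor.hext (fun x => (pushObj_linBarObj F f x).symm) fun x y g => ?_
  refine BarObj.hom_heq (pushObj_linBarObj F f x).symm (pushObj_linBarObj F f y).symm fun S => ?_
  change HEq (F.F.map (entriesMap m' (fun i => pushMap (f i) (g i)) S))
    (pushApp (odotMap f) (linBarMap F m g) S)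
  by_cases hS : Flag (odotMap f) S
  · refine HEq.trans ?_ (pushApp_heq (odotMap f) (linBarMap F m g) hS).symm
    refine map_heq F.F (entries_push f x hS).symm (entries_push f y hS).symm
      (pi_hom_heq (entries_push f x hS).symm (entries_push f y hS).symm fun i => ?_)
    refine (pushApp_heq (f i) (g i) ((flag_odotMap f S).1 hS i)).trans ?_
    exact (BarObj.app_heq (g i) (subBlock_pull f S i)).symm
  · refine IsId.heq' (f := F.F.map (entriesMap m' (fun i => pushMap (f i) (g i)) S)) ?_ ?_
      (pushApp_isId (odotMap f) (linBarMap F m g) hS)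
    · exact (congrArg (fun X => BarObj.obj X S) (pushObj_linBarObj F f x)).symm
    · rw [flag_odotMap] at hS
      obtain ⟨i, hi⟩ := not_forall.1 hS
      have hx := fun x : ∀ i, BarObj (C i) (circM (m i)) => pushPart_not (f i) (x i) hi
      exact isId_of_heq (F.unit_obj _ i (hx x)) (F.unit_obj _ i (hx y)) (F.unit_map _ i
        ((pushApp_isId (f i) (g i) hi).heq (hx x)) (hx x) (hx y))

/-- A base system makes one variable the unit for every tuple of subsets. Its isomorphisms are
identities, which settles the places of its own block; at the other places the unit is in another
variable. -/
theorem linBarObj_base (x : ∀ i, BarObj (C i) (circM (m i))) (i : Fin k)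
    (h : x i = BarObj.base (C i) (circM (m i))) :
    linBarObj F m x = BarObj.base D (circM (odot m)) := by
  have hi : ∀ S, (x i).obj S = 𝟙_ (C i) := fun S =>
    congrArg (fun X : BarObj (C i) (circM (m i)) => X.obj S) h
  have e : ∀ S, F.F.obj (entries m x S) = 𝟙_ D := fun S => F.unit_obj _ i (hi _)
  refine BarObj.ext' e fun s T U S H => ?_
  refine IsId.heq' (congrArg₂ (· ⊗ ·) (e T) (e U)) ?_ (StrictUnit.left _)
  obtain ⟨i', j, rfl⟩ := exists_oplace m s
  refine linρ'_isId F x H ?_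
  by_cases hii : i = i'
  · subst hii
    refine Or.inl ⟨Or.inl (hi _), ?_⟩
    rw [h]
    exact StrictUnit.left _
  · exact Or.inr ⟨i, hii, hi _⟩

theorem BarObj.isId_of_app {ι : Type} {M : ι → Type} [∀ i, Zero (M i)] {X Y : BarObj D M}
    {g : X ⟶ Y} (h : X = Y) (hg : ∀ S, IsId (BarObj.Hom.app g S)) : IsId g := by
  subst h
  exact ⟨rfl, BarObj.Hom.ext (funext fun S => (hg S).eq (IsId.id _))⟩

theorem BarObj.isId_app {ι : Type} {M : ι → Type} [∀ i, Zero (M i)] {X Y : BarObj D M}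
    {g : X ⟶ Y} (hg : IsId g) (S : BSub M) : IsId (BarObj.Hom.app g S) := by
  obtain ⟨rfl, rfl⟩ := hg
  exact IsId.id _

theorem linBarMap_base {x y : ∀ i, BarObj (C i) (circM (m i))} (f : ∀ i, x i ⟶ y i) (i : Fin k)
    (h : x i = BarObj.base (C i) (circM (m i))) (hf : IsId (f i)) : IsId (linBarMap F m f) := by
  have hy := hf.1.symm.trans h
  have hi : ∀ {X : BarObj (C i) (circM (m i))} (S), X = BarObj.base (C i) (circM (m i)) →
      X.obj S = 𝟙_ (C i) := fun S h => congrArg (fun X => BarObj.obj X S) h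
  refine BarObj.isId_of_app ((linBarObj_base F x i h).trans (linBarObj_base F y i hy).symm)
    fun S => ?_
  exact isId_of_heq (F.unit_obj _ i (hi _ h)) (F.unit_obj _ i (hi _ hy)) (F.unit_map _ i
    ((BarObj.isId_app hf (subBlock m S i)).heq (hi _ h)) (hi _ h) (hi _ hy))

/-- The `k`-ary morphism of `E_*`-categories given by a `k`-linear functor. -/
noncomputable def linBar : EMap (fun i => Bar (C i)) (Bar D) where
  app m := linBarFunctor C F m
  natural f := linBarFunctor_natural F f
  base_obj m x i h := linBarObj_base F x i h
  base_map m x y f i h hf := linBarMap_base F f i h hf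

/-- Objects and morphisms agree by definition. The isomorphisms need `linρ'_heq`, because the
description admits every choice of intermediate tuple. -/
theorem linBar_descr : BarDescr F (linBar F) where
  obj m x S := rfl
  ρ m x i j T U S h y h' r hr := linρ'_heq F m x h rfl rfl rfl h' hr HEq.rfl
  map m x y f S := HEq.rfl

variable {F} {F' : LinFun C D} (φ : F ⟶ F')

variable (m) in
/-- The morphism of systems given by a `k`-linear transformation. -/
noncomputable def linBarApp (x : ∀ i, BarObj (C i) (circM (m i))) :
    linBarObj F m x ⟶ linBarObj F' m x :=
  BarObj.Hom.mk (X := linBarObj F m x) (Y := linBarObj F' m x)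
    (fun S => (LinFun.Hom.app φ).app (entries m x S))
    (fun S s h => by
      obtain ⟨i, j, rfl⟩ := exists_oplace m s
      exact LinFun.Hom.unit φ _ i ((x i).unit_obj _ j (subBlock_empty h)))
    (fun s T U S h => by
      obtain ⟨i, j, rfl⟩ := exists_oplace m s
      obtain ⟨w, hw, r, hr, e⟩ := exists_linρ' F m x h
      -- The tuple `w` and the morphism `r` come from the systems alone, so they also present the
      -- isomorphism for `F'`. What remains is the naturality of `φ` at `r` and its compatibility
      -- with `δᵢ`.
      have e' := eq_of_heq (linρ'_heq F' m x h rfl rfl rfl hw hr HEq.rfl)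
      change (linρ' F m x _ h).hom ≫ _ = _ ≫ (linρ' F' m x _ h).hom
      rw [e, e', Category.assoc, (LinFun.Hom.app φ).naturality, ← Category.assoc,
        LinFun.Hom.comm φ, Category.assoc]
      rfl)

/-- The cell of `E_*`-categories given by a `k`-linear transformation. -/
noncomputable def linBarCell : linBar F ⟶ linBar F' :=
  EMap.Hom.mk (F := linBar F) (G := linBar F')
    (fun m => NatTrans.mk (F := linBarFunctor C F m) (G := linBarFunctor C F' m)
      (fun x => linBarApp m φ x) fun x y f => BarObj.Hom.ext (funext fun S =>
        (LinFun.Hom.app φ).naturality (entriesMap m f S)))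
    (fun {m m'} f x => by
      change ∀ i, BarObj (C i) (circM (m i)) at x
      change HEq (linBarApp m' φ fun i => pushObj (f i) (x i))
        (pushMap (odotMap f) (linBarApp m φ x))
      refine BarObj.hom_heq (pushObj_linBarObj F f x).symm (pushObj_linBarObj F' f x).symm
        fun S => ?_
      change HEq ((LinFun.Hom.app φ).app (entries m' (fun i => pushObj (f i) (x i)) S))
        (pushApp (odotMap f) (linBarApp m φ x) S)
      -- With the flag both sides are components of `φ` at equal tuples. Without it one variable is
      -- the unit, where a multilinear transformation is an identity.
      by_cases hS : Flag (odotMap f) S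
      · refine HEq.trans ?_ (pushApp_heq (odotMap f) (linBarApp m φ x) hS).symm
        exact app_heq _ (entries_push f x hS).symm
      · refine IsId.heq' ?_ ?_ (pushApp_isId (odotMap f) (linBarApp m φ x) hS)
        · exact (congrArg (fun X => BarObj.obj X S) (pushObj_linBarObj F f x)).symm
        · rw [flag_odotMap] at hS
          obtain ⟨i, hi⟩ := not_forall.1 hS
          exact LinFun.Hom.unit φ _ i (pushPart_not (f i) (x i) hi))
    (fun m x i h => BarObj.isId_of_app ((linBarObj_base F x i h).trans
      (linBarObj_base F' x i h).symm) fun S => LinFun.Hom.unit φ _ i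
        (congrArg (fun X : BarObj (C i) (circM (m i)) => X.obj (subBlock m S i)) h))

/-- The functor from `k`-linear functors to `k`-ary morphisms of `E_*`-categories. -/
noncomputable def linBarHomFunctor (C : Fin k → SMCat.{u}) (D : SMCat.{u}) :
    LinFun C D ⥤ EMap (fun i => Bar (C i)) (Bar D) where
  obj F := linBar F
  map φ := linBarCell φ
  map_id F := rfl
  map_comp φ ψ := rfl

theorem linBarCell_descr : CellDescr φ (linBarCell φ) := fun _ _ _ => HEq.rfl

end

/-! ### Permuting the places of a system -/

section Perm

variable {A : SMCat.{u}} {a b : EObj} (e : Fin a.r ≃ Fin b.r) (h : ∀ i, b.m (e i) = a.m i)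

theorem circle_eqToHom {q q' : SimplexCategory} (h : q = q') (x : Fin (q'.len + 1)) :
    circle (eqToHom h) x =
      Fin.cast (congrArg (fun q : SimplexCategory => q.len + 1) h.symm) x := by
  subst h
  exact circle_id q x

/-- The morphism of `Δ` at each place is an equality of objects, and the map of based sets it
induces is a cast. -/
theorem pull_perm (S : BSub (circM b)) {i : Fin a.r} {k : Fin b.r} (hi : e i = k)
    (hk : a.m i = b.m k) : (pull (EObj.perm e h) S).1 i =
      Fin.cast (congrArg (fun q : SimplexCategory => q.len + 1) hk) ⁻¹' S.1 k := by
  refine (pull_val (EObj.perm e h) S i k hi).trans (Set.ext fun x => ?_)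
  exact iff_of_eq (congrArg (· ∈ S.1 k) (circle_eqToHom hk.symm x))

theorem flag_perm (S : BSub (circM b)) : Flag (EObj.perm e h) S :=
  fun k hk => absurd (e.apply_symm_apply k) (hk (e.symm k))

/-- A bijection has no places outside its image, so no units are inserted and only relabelled data
are compared. -/
theorem pushObj_perm (X : BarObj A (circM a)) (Y : BarObj A (circM b))
    (hobj : ∀ S, X.obj (pull (EObj.perm e h) S) = Y.obj S)
    (hρ : ∀ (i k) (hi : e i = k) {T U S : BSub (circM b)} (H : SplitAt k T U S),
      HEq (X.ρ i (pull_split (EObj.perm e h) hi H)).hom (Y.ρ k H).hom) :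
    pushObj (EObj.perm e h) X = Y :=
  pushPart_heq_of _ X Y (fun S _ => hobj S) (fun S hS => absurd (flag_perm e h S) hS)
    (fun i k hi _ _ _ H _ => hρ i k hi H)
    fun k _ _ S _ hS => absurd ⟨flag_perm e h S, e.symm k, e.apply_symm_apply k⟩ hS

theorem pushMap_perm_heq {X X' : BarObj A (circM a)} {Y Y' : BarObj A (circM b)} {f : X ⟶ X'}
    {g : Y ⟶ Y'} (hY : pushObj (EObj.perm e h) X = Y) (hY' : pushObj (EObj.perm e h) X' = Y')
    (H : ∀ S, HEq (BarObj.Hom.app f (pull (EObj.perm e h) S)) (BarObj.Hom.app g S)) :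
    HEq (pushMap (EObj.perm e h) f) g :=
  BarObj.hom_heq hY hY' fun S => (pushApp_heq _ f (flag_perm e h S)).trans (H S)

end Perm

theorem EMap.hom_heq {k : ℕ} {X : Fin k → EStar.{u}} {Y : EStar.{u}} {F F' G G' : EMap X Y}
    {φ : F ⟶ G} {ψ : F' ⟶ G'} (hF : F = F') (hG : G = G')
    (h : ∀ m x, HEq ((EMap.Hom.app φ m).app x) ((EMap.Hom.app ψ m).app x)) : HEq φ ψ := by
  subst hF; subst hG
  exact heq_of_eq (EMap.Hom.ext (funext fun m => NatTrans.ext (funext fun x => eq_of_heq (h m x))))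

/-! ### Compatibility of `J` with identities. -/

section One

variable {A : SMCat.{u}}

theorem pull_unitE (m : Fin 1 → EObj) (S : BSub (circM (odot m))) :
    pull (unitE m) S = subBlock m S 0 :=
  Subtype.ext (funext fun j => pull_perm (unitEquiv m) (odot_m m 0) S (k := oplace m 0 j) rfl
    (odot_m m 0 j).symm)

/-- The distributivity of the identity functor is an equality of objects, so its system has the
given isomorphisms `ρ`, up to the relabelling of the places by the only block. -/
theorem pushObj_unitE (m : Fin 1 → EObj) (x : ∀ i, BarObj A (circM (m i))) :
    pushObj (unitE m) (x 0) = linBarObj (LinFun.one A) m x := by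
  refine pushObj_perm _ _ _ _ (fun S => congrArg (x 0).obj (pull_unitE m S))
    fun j s hs T U S H => ?_
  obtain rfl : oplace m 0 j = s := hs
  obtain ⟨w, hw, r, hr, e⟩ := exists_linρ' (LinFun.one A) m x H
  refine HEq.trans ?_ (heq_of_eq e.symm)
  refine HEq.trans ?_ (eqToHom_comp_heq (r 0) hw.at_eq.symm).symm
  refine HEq.trans ?_ hr.at_eq.symm
  exact (x 0).ρ_heq j _ _ (pull_unitE m T) (pull_unitE m U) (pull_unitE m S)

theorem linBar_one (A : SMCat.{u}) : linBar (LinFun.one A) = EMap.one (Bar A) := by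
  refine EMap.ext (funext fun m => ?_)
  refine CategoryTheory.Functor.hext (fun x => (pushObj_unitE m x).symm) fun x y f => ?_
  refine (pushMap_perm_heq (X := x 0) (X' := y 0) (f := f 0) (g := linBarMap (LinFun.one A) m f)
    _ _ (pushObj_unitE m x) (pushObj_unitE m y) fun S => ?_).symm
  exact BarObj.app_heq (f 0) (pull_unitE m S)

end One

/-! ### Compatibility of `J` with permutations of the variables. -/

section Act

variable {k l : ℕ} (e : Fin k ≃ Fin l) {C : Fin l → SMCat.{u}} {D : SMCat.{u}}

/-- `permE` moves blocks as a whole, without changing the order inside a block. -/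
theorem subBlock_permE (m : Fin l → EObj) (S : BSub (circM (odot m))) (i : Fin k) :
    subBlock (fun i => m (e i)) (pull (permE e m) S) i = subBlock m S (e i) :=
  Subtype.ext (funext fun j => congrArg (fun X => Fin.cast _ ⁻¹' X) (pull_perm _ _ S
    (i := oplace (fun i => m (e i)) i j) (k := oplace m (e i) j)
    (blockPerm_place e (fun i => (m i).r) i j)
    ((odot_m (fun i => m (e i)) i j).trans (odot_m m (e i) j).symm)))

theorem entries_permE (m : Fin l → EObj) (x : ∀ i, BarObj (C i) (circM (m i)))
    (S : BSub (circM (odot m))) :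
    entries (C := fun i => C (e i)) (fun i => m (e i)) (fun i => x (e i)) (pull (permE e m) S) =
      fun i => entries m x S (e i) :=
  funext fun i => congrArg (x (e i)).obj (subBlock_permE e m S i)

variable (F : LinFun (fun i => C (e i)) D)

/-- The distributivity of the permuted functor in the variable `e i` is that of `F` in the variable
`i`. It is applied to the isomorphism of the same system, `x (e i)`. -/
theorem pushObj_permE (m : Fin l → EObj) (x : ∀ i, BarObj (C i) (circM (m i))) :
    pushObj (permE e m) (linBarObj F (fun i => m (e i)) fun i => x (e i)) =
      linBarObj (LinFun.act e F) m x := by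
  refine pushObj_perm _ _ _ _ (fun S => congrArg F.F.obj (entries_permE e m x S))
    fun s s' hs T U S H => ?_
  obtain ⟨i, j, rfl⟩ := exists_oplace _ s
  obtain rfl : oplace m (e i) j = s' :=
    (blockPerm_place e (fun i => (m i).r) i j).symm.trans hs
  obtain ⟨w, hw, r, hr, he⟩ := exists_linρ' (LinFun.act e F) m x H
  have hw' := AddAt.reindex_of_eq e e.injective rfl hw
  refine HEq.trans ?_ (heq_of_eq (he.trans
    (congrArg (· ≫ F.F.map fun i => r (e i)) (LinFun.act_δ e F rfl hw hw'))).symm)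
  refine linρ'_heq F _ (fun i => x (e i)) (pull_split (permE e m) hs H) (entries_permE e m x T)
    (entries_permE e m x U) (entries_permE e m x S) hw' (hr.reindex e) ?_
  exact (x (e i)).ρ_heq j _ _ (subBlock_permE e m T i) (subBlock_permE e m U i)
    (subBlock_permE e m S i)

theorem linBar_act : linBar (LinFun.act e F) = EMap.act (X := fun i => Bar (C i)) e (linBar F) := by
  refine EMap.ext (funext fun m => ?_)
  refine CategoryTheory.Functor.hext (fun x => (pushObj_permE e F m x).symm) fun x y f => ?_
  refine (pushMap_perm_heq (f := linBarMap F (fun i => m (e i)) fun i => f (e i))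
    (g := linBarMap (LinFun.act e F) m f)
    _ _ (pushObj_permE e F m x) (pushObj_permE e F m y) fun S => ?_).symm
  refine map_heq F.F (entries_permE e m x S) (entries_permE e m y S)
    (pi_hom_heq (entries_permE e m x S) (entries_permE e m y S) fun i => ?_)
  exact BarObj.app_heq (f (e i)) (subBlock_permE e m S i)

/-- On cells, both sides consist of the components of `φ` at the same permuted tuples of objects. -/
theorem linBarHomFunctor_act (C : Fin l → SMCat.{u}) (D : SMCat.{u}) :
    LinFun.actFunctor e ⋙ linBarHomFunctor C D = linBarHomFunctor (fun i => C (e i)) D ⋙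
      EMap.actFunctor (X := fun i => Bar (C i)) e := by
  refine CategoryTheory.Functor.hext (fun F => linBar_act e F) fun F G φ => ?_
  refine EMap.hom_heq (linBar_act e F) (linBar_act e G) fun m x => ?_
  refine (pushMap_perm_heq (f := linBarApp (fun i => m (e i)) φ fun i => x (e i))
    (g := linBarApp m ((LinFun.actFunctor e).map φ) x)
    _ _ (pushObj_permE e F m x) (pushObj_permE e G m x) fun S => ?_).symm
  exact app_heq (LinFun.Hom.app φ) (entries_permE e m x S)

end Act

/-! ### Compatibility of `J` with composition. -/

section Comp

variable {n : ℕ} {k : Fin n → ℕ} {A : Fin (∑ i, k i) → SMCat.{u}} {B : Fin n → SMCat.{u}}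
  {D : SMCat.{u}}

/-- Regrouping keeps every entry of the family intact: the `j`-th block inside the `i`-th block is
the entry `place i j`. -/
theorem subBlock_assocE (m : Fin (∑ i, k i) → EObj) (S : BSub (circM (odot m))) (i : Fin n)
    (j : Fin (k i)) : subBlock (fun j => m (place i j))
      (subBlock (fun i => odot fun j => m (place i j)) (pull (assocE m) S) i) j =
      subBlock m S (place i j) :=
  Subtype.ext (funext fun t => congrArg (fun X => Fin.cast _ ⁻¹' (Fin.cast _ ⁻¹' X))
    (pull_perm _ _ S (i := oplace (fun i => odot fun j => m (place i j)) i
      (oplace (fun j => m (place i j)) j t)) (k := oplace m (place i j) t)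
      (blockAssoc_place k (fun s => (m s).r) i j t)
      ((odot_m (fun i => odot fun j => m (place i j)) i _).trans
        ((odot_m (fun j => m (place i j)) j t).trans (odot_m m (place i j) t).symm))))

variable (G : LinFun B D) (F : ∀ i, LinFun (fun j : Fin (k i) => A (place i j)) (B i))
  (m : Fin (∑ i, k i) → EObj)

/-- The values of a family of multilinear functors on the blocks of a tuple of systems. -/
noncomputable abbrev innerBar (x : ∀ s, BarObj (A s) (circM (m s))) (i : Fin n) :
    BarObj (B i) (circM (odot fun j => m (place i j))) :=
  linBarObj (F i) (fun j => m (place i j)) fun j => x (place i j)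

theorem entries_inner (x : ∀ s, BarObj (A s) (circM (m s))) (S : BSub (circM (odot m)))
    (i : Fin n) : entries (C := fun j => A (place i j)) (fun j => m (place i j))
      (fun j => x (place i j))
      (subBlock (fun i => odot fun j => m (place i j)) (pull (assocE m) S) i) =
      fun j => entries m x S (place i j) :=
  funext fun j => congrArg (x (place i j)).obj (subBlock_assocE m S i j)

theorem entries_assocE (x : ∀ s, BarObj (A s) (circM (m s))) (S : BSub (circM (odot m))) :
    entries (fun i => odot fun j => m (place i j)) (innerBar F m x) (pull (assocE m) S) =
      innerObj F (entries m x S) :=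
  funext fun i => congrArg (F i).F.obj (entries_inner m x S i)

/-- At a place of the entry `place i j`, both systems have the isomorphism `G(Fᵢ(ρ) ∘ δⱼ) ∘ δᵢ`: on
one side by iterating the construction of systems, on the other by the definition of the
distributivity of a composite. Two applications of `linρ'_heq`, to `G` and to `F i`, leave the
isomorphism `ρ` of one given system. -/
theorem pushObj_assocE (x : ∀ s, BarObj (A s) (circM (m s))) :
    pushObj (assocE m) (linBarObj G _ (innerBar F m x)) = linBarObj (G.blockComp F) m x := by
  refine pushObj_perm _ _ _ _ (fun S => congrArg G.F.obj (entries_assocE F m x S))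
    fun s s' hs T U S H => ?_
  obtain ⟨i, t, rfl⟩ := exists_oplace _ s
  obtain ⟨j, t, rfl⟩ := exists_oplace _ t
  obtain rfl : oplace m (place i j) t = s' :=
    (blockAssoc_place k (fun s => (m s).r) i j t).symm.trans hs
  obtain ⟨w, hw, r, hr, e⟩ := exists_linρ' (G.blockComp F) m x H
  obtain ⟨w', hw', r', hr', e'⟩ := LinFun.blockComp_δ_exists G F hw
  -- The image of `ρ` is moved inside `G`, so that both sides are a distributivity of `G` followed
  -- by a single image under `G`.
  have e₂ : (linρ' (G.blockComp F) m x _ H).hom =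
      (G.δ i hw').hom ≫ G.F.map (r' ≫ innerHom F r) :=
    e.trans ((congrArg (· ≫ G.F.map (innerHom F r)) e').trans ((Category.assoc _ _ _).trans
      (congrArg ((G.δ i hw').hom ≫ ·) (G.F.map_comp r' (innerHom F r)).symm)))
  refine HEq.trans ?_ (heq_of_eq e₂.symm)
  have H' := pull_split (assocE m) hs H
  refine linρ'_heq G _ (innerBar F m x) H' (entries_assocE F m x T)
    (entries_assocE F m x U) (entries_assocE F m x S) hw'
    (hr'.comp hw'.at_eq rfl rfl (innerHom_onlyAt F hr)) ?_
  refine linρ'_heq (F i) _ (fun j => x (place i j)) (subBlock_split _ i _ H')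
    (entries_inner m x T i) (entries_inner m x U i) (entries_inner m x S i) hw.placeBlock
    hr.placeBlock ?_
  exact (x (place i j)).ρ_heq t _ _ (subBlock_assocE m T i j) (subBlock_assocE m U i j)
    (subBlock_assocE m S i j)

theorem entriesMap_assocE {x y : ∀ s, BarObj (A s) (circM (m s))} (f : ∀ s, x s ⟶ y s)
    (S : BSub (circM (odot m))) :
    HEq (entriesMap (fun i => odot fun j => m (place i j)) (x := innerBar F m x)
      (y := innerBar F m y) (fun i => linBarMap (F i) (fun j => m (place i j))
        fun j => f (place i j)) (pull (assocE m) S)) (innerHom F (entriesMap m f S)) := by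
  refine pi_hom_heq (entries_assocE F m x S) (entries_assocE F m y S) fun i => ?_
  refine map_heq (F i).F (entries_inner m x S i) (entries_inner m y S i)
    (pi_hom_heq (entries_inner m x S i) (entries_inner m y S i) fun j => ?_)
  exact BarObj.app_heq (f (place i j)) (subBlock_assocE m S i j)

theorem linBar_comp : linBar (G.blockComp F) =
    EMap.comp (X := fun s => Bar (A s)) (Y := fun i => Bar (B i)) (linBar G)
      fun i => linBar (F i) := by
  refine EMap.ext (funext fun m => ?_)
  refine CategoryTheory.Functor.hext (fun x => (pushObj_assocE G F m x).symm) fun x y f => ?_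
  refine (pushMap_perm_heq (f := linBarMap G _ (x := innerBar F m x) (y := innerBar F m y)
      fun i => linBarMap (F i) (fun j => m (place i j)) fun j => f (place i j))
    (g := linBarMap (G.blockComp F) m f)
    _ _ (pushObj_assocE G F m x) (pushObj_assocE G F m y) fun S => ?_).symm
  exact map_heq G.F (entries_assocE F m x S) (entries_assocE F m y S) (entriesMap_assocE F m f S)

variable {G F} {G' : LinFun B D} {F' : ∀ i, LinFun (fun j : Fin (k i) => A (place i j)) (B i)}
  (φ : G ⟶ G') (ψ : ∀ i, F i ⟶ F' i)

/-- For each tuple of subsets, both components are `φ` at the values of the `F i` followed by the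
image under `G'` of the components of the `ψ i`. -/
theorem linBarCell_comp_heq (x : ∀ s, BarObj (A s) (circM (m s))) :
    HEq (pushMap (assocE m) (linBarApp _ φ (innerBar F m x) ≫ linBarMap G' _
      fun i => linBarApp (fun j => m (place i j)) (ψ i) fun j => x (place i j)))
      (linBarApp m (LinFun.compMap (e := finSigmaFinEquiv) φ ψ) x) := by
  refine pushMap_perm_heq (Y := linBarObj (G.blockComp F) m x)
    (Y' := linBarObj (G'.blockComp F') m x) _ _ (pushObj_assocE G F m x)
    (pushObj_assocE G' F' m x) fun S => ?_
  refine heq_comp (congrArg G.F.obj (entries_assocE F m x S))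
    (congrArg G'.F.obj (entries_assocE F m x S)) (congrArg G'.F.obj (entries_assocE F' m x S))
    (app_heq (LinFun.Hom.app φ) (entries_assocE F m x S)) ?_
  refine map_heq G'.F (entries_assocE F m x S) (entries_assocE F' m x S)
    (pi_hom_heq (entries_assocE F m x S) (entries_assocE F' m x S) fun i => ?_)
  exact app_heq (LinFun.Hom.app (ψ i)) (entries_inner m x S i)

end Comp

theorem linBarHomFunctor_comp {n : ℕ} {k : Fin n → ℕ} (a : Fin (∑ i, k i) → SMCat.{u})
    (b : Fin n → SMCat.{u}) (c : SMCat.{u}) :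
    LinFun.compFunctor (e := finSigmaFinEquiv) (A := a) (B := b) (D := c) ⋙ linBarHomFunctor a c =
      (linBarHomFunctor b c).prod
          (Functor.pi fun i => linBarHomFunctor (fun j => a (place i j)) (b i)) ⋙
        EMap.compFunctor (X := fun s => Bar (a s)) (Y := fun i => Bar (b i)) := by
  refine CategoryTheory.Functor.hext (fun p => linBar_comp p.1 p.2) fun p q f => ?_
  refine EMap.hom_heq (linBar_comp p.1 p.2) (linBar_comp q.1 q.2) fun m x => ?_
  refine HEq.symm (HEq.trans (heq_of_eq ?_) (linBarCell_comp_heq m f.1 f.2 x))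
  -- The composition of cells of `E_*`-categories applies `assocE` to the two factors of the
  -- horizontal composite separately; functoriality joins them.
  exact ((pushFunctor c (assocE m)).map_comp _ _).symm

/-- The multifunctor from symmetric monoidal categories to `E_*`-categories. -/
noncomputable def barMultifunctor : EnrichedMultifunctor SMC.{u} EStarCat.{u} Bar.{u} where
  map a b := linBarHomFunctor a b
  map_one a := linBar_one a
  map_comp a b c := linBarHomFunctor_comp a b c
  map_act e a b := linBarHomFunctor_act e a b

/-! ### The levels as diagonals -/

section Diagonal

variable {k : ℕ}

theorem odotMap_diagE (p : Fin k → ℕ) {q' q : SimplexCategory} (θ : q' ⟶ q) :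
    odotMap (m := diagTuple p q) (m' := diagTuple p q') (fun i => (diagE (p i)).map θ.op) =
      (diagE (∑ i, p i)).map θ.op := by
  refine EHom.ext' (fun s => ?_) (fun s t h h' => ?_) fun s h h' => absurd rfl (h' s)
  · obtain ⟨i, j, rfl⟩ := exists_oplace (diagTuple p q) s
    exact odotMap_q (m := diagTuple p q) (m' := diagTuple p q') _ i j
  · exact Category.id_comp θ

theorem odotMap_diagPerm {p p' : Fin k → ℕ} (e : ∀ i, Fin (p i) ≃ Fin (p' i))
    (q : SimplexCategory) :
    odotMap (m := diagTuple p q) (m' := diagTuple p' q) (fun i => (diagPerm (e i)).app (op q)) =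
      (diagPerm (blockSum e)).app (op q) :=
  odotMap_perm (m := diagTuple p q) (m' := diagTuple p' q) e fun _ _ => rfl

/-- Stabilizing each block puts its new places at the end of that block, while stabilizing the
concatenation puts all new places at the very end. The shuffle accounts for the difference, and
`flat` lists the indices `j` in the latter order. -/
theorem odotMap_stabE (p m : Fin k → ℕ) (q : SimplexCategory)
    (j : ∀ i, Fin (m i) → Fin (q.len + 1)) :
    odotMap (m := diagTuple p q) (m' := diagTuple (fun i => p i + m i) q)
        (fun i => stabE (p i) (m i) q (j i)) =
      stabE (∑ i, p i) (∑ i, m i) q (flat j) ≫ (diagPerm (shuffle p m)).app (op q) := by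
  refine EHom.ext' (fun s => ?_) (fun s t h h' => eq_of_heq ?_) fun s h h' => eq_of_heq ?_
  · obtain ⟨i, t, rfl⟩ := exists_oplace (diagTuple p q) s
    refine (odotMap_q (m := diagTuple p q) (m' := diagTuple (fun i => p i + m i) q) _ i t).trans ?_
    exact (shuffle_left p m i t).symm
  · refine HEq.trans (heq_of_eq (Category.id_comp (𝟙 q))) ?_
    exact (eobj_perm_β (a := (diagE (∑ i, p i + ∑ i, m i)).obj (op q))
      (b := (diagE (∑ i, (p i + m i))).obj (op q)) (shuffle p m) (fun _ => rfl)
      (stabE (∑ i, p i) (∑ i, m i) q (flat j)) s _ t rfl h' h').symm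
  · obtain ⟨i, l, rfl⟩ := exists_oplace (diagTuple (fun i => p i + m i) q) s
    have hl := (odotMap_range (m := diagTuple p q) (m' := diagTuple (fun i => p i + m i) q) _).1 h
    refine (odotMap_γ (m := diagTuple p q) (m' := diagTuple (fun i => p i + m i) q) _ i l hl
      h).trans ?_
    change Fin (p i + m i) at l
    -- Old places of a block lie in the image of the injection; only the new ones have a threshold
    -- to be compared.
    induction l using Fin.addCases with
    | left t => exact absurd rfl (hl t)
    | right t =>
      have ht : ∀ s : Fin (∑ i, p i), Fin.castAdd (∑ i, m i) s ≠ Fin.natAdd _ (place i t) := by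
        intro s hs
        have := congrArg Fin.val hs
        simp at this
        omega
      refine HEq.trans (heq_of_eq ?_) (eobj_perm_γ (a := (diagE (∑ i, p i + ∑ i, m i)).obj (op q))
        (b := (diagE (∑ i, (p i + m i))).obj (op q)) (shuffle p m) (fun _ => rfl)
        (stabE (∑ i, p i) (∑ i, m i) q (flat j)) (Fin.natAdd _ (place i t)) _ ht
        (shuffle_right p m i t) h').symm
      exact congrArg threshold ((Fin.addCases_right _).trans ((flat_place j i t).symm.trans
        (Fin.addCases_right (motive := fun _ => Fin (q.len + 1)) _).symm))

/-- The iterated structure map is induced by a single morphism of tuples. So linearity is one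
instance of naturality and needs no induction over the iterates. -/
theorem toSpec_iter (X : EStar.{u}) (n m : ℕ) (q : SimplexCategory)
    (j : Fin m → Fin (q.len + 1)) : (toSpec X).iter n m q j = X.fmap (stabE n m q j) :=
  congrArg BasedFunctor.functor (iterMap_suspE X q n m j)

variable {X : Fin k → EStar.{u}} {Y : EStar.{u}}

theorem toSpec_linear (p m : Fin k → ℕ) (q : SimplexCategory)
    (j : ∀ i, Fin (m i) → Fin (q.len + 1)) :
    Y.fmap (odotMap (m := diagTuple p q) (m' := diagTuple (fun i => p i + m i) q)
        fun i => stabE (p i) (m i) q (j i)) =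
      (toSpec Y).iter (∑ i, p i) (∑ i, m i) q (flat j) ⋙ (toSpec Y).perm (shuffle p m) q := by
  rw [toSpec_iter]
  refine (congrArg (fun f => (Y.F.map f).functor) (odotMap_stabE p m q j)).trans ?_
  exact congrArg BasedFunctor.functor (Y.F.map_comp (stabE (∑ i, p i) (∑ i, m i) q (flat j))
    ((diagPerm (shuffle p m)).app (op q)))

/-- The `k`-linear map of symmetric spectra given by a `k`-ary morphism of `E_*`-categories. -/
noncomputable def EMap.toSpec (F : EMap X Y) : SMap (fun i => EM.toSpec (X i)) (EM.toSpec Y) where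
  app p q := F.app (diagTuple p q)
  natural p q' q θ := (F.natural (m := diagTuple p q) (m' := diagTuple p q')
    fun i => (diagE (p i)).map θ.op).trans
      (congrArg (fun f => F.app (diagTuple p q) ⋙ Y.fmap f) (odotMap_diagE p θ))
  equivariant {p p'} e q := (F.natural (m := diagTuple p q) (m' := diagTuple p' q)
    fun i => (diagPerm (e i)).app (op q)).trans
      (congrArg (fun f => F.app (diagTuple p q) ⋙ Y.fmap f) (odotMap_diagPerm e q))
  linear p m q j := by
    have h : (fun i => (EM.toSpec (X i)).iter (p i) (m i) q (j i)) =
        fun i => (X i).fmap (stabE (p i) (m i) q (j i)) :=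
      funext fun i => toSpec_iter (X i) (p i) (m i) q (j i)
    rw [h]
    exact (F.natural (m := diagTuple p q) (m' := diagTuple (fun i => p i + m i) q)
      fun i => stabE (p i) (m i) q (j i)).trans
        (congrArg (F.app (diagTuple p q) ⋙ ·) (toSpec_linear p m q j))
  base_obj p q x i h := F.base_obj (diagTuple p q) x i h
  base_map p q x y f i h hf := F.base_map (diagTuple p q) f i h hf

variable {F G : EMap X Y} (φ : F ⟶ G)

/-- The cell of symmetric spectra given by a cell of `E_*`-categories. -/
noncomputable def EMap.toSpecCell : F.toSpec ⟶ G.toSpec :=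
  SMap.Hom.mk (F := F.toSpec) (G := G.toSpec) (fun p q => EMap.Hom.app φ (diagTuple p q))
    (fun p q' q θ x => (EMap.Hom.natural φ (m := diagTuple p q) (m' := diagTuple p q')
      (fun i => (diagE (p i)).map θ.op) x).trans
        (functor_map_heq (congrArg Y.fmap (odotMap_diagE p θ)) _))
    (fun {p p'} e q x => (EMap.Hom.natural φ (m := diagTuple p q) (m' := diagTuple p' q)
      (fun i => (diagPerm (e i)).app (op q)) x).trans
        (functor_map_heq (congrArg Y.fmap (odotMap_diagPerm e q)) _))
    (fun p m q j => by
      have h : (fun i => (EM.toSpec (X i)).iter (p i) (m i) q (j i)) =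
          fun i => (X i).fmap (stabE (p i) (m i) q (j i)) :=
        funext fun i => toSpec_iter (X i) (p i) (m i) q (j i)
      rw [h]
      exact fun x => (EMap.Hom.natural φ (m := diagTuple p q)
        (m' := diagTuple (fun i => p i + m i) q) (fun i => stabE (p i) (m i) q (j i)) x).trans
          (functor_map_heq (toSpec_linear p m q j) _))
    fun p q x i h => EMap.Hom.base φ (diagTuple p q) x i h

/-- The functor from `k`-ary morphisms of `E_*`-categories to `k`-linear maps of symmetric
spectra. -/
noncomputable def toSpecHomFunctor (X : Fin k → EStar.{u}) (Y : EStar.{u}) :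
    EMap X Y ⥤ SMap (fun i => EM.toSpec (X i)) (EM.toSpec Y) where
  obj F := F.toSpec
  map φ := EMap.toSpecCell φ
  map_id F := rfl
  map_comp φ ψ := rfl

end Diagonal

/-- The multifunctor from `E_*`-categories to symmetric spectra. -/
noncomputable def specMultifunctor : EnrichedMultifunctor EStarCat.{u} SpecSCat.{u} toSpec.{u} where
  map a b := toSpecHomFunctor a b
  -- On tuples `([q], …, [q])` the morphisms `unitE`, `assocE` and `permE` are by definition the
  -- permutations that occur in the multicategory of spectra. Hence all three laws hold
  -- definitionally.
  map_one a := rfl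
  map_comp a b c := rfl
  map_act e a b := rfl

/-! ### The level zero -/

section LevelZero

variable {A : SMCat.{u}}

/-- The tuple `([1])`. -/
abbrev oneE : EObj := ⟨1, fun _ => SimplexCategory.mk 1⟩

/-- The tuple of the subset `{1}` of the based set `{0, 1}`. -/
def fullSub : BSub (circM oneE) := ⟨fun _ => {(1 : Fin 2)}, fun _ h => by
  have : (0 : Fin 2) = 1 := h
  exact absurd this (by decide)⟩

/-- The base point is excluded, so a subset of `{0, 1}` is either `{1}` or empty; together with
`sub_empty` this lists all cases. -/
theorem eq_fullSub {S : BSub (circM oneE)} (h : (1 : Fin 2) ∈ S.1 (0 : Fin 1)) : S = fullSub := by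
  refine Subtype.ext (funext fun i => ?_)
  obtain rfl : i = (0 : Fin 1) := Subsingleton.elim (α := Fin 1) i 0
  refine Set.ext fun x => ⟨fun hx => ?_, ?_⟩
  · change Fin 2 at x
    change x = 1
    by_contra hx1
    obtain rfl : x = 0 := by omega
    exact S.2 _ hx
  · rintro rfl
    exact h

theorem sub_empty {S : BSub (circM oneE)} (h : (1 : Fin 2) ∉ S.1 (0 : Fin 1)) :
    S.1 (0 : Fin 1) = ∅ := by
  refine Set.eq_empty_of_forall_notMem fun x hx => ?_
  change Fin 2 at x
  by_cases hx1 : x = 1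
  · exact h (hx1 ▸ hx)
  · obtain rfl : x = 0 := by omega
    exact S.2 _ hx

variable (A) in
/-- The functor `C̄({0, 1}) ⟶ C̄()` which takes a system to its value at `{1}`. -/
def restrictEmpty (q : SimplexCategoryᵒᵖ) :
    BarObj A (circM oneE) ⥤ BarObj A (circM ((diagE 0).obj q)) where
  obj Y :=
    { obj := fun _ => Y.obj fullSub
      ρ := fun i => Fin.elim0 i
      unit_obj := fun _ i => Fin.elim0 i
      unit_ρ := fun i => Fin.elim0 i
      symm := fun i => Fin.elim0 i
      assoc := fun i => Fin.elim0 i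
      comm := fun i => Fin.elim0 i }
  map f := ⟨fun _ => f.app fullSub, fun _ i => Fin.elim0 i, fun i => Fin.elim0 i⟩

/-- The map at the only place is the identity of `[1]`, and it induces the identity on the circle.
-/
theorem flag_extE (q : SimplexCategoryᵒᵖ) (S : BSub (circM oneE)) :
    Flag (extE q) S ↔ (1 : Fin 2) ∈ S.1 (0 : Fin 1) := by
  have h : ∀ k hk, circle (EHom.γ (extE q) k hk) (1 : Fin 2) = (1 : Fin 2) :=
    fun _ _ => circle_id (SimplexCategory.mk 1) (1 : Fin 2)
  constructor
  · intro H
    have := H (0 : Fin 1) fun i => Fin.elim0 i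
    rwa [h] at this
  · intro H k hk
    obtain rfl : k = (0 : Fin 1) := Subsingleton.elim (α := Fin 1) k 0
    rw [h]
    exact H

theorem bsub_empty_eq {q : SimplexCategoryᵒᵖ} (S S' : BSub (circM ((diagE 0).obj q))) : S = S' :=
  Subtype.ext (funext fun i => Fin.elim0 i)

/-- The value at the empty set is forced to be the unit. In a splitting of `{1}` or of the empty set
one part is empty, so the isomorphism is forced to be an identity. The object at `{1}` is the only
free datum. -/
theorem pushObj_extE (q : SimplexCategoryᵒᵖ) (Y : BarObj A (circM oneE)) :
    pushObj (extE q) ((restrictEmpty A q).obj Y) = Y := by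
  refine pushPart_heq_of _ _ Y (fun S hS => ?_) (fun S hS => ?_) (fun i => Fin.elim0 i)
    fun k T U S h _ => ?_
  · rw [eq_fullSub ((flag_extE q S).1 hS)]
    rfl
  · exact Y.unit_obj S (0 : Fin 1) (sub_empty fun h => hS ((flag_extE q S).2 h))
  · obtain rfl : k = (0 : Fin 1) := Subsingleton.elim (α := Fin 1) k 0
    refine Y.unit_ρ _ h (Or.inr ?_)
    by_cases hT : (1 : Fin 2) ∈ T.1 (0 : Fin 1)
    · exact Or.inr (sub_empty fun hU => Set.disjoint_left.1 h.disjoint hT hU)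
    · exact Or.inl (sub_empty hT)

/-- Over the empty tuple there is exactly one tuple of subsets and no place at which it could be
split. -/
theorem restrictEmpty_pushObj (q : SimplexCategoryᵒᵖ) (X : BarObj A (circM ((diagE 0).obj q))) :
    (restrictEmpty A q).obj (pushObj (extE q) X) = X :=
  BarObj.ext' (fun S => (pushPart_of _ X ((flag_extE q fullSub).2 rfl)).trans
    (congrArg X.obj (bsub_empty_eq _ S))) fun i => Fin.elim0 i

theorem restrictEmpty_base (q : SimplexCategoryᵒᵖ) :
    (restrictEmpty A q).obj (BarObj.base A _) = BarObj.base A _ :=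
  BarObj.ext' (fun _ => rfl) fun i => Fin.elim0 i

theorem pushFunctor_restrictEmpty (q : SimplexCategoryᵒᵖ) :
    pushFunctor A (extE q) ⋙ restrictEmpty A q = 𝟭 _ := by
  refine CategoryTheory.Functor.hext (restrictEmpty_pushObj q) fun X Y f => ?_
  refine BarObj.hom_heq (restrictEmpty_pushObj q X) (restrictEmpty_pushObj q Y) fun S => ?_
  exact (pushApp_heq _ f ((flag_extE q fullSub).2 rfl)).trans (BarObj.app_heq f (bsub_empty_eq _ S))

theorem restrictEmpty_pushFunctor (q : SimplexCategoryᵒᵖ) :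
    restrictEmpty A q ⋙ pushFunctor A (extE q) = 𝟭 _ := by
  refine CategoryTheory.Functor.hext (pushObj_extE q) fun X Y f => ?_
  refine BarObj.hom_heq (pushObj_extE q X) (pushObj_extE q Y) fun S => ?_
  by_cases hS : Flag (extE q) S
  · refine (pushApp_heq (extE q) ((restrictEmpty A q).map f) hS).trans ?_
    rw [eq_fullSub ((flag_extE q S).1 hS)]
    rfl
  · exact IsId.heq' (congrArg (fun X => BarObj.obj X S) (pushObj_extE q X))
      (pushApp_isId (extE q) ((restrictEmpty A q).map f) hS)
      (BarObj.Hom.unit f S (0 : Fin 1) (sub_empty fun h => hS ((flag_extE q S).2 h)))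

variable (A) in
/-- The isomorphism of based categories between `C̄()` and `C̄({0, 1})`. -/
noncomputable def extIso (q : SimplexCategoryᵒᵖ) :
    (Bar A).F.obj ((diagE 0).obj q) ≅ (Bar A).F.obj oneE where
  hom := (Bar A).F.map (extE q)
  inv := BasedFunctor.mk (A := barCat A (circM oneE)) (B := barCat A (circM ((diagE 0).obj q)))
    (restrictEmpty A q) (restrictEmpty_base q)
  hom_inv_id := BasedFunctor.ext (pushFunctor_restrictEmpty q)
  inv_hom_id := BasedFunctor.ext (restrictEmpty_pushFunctor q)

/-- The empty tuple has no entries on which the simplicial operator could act. This makes the level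
`0` constant. -/
theorem diagE_map_extE {q q' : SimplexCategoryᵒᵖ} (θ : q ⟶ q') :
    (diagE 0).map θ ≫ extE q' = extE q :=
  EHom.ext' (fun i => Fin.elim0 i) (fun i => Fin.elim0 i) fun k h h' =>
    EHom.comp_γ' ((diagE 0).map θ) (extE q') k h' h

variable (A) in
/-- The level `0` of the spectrum of a symmetric monoidal category is constant. -/
noncomputable def levelZeroIso : (toSpec (Bar A)).level 0 ≅
    (Functor.const SimplexCategoryᵒᵖ).obj (barCat A fun _ : Fin 1 => Fin 2) :=
  NatIso.ofComponents (F := diagE 0 ⋙ (Bar A).F)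
    -- The value at `([1])` is by definition the based category of systems on the one based set `{0,
    -- 1}`.
    (G := (Functor.const SimplexCategoryᵒᵖ).obj ((Bar A).F.obj oneE)) (fun q => extIso A q)
    fun {q q'} θ => by
      refine ((Bar A).F.map_comp ((diagE 0).map θ) (extE q')).symm.trans ?_
      rw [diagE_map_extE]
      exact (Category.comp_id _).symm

end LevelZero

end EM

/-! ### The multifunctors `J`, `I` and their composite. -/

theorem mainTheorem7 :
    EM.SMC.{u}.IsSymmetricMulticategory ∧ EM.EStarCat.{u}.IsSymmetricMulticategory ∧
    EM.SpecSCat.{u}.IsSymmetricMulticategory ∧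
    ∃ (J : EM.EnrichedMultifunctor EM.SMC.{u} EM.EStarCat.{u} EM.Bar.{u})
      (I : EM.EnrichedMultifunctor EM.EStarCat.{u} EM.SpecSCat.{u} EM.toSpec.{u})
      (K : EM.EnrichedMultifunctor EM.SMC.{u} EM.SpecSCat.{u} fun C => EM.toSpec (EM.Bar C)),
      (∀ {k : ℕ} (C : Fin k → EM.SMC.Obj) (D : EM.SMC.Obj),
        (∀ F : EM.SMC.Hom C D, EM.BarDescr F (J.onHom F)) ∧
        (∀ {F F' : EM.SMC.Hom C D} (φ : F ⟶ F'), EM.CellDescr φ (J.onCell φ))) ∧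
      (∀ {k : ℕ} (X : Fin k → EM.EStarCat.Obj) (Y : EM.EStarCat.Obj),
        (∀ (F : EM.EStarCat.Hom X Y) (p : Fin k → ℕ) (q : SimplexCategory),
          EM.SMap.app (I.onHom F) p q = EM.EMap.app F (EM.diagTuple p q)) ∧
        (∀ {F F' : EM.EStarCat.Hom X Y} (φ : F ⟶ F') (p : Fin k → ℕ) (q : SimplexCategory),
          HEq (EM.SMap.Hom.app (I.onCell φ) p q)
            (EM.EMap.Hom.app φ (EM.diagTuple p q)))) ∧
      K = J.trans I ∧
      ∀ C : EM.SMCat.{u},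
        (∀ n : ℕ, 0 < n →
          (EM.toSpec (EM.Bar C)).level n = EM.diagE n ⋙ (EM.Bar C).F) ∧
        ∃ e : (EM.toSpec (EM.Bar C)).level 0 ≅ (Functor.const SimplexCategoryᵒᵖ).obj
            (EM.barCat C fun _ : Fin 1 => Fin 2),
          ∀ q : SimplexCategoryᵒᵖ, e.hom.app q = (EM.Bar C).F.map (EM.extE q) :=
  ⟨EM.smc_isSymmetricMulticategory, EM.eStarCat_isSymmetricMulticategory,
    EM.specSCat_isSymmetricMulticategory, EM.barMultifunctor, EM.specMultifunctor,
    EM.barMultifunctor.trans EM.specMultifunctor,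
    fun _ _ => ⟨fun F => EM.linBar_descr F, fun φ => EM.linBarCell_descr φ⟩,
    -- The components of `I` are restrictions to the tuples `([q], …, [q])` by construction, and `K`
    -- is taken to be the composite.
    fun _ _ => ⟨fun _ _ _ => rfl, fun _ _ _ => HEq.rfl⟩, rfl,
    fun C => ⟨fun _ _ => rfl, EM.levelZeroIso C, fun _ => rfl⟩⟩
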